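/- Let $(M,g,J)$ and $(\tilde M,\tilde g,\tilde J)$ be Kähler manifolds of real dimension $2n$ with Kähler forms $\omega=g(J\cdot,\cdot)$ and $\tilde\omega=\tilde g(\tilde J\cdot,\cdot)$, and let $f:M\to\tilde M$ be a symplectomorphism, that is, a diffeomorphism with $f^*\tilde\omega=\omega$. Equip $M\times\tilde M$ with the product metric $G=g\oplus\tilde g$ and the almost complex structure $\mathcal J(u,v)=(Ju,-\tilde Jv)$. Let $F:[0,T)\times M\to M\times\tilde M$ be a smooth family of immersions, smooth up to $t=0$, that solves the mean curvature flow $\partial_tF=H$ with $F(0,x)=(x,f(x))$, and put $\Sigma_t=F(t,M)$. Let $\Omega$ be the pullback to $M\times\tilde M$ of the volume form $\omega^n/n!$ of $M$, and let $*\Omega=\Omega(e_1,\dots,e_{2n})$ for an oriented orthonormal basis $(e_i)$ of the tangent space of $\Sigma_t$, where $\Sigma_t$ is oriented by $M$. Fix $t\in[0,T)$ and $x\in M$ such that $*\Omega>0$ at $q=F(t,x)=(p,\tilde p)$. Near $q$, $\Sigma_t$ is then the graph of a map $f_t$ with $f_t(p)=\tilde p$; put $L=Df_t|_p$. Write $i'=i+(-1)^{i+1}$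 for $1\le i\le 2n$. All sums run over $1,\dots,2n$ unless indicated otherwise. A singular frame at $q$ is an orthonormal basis $(a_i)$ of $T_pM$ with $a_{2j}=Ja_{2j-1}$, together with numbers $\lambda_i>0$, such that $L^*La_i=\lambda_i^2a_i$ and $\lambda_i\lambda_{i'}=1$. Given one, put $$e_i=\frac{(a_i,La_i)}{\sqrt{1+\lambda_i^2}},\qquad \tilde a_i=\lambda_i^{-1}La_i,\qquad h_{ijk}=G(\nabla_{e_i}e_j,\mathcal Je_k),$$ $$R_{ikik}=R(a_i,a_k,a_i,a_k),\qquad \tilde R_{ikik}=\tilde R(\tilde a_i,\tilde a_k,\tilde a_i,\tilde a_k),$$ where $\nabla$ is the Levi-Civita connection of $G$ and $R,\tilde R$ are the curvature tensors of $M,\tilde M$, with the sign for which $R_{ikik}$ is the sectional curvature of the plane spanned by $a_i,a_k$ when $i\ne k$. Put also $$Q(\lambda_i,h_{ijk})=\sum_{i,j,k}h_{ijk}^2-2\sum_k\sum_{i\text{ odd}}(h_{iik}h_{i'i'k}-h_{ii'k}^2)-2\sum_k\sum_{i<j,\,j\ne i'}(-1)^{i+j}\lambda_i\lambda_j(h_{i'ik}h_{j'jk}-h_{i'jk}h_{j'ik}),$$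 $$\tilde Q(\lambda_i,h_{ijk})=Q(\lambda_i,h_{ijk})+\sum_k\Big[\sum_{i\text{ odd}}(\lambda_i-\lambda_{i'})h_{ii'k}\Big]^2 .$$ (1) Suppose that $g$ and $\tilde g$ are Einstein metrics of the same scalar curvature, and that $M$ is compact or, if it is not, that every $\Sigma_s$, $s\in[0,T)$, is Lagrangian for $\pi_1^*\omega-\pi_2^*\tilde\omega$. Then a singular frame exists at $q$, $\ln*\Omega$ is smooth on $\Sigma_t$ near $q$, and for every singular frame at $q$ $$\frac{d}{dt}\ln*\Omega=\Delta\ln*\Omega+\tilde Q(\lambda_i,h_{ijk})+\sum_k\sum_{i\ne k}\frac{\lambda_i}{(1+\lambda_k^2)(\lambda_i+\lambda_{i'})}\big(R_{ikik}-\lambda_k^2\tilde R_{ikik}\big)$$ at $q$, where $\Delta$ is the Laplacian of the metric induced on $\Sigma_t$, and $d/dt$ is taken at fixed $x$ (one-sided at $t=0$). (2) Suppose that $M$ and $\tilde M$ are both $\mathbb{CP}^n$ with the Fubini–Study metric of holomorphic sectional curvature $1$. Then the conclusions of (1) hold, with the equation $$\frac{d}{dt}\ln*\Omega=\Delta\ln*\Omega+\tilde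 Q(\lambda_i,h_{ijk})+\sum_{k\text{ odd}}\frac{(1-\lambda_k^2)^2}{(1+\lambda_k^2)^2}.$$ -/

import Mathlib

open Set Module
open scoped Manifold ContDiff

noncomputable section

/-! ### Riemannian geometry in charts

All manifolds are without boundary.  In Mathlib the tangent space at `x` is the model vector space
`E`, a vector being identified with its components in the preferred chart at `x`.  Every tensor at
`x` below is given by its classical coordinate expression in this chart. -/

section Riemannian

variable {E : Type*} [NormedAddCommGroup E] [NormedSpace ℝ E]
  {H : Type*} [TopologicalSpace H] (I : ModelWithCorners ℝ E H)
  (M : Type*) [TopologicalSpace M] [ChartedSpace H M]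

/-- A field of bilinear forms on the tangent spaces of `M`. -/
abbrev MetricField := ∀ x : M, TangentSpace I x →L[ℝ] TangentSpace I x →L[ℝ] ℝ

variable {I M}

/-- The components of `g` in the preferred chart at `x`, at the coordinate point `y`. -/
def metricInChart (g : MetricField I M) (x : M) (y : E) : E →L[ℝ] E →L[ℝ] ℝ :=
  let G : E →L[ℝ] E →L[ℝ] ℝ := g ((extChartAt I x).symm y)
  let D : E →L[ℝ] E := mfderiv 𝓘(ℝ, E) I (extChartAt I x).symm y
  G.bilinearComp D D

/-- The Christoffel symbols of `g` in the preferred chart at `x`: `Γ(u, v)` is the vector with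
`g(Γ(u, v), z) = (∂_u g(v, z) + ∂_v g(u, z) - ∂_z g(u, v)) / 2` for all `z`. -/
def christoffel (g : MetricField I M) (x : M) (y u v : E) : E :=
  let D : E →L[ℝ] E →L[ℝ] E →L[ℝ] ℝ := fderiv ℝ (metricInChart g x) y
  (metricInChart g x y).inverse ((1 / 2 : ℝ) • (D u v + D v u - (D.flip u).flip v))

/-- The Riemann curvature `R(u, v) w = ∇_u ∇_v w - ∇_v ∇_u w - ∇_[u,v] w` at `x`. -/
def curvature (g : MetricField I M) (x : M) (u v w : TangentSpace I x) : TangentSpace I x :=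
  let Γ : E → E → E → E := christoffel g x
  let y : E := extChartAt I x x
  fderiv ℝ (fun z => Γ z v w) y u - fderiv ℝ (fun z => Γ z u w) y v
    + Γ y u (Γ y v w) - Γ y v (Γ y u w)

/-- The curvature tensor with all indices lowered, with the sign for which
`curvatureTensor g x u v u v` is the sectional curvature of the plane spanned by orthonormal
`u`, `v`. -/
def curvatureTensor (g : MetricField I M) (x : M) (u v w z : TangentSpace I x) : ℝ :=
  g x (curvature g x u v z) w

/-- The trace `g^{ij} B(b_i, b_j)` of a bilinear map `B` on `T_x M` with respect to `g`. -/
def metricTrace [FiniteDimensional ℝ E] {V : Type*} [AddCommGroup V] [Module ℝ V]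
    (g : MetricField I M) (x : M) (B : TangentSpace I x → TangentSpace I x → V) : V :=
  let b : Basis (Fin (finrank ℝ E)) ℝ E := finBasis ℝ E
  ∑ i, ∑ j, ((Matrix.of fun k l => g x (b k) (b l))⁻¹ i j) • B (b i) (b j)

/-- The Ricci tensor. -/
def ricci [FiniteDimensional ℝ E] (g : MetricField I M) (x : M) (v w : TangentSpace I x) : ℝ :=
  metricTrace g x fun u u' => curvatureTensor g x u v u' w

/-- The scalar curvature. -/
def scalarCurvature [FiniteDimensional ℝ E] (g : MetricField I M) (x : M) : ℝ :=
  metricTrace g x (ricci g x)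

/-- `g` is an Einstein metric: its Ricci tensor is a constant multiple of `g`. -/
def IsEinstein [FiniteDimensional ℝ E] (g : MetricField I M) : Prop :=
  ∃ c : ℝ, ∀ (x : M) (v w : TangentSpace I x), ricci g x v w = c * g x v w

/-- The Hessian `∇² φ` of a function at `x`. -/
def hessian (g : MetricField I M) (φ : M → ℝ) (x : M) (u v : TangentSpace I x) : ℝ :=
  let φ' : E → ℝ := φ ∘ (extChartAt I x).symm
  let y : E := extChartAt I x x
  fderiv ℝ (fderiv ℝ φ') y u v - fderiv ℝ φ' y (christoffel g x y u v)

/-- The Laplace-Beltrami operator (the trace of the Hessian). -/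
def laplacian [FiniteDimensional ℝ E] (g : MetricField I M) (φ : M → ℝ) (x : M) : ℝ :=
  metricTrace g x (hessian g φ x)

variable {E' : Type*} [NormedAddCommGroup E'] [NormedSpace ℝ E']
  {H' : Type*} [TopologicalSpace H'] {I' : ModelWithCorners ℝ E' H'}
  {N : Type*} [TopologicalSpace N] [ChartedSpace H' N]

/-- The product metric on `M × N`. -/
def prodMetric (g : MetricField I M) (g' : MetricField I' N) : MetricField (I.prod I') (M × N) :=
  fun p =>
    let B : E →L[ℝ] E →L[ℝ] ℝ := g p.1
    let B' : E' →L[ℝ] E' →L[ℝ] ℝ := g' p.2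
    let G : (E × E') →L[ℝ] (E × E') →L[ℝ] ℝ :=
      B.bilinearComp (ContinuousLinearMap.fst ℝ E E') (ContinuousLinearMap.fst ℝ E E') +
        B'.bilinearComp (ContinuousLinearMap.snd ℝ E E') (ContinuousLinearMap.snd ℝ E E')
    G

/-- The metric on `M` induced by a map `F` into a Riemannian manifold. -/
def pullbackMetric (G : MetricField I' N) (F : M → N) : MetricField I M :=
  fun x =>
    let B : E' →L[ℝ] E' →L[ℝ] ℝ := G (F x)
    let D : E →L[ℝ] E' := mfderiv I I' F x
    let P : E →L[ℝ] E →L[ℝ] ℝ := B.bilinearComp D D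
    P

/-- The second fundamental form `A(u, v) = ∇_{dF u} dF v - dF(∇_u v)` of an immersion `F` at `x`,
where `∇` is the Levi-Civita connection of the ambient metric `G`, respectively of the induced
metric.  It takes its values in the normal space. -/
def secondFundamentalForm (G : MetricField I' N) (F : M → N) (x : M) (u v : TangentSpace I x) :
    TangentSpace I' (F x) :=
  let F' : E → E' := writtenInExtChartAt I I' x F
  let y : E := extChartAt I x x
  let g : MetricField I M := pullbackMetric G F
  fderiv ℝ (fderiv ℝ F') y u v
    + christoffel G (F x) (extChartAt I' (F x) (F x)) (fderiv ℝ F' y u) (fderiv ℝ F' y v)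
    - fderiv ℝ F' y (christoffel g x y u v)

/-- The mean curvature vector: the trace of the second fundamental form. -/
def meanCurvature [FiniteDimensional ℝ E] (I : ModelWithCorners ℝ E H) {M : Type*}
    [TopologicalSpace M] [ChartedSpace H M] (G : MetricField I' N) (F : M → N) (x : M) :
    TangentSpace I' (F x) :=
  let g : MetricField I M := pullbackMetric G F
  metricTrace g x (secondFundamentalForm G F x)

/-- `F : [0, T) × M → N` is a smooth solution of the mean curvature flow `∂F/∂t = H` by immersions
in the Riemannian manifold `(N, G)`, smooth up to the initial time. -/
structure IsMeanCurvatureFlow [FiniteDimensional ℝ E] (I : ModelWithCorners ℝ E H) {M : Type*}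
    [TopologicalSpace M] [ChartedSpace H M] (G : MetricField I' N) (T : ℝ) (F : ℝ → M → N) :
    Prop where
  smooth : ContMDiffOn (𝓘(ℝ, ℝ).prod I) I' ∞ (fun p : ℝ × M => F p.1 p.2) (Ico 0 T ×ˢ univ)
  immersion : ∀ t ∈ Ico 0 T, ∀ x : M, Function.Injective (mfderiv I I' (F t) x)
  flow : ∀ t ∈ Ico 0 T, ∀ x : M,
    mfderivWithin 𝓘(ℝ, ℝ) I' (fun s : ℝ => F s x) (Ico 0 T) t (1 : ℝ) = meanCurvature I G (F t) x

end Riemannian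

/-! ### Kähler manifolds -/

/-- A Kähler structure on a manifold `M` of real dimension `2n`: a smooth Riemannian metric and a
smooth, orthogonal almost complex structure `J` that is parallel for the Levi-Civita connection. -/
structure KahlerStructure (n : ℕ) (M : Type*) [TopologicalSpace M]
    [ChartedSpace (EuclideanSpace ℝ (Fin (2 * n))) M] [IsManifold (𝓡 (2 * n)) ∞ M] where
  metric : Bundle.ContMDiffRiemannianMetric (𝓡 (2 * n)) ∞ (EuclideanSpace ℝ (Fin (2 * n)))
    (TangentSpace (𝓡 (2 * n)) : M → Type _)
  J : ∀ x : M, TangentSpace (𝓡 (2 * n)) x →L[ℝ] TangentSpace (𝓡 (2 * n)) x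
  J_smooth : ContMDiff (𝓡 (2 * n))
    ((𝓡 (2 * n)).prod 𝓘(ℝ, EuclideanSpace ℝ (Fin (2 * n)) →L[ℝ] EuclideanSpace ℝ (Fin (2 * n)))) ∞
    (fun x => Bundle.TotalSpace.mk'
      (EuclideanSpace ℝ (Fin (2 * n)) →L[ℝ] EuclideanSpace ℝ (Fin (2 * n)))
      (E := fun x : M => TangentSpace (𝓡 (2 * n)) x →L[ℝ] TangentSpace (𝓡 (2 * n)) x) x (J x))
  J_sq : ∀ (x : M) (v : TangentSpace (𝓡 (2 * n)) x), J x (J x v) = -v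
  J_orthogonal : ∀ (x : M) (u v : TangentSpace (𝓡 (2 * n)) x),
    metric.inner x (J x u) (J x v) = metric.inner x u v
  /-- `(∇_u J) v = (∂_u J) v + Γ(u, J v) - J Γ(u, v) = 0`, where `∂_u J` is the derivative of the
  components of `J` in the preferred chart at `x`. -/
  J_parallel : ∀ (x : M) (u v : EuclideanSpace ℝ (Fin (2 * n))),
    let φ := extChartAt (𝓡 (2 * n)) x
    let J' : EuclideanSpace ℝ (Fin (2 * n)) →
        EuclideanSpace ℝ (Fin (2 * n)) →L[ℝ] EuclideanSpace ℝ (Fin (2 * n)) := fun y =>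
      (mfderiv (𝓡 (2 * n)) 𝓘(ℝ, EuclideanSpace ℝ (Fin (2 * n))) φ (φ.symm y)) ∘L
        (J (φ.symm y)) ∘L
          (mfderiv 𝓘(ℝ, EuclideanSpace ℝ (Fin (2 * n))) (𝓡 (2 * n)) φ.symm y)
    let Γ := christoffel (I := 𝓡 (2 * n)) metric.inner x (φ x)
    fderiv ℝ J' (φ x) u v + Γ u (J' (φ x) v) - J' (φ x) (Γ u v) = 0

namespace KahlerStructure

variable {n : ℕ} {M : Type*} [TopologicalSpace M]
  [ChartedSpace (EuclideanSpace ℝ (Fin (2 * n))) M] [IsManifold (𝓡 (2 * n)) ∞ M]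
  {N : Type*} [TopologicalSpace N]
  [ChartedSpace (EuclideanSpace ℝ (Fin (2 * n))) N] [IsManifold (𝓡 (2 * n)) ∞ N]

/-- The Kähler metric. -/
def g (K : KahlerStructure n M) : MetricField (𝓡 (2 * n)) M := K.metric.inner

/-- The Kähler form `ω(u, v) = g(J u, v)`. -/
def kahlerForm (K : KahlerStructure n M) (x : M) (u v : TangentSpace (𝓡 (2 * n)) x) : ℝ :=
  K.g x (K.J x u) v

/-- The volume form `ωⁿ / n!` of `M`, equal to `1` on `(a₁, J a₁, …, aₙ, J aₙ)` whenever this is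
an orthonormal basis. -/
def volumeForm (K : KahlerStructure n M) (x : M)
    (v : Fin (2 * n) → TangentSpace (𝓡 (2 * n)) x) : ℝ :=
  ((2 ^ n * n.factorial : ℕ) : ℝ)⁻¹ * ∑ σ : Equiv.Perm (Fin (2 * n)),
    ((Equiv.Perm.sign σ : ℤ) : ℝ) * ∏ i : Fin n,
      K.kahlerForm x (v (σ ⟨2 * i, by omega⟩)) (v (σ ⟨2 * i + 1, by omega⟩))

/-- `M` is the complex projective space `ℂℙⁿ` with the Fubini-Study metric of holomorphic sectional
curvature `1`: there is a holomorphic map `π` from `ℂⁿ⁺¹ \ {0}` onto `M` whose fibres are the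
punctured complex lines through `0`, and the metric of `M` is given by
`g(dπ_z v, dπ_z w) = 4 Re(|z|² ⟨v, w⟩ - ⟨v, z⟩ ⟨z, w⟩) / |z|⁴`. -/
def IsFubiniStudy (K : KahlerStructure n M) : Prop :=
  ∃ π : EuclideanSpace ℂ (Fin (n + 1)) → M,
    ContMDiffOn 𝓘(ℝ, EuclideanSpace ℂ (Fin (n + 1))) (𝓡 (2 * n)) ∞ π {0}ᶜ ∧
    (∀ x : M, ∃ z, z ≠ 0 ∧ π z = x) ∧
    (∀ z w, z ≠ 0 → w ≠ 0 → (π z = π w ↔ ∃ c : ℂ, w = c • z)) ∧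
    ∀ z, z ≠ 0 →
      let dπ := mfderiv 𝓘(ℝ, EuclideanSpace ℂ (Fin (n + 1))) (𝓡 (2 * n)) π z
      (∀ v : EuclideanSpace ℂ (Fin (n + 1)), dπ (Complex.I • v) = K.J (π z) (dπ v)) ∧
      ∀ v w : EuclideanSpace ℂ (Fin (n + 1)), K.g (π z) (dπ v) (dπ w) =
        4 * (((‖z‖ ^ 2 : ℝ) : ℂ) * inner ℂ v w - inner ℂ v z * inner ℂ z w).re / ‖z‖ ^ 4

variable (K : KahlerStructure n M) (K' : KahlerStructure n N)

/-- `f` is a symplectomorphism: `f^* ω' = ω`. -/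
def IsSymplectomorphism (f : M ≃ₘ⟮𝓡 (2 * n), 𝓡 (2 * n)⟯ N) : Prop :=
  ∀ (x : M) (u v : TangentSpace (𝓡 (2 * n)) x),
    K'.kahlerForm (f x) (mfderiv (𝓡 (2 * n)) (𝓡 (2 * n)) f x u) (mfderiv (𝓡 (2 * n)) (𝓡 (2 * n)) f x v)
      = K.kahlerForm x u v

/-- The product metric `G = g ⊕ g'` on `M × N`. -/
def prodG : MetricField ((𝓡 (2 * n)).prod (𝓡 (2 * n))) (M × N) := prodMetric K.g K'.g

/-- The almost complex structure `(u, v) ↦ (J u, - J' v)` of `M × N`. -/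
def prodJ (q : M × N) (w : TangentSpace ((𝓡 (2 * n)).prod (𝓡 (2 * n))) q) :
    TangentSpace ((𝓡 (2 * n)).prod (𝓡 (2 * n))) q :=
  let u : TangentSpace (𝓡 (2 * n)) q.1 := w.1
  let v : TangentSpace (𝓡 (2 * n)) q.2 := w.2
  (K.J q.1 u, -K'.J q.2 v)

/-- The differential of `F : M → M × N`. -/
abbrev dF (F : M → M × N) (x : M) : TangentSpace (𝓡 (2 * n)) x →L[ℝ]
    TangentSpace ((𝓡 (2 * n)).prod (𝓡 (2 * n))) (F x) :=
  mfderiv (𝓡 (2 * n)) ((𝓡 (2 * n)).prod (𝓡 (2 * n))) F x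

/-- The differential of the first component `π₁ ∘ F`. -/
def dF₁ (F : M → M × N) (x : M) :
    TangentSpace (𝓡 (2 * n)) x →L[ℝ] TangentSpace (𝓡 (2 * n)) (F x).1 :=
  (ContinuousLinearMap.fst ℝ (EuclideanSpace ℝ (Fin (2 * n))) (EuclideanSpace ℝ (Fin (2 * n)))) ∘L
    (dF F x)

/-- The differential of the second component `π₂ ∘ F`. -/
def dF₂ (F : M → M × N) (x : M) :
    TangentSpace (𝓡 (2 * n)) x →L[ℝ] TangentSpace (𝓡 (2 * n)) (F x).2 :=
  (ContinuousLinearMap.snd ℝ (EuclideanSpace ℝ (Fin (2 * n))) (EuclideanSpace ℝ (Fin (2 * n)))) ∘L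
    (dF F x)

/-- The immersed submanifold `F(M) ⊆ M × N` is Lagrangian for `π₁^* ω - π₂^* ω'`. -/
def IsLagrangian (F : M → M × N) : Prop :=
  ∀ (x : M) (u v : TangentSpace (𝓡 (2 * n)) x),
    K.kahlerForm (F x).1 (dF₁ F x u) (dF₁ F x v) - K'.kahlerForm (F x).2 (dF₂ F x u) (dF₂ F x v) = 0

/-- The function `*Ω` of the immersed submanifold `F(M)`, at the point `F x`.  Here `Ω` is the
pullback of the volume form of `M` under the projection `π₁`, and `*Ω = Ω(e₁, …, e₂ₙ)` for an
oriented orthonormal basis `e` of the tangent space of `F(M)`; equivalently, for any basis `b` of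
`T_x M`, it is `Ω(dF b₁, …, dF b₂ₙ)` divided by the volume `(det G(dF bᵢ, dF bⱼ))^(1/2)`, times the
sign of the orientation of `b` in `M`. -/
def starOmega (F : M → M × N) (x : M) : ℝ :=
  let b : Fin (2 * n) → TangentSpace (𝓡 (2 * n)) x :=
    EuclideanSpace.basisFun (Fin (2 * n)) ℝ
  Real.sign (K.volumeForm x b) * K.volumeForm (F x).1 (fun i => dF₁ F x (b i)) /
    Real.sqrt (Matrix.det (Matrix.of fun i j =>
      K.prodG K' (F x) (dF F x (b i)) (dF F x (b j))))

end KahlerStructure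

/-! ### Singular frames and the reaction terms

The indices `1, …, 2n` are shifted to `0, …, 2n - 1`, so that the odd indices become the even
elements of `Fin (2 * n)`. -/

/-- The index `i'` paired with `i`: the pairs are `(0, 1), (2, 3), …`. -/
def partner {n : ℕ} (i : Fin (2 * n)) : Fin (2 * n) :=
  if h : Even i.val then ⟨i.val + 1, by have := i.isLt; rcases h with ⟨k, hk⟩; omega⟩
  else ⟨i.val - 1, by have := i.isLt; omega⟩

/-- The first members of the pairs `(i, i')`. -/
def firsts (n : ℕ) : Finset (Fin (2 * n)) := Finset.univ.filter fun i => Even i.val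

/-- The quadratic form `Q(λ, h)`. -/
def quadQ {n : ℕ} (lam : Fin (2 * n) → ℝ) (h : Fin (2 * n) → Fin (2 * n) → Fin (2 * n) → ℝ) : ℝ :=
  (∑ i, ∑ j, ∑ k, h i j k ^ 2)
    - 2 * ∑ k, ∑ i ∈ firsts n, (h i i k * h (partner i) (partner i) k - h i (partner i) k ^ 2)
    - 2 * ∑ k, ∑ i, ∑ j ∈ Finset.univ.filter (fun j => i < j ∧ j ≠ partner i),
        (-1) ^ (i.val + j.val) * lam i * lam j *
          (h (partner i) i k * h (partner j) j k - h (partner i) j k * h (partner j) i k)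

/-- The quadratic form `Q̃(λ, h)`. -/
def quadQTilde {n : ℕ} (lam : Fin (2 * n) → ℝ)
    (h : Fin (2 * n) → Fin (2 * n) → Fin (2 * n) → ℝ) : ℝ :=
  quadQ lam h + ∑ k, (∑ i ∈ firsts n, (lam i - lam (partner i)) * h i (partner i) k) ^ 2

namespace KahlerStructure

variable {n : ℕ} {M : Type*} [TopologicalSpace M]
  [ChartedSpace (EuclideanSpace ℝ (Fin (2 * n))) M] [IsManifold (𝓡 (2 * n)) ∞ M]
  {N : Type*} [TopologicalSpace N]
  [ChartedSpace (EuclideanSpace ℝ (Fin (2 * n))) N] [IsManifold (𝓡 (2 * n)) ∞ N]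
  (K : KahlerStructure n M) (K' : KahlerStructure n N)

/-- `(a_i)` is an orthonormal basis of `T_p M` of the form `(a₁, J a₁, a₃, J a₃, …)` that
diagonalizes `L^* L`, with eigenvalues `λ_i ^ 2`, `λ_i > 0` and `λ_i λ_{i'} = 1`. -/
structure IsSingularFrame {p : M} {q : N}
    (L : TangentSpace (𝓡 (2 * n)) p →L[ℝ] TangentSpace (𝓡 (2 * n)) q)
    (a : Fin (2 * n) → TangentSpace (𝓡 (2 * n)) p) (lam : Fin (2 * n) → ℝ) : Prop where
  orthonormal : ∀ i j, K.g p (a i) (a j) = if i = j then 1 else 0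
  J_frame : ∀ i ∈ firsts n, K.J p (a i) = a (partner i)
  pos : ∀ i, 0 < lam i
  pair : ∀ i, lam i * lam (partner i) = 1
  diag : ∀ i (v : TangentSpace (𝓡 (2 * n)) p), K'.g q (L (a i)) (L v) = lam i ^ 2 * K.g p (a i) v

/-- Where `π₁ ∘ F` is a local diffeomorphism, `F(M)` is locally the graph of a map from `M` to `N`;
this is the differential of that map at `π₁ (F x)`. -/
def graphDeriv (F : M → M × N) (x : M) :
    TangentSpace (𝓡 (2 * n)) (F x).1 →L[ℝ] TangentSpace (𝓡 (2 * n)) (F x).2 :=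
  (dF₂ F x) ∘L (dF₁ F x).inverse

/-- The vectors of `T_x M` that `dF` maps to `e_i = (a_i, L a_i) / (1 + λ_i ^ 2) ^ (1/2)`, where
`L` is the differential of the map whose graph is `F(M)`. -/
def tangentFrame (F : M → M × N) (x : M) (a : Fin (2 * n) → TangentSpace (𝓡 (2 * n)) (F x).1)
    (lam : Fin (2 * n) → ℝ) (i : Fin (2 * n)) : TangentSpace (𝓡 (2 * n)) x :=
  (Real.sqrt (1 + lam i ^ 2))⁻¹ • (dF₁ F x).inverse (a i)

/-- The coefficients `h_{ijk} = G(∇_{e_i} e_j, 𝒥 e_k)` of the second fundamental form. -/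
def hCoeff (F : M → M × N) (x : M) (a : Fin (2 * n) → TangentSpace (𝓡 (2 * n)) (F x).1)
    (lam : Fin (2 * n) → ℝ) (i j k : Fin (2 * n)) : ℝ :=
  let ε := tangentFrame F x a lam
  K.prodG K' (F x) (secondFundamentalForm (K.prodG K') F x (ε i) (ε j))
    (K.prodJ K' (F x) (dF F x (ε k)))

/-- The curvature term
`∑_k ∑_{i ≠ k} λ_i / ((1 + λ_k²) (λ_i + λ_{i'})) (R_{ikik} - λ_k² R'_{ikik})`.  The components of
`R` are taken in the basis `a_i`, those of `R'` in the basis `E a_i = λ_i⁻¹ L a_i`, where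
`E = L (L^* L)^(-1/2)` is the isometric part of `L`. -/
def curvatureTerm {p : M} {q : N}
    (L : TangentSpace (𝓡 (2 * n)) p →L[ℝ] TangentSpace (𝓡 (2 * n)) q)
    (a : Fin (2 * n) → TangentSpace (𝓡 (2 * n)) p) (lam : Fin (2 * n) → ℝ) : ℝ :=
  let a' : Fin (2 * n) → TangentSpace (𝓡 (2 * n)) q := fun i => (lam i)⁻¹ • L (a i)
  ∑ k, ∑ i ∈ Finset.univ.filter (fun i => i ≠ k),
    lam i / ((1 + lam k ^ 2) * (lam i + lam (partner i))) *
      (curvatureTensor K.g p (a i) (a k) (a i) (a k)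
        - lam k ^ 2 * curvatureTensor K'.g q (a' i) (a' k) (a' i) (a' k))

end KahlerStructure

end

/-!
The argument is local.  A chart turns each Kähler manifold into a metric `m` and a complex structure
`J` on an open subset of a vector space (`IsMetricOn`, `IsKahlerOn`), with Christoffel symbols `chrL`
and curvature `riem`, and the flow into a family of immersions (`IsImmersionOn`) with second
fundamental form `sff`, which is normal and satisfies the Codazzi equation
(`IsImmersionOn.codazzi`).  All of these transform as tensors (`riem_natural`, `meanL_comp`), so
that statements about the manifolds can be read off in any charts (`KahlerStructure.isKahlerOn`,
`IsFlowChart`, `KahlerStructure.starOmega_eq`).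

**The evolution equation.**  Let `Q` be the inverse of the differential of the first component of the
immersion, and `π = Q ∘ fst` the projection to the tangent space along the second factor.  Since the
projection to the first factor and the Kähler form are parallel, the derivative of `ln *Ω` in the
direction `v` is the trace of `w ↦ π (A(v, w))`; differentiating again gives the Hessian
(`IsImmersionOn.hessian_log_starF`) as the trace of `π ∘ ∇A` minus that of a square.  In time, the
derivative is the trace of `π ∘ ∇H` minus that of the tangential part of `∇H`
(`hasFDerivWithinAt_log_starD`).  By Codazzi, `∇H` is the trace of `∇A` up to curvature, so the
derivatives of `A` cancel in the difference with the Laplacian, and what remains is quadratic in `A`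
or linear in the curvature (`IsImmersionOn.hasDerivWithinAt_log_starF`).  If the submanifold is
Lagrangian, then `h_{ijk}` is totally symmetric (`IsImmersionOn.inner_sff_J_symm`), and in a singular
frame `π` exchanges `J e_l` with a multiple of its partner, which makes the quadratic terms `Q̃`
(`quadQTilde_eq`); this is `IsImmersionOn.evolution_singular_frame`.  The graph map of a Lagrangian
submanifold is symplectic, and the singular frame is built by minimising `|L v|` over unit vectors
and splitting off the complex line of the minimiser (`IsInner.exists_singular_frame`).

**Preservation of the Lagrangian condition.**  The graph of a symplectomorphism is Lagrangian, and
the noncompact case assumes that this persists.  If `M` is compact, let `ω` be the restriction to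
`Σ_s` of the Kähler form of the product, `g` the induced metric, and compare `ω(a, b)` with the
barrier `θ/2 (g(a, a) + g(b, b))`, where `θ = ε e^{Cs}`.  At a first touching point
(`KahlerStructure.exists_touches`) the first and second order conditions hold in space, and the
barrier condition in time.  Codazzi turns the sum of the second order conditions into a bound for the
time derivative of `ω`, up to quadratic terms in `A` and an ambient curvature term.  Since `θ` is
small, the submanifold is almost Lagrangian, so the Kähler form of the normal space is of order `θ`
(`IsInner.kahler_normal_le`) and the curvature term is, up to order `θ`, the Ricci form of the product
(`IsInner.trace_sub_le`).  The factors are Einstein with the same constant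
(`KahlerStructure.exists_einstein_constant`), so this is a multiple of `ω(a, b)`, again of order `θ`.
Dividing by `θ` bounds `C` (`IsImmersionOn.barrier_le`), uniformly on compact sets of space and time
(`KahlerStructure.exists_growth_bound`).  Barriers with larger `C` are therefore never touched, and
`ε → 0` gives `ω = 0` (`KahlerStructure.isLagrangian_of_compact`).

**Complex projective space.**  The affine slice `{z₀ + w}`, with `|z₀| = 1` and `w` orthogonal to `z₀`,
is a chart in which the Fubini-Study metric is explicit (`fsMetric`).  So are its Christoffel symbols,
and differentiating them at `w = 0` gives the curvature tensor of constant holomorphic sectional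
curvature `1` (`riem_fsMetric`, `KahlerStructure.IsFubiniStudy.riem_eq`).  Hence the metric is Einstein
with constant `(n + 1) / 2`, and `M`, an image of a sphere, is compact, so the flow stays Lagrangian.
The curvature term of the evolution equation becomes an elementary sum in the `λ_k`
(`KahlerStructure.curvatureTerm_of_isFubiniStudy`).
-/


section

open Set Module Filter
open scoped Manifold ContDiff Topology

set_option maxSynthPendingDepth 3
set_option linter.unusedSectionVars false

noncomputable section

section

/-! ### Metrics on open subsets of a vector space -/

variable {V W : Type*} [NormedAddCommGroup V] [NormedSpace ℝ V]
  [NormedAddCommGroup W] [NormedSpace ℝ W]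

/-- `m` is a smooth Riemannian metric on the open subset `U` of a vector space. -/
structure IsMetricOn (m : W → W →L[ℝ] W →L[ℝ] ℝ) (U : Set W) : Prop where
  isOpen : IsOpen U
  smooth : ContDiffOn ℝ ∞ m U
  symm : ∀ y ∈ U, ∀ u v, m y u v = m y v u
  pos : ∀ y ∈ U, ∀ u, u ≠ 0 → 0 < m y u u

/-- The right-hand side of the Koszul formula,
`(∂_u m(v, z) + ∂_v m(u, z) - ∂_z m(u, v)) / 2`, as a function of `u`, `v`, `z`. -/
def koszul (m : W → W →L[ℝ] W →L[ℝ] ℝ) (y : W) : W →L[ℝ] W →L[ℝ] W →L[ℝ] ℝ :=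
  (1 / 2 : ℝ) • (fderiv ℝ m y + (fderiv ℝ m y).flip -
    ((ContinuousLinearMap.flipₗᵢ ℝ W W ℝ : (W →L[ℝ] W →L[ℝ] ℝ) →L[ℝ] W →L[ℝ] W →L[ℝ] ℝ) ∘L
      (fderiv ℝ m y).flip))

/-- The Christoffel symbols of the metric `m` on a vector space, as a continuous bilinear map. -/
def chrL (m : W → W →L[ℝ] W →L[ℝ] ℝ) (y : W) : W →L[ℝ] W →L[ℝ] W :=
  (ContinuousLinearMap.compL ℝ W (W →L[ℝ] ℝ) W (m y).inverse) ∘L koszul m y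

theorem koszul_apply (m : W → W →L[ℝ] W →L[ℝ] ℝ) (y u v z : W) :
    koszul m y u v z =
      (1 / 2) * (fderiv ℝ m y u v z + fderiv ℝ m y v u z - fderiv ℝ m y z u v) := rfl

namespace IsMetricOn

variable {m : W → W →L[ℝ] W →L[ℝ] ℝ} {U : Set W}

theorem contDiffAt (h : IsMetricOn m U) {y : W} (hy : y ∈ U) : ContDiffAt ℝ ∞ m y :=
  h.smooth.contDiffAt (h.isOpen.mem_nhds hy)

theorem differentiableAt (h : IsMetricOn m U) {y : W} (hy : y ∈ U) : DifferentiableAt ℝ m y :=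
  (h.contDiffAt hy).differentiableAt (by simp)

theorem fderiv_symm (h : IsMetricOn m U) {y : W} (hy : y ∈ U) (u v w : W) :
    fderiv ℝ m y u v w = fderiv ℝ m y u w v := by
  have h1 : ∀ a b : W, HasFDerivAt (fun z => m z a b)
      (((ContinuousLinearMap.apply ℝ ℝ b) ∘L (ContinuousLinearMap.apply ℝ (W →L[ℝ] ℝ) a)) ∘L
        fderiv ℝ m y) y := fun a b =>
    (((ContinuousLinearMap.apply ℝ ℝ b) ∘L
      (ContinuousLinearMap.apply ℝ (W →L[ℝ] ℝ) a)).hasFDerivAt).comp y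
        (h.differentiableAt hy).hasFDerivAt
  have h2 : (fun z => m z v w) =ᶠ[𝓝 y] fun z => m z w v := by
    filter_upwards [h.isOpen.mem_nhds hy] with z hz using h.symm z hz v w
  have := (h1 v w).unique ((h1 w v).congr_of_eventuallyEq h2)
  exact DFunLike.congr_fun this u

theorem ext_inner (h : IsMetricOn m U) {y : W} (hy : y ∈ U) {u v : W}
    (huv : ∀ z, m y u z = m y v z) : u = v := by
  by_contra hne
  have h1 := h.pos y hy (u - v) (sub_ne_zero.2 hne)
  have h2 := huv (u - v)
  have h3 : m y (u - v) (u - v) = m y u (u - v) - m y v (u - v) := by simp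
  linarith

variable [FiniteDimensional ℝ W]

theorem isInvertible (h : IsMetricOn m U) {y : W} (hy : y ∈ U) : (m y).IsInvertible := by
  have hinj : Function.Injective (m y) := fun u v huv =>
    h.ext_inner hy fun z => by rw [huv]
  have hfr : finrank ℝ W = finrank ℝ (W →L[ℝ] ℝ) := by
    rw [← (LinearMap.toContinuousLinearMap (𝕜 := ℝ) (E := W) (F' := ℝ)).finrank_eq]
    exact (Subspace.dual_finrank_eq (K := ℝ) (V := W)).symm
  refine ⟨(LinearEquiv.ofInjectiveOfFinrankEq (m y : W →ₗ[ℝ] W →L[ℝ] ℝ) hinj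
    hfr).toContinuousLinearEquiv, ?_⟩
  ext u v
  rfl

theorem inner_chrL (h : IsMetricOn m U) {y : W} (hy : y ∈ U) (u v z : W) :
    m y (chrL m y u v) z =
      (1 / 2) * (fderiv ℝ m y u v z + fderiv ℝ m y v u z - fderiv ℝ m y z u v) := by
  have : m y (chrL m y u v) = koszul m y u v := by
    change m y ((m y).inverse (koszul m y u v)) = _
    obtain ⟨e, he⟩ := h.isInvertible hy
    rw [← he, ContinuousLinearMap.inverse_equiv]
    simp
  rw [this, koszul_apply]

theorem chrL_symm (h : IsMetricOn m U) {y : W} (hy : y ∈ U) (u v : W) :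
    chrL m y u v = chrL m y v u := by
  refine h.ext_inner hy fun z => ?_
  rw [h.inner_chrL hy, h.inner_chrL hy, h.fderiv_symm hy z u v]
  ring

theorem fderiv_eq (h : IsMetricOn m U) {y : W} (hy : y ∈ U) (u v w : W) :
    fderiv ℝ m y u v w = m y (chrL m y u v) w + m y v (chrL m y u w) := by
  rw [h.symm y hy v, h.inner_chrL hy, h.inner_chrL hy, h.fderiv_symm hy u w v,
    h.fderiv_symm hy v u w, h.fderiv_symm hy w u v]
  ring

theorem contDiffOn_chrL (h : IsMetricOn m U) : ContDiffOn ℝ ∞ (chrL m) U := by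
  have h1 : ContDiffOn ℝ ∞ (fderiv ℝ m) U :=
    h.smooth.fderiv_of_isOpen h.isOpen (by simp)
  have h2 : ContDiffOn ℝ ∞ (koszul m) U := by
    unfold koszul
    have hf : ContDiffOn ℝ ∞ (fun y => (fderiv ℝ m y).flip) U :=
      (ContinuousLinearMap.flipₗᵢ ℝ W W (W →L[ℝ] ℝ)).contDiff.comp_contDiffOn h1
    refine ContDiffOn.const_smul _ ((h1.add hf).sub ?_)
    exact (contDiffOn_const).clm_comp hf
  have h3 : ContDiffOn ℝ ∞ (fun y => (m y).inverse) U := by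
    intro y hy
    obtain ⟨e, he⟩ := h.isInvertible hy
    have := contDiffAt_map_inverse (𝕜 := ℝ) (n := ∞) e
    rw [he] at this
    exact (this.comp y (h.contDiffAt hy)).contDiffWithinAt
  exact ((ContinuousLinearMap.compL ℝ W (W →L[ℝ] ℝ) W).contDiff.comp_contDiffOn h3).clm_comp h2

theorem differentiableAt_chrL (h : IsMetricOn m U) {y : W} (hy : y ∈ U) :
    DifferentiableAt ℝ (chrL m) y :=
  (h.contDiffOn_chrL.contDiffAt (h.isOpen.mem_nhds hy)).differentiableAt (by simp)

end IsMetricOn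

/-- The Riemann curvature of the metric `m`. -/
def riem (m : W → W →L[ℝ] W →L[ℝ] ℝ) (y u v w : W) : W :=
  fderiv ℝ (chrL m) y u v w - fderiv ℝ (chrL m) y v u w
    + chrL m y u (chrL m y v w) - chrL m y v (chrL m y u w)

theorem riem_antisymm (m : W → W →L[ℝ] W →L[ℝ] ℝ) (y u v w : W) :
    riem m y u v w = - riem m y v u w := by
  unfold riem
  abel

theorem fderiv_apply₂ {X Y Z : Type*} [NormedAddCommGroup X] [NormedSpace ℝ X]
    [NormedAddCommGroup Y] [NormedSpace ℝ Y] [NormedAddCommGroup Z] [NormedSpace ℝ Z]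
    {B : V → X →L[ℝ] Y →L[ℝ] Z} {y : V} (h : DifferentiableAt ℝ B y) (u : V) (v : X) (w : Y) :
    fderiv ℝ (fun z => B z v w) y u = fderiv ℝ B y u v w := by
  have h1 : HasFDerivAt (fun z => B z v w)
      (((ContinuousLinearMap.apply ℝ Z w) ∘L (ContinuousLinearMap.apply ℝ (Y →L[ℝ] Z) v)) ∘L
        fderiv ℝ B y) y :=
    (((ContinuousLinearMap.apply ℝ Z w) ∘L
      (ContinuousLinearMap.apply ℝ (Y →L[ℝ] Z) v)).hasFDerivAt).comp y h.hasFDerivAt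
  rw [h1.fderiv]
  rfl

theorem fderiv_apply₁ {X Y : Type*} [NormedAddCommGroup X] [NormedSpace ℝ X]
    [NormedAddCommGroup Y] [NormedSpace ℝ Y]
    {B : V → X →L[ℝ] Y} {y : V} (h : DifferentiableAt ℝ B y) (u : V) (v : X) :
    fderiv ℝ (fun z => B z v) y u = fderiv ℝ B y u v := by
  have h1 : HasFDerivAt (fun z => B z v) ((ContinuousLinearMap.apply ℝ Y v) ∘L fderiv ℝ B y) y :=
    ((ContinuousLinearMap.apply ℝ Y v).hasFDerivAt).comp y h.hasFDerivAt
  rw [h1.fderiv]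
  rfl

/-- The rule for differentiating `B(y)(X(y), Y(y))`. -/
theorem HasFDerivWithinAt.clm_apply₂ {X Y Z : Type*} [NormedAddCommGroup X] [NormedSpace ℝ X]
    [NormedAddCommGroup Y] [NormedSpace ℝ Y] [NormedAddCommGroup Z] [NormedSpace ℝ Z]
    {B : V → X →L[ℝ] Y →L[ℝ] Z} {B' : V →L[ℝ] X →L[ℝ] Y →L[ℝ] Z} {a : V → X} {a' : V →L[ℝ] X}
    {b : V → Y} {b' : V →L[ℝ] Y} {s : Set V} {y : V} (hB : HasFDerivWithinAt B B' s y)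
    (ha : HasFDerivWithinAt a a' s y) (hb : HasFDerivWithinAt b b' s y) :
    ∃ D : V →L[ℝ] Z, HasFDerivWithinAt (fun z => B z (a z) (b z)) D s y ∧
      ∀ v, D v = B' v (a y) (b y) + B y (a' v) (b y) + B y (a y) (b' v) := by
  refine ⟨_, (hB.clm_apply ha).clm_apply hb, fun v => ?_⟩
  simp
  abel

section Curvature

variable [FiniteDimensional ℝ W] {m : W → W →L[ℝ] W →L[ℝ] ℝ} {U : Set W}

theorem curvature_eq_riem {H : Type*} [TopologicalSpace H] {I : ModelWithCorners ℝ W H}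
    {M : Type*} [TopologicalSpace M] [ChartedSpace H M] (g : MetricField I M) (x : M)
    (h : IsMetricOn (metricInChart g x) U) (hx : extChartAt I x x ∈ U) (u v w : W) :
    curvature g x u v w = riem (metricInChart g x) (extChartAt I x x) u v w := by
  have h1 := h.differentiableAt_chrL hx
  unfold riem
  rw [← fderiv_apply₂ h1, ← fderiv_apply₂ h1]
  rfl

namespace IsMetricOn

theorem fderiv_chrL_symm (h : IsMetricOn m U) {y : W} (hy : y ∈ U) (u v w : W) :
    fderiv ℝ (chrL m) y u v w = fderiv ℝ (chrL m) y u w v := by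
  rw [← fderiv_apply₂ (h.differentiableAt_chrL hy), ← fderiv_apply₂ (h.differentiableAt_chrL hy)]
  have h2 : (fun z => chrL m z v w) =ᶠ[𝓝 y] fun z => chrL m z w v := by
    filter_upwards [h.isOpen.mem_nhds hy] with z hz using h.chrL_symm hz v w
  rw [h2.fderiv_eq]

theorem riem_bianchi (h : IsMetricOn m U) {y : W} (hy : y ∈ U) (u v w : W) :
    riem m y u v w + riem m y v w u + riem m y w u v = 0 := by
  unfold riem
  rw [h.fderiv_chrL_symm hy u v w, h.fderiv_chrL_symm hy v w u, h.fderiv_chrL_symm hy w u v,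
    h.chrL_symm hy v w, h.chrL_symm hy w u, h.chrL_symm hy u v]
  abel

/-- Metric compatibility, differentiated once more. -/
theorem fderiv_fderiv (h : IsMetricOn m U) {y : W} (hy : y ∈ U) (u v w z : W) :
    fderiv ℝ (fderiv ℝ m) y u v w z =
      m y (fderiv ℝ (chrL m) y u v w) z + m y w (fderiv ℝ (chrL m) y u v z)
      + (m y (chrL m y u (chrL m y v w)) z + m y (chrL m y v w) (chrL m y u z))
      + (m y (chrL m y u w) (chrL m y v z) + m y w (chrL m y u (chrL m y v z))) := by
  have h1 : ContDiffOn ℝ ∞ (fderiv ℝ m) U := h.smooth.fderiv_of_isOpen h.isOpen (by simp)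
  have h1' : DifferentiableAt ℝ (fderiv ℝ m) y :=
    (h1.contDiffAt (h.isOpen.mem_nhds hy)).differentiableAt (by simp)
  have hv : HasFDerivAt (fun x => fderiv ℝ m x v) ((ContinuousLinearMap.apply ℝ _ v) ∘L
      fderiv ℝ (fderiv ℝ m) y) y :=
    ((ContinuousLinearMap.apply ℝ (W →L[ℝ] W →L[ℝ] ℝ) v).hasFDerivAt).comp y h1'.hasFDerivAt
  have e1 : fderiv ℝ (fderiv ℝ m) y u v w z = fderiv ℝ (fun x => fderiv ℝ m x v w z) y u := by
    rw [fderiv_apply₂ hv.differentiableAt, hv.fderiv]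
    rfl
  have e2 : (fun x => fderiv ℝ m x v w z) =ᶠ[𝓝 y]
      fun x => m x (chrL m x v w) z + m x w (chrL m x v z) := by
    filter_upwards [h.isOpen.mem_nhds hy] with x hx using h.fderiv_eq hx v w z
  have hm := (h.differentiableAt hy).hasFDerivAt.hasFDerivWithinAt (s := univ)
  have hΓ : ∀ a : W, HasFDerivWithinAt (fun x => chrL m x v a)
      (fderiv ℝ (fun x => chrL m x v a) y) univ y := fun a =>
    (((h.differentiableAt_chrL hy).clm_apply (differentiableAt_const v)).clm_apply
      (differentiableAt_const a)).hasFDerivAt.hasFDerivWithinAt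
  have hc : ∀ a : W, HasFDerivWithinAt (fun _ : W => a) (0 : W →L[ℝ] W) univ y := fun a =>
    hasFDerivWithinAt_const a y univ
  obtain ⟨D1, hD1, hD1'⟩ := hm.clm_apply₂ (hΓ w) (hc z)
  obtain ⟨D2, hD2, hD2'⟩ := hm.clm_apply₂ (hc w) (hΓ z)
  rw [e1, e2.fderiv_eq]
  refine (DFunLike.congr_fun ((hD1.add hD2).hasFDerivAt univ_mem).fderiv u).trans ?_
  simp only [add_apply, hD1', hD2', h.fderiv_eq hy,
    fderiv_apply₂ (h.differentiableAt_chrL hy)]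
  simp
  ring

theorem riem_skew (h : IsMetricOn m U) {y : W} (hy : y ∈ U) (u v w z : W) :
    m y (riem m y u v w) z = - m y (riem m y u v z) w := by
  have h1 := h.fderiv_fderiv hy u v w z
  have h2 := h.fderiv_fderiv hy v u w z
  have h3 : fderiv ℝ (fderiv ℝ m) y u v = fderiv ℝ (fderiv ℝ m) y v u :=
    ((h.contDiffAt hy).isSymmSndFDerivAt (by simpa using ENat.LEInfty.out)).eq u v
  rw [h3] at h1
  rw [h1] at h2
  rw [h.symm y hy (riem m y u v z) w]
  simp only [riem, map_add, map_sub, add_apply, sub_apply]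
  linarith

theorem riem_pair (h : IsMetricOn m U) {y : W} (hy : y ∈ U) (u v w z : W) :
    m y (riem m y u v w) z = m y (riem m y w z u) v := by
  have a : ∀ p q r s, m y (riem m y p q r) s = - m y (riem m y q p r) s := fun p q r s => by
    rw [riem_antisymm]; simp
  have b := fun p q r s => h.riem_skew hy p q r s
  have c : ∀ p q r s, m y (riem m y p q r) s + m y (riem m y q r p) s + m y (riem m y r p q) s = 0 :=
    fun p q r s => by
      have := congrArg (fun t => m y t s) (h.riem_bianchi hy p q r)
      simpa using this
  linarith [c u v w z, c v w z u, c w z u v, c z u v w, a u v w z, a u w v z, b u v w z, b v w u z,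
    b v w z u, b w z v u, b w u v z, b w z u v, b z u w v, b z v u w, b u v z w, b z u v w,
    a z v u w, a w u v z, b u w v z, b v z u w, a v w u z, a w z u v, a z u v w, a w z v u,
    a z v w u, b z v w u, b v w u z, b v u w z, a v u w z, a v u z w, b v u z w, a u z w v, b u z w v,
    a u z v w, b u z v w, a v z w u, a v z u w, b v z w u, b u w z v, a u w z v, b w u z v, a w u z v]

end IsMetricOn

end Curvature

end

section

/-! ### Traces and orthonormal bases for a positive definite form -/

section LinearAlgebra

variable {V W : Type*} [NormedAddCommGroup V] [NormedSpace ℝ V]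
  [NormedAddCommGroup W] [NormedSpace ℝ W]

/-- `g` is a (positive definite) inner product. -/
structure IsInner (g : V →L[ℝ] V →L[ℝ] ℝ) : Prop where
  symm : ∀ u v, g u v = g v u
  pos : ∀ u, u ≠ 0 → 0 < g u u

/-- The family `e` is orthonormal for `g`. -/
def OrthonormalFor {ι : Type*} [DecidableEq ι] (g : V →L[ℝ] V →L[ℝ] ℝ) (e : ι → V) : Prop :=
  ∀ i j, g (e i) (e j) = if i = j then 1 else 0

theorem IsMetricOn.isInner {m : W → W →L[ℝ] W →L[ℝ] ℝ} {U : Set W} (h : IsMetricOn m U) {y : W}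
    (hy : y ∈ U) : IsInner (m y) := ⟨h.symm y hy, h.pos y hy⟩

namespace IsInner

variable {g : V →L[ℝ] V →L[ℝ] ℝ}

theorem nonneg (h : IsInner g) (u : V) : 0 ≤ g u u := by
  rcases eq_or_ne u 0 with rfl | hu
  · simp
  · exact (h.pos u hu).le

theorem ext_inner (h : IsInner g) {u v : V} (huv : ∀ z, g u z = g v z) : u = v := by
  by_contra hne
  have h1 := h.pos (u - v) (sub_ne_zero.2 hne)
  have h2 := huv (u - v)
  have h3 : g (u - v) (u - v) = g u (u - v) - g v (u - v) := by simp
  linarith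

theorem cauchy_schwarz (h : IsInner g) (u v : V) : g u v ^ 2 ≤ g u u * g v v := by
  rcases eq_or_ne v 0 with rfl | hv
  · simp
  have hv' := h.pos v hv
  have h1 := h.nonneg (g v v • u - g u v • v)
  simp only [map_sub, map_smul, sub_apply, smul_apply, smul_eq_mul, h.symm v u] at h1
  have h2 : 0 ≤ g v v * (g u u * g v v - g u v ^ 2) := by nlinarith
  have := nonneg_of_mul_nonneg_right h2 hv'
  linarith

theorem abs_le (h : IsInner g) {u v : V} {a b : ℝ} (ha : 0 ≤ a) (hb : 0 ≤ b)
    (hu : g u u ≤ a ^ 2) (hv : g v v ≤ b ^ 2) : |g u v| ≤ a * b := by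
  refine abs_le_of_sq_le_sq ?_ (mul_nonneg ha hb)
  calc g u v ^ 2 ≤ g u u * g v v := h.cauchy_schwarz u v
    _ ≤ a ^ 2 * b ^ 2 := mul_le_mul hu hv (h.nonneg v) (sq_nonneg a)
    _ = (a * b) ^ 2 := by ring

theorem exists_orthonormal [FiniteDimensional ℝ V] (h : IsInner g) :
    ∃ e : Basis (Fin (finrank ℝ V)) ℝ V, OrthonormalFor g e := by
  let B : LinearMap.BilinForm ℝ V :=
    LinearMap.mk₂ ℝ (fun u v => g u v) (by simp) (by simp) (by simp) (by simp)
  have hB : LinearMap.IsSymm B := ⟨fun u v => h.symm u v⟩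
  obtain ⟨v, hv⟩ := LinearMap.BilinForm.exists_orthogonal_basis hB
  have hv' : ∀ i j, i ≠ j → g (v i) (v j) = 0 := fun i j hij => hv hij
  have hp : ∀ i, 0 < g (v i) (v i) := fun i => h.pos _ (v.ne_zero i)
  have hs : ∀ i, Real.sqrt (g (v i) (v i)) ≠ 0 := fun i => (Real.sqrt_pos.2 (hp i)).ne'
  refine ⟨v.unitsSMul fun i => (Units.mk0 _ (hs i))⁻¹, fun i j => ?_⟩
  have e1 : ∀ i, v.unitsSMul (fun i => (Units.mk0 _ (hs i))⁻¹) i =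
      (Real.sqrt (g (v i) (v i)))⁻¹ • v i := fun i => by
    rw [Basis.unitsSMul_apply, Units.smul_def]; simp
  rw [e1, e1]
  simp only [map_smul, smul_apply, smul_eq_mul]
  split_ifs with hij
  · subst hij
    have := hs i
    have h2 := Real.mul_self_sqrt (hp i).le
    field_simp
    nlinarith
  · rw [hv' i j hij]; simp

end IsInner

variable {g : V →L[ℝ] V →L[ℝ] ℝ} {ι : Type*} [Fintype ι] [DecidableEq ι]

theorem OrthonormalFor.linearIndependent {e : ι → V} (he : OrthonormalFor g e) :
    LinearIndependent ℝ e := by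
  rw [Fintype.linearIndependent_iff]
  intro c hc i
  have := congrArg (fun v => g v (e i)) hc
  simpa [he _ _] using this

theorem OrthonormalFor.exists_basis [FiniteDimensional ℝ V] {e : ι → V} (he : OrthonormalFor g e)
    (hcard : Fintype.card ι = finrank ℝ V) : ∃ b : Basis ι ℝ V, ⇑b = e := by
  rcases isEmpty_or_nonempty ι with hι | hι
  · have h0 : finrank ℝ V = 0 := by rw [← hcard, Fintype.card_eq_zero]
    have : Subsingleton V := finrank_zero_iff.1 h0
    exact ⟨Basis.empty V, funext fun i => (hι.false i).elim⟩
  · exact ⟨basisOfLinearIndependentOfCardEqFinrank he.linearIndependent hcard, by simp⟩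

theorem OrthonormalFor.repr {e : Basis ι ℝ V} (he : OrthonormalFor g e) (v : V) (i : ι) :
    e.repr v i = g v (e i) := by
  have h := congrArg (fun v => g v (e i)) (e.sum_repr v)
  simp only [map_sum, map_smul, sum_apply, smul_apply, smul_eq_mul, he _ _, mul_ite, mul_one,
    mul_zero, Finset.sum_ite_eq', Finset.mem_univ, if_true] at h
  exact h

theorem OrthonormalFor.sum_smul {e : Basis ι ℝ V} (he : OrthonormalFor g e) (v : V) :
    ∑ i, g v (e i) • e i = v := by
  conv_rhs => rw [← e.sum_repr v]
  simp [he.repr]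

theorem OrthonormalFor.inner_eq_sum {e : Basis ι ℝ V} (he : OrthonormalFor g e) (u v : V) :
    g u v = ∑ i, g u (e i) * g v (e i) := by
  conv_lhs => rw [← he.sum_smul u]
  have h : ∀ i, g (e i) v = g v (e i) := fun i => by
    conv_lhs => rw [← he.sum_smul v]
    simp [he _ _]
  simp [h]

theorem OrthonormalFor.trace_eq_sum {e : Basis ι ℝ V} (he : OrthonormalFor g e) (T : V →ₗ[ℝ] V) :
    LinearMap.trace ℝ V T = ∑ i, g (T (e i)) (e i) := by
  rw [LinearMap.trace_eq_matrix_trace ℝ e, Matrix.trace]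
  simp [LinearMap.toMatrix_apply, he.repr]

/-- Sums over dual bases, `∑ B(s_j, b_j)` with `g(s_j, ·)` dual to `b_j`, agree with the sum over
an orthonormal basis. -/
theorem OrthonormalFor.sum_dual {κ X : Type*} [Fintype κ] [AddCommGroup X] [Module ℝ X]
    {e : Basis ι ℝ V} (he : OrthonormalFor g e) (hg : IsInner g) (b : Basis κ ℝ V) {s : κ → V}
    (hs : ∀ j v, g (s j) v = b.repr v j) (B : V →ₗ[ℝ] V →ₗ[ℝ] X) :
    ∑ j, B (s j) (b j) = ∑ k, B (e k) (e k) := by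
  have h1 : ∀ k, ∑ j, g (b j) (e k) • s j = e k := fun k => hg.ext_inner fun z => by
    have h := congrArg (fun v => g v (e k)) (b.sum_repr z)
    simp only [map_sum, map_smul, sum_apply, smul_apply, smul_eq_mul] at h
    rw [hg.symm (e k) z, ← h]
    simp [hs, mul_comm]
  have h2 : ∀ j, B (s j) (b j) = ∑ k, g (b j) (e k) • B (s j) (e k) := fun j => by
    conv_lhs => rw [← he.sum_smul (b j)]
    simp
  rw [Finset.sum_congr rfl fun j _ => h2 j, Finset.sum_comm]
  refine Finset.sum_congr rfl fun k _ => ?_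
  have h := congrArg (fun v => B v (e k)) (h1 k)
  simpa only [map_sum, map_smul, LinearMap.sum_apply, LinearMap.smul_apply] using h

/-- The trace of a bilinear map with respect to the inner product `g`. -/
def mtr {X : Type*} [AddCommGroup X] [Module ℝ X] [FiniteDimensional ℝ V]
    (g : V →L[ℝ] V →L[ℝ] ℝ) (B : V → V → X) : X :=
  ∑ i, ∑ j, ((Matrix.of fun k l => g (finBasis ℝ V k) (finBasis ℝ V l))⁻¹ i j) •
    B (finBasis ℝ V i) (finBasis ℝ V j)

theorem metricTrace_eq_mtr [FiniteDimensional ℝ V] {H : Type*} [TopologicalSpace H]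
    {I : ModelWithCorners ℝ V H} {M : Type*} [TopologicalSpace M] [ChartedSpace H M] {X : Type*}
    [AddCommGroup X] [Module ℝ X] (g : MetricField I M) (x : M)
    (B : TangentSpace I x → TangentSpace I x → X) : metricTrace g x B = mtr (V := V) (g x) B := rfl

theorem IsInner.mtr_eq_sum_dual {X : Type*} [AddCommGroup X] [Module ℝ X] [FiniteDimensional ℝ V]
    (hg : IsInner g) {s : Fin (finrank ℝ V) → V}
    (hs : ∀ j v, g (s j) v = (finBasis ℝ V).repr v j) (B : V →ₗ[ℝ] V →ₗ[ℝ] X) :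
    mtr g (fun u v => B u v) = ∑ j, B (s j) (finBasis ℝ V j) := by
  set b := finBasis ℝ V
  have hS : (Matrix.of fun k l => g (b k) (b l))⁻¹ = Matrix.of fun k l => b.repr (s k) l := by
    apply Matrix.inv_eq_left_inv
    ext i j
    have := hs i (b j)
    conv at this => lhs; rw [← b.sum_repr (s i)]
    simp only [map_sum, map_smul, sum_apply, smul_apply, smul_eq_mul] at this
    simp only [Matrix.mul_apply, Matrix.of_apply, this, Matrix.one_apply, Basis.repr_self]
    simp [Finsupp.single_apply, eq_comm]
  have h1 : ∀ i, ∑ j, b.repr (s i) j • b j = s i := fun i => b.sum_repr (s i)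
  have hsym : ∀ i j, b.repr (s i) j = b.repr (s j) i := fun i j => by
    rw [← hs, ← hs, hg.symm]
  unfold mtr
  rw [hS, Finset.sum_comm]
  refine Finset.sum_congr rfl fun j _ => ?_
  conv_rhs => rw [← h1 j]
  simp only [map_sum, map_smul, LinearMap.sum_apply, LinearMap.smul_apply, Matrix.of_apply]
  exact Finset.sum_congr rfl fun i _ => by rw [hsym]

theorem IsInner.exists_dual [FiniteDimensional ℝ V] (hg : IsInner g) {κ : Type*}
    (b : Basis κ ℝ V) (j : κ) : ∃ s : V, ∀ v, g s v = b.repr v j := by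
  obtain ⟨e, he⟩ := hg.exists_orthonormal
  refine ⟨∑ k, b.repr (e k) j • e k, fun v => ?_⟩
  conv_rhs => rw [← he.sum_smul v]
  simp [hg.symm _ v, mul_comm]

theorem OrthonormalFor.mtr_eq_sum {X : Type*} [AddCommGroup X] [Module ℝ X]
    [FiniteDimensional ℝ V] (hg : IsInner g) {e : Basis ι ℝ V} (he : OrthonormalFor g e)
    (B : V →ₗ[ℝ] V →ₗ[ℝ] X) : mtr g (fun u v => B u v) = ∑ k, B (e k) (e k) := by
  choose s hs using hg.exists_dual (finBasis ℝ V)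
  rw [hg.mtr_eq_sum_dual hs, he.sum_dual hg _ hs]

end LinearAlgebra

/-! ### Covariant derivatives along maps -/

section Covariant

variable {V W : Type*} [NormedAddCommGroup V] [NormedSpace ℝ V]
  [NormedAddCommGroup W] [NormedSpace ℝ W] [FiniteDimensional ℝ W]
  {m : W → W →L[ℝ] W →L[ℝ] ℝ} {U : Set W}

/-- The covariant derivative `D_v X` of a vector field `X` along the map `f`. -/
def cov (m : W → W →L[ℝ] W →L[ℝ] ℝ) (f X : V → W) (y v : V) : W :=
  fderiv ℝ X y v + chrL m (f y) (fderiv ℝ f y v) (X y)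

theorem IsMetricOn.hasFDerivWithinAt_inner (h : IsMetricOn m U) {c X Z : V → W}
    {c' X' Z' : V →L[ℝ] W} {S : Set V} {y : V} (hy : c y ∈ U) (hc : HasFDerivWithinAt c c' S y)
    (hX : HasFDerivWithinAt X X' S y) (hZ : HasFDerivWithinAt Z Z' S y) :
    ∃ D : V →L[ℝ] ℝ, HasFDerivWithinAt (fun z => m (c z) (X z) (Z z)) D S y ∧
      ∀ v, D v = m (c y) (X' v + chrL m (c y) (c' v) (X y)) (Z y) +
        m (c y) (X y) (Z' v + chrL m (c y) (c' v) (Z y)) := by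
  have h1 : HasFDerivWithinAt (fun z => m (c z)) (fderiv ℝ m (c y) ∘L c') S y :=
    (h.differentiableAt hy).hasFDerivAt.comp_hasFDerivWithinAt y hc
  obtain ⟨D, hD, hD'⟩ := h1.clm_apply₂ hX hZ
  refine ⟨D, hD, fun v => ?_⟩
  rw [hD', ContinuousLinearMap.comp_apply, h.fderiv_eq hy]
  simp only [map_add, add_apply]
  ring

theorem IsMetricOn.fderiv_inner (h : IsMetricOn m U) {f X Z : V → W} {y : V} (hy : f y ∈ U)
    (hf : DifferentiableAt ℝ f y) (hX : DifferentiableAt ℝ X y) (hZ : DifferentiableAt ℝ Z y)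
    (v : V) : fderiv ℝ (fun z => m (f z) (X z) (Z z)) y v =
      m (f y) (cov m f X y v) (Z y) + m (f y) (X y) (cov m f Z y v) := by
  obtain ⟨D, hD, hD'⟩ := h.hasFDerivWithinAt_inner hy hf.hasFDerivAt.hasFDerivWithinAt
    hX.hasFDerivAt.hasFDerivWithinAt hZ.hasFDerivAt.hasFDerivWithinAt (S := univ)
  rw [(hD.hasFDerivAt univ_mem).fderiv, hD']
  rfl

theorem cov_add {f X Z : V → W} {y : V} (hX : DifferentiableAt ℝ X y)
    (hZ : DifferentiableAt ℝ Z y) (v : V) :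
    cov m f (fun z => X z + Z z) y v = cov m f X y v + cov m f Z y v := by
  unfold cov
  rw [fderiv_fun_add hX hZ]
  simp only [map_add, add_apply]
  abel

theorem cov_sub {f X Z : V → W} {y : V} (hX : DifferentiableAt ℝ X y)
    (hZ : DifferentiableAt ℝ Z y) (v : V) :
    cov m f (fun z => X z - Z z) y v = cov m f X y v - cov m f Z y v := by
  unfold cov
  rw [fderiv_fun_sub hX hZ]
  simp only [map_sub, sub_apply]
  abel

theorem cov_congr {f X Z : V → W} {y : V} (h : X =ᶠ[𝓝 y] Z) (v : V) :
    cov m f X y v = cov m f Z y v := by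
  unfold cov
  rw [h.fderiv_eq, h.eq_of_nhds]

theorem cov_sum {κ : Type*} {f : V → W} {X : κ → V → W} {y : V} (t : Finset κ)
    (hX : ∀ j, DifferentiableAt ℝ (X j) y) (v : V) :
    cov m f (fun z => ∑ j ∈ t, X j z) y v = ∑ j ∈ t, cov m f (X j) y v := by
  unfold cov
  rw [fderiv_fun_sum fun j _ => hX j]
  simp [Finset.sum_add_distrib]

theorem IsMetricOn.hasFDerivAt_cov (h : IsMetricOn m U) {f X : V → W} {y : V} (hy : f y ∈ U)
    (hf : ContDiffAt ℝ ∞ f y) (hX : ContDiffAt ℝ ∞ X y) (w : V) :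
    ∃ D : V →L[ℝ] W, HasFDerivAt (fun z => cov m f X z w) D y ∧ ∀ v, D v =
      fderiv ℝ (fderiv ℝ X) y v w +
        (fderiv ℝ (chrL m) (f y) (fderiv ℝ f y v) (fderiv ℝ f y w) (X y) +
        chrL m (f y) (fderiv ℝ (fderiv ℝ f) y v w) (X y) +
        chrL m (f y) (fderiv ℝ f y w) (fderiv ℝ X y v)) := by
  have hd : ∀ {Y : V → W}, ContDiffAt ℝ ∞ Y y → HasFDerivWithinAt (fun z => fderiv ℝ Y z w)
      ((ContinuousLinearMap.apply ℝ W w) ∘L fderiv ℝ (fderiv ℝ Y) y) univ y := fun {Y} hY => by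
    have : DifferentiableAt ℝ (fderiv ℝ Y) y :=
      (hY.fderiv_right (m := ∞) (by simp)).differentiableAt (by simp)
    exact (((ContinuousLinearMap.apply ℝ W w).hasFDerivAt).comp y this.hasFDerivAt).hasFDerivWithinAt
  have hc : HasFDerivWithinAt (fun z => chrL m (f z)) (fderiv ℝ (chrL m) (f y) ∘L fderiv ℝ f y)
      univ y :=
    ((h.differentiableAt_chrL hy).hasFDerivAt.comp y
      (hf.differentiableAt (by simp)).hasFDerivAt).hasFDerivWithinAt
  obtain ⟨D, hD, hD'⟩ := hc.clm_apply₂ (hd hf)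
    (hX.differentiableAt (by simp)).hasFDerivAt.hasFDerivWithinAt
  refine ⟨_, ((hd hX).add hD).hasFDerivAt univ_mem, fun v => ?_⟩
  simp only [add_apply, hD']
  rfl

/-- The curvature is the commutator of covariant derivatives. -/
theorem IsMetricOn.cov_comm (h : IsMetricOn m U) {f X : V → W} {y : V} (hy : f y ∈ U)
    (hf : ContDiffAt ℝ ∞ f y) (hX : ContDiffAt ℝ ∞ X y) (v w : V) :
    cov m f (fun z => cov m f X z w) y v - cov m f (fun z => cov m f X z v) y w =
      riem m (f y) (fderiv ℝ f y v) (fderiv ℝ f y w) (X y) := by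
  obtain ⟨D1, hD1, h1⟩ := h.hasFDerivAt_cov hy hf hX w
  obtain ⟨D2, hD2, h2⟩ := h.hasFDerivAt_cov hy hf hX v
  have e1 : fderiv ℝ (fderiv ℝ X) y v w = fderiv ℝ (fderiv ℝ X) y w v :=
    (hX.isSymmSndFDerivAt (by simpa using ENat.LEInfty.out)).eq v w
  have e2 : fderiv ℝ (fderiv ℝ f) y v w = fderiv ℝ (fderiv ℝ f) y w v :=
    (hf.isSymmSndFDerivAt (by simpa using ENat.LEInfty.out)).eq v w
  have e3 : cov m f (fun z => cov m f X z w) y v =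
    D1 v + chrL m (f y) (fderiv ℝ f y v) (cov m f X y w) := by rw [cov, hD1.fderiv]
  have e4 : cov m f (fun z => cov m f X z v) y w =
    D2 w + chrL m (f y) (fderiv ℝ f y w) (cov m f X y v) := by rw [cov, hD2.fderiv]
  rw [e3, e4, h1, h2, e1, e2]
  simp only [riem, cov, map_add]
  abel

end Covariant

end

section

/-! ### Immersions -/

section Immersion

variable {V W : Type*} [NormedAddCommGroup V] [NormedSpace ℝ V]
  [NormedAddCommGroup W] [NormedSpace ℝ W]

theorem ContDiffOn.clm_bilinearComp {X Y Z Z' : Type*} [NormedAddCommGroup X] [NormedSpace ℝ X]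
    [NormedAddCommGroup Y] [NormedSpace ℝ Y] [NormedAddCommGroup Z] [NormedSpace ℝ Z]
    [NormedAddCommGroup Z'] [NormedSpace ℝ Z']
    {B : V → X →L[ℝ] Y →L[ℝ] Z} {D : V → Z' →L[ℝ] X} {D' : V → Z' →L[ℝ] Y} {O : Set V}
    {k : WithTop ℕ∞}
    (hB : ContDiffOn ℝ k B O) (hD : ContDiffOn ℝ k D O) (hD' : ContDiffOn ℝ k D' O) :
    ContDiffOn ℝ k (fun y => (B y).bilinearComp (D y) (D' y)) O := by
  have h1 := (ContinuousLinearMap.flipₗᵢ ℝ Z' Y Z).contDiff.comp_contDiffOn (hB.clm_comp hD)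
  exact (ContinuousLinearMap.flipₗᵢ ℝ Z' Z' Z).contDiff.comp_contDiffOn (h1.clm_comp hD')

/-- The metric induced by `f`. -/
def pull (m : W → W →L[ℝ] W →L[ℝ] ℝ) (f : V → W) (y : V) : V →L[ℝ] V →L[ℝ] ℝ :=
  (m (f y)).bilinearComp (fderiv ℝ f y) (fderiv ℝ f y)

/-- The covariant derivative of the differential of `f`, for the flat connection of the domain:
`nab m f y u v = D_u (∂_v f)`. -/
def nab (m : W → W →L[ℝ] W →L[ℝ] ℝ) (f : V → W) (y : V) : V →L[ℝ] V →L[ℝ] W :=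
  fderiv ℝ (fderiv ℝ f) y + (chrL m (f y)).bilinearComp (fderiv ℝ f y) (fderiv ℝ f y)

/-- The second fundamental form of the immersion `f`. -/
def sff (m : W → W →L[ℝ] W →L[ℝ] ℝ) (f : V → W) (y : V) : V →L[ℝ] V →L[ℝ] W :=
  nab m f y - (ContinuousLinearMap.compL ℝ V V W (fderiv ℝ f y)) ∘L chrL (pull m f) y

/-- The covariant derivative of the second fundamental form, as a form with values in the ambient
tangent spaces. -/
def nablaSff (m : W → W →L[ℝ] W →L[ℝ] ℝ) (f : V → W) (y w u v : V) : W :=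
  cov m f (fun z => sff m f z u v) y w - sff m f y (chrL (pull m f) y w u) v
    - sff m f y u (chrL (pull m f) y w v)

/-- The mean curvature vector. -/
def meanL [FiniteDimensional ℝ V] (m : W → W →L[ℝ] W →L[ℝ] ℝ) (f : V → W) (y : V) : W :=
  mtr (pull m f y) fun u v => sff m f y u v

theorem pull_apply (m : W → W →L[ℝ] W →L[ℝ] ℝ) (f : V → W) (y u v : V) :
    pull m f y u v = m (f y) (fderiv ℝ f y u) (fderiv ℝ f y v) := rfl

theorem nab_apply (m : W → W →L[ℝ] W →L[ℝ] ℝ) (f : V → W) (y u v : V) :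
    nab m f y u v = fderiv ℝ (fderiv ℝ f) y u v
      + chrL m (f y) (fderiv ℝ f y u) (fderiv ℝ f y v) := rfl

theorem sff_apply (m : W → W →L[ℝ] W →L[ℝ] ℝ) (f : V → W) (y u v : V) :
    sff m f y u v = nab m f y u v - fderiv ℝ f y (chrL (pull m f) y u v) := rfl

theorem nab_eq (m : W → W →L[ℝ] W →L[ℝ] ℝ) (f : V → W) (y u v : V) :
    nab m f y u v = sff m f y u v + fderiv ℝ f y (chrL (pull m f) y u v) := by
  rw [sff_apply]; abel

/-- `f` is an immersion of the open set `O` into the open set `U`, on which `m` is a metric. -/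
structure IsImmersionOn (m : W → W →L[ℝ] W →L[ℝ] ℝ) (U : Set W) (f : V → W) (O : Set V) :
    Prop where
  metric : IsMetricOn m U
  isOpen : IsOpen O
  smooth : ContDiffOn ℝ ∞ f O
  mapsTo : MapsTo f O U
  inj : ∀ y ∈ O, Function.Injective (fderiv ℝ f y)

namespace IsImmersionOn

variable {m : W → W →L[ℝ] W →L[ℝ] ℝ} {U : Set W} {f : V → W} {O : Set V}

theorem mono (h : IsImmersionOn m U f O) {O' : Set V} (hO : IsOpen O') (hsub : O' ⊆ O) :
    IsImmersionOn m U f O' :=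
  ⟨h.metric, hO, h.smooth.mono hsub, h.mapsTo.mono_left hsub, fun y hy => h.inj y (hsub hy)⟩

theorem contDiffAt (h : IsImmersionOn m U f O) {y : V} (hy : y ∈ O) : ContDiffAt ℝ ∞ f y :=
  h.smooth.contDiffAt (h.isOpen.mem_nhds hy)

theorem differentiableAt (h : IsImmersionOn m U f O) {y : V} (hy : y ∈ O) :
    DifferentiableAt ℝ f y := (h.contDiffAt hy).differentiableAt (by simp)

theorem contDiffOn_fderiv (h : IsImmersionOn m U f O) : ContDiffOn ℝ ∞ (fderiv ℝ f) O :=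
  h.smooth.fderiv_of_isOpen h.isOpen (by simp)

theorem contDiffAt_fderiv (h : IsImmersionOn m U f O) {y : V} (hy : y ∈ O) :
    ContDiffAt ℝ ∞ (fderiv ℝ f) y := h.contDiffOn_fderiv.contDiffAt (h.isOpen.mem_nhds hy)

theorem isMetricOn_pull (h : IsImmersionOn m U f O) : IsMetricOn (pull m f) O where
  isOpen := h.isOpen
  smooth := ContDiffOn.clm_bilinearComp (h.metric.smooth.comp h.smooth h.mapsTo)
    h.contDiffOn_fderiv h.contDiffOn_fderiv
  symm y hy u v := h.metric.symm _ (h.mapsTo hy) _ _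
  pos y hy u hu := h.metric.pos _ (h.mapsTo hy) _ fun h0 => hu (h.inj y hy (by simpa using h0))

variable [FiniteDimensional ℝ V] [FiniteDimensional ℝ W]

theorem contDiffOn_nab (h : IsImmersionOn m U f O) : ContDiffOn ℝ ∞ (nab m f) O :=
  (h.contDiffOn_fderiv.fderiv_of_isOpen h.isOpen (by simp)).add
    (ContDiffOn.clm_bilinearComp (h.metric.contDiffOn_chrL.comp h.smooth h.mapsTo)
      h.contDiffOn_fderiv h.contDiffOn_fderiv)

theorem contDiffOn_sff (h : IsImmersionOn m U f O) : ContDiffOn ℝ ∞ (sff m f) O :=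
  h.contDiffOn_nab.sub
    (((ContinuousLinearMap.compL ℝ V V W).contDiff.comp_contDiffOn h.contDiffOn_fderiv).clm_comp
      h.isMetricOn_pull.contDiffOn_chrL)

theorem differentiableAt_nab (h : IsImmersionOn m U f O) {y : V} (hy : y ∈ O) :
    DifferentiableAt ℝ (nab m f) y :=
  (h.contDiffOn_nab.contDiffAt (h.isOpen.mem_nhds hy)).differentiableAt (by simp)

theorem differentiableAt_sff (h : IsImmersionOn m U f O) {y : V} (hy : y ∈ O) :
    DifferentiableAt ℝ (sff m f) y :=
  (h.contDiffOn_sff.contDiffAt (h.isOpen.mem_nhds hy)).differentiableAt (by simp)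

theorem differentiableAt_fderiv (h : IsImmersionOn m U f O) {y : V} (hy : y ∈ O) :
    DifferentiableAt ℝ (fderiv ℝ f) y := (h.contDiffAt_fderiv hy).differentiableAt (by simp)

theorem cov_fderiv_apply (h : IsImmersionOn m U f O) {y : V} (hy : y ∈ O) {Y : V → V}
    (hY : DifferentiableAt ℝ Y y) (w : V) :
    cov m f (fun z => fderiv ℝ f z (Y z)) y w = nab m f y w (Y y) + fderiv ℝ f y (fderiv ℝ Y y w) := by
  have := (h.differentiableAt_fderiv hy).hasFDerivAt.clm_apply hY.hasFDerivAt
  unfold cov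
  rw [this.fderiv, nab_apply]
  simp
  abel

theorem cov_fderiv (h : IsImmersionOn m U f O) {y : V} (hy : y ∈ O) (v w : V) :
    cov m f (fun z => fderiv ℝ f z v) y w = nab m f y w v := by
  simpa using h.cov_fderiv_apply hy (differentiableAt_const v) w

theorem nab_symm (h : IsImmersionOn m U f O) {y : V} (hy : y ∈ O) (u v : V) :
    nab m f y u v = nab m f y v u := by
  rw [nab_apply, nab_apply, h.metric.chrL_symm (h.mapsTo hy),
    ((h.contDiffAt hy).isSymmSndFDerivAt (by simpa using ENat.LEInfty.out)).eq u v]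

theorem sff_symm (h : IsImmersionOn m U f O) {y : V} (hy : y ∈ O) (u v : V) :
    sff m f y u v = sff m f y v u := by
  rw [sff_apply, sff_apply, h.nab_symm hy, h.isMetricOn_pull.chrL_symm hy]

theorem fderiv_pull (h : IsImmersionOn m U f O) {y : V} (hy : y ∈ O) (u v w : V) :
    fderiv ℝ (pull m f) y u v w =
      m (f y) (nab m f y u v) (fderiv ℝ f y w) + m (f y) (fderiv ℝ f y v) (nab m f y u w) := by
  have hd : ∀ a, DifferentiableAt ℝ (fun z => fderiv ℝ f z a) y := fun a =>
    (h.differentiableAt_fderiv hy).clm_apply (differentiableAt_const a)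
  rw [← fderiv_apply₂ (h.isMetricOn_pull.differentiableAt hy), ← h.cov_fderiv hy v u,
    ← h.cov_fderiv hy w u, ← h.metric.fderiv_inner (h.mapsTo hy) (h.differentiableAt hy)
      (hd v) (hd w)]
  rfl

theorem inner_nab (h : IsImmersionOn m U f O) {y : V} (hy : y ∈ O) (u v w : V) :
    m (f y) (nab m f y u v) (fderiv ℝ f y w) = pull m f y (chrL (pull m f) y u v) w := by
  rw [h.isMetricOn_pull.inner_chrL hy, h.fderiv_pull hy, h.fderiv_pull hy, h.fderiv_pull hy,
    h.nab_symm hy v u, h.nab_symm hy w u, h.nab_symm hy w v]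
  have hs := h.metric.symm _ (h.mapsTo hy)
  rw [hs (fderiv ℝ f y v) (nab m f y u w), hs (fderiv ℝ f y u) (nab m f y v w)]
  ring

/-- The second fundamental form is normal. -/
theorem inner_sff (h : IsImmersionOn m U f O) {y : V} (hy : y ∈ O) (u v w : V) :
    m (f y) (sff m f y u v) (fderiv ℝ f y w) = 0 := by
  rw [sff_apply, map_sub, sub_apply, h.inner_nab hy, pull_apply, sub_self]

theorem inner_sff' (h : IsImmersionOn m U f O) {y : V} (hy : y ∈ O) (u v w : V) :
    m (f y) (fderiv ℝ f y w) (sff m f y u v) = 0 := by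
  rw [h.metric.symm _ (h.mapsTo hy), h.inner_sff hy]

theorem inner_nablaSff (h : IsImmersionOn m U f O) {y : V} (hy : y ∈ O) (w u v z : V) :
    m (f y) (nablaSff m f y w u v) (fderiv ℝ f y z) =
      - m (f y) (sff m f y u v) (sff m f y w z) := by
  have h1 : (fun x => m (f x) (sff m f x u v) (fderiv ℝ f x z)) =ᶠ[𝓝 y] fun _ => 0 := by
    filter_upwards [h.isOpen.mem_nhds hy] with x hx using h.inner_sff hx u v z
  have h2 := h.metric.fderiv_inner (h.mapsTo hy) (h.differentiableAt hy)
    (((h.differentiableAt_sff hy).clm_apply (differentiableAt_const u)).clm_apply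
      (differentiableAt_const v))
    ((h.differentiableAt_fderiv hy).clm_apply (differentiableAt_const z)) w
  rw [h1.fderiv_eq, h.cov_fderiv hy, nab_eq m f y w z] at h2
  simp only [map_add, h.inner_sff hy, fderiv_fun_const, Pi.zero_apply, zero_apply] at h2
  unfold nablaSff
  simp only [map_sub, sub_apply, h.inner_sff hy]
  linarith

theorem nablaSff_symm (h : IsImmersionOn m U f O) {y : V} (hy : y ∈ O) (w u v : V) :
    nablaSff m f y w u v = nablaSff m f y w v u := by
  have h1 : (fun z => sff m f z u v) =ᶠ[𝓝 y] fun z => sff m f z v u := by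
    filter_upwards [h.isOpen.mem_nhds hy] with x hx using h.sff_symm hx u v
  unfold nablaSff
  rw [cov_congr h1, h.sff_symm hy _ v, h.sff_symm hy u]
  abel

theorem cov_sff (h : IsImmersionOn m U f O) {y : V} (hy : y ∈ O) (w u v : V) :
    cov m f (fun z => sff m f z u v) y w = cov m f (fun z => nab m f z u v) y w
      - (nab m f y w (chrL (pull m f) y u v)
        + fderiv ℝ f y (fderiv ℝ (chrL (pull m f)) y w u v)) := by
  have hγ : DifferentiableAt ℝ (fun z => chrL (pull m f) z u v) y :=
    ((h.isMetricOn_pull.differentiableAt_chrL hy).clm_apply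
      (differentiableAt_const u)).clm_apply (differentiableAt_const v)
  rw [← fderiv_apply₂ (h.isMetricOn_pull.differentiableAt_chrL hy),
    ← h.cov_fderiv_apply hy hγ, ← cov_sub]
  · rfl
  · exact ((h.differentiableAt_nab hy).clm_apply
      (differentiableAt_const u)).clm_apply (differentiableAt_const v)
  · exact (h.differentiableAt_fderiv hy).clm_apply hγ

theorem cov_nab_comm (h : IsImmersionOn m U f O) {y : V} (hy : y ∈ O) (w u v : V) :
    cov m f (fun z => nab m f z u v) y w - cov m f (fun z => nab m f z w v) y u =
      riem m (f y) (fderiv ℝ f y w) (fderiv ℝ f y u) (fderiv ℝ f y v) := by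
  have h0 : ∀ u, (fun z => nab m f z u v) =ᶠ[𝓝 y] fun z => cov m f (fun x => fderiv ℝ f x v) z u :=
    fun u => by
      filter_upwards [h.isOpen.mem_nhds hy] with x hx using (h.cov_fderiv hx v u).symm
  rw [cov_congr (h0 u), cov_congr (h0 w)]
  exact h.metric.cov_comm (h.mapsTo hy) (h.contDiffAt hy)
    ((h.contDiffAt_fderiv hy).clm_apply contDiffAt_const) w u

/-- The Codazzi equation, with the tangential component given by the Gauss equation. -/
theorem codazzi (h : IsImmersionOn m U f O) {y : V} (hy : y ∈ O) (w u v : V) :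
    nablaSff m f y w u v = nablaSff m f y u w v
      + riem m (f y) (fderiv ℝ f y w) (fderiv ℝ f y u) (fderiv ℝ f y v)
      - fderiv ℝ f y (riem (pull m f) y w u v) := by
  have h1 := h.cov_nab_comm hy w u v
  have h2 := h.cov_sff hy w u v
  have h3 := h.cov_sff hy u w v
  rw [← h1]
  unfold nablaSff
  rw [h2, h3]
  simp only [sff_apply, riem, map_add, map_sub, h.isMetricOn_pull.chrL_symm hy w u]
  abel

theorem nablaSff_eq (h : IsImmersionOn m U f O) {y : V} (hy : y ∈ O) (w u v : V) :
    nablaSff m f y w u v = fderiv ℝ (sff m f) y w u v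
      + chrL m (f y) (fderiv ℝ f y w) (sff m f y u v)
      - sff m f y (chrL (pull m f) y w u) v - sff m f y u (chrL (pull m f) y w v) := by
  unfold nablaSff cov
  rw [fderiv_apply₂ (h.differentiableAt_sff hy)]

/-- The covariant derivative of the mean curvature is the trace of that of the second fundamental
form. -/
theorem cov_meanL (h : IsImmersionOn m U f O) {y : V} (hy : y ∈ O) {ι : Type*} [Fintype ι]
    [DecidableEq ι] {e : Basis ι ℝ V} (he : OrthonormalFor (pull m f y) e) (w : V) :
    cov m f (meanL m f) y w = ∑ k, nablaSff m f y w (e k) (e k) := by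
  have hg := h.isMetricOn_pull
  set b := finBasis ℝ V with hb
  set γ := chrL (pull m f) with hγ
  -- the dual basis of `b` for the varying induced metric
  let ℓ : Fin (finrank ℝ V) → V →L[ℝ] ℝ := fun j => LinearMap.toContinuousLinearMap (b.coord j)
  let s : Fin (finrank ℝ V) → V → V := fun j z => (pull m f z).inverse (ℓ j)
  have hs : ∀ z ∈ O, ∀ j v, pull m f z (s j z) v = b.repr v j := fun z hz j v => by
    have : pull m f z ((pull m f z).inverse (ℓ j)) = ℓ j := by
      obtain ⟨E, hE⟩ := hg.isInvertible hz
      rw [← hE, ContinuousLinearMap.inverse_equiv]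
      simp
    rw [this]; rfl
  have hsd : ∀ j, DifferentiableAt ℝ (s j) y := fun j => by
    obtain ⟨E, hE⟩ := hg.isInvertible hy
    have := contDiffAt_map_inverse (𝕜 := ℝ) (n := ∞) E
    rw [hE] at this
    exact (((this.comp y (hg.contDiffAt hy)).differentiableAt (by simp)).clm_apply
      (differentiableAt_const _))
  have hH : meanL m f =ᶠ[𝓝 y] fun z => ∑ j, sff m f z (s j z) (b j) := by
    filter_upwards [h.isOpen.mem_nhds hy] with z hz
    exact (hg.isInner hz).mtr_eq_sum_dual (hs z hz) (LinearMap.mk₂ ℝ (fun u v => sff m f z u v)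
      (by simp) (by simp) (by simp) (by simp))
  have hA := h.differentiableAt_sff hy
  have hterm : ∀ j, cov m f (fun z => sff m f z (s j z) (b j)) y w =
      nablaSff m f y w (s j y) (b j) + sff m f y (γ y w (s j y)) (b j)
        + sff m f y (s j y) (γ y w (b j)) + sff m f y (fderiv ℝ (s j) y w) (b j) := fun j => by
    obtain ⟨D, hD, hD'⟩ := hA.hasFDerivAt.hasFDerivWithinAt.clm_apply₂
      (hsd j).hasFDerivAt.hasFDerivWithinAt (hasFDerivWithinAt_const (b j) y univ)
    unfold nablaSff cov
    rw [(hD.hasFDerivAt univ_mem).fderiv, hD', fderiv_apply₂ hA]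
    simp
    abel
  have hds : ∀ j v, pull m f y (fderiv ℝ (s j) y w) v =
      - pull m f y (γ y w (s j y)) v - pull m f y (s j y) (γ y w v) := fun j v => by
    obtain ⟨D, hD, hD'⟩ := (hg.differentiableAt hy).hasFDerivAt.hasFDerivWithinAt.clm_apply₂
      (hsd j).hasFDerivAt.hasFDerivWithinAt (hasFDerivWithinAt_const v y univ)
    have h0 : (fun z => pull m f z (s j z) v) =ᶠ[𝓝 y] fun _ => b.repr v j := by
      filter_upwards [h.isOpen.mem_nhds hy] with z hz using hs z hz j v
    have h1 := h0.fderiv_eq (𝕜 := ℝ)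
    rw [(hD.hasFDerivAt univ_mem).fderiv] at h1
    have h2 := DFunLike.congr_fun h1 w
    rw [hD', hg.fderiv_eq hy] at h2
    simp at h2
    linarith
  have hi := hg.isInner hy
  let A : V →ₗ[ℝ] V →ₗ[ℝ] W := LinearMap.mk₂ ℝ (fun u v => sff m f y u v)
    (by simp) (by simp) (by simp) (by simp)
  have hAa : ∀ u v, A u v = sff m f y u v := fun _ _ => rfl
  let C : V →ₗ[ℝ] V := (γ y w : V →ₗ[ℝ] V)
  have hCa : ∀ u, C u = γ y w u := fun _ => rfl
  -- `t j` is the image of `s j` under the adjoint of the Christoffel operator `γ y w`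
  let t : Fin (finrank ℝ V) → V := fun j => - fderiv ℝ (s j) y w - γ y w (s j y)
  have ht : ∀ j v, pull m f y (t j) v = pull m f y (s j y) (γ y w v) := fun j v => by
    simp only [t, map_sub, map_neg, sub_apply, neg_apply, hds]
    ring
  have hsum1 : ∑ j, A (s j y) (C (b j)) = ∑ k, A (e k) (C (e k)) :=
    he.sum_dual hi b (hs y hy) (A.compl₂ C)
  have hsum2 : ∑ j, A (t j) (b j) = ∑ k, A (e k) (C (e k)) := by
    have h1 : ∀ j, t j = ∑ k, pull m f y (s j y) (C (e k)) • e k := fun j => by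
      rw [← he.sum_smul (t j)]
      simp [ht, hCa]
    have h2 : ∀ k, ∑ j, pull m f y (s j y) (C (e k)) • b j = C (e k) := fun k => by
      simp only [hs y hy]
      exact b.sum_repr _
    calc ∑ j, A (t j) (b j) = ∑ j, ∑ k, pull m f y (s j y) (C (e k)) • A (e k) (b j) :=
          Finset.sum_congr rfl fun j _ => by
            conv_lhs => rw [h1 j]
            simp only [map_sum, map_smul, LinearMap.sum_apply, LinearMap.smul_apply]
      _ = ∑ k, ∑ j, pull m f y (s j y) (C (e k)) • A (e k) (b j) := Finset.sum_comm
      _ = ∑ k, A (e k) (C (e k)) := Finset.sum_congr rfl fun k _ => by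
            conv_rhs => rw [← h2 k]
            simp only [map_sum, map_smul]
  have hnl : ∑ j, nablaSff m f y w (s j y) (b j) = ∑ k, nablaSff m f y w (e k) (e k) := by
    exact he.sum_dual hi b (hs y hy) (LinearMap.mk₂ ℝ (fun u v => nablaSff m f y w u v)
      (fun _ _ _ => by simp only [h.nablaSff_eq hy, map_add, add_apply]; abel)
      (fun _ _ _ => by simp only [h.nablaSff_eq hy, map_smul, smul_apply, smul_sub, smul_add])
      (fun _ _ _ => by simp only [h.nablaSff_eq hy, map_add]; abel)
      (fun _ _ _ => by simp only [h.nablaSff_eq hy, map_smul, smul_sub, smul_add]))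
  rw [cov_congr hH, cov_sum]
  · rw [Finset.sum_congr rfl fun j _ => hterm j, ← hnl]
    have h4 : ∀ j, nablaSff m f y w (s j y) (b j) + sff m f y (γ y w (s j y)) (b j)
        + sff m f y (s j y) (γ y w (b j)) + sff m f y (fderiv ℝ (s j) y w) (b j) =
        nablaSff m f y w (s j y) (b j) + (A (s j y) (C (b j)) - A (t j) (b j)) := fun j => by
      simp only [t, map_sub, map_neg, LinearMap.sub_apply, LinearMap.neg_apply]
      simp only [hAa, hCa]
      abel
    rw [Finset.sum_congr rfl fun j _ => h4 j, Finset.sum_add_distrib, Finset.sum_sub_distrib,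
      hsum1, hsum2, sub_self, add_zero]
  · intro j
    exact (hA.clm_apply (hsd j)).clm_apply (differentiableAt_const _)

end IsImmersionOn

end Immersion

end

section

/-! ### Change of coordinates -/

section Naturality

variable {V V' W W' : Type*} [NormedAddCommGroup V] [NormedSpace ℝ V]
  [NormedAddCommGroup W] [NormedSpace ℝ W] [NormedAddCommGroup V'] [NormedSpace ℝ V']
  [NormedAddCommGroup W'] [NormedSpace ℝ W']

theorem chrL_congr {m m' : W → W →L[ℝ] W →L[ℝ] ℝ} {y : W} (h : m =ᶠ[𝓝 y] m') :
    chrL m y = chrL m' y := by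
  unfold chrL koszul
  rw [h.fderiv_eq, h.eq_of_nhds]

theorem chrL_eventuallyEq {m m' : W → W →L[ℝ] W →L[ℝ] ℝ} {y : W} (h : m =ᶠ[𝓝 y] m') :
    chrL m =ᶠ[𝓝 y] chrL m' := by
  filter_upwards [eventually_eventually_nhds.2 h] with z hz using chrL_congr hz

theorem riem_congr {m m' : W → W →L[ℝ] W →L[ℝ] ℝ} {y : W} (h : m =ᶠ[𝓝 y] m') (u v w : W) :
    riem m y u v w = riem m' y u v w := by
  unfold riem
  rw [(chrL_eventuallyEq h).fderiv_eq, chrL_congr h]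

theorem pull_congr {m m' : W → W →L[ℝ] W →L[ℝ] ℝ} {f f' : V → W} {y : V}
    (hf : f =ᶠ[𝓝 y] f') (hc : ContinuousAt f y) (h : m =ᶠ[𝓝 (f y)] m') :
    pull m f =ᶠ[𝓝 y] pull m' f' := by
  filter_upwards [hf.eventuallyEq_nhds, hc.eventually h] with z hz hz'
  unfold pull
  rw [hz.fderiv_eq, ← hz.eq_of_nhds, hz']

theorem sff_congr {m m' : W → W →L[ℝ] W →L[ℝ] ℝ} {f f' : V → W} {y : V}
    (hf : f =ᶠ[𝓝 y] f') (hc : ContinuousAt f y) (h : m =ᶠ[𝓝 (f y)] m') :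
    sff m f y = sff m' f' y := by
  unfold sff nab
  rw [chrL_congr (pull_congr hf hc h), chrL_congr h, hf.fderiv.fderiv_eq, hf.fderiv_eq,
    hf.eq_of_nhds]

variable [FiniteDimensional ℝ V] [FiniteDimensional ℝ W] [FiniteDimensional ℝ V']
  [FiniteDimensional ℝ W']

namespace IsImmersionOn

variable {m : W → W →L[ℝ] W →L[ℝ] ℝ} {U : Set W} {f : V → W} {O : Set V}

theorem surj (h : IsImmersionOn m U f O) (hd : finrank ℝ V = finrank ℝ W) {y : V} (hy : y ∈ O) :
    Function.Surjective (fderiv ℝ f y) :=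
  (LinearMap.injective_iff_surjective_of_finrank_eq_finrank
    (f := (fderiv ℝ f y : V →ₗ[ℝ] W)) hd).1 (h.inj y hy)

/-- A local diffeomorphism has no normal directions. -/
theorem sff_eq_zero (h : IsImmersionOn m U f O) (hd : finrank ℝ V = finrank ℝ W) {y : V}
    (hy : y ∈ O) : sff m f y = 0 := by
  ext u v
  obtain ⟨w, hw⟩ := h.surj hd hy (sff m f y u v)
  refine h.metric.ext_inner (h.mapsTo hy) fun z => ?_
  obtain ⟨z', rfl⟩ := h.surj hd hy z
  simpa using h.inner_sff hy u v z'

/-- The transformation law of the Christoffel symbols. -/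
theorem nab_eq_of_finrank (h : IsImmersionOn m U f O) (hd : finrank ℝ V = finrank ℝ W) {y : V}
    (hy : y ∈ O) (u v : V) : nab m f y u v = fderiv ℝ f y (chrL (pull m f) y u v) := by
  rw [nab_eq, h.sff_eq_zero hd hy]
  simp

/-- The curvature is a tensor. -/
theorem riem_natural (h : IsImmersionOn m U f O) (hd : finrank ℝ V = finrank ℝ W) {y : V}
    (hy : y ∈ O) (u v w : V) :
    riem m (f y) (fderiv ℝ f y u) (fderiv ℝ f y v) (fderiv ℝ f y w) =
      fderiv ℝ f y (riem (pull m f) y u v w) := by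
  have h0 : sff m f =ᶠ[𝓝 y] fun _ => 0 := by
    filter_upwards [h.isOpen.mem_nhds hy] with z hz using h.sff_eq_zero hd hz
  have h1 : ∀ a b c, nablaSff m f y a b c = 0 := fun a b c => by
    rw [h.nablaSff_eq hy, h0.fderiv_eq, h0.eq_of_nhds]
    simp
  have := h.codazzi hy u v w
  rw [h1, h1, zero_add] at this
  exact (sub_eq_zero.1 this.symm)

/-- The second fundamental form is equivariant under local isometries of the ambient space. -/
theorem sff_comp_left (h : IsImmersionOn m U f O) {m' : W' → W' →L[ℝ] W' →L[ℝ] ℝ} {U' : Set W'}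
    {β : W → W'} (hβ : IsImmersionOn m' U' β U) (hm : ∀ z ∈ U, m z = pull m' β z)
    (hd : finrank ℝ W = finrank ℝ W') {y : V} (hy : y ∈ O) (u v : V) :
    sff m' (β ∘ f) y u v = fderiv ℝ β (f y) (sff m f y u v) := by
  have hfd : ∀ z ∈ O, fderiv ℝ (β ∘ f) z = fderiv ℝ β (f z) ∘L fderiv ℝ f z := fun z hz =>
    fderiv_comp z (hβ.differentiableAt (h.mapsTo hz)) (h.differentiableAt hz)
  have hpull : pull m' (β ∘ f) =ᶠ[𝓝 y] pull m f := by
    filter_upwards [h.isOpen.mem_nhds hy] with z hz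
    ext a b
    rw [pull_apply, pull_apply, hm _ (h.mapsTo hz), pull_apply, hfd z hz]
    rfl
  have hm' : m =ᶠ[𝓝 (f y)] pull m' β := by
    filter_upwards [h.metric.isOpen.mem_nhds (h.mapsTo hy)] with z hz using hm z hz
  have h2 : fderiv ℝ (fderiv ℝ (β ∘ f)) y u v =
      fderiv ℝ (fderiv ℝ β) (f y) (fderiv ℝ f y u) (fderiv ℝ f y v)
        + fderiv ℝ β (f y) (fderiv ℝ (fderiv ℝ f) y u v) := by
    have e : fderiv ℝ (β ∘ f) =ᶠ[𝓝 y] fun z => fderiv ℝ β (f z) ∘L fderiv ℝ f z := by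
      filter_upwards [h.isOpen.mem_nhds hy] with z hz using hfd z hz
    have d1 : HasFDerivAt (fun z => fderiv ℝ β (f z)) (fderiv ℝ (fderiv ℝ β) (f y) ∘L fderiv ℝ f y)
        y := (hβ.differentiableAt_fderiv (h.mapsTo hy)).hasFDerivAt.comp y
          (h.differentiableAt hy).hasFDerivAt
    rw [e.fderiv_eq, (d1.clm_comp (h.differentiableAt_fderiv hy).hasFDerivAt).fderiv]
    simp
    abel
  have h3 := hβ.nab_eq_of_finrank hd (h.mapsTo hy) (fderiv ℝ f y u) (fderiv ℝ f y v)
  rw [nab_apply] at h3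
  rw [sff_apply, sff_apply, nab_apply, nab_apply, h2, chrL_congr hpull, chrL_congr hm', hfd y hy]
  simp only [map_add, map_sub, ContinuousLinearMap.comp_apply, Function.comp_apply, ← h3]
  abel

/-- The second fundamental form is a tensor on the immersed manifold. -/
theorem sff_comp_right (h : IsImmersionOn m U f O) {χ : V' → V} {O' : Set V'}
    (hχ : IsImmersionOn (pull m f) O χ O') (hd : finrank ℝ V' = finrank ℝ V) {y : V'}
    (hy : y ∈ O') (u v : V') :
    sff m (f ∘ χ) y u v = sff m f (χ y) (fderiv ℝ χ y u) (fderiv ℝ χ y v) := by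
  have hfd : ∀ z ∈ O', fderiv ℝ (f ∘ χ) z = fderiv ℝ f (χ z) ∘L fderiv ℝ χ z := fun z hz =>
    fderiv_comp z (h.differentiableAt (hχ.mapsTo hz)) (hχ.differentiableAt hz)
  have hpull : pull m (f ∘ χ) =ᶠ[𝓝 y] pull (pull m f) χ := by
    filter_upwards [hχ.isOpen.mem_nhds hy] with z hz
    ext a b
    rw [pull_apply, pull_apply, pull_apply, hfd z hz]
    rfl
  have h2 : fderiv ℝ (fderiv ℝ (f ∘ χ)) y u v =
      fderiv ℝ (fderiv ℝ f) (χ y) (fderiv ℝ χ y u) (fderiv ℝ χ y v)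
        + fderiv ℝ f (χ y) (fderiv ℝ (fderiv ℝ χ) y u v) := by
    have e : fderiv ℝ (f ∘ χ) =ᶠ[𝓝 y] fun z => fderiv ℝ f (χ z) ∘L fderiv ℝ χ z := by
      filter_upwards [hχ.isOpen.mem_nhds hy] with z hz using hfd z hz
    have d1 : HasFDerivAt (fun z => fderiv ℝ f (χ z)) (fderiv ℝ (fderiv ℝ f) (χ y) ∘L fderiv ℝ χ y)
        y := (h.differentiableAt_fderiv (hχ.mapsTo hy)).hasFDerivAt.comp y
          (hχ.differentiableAt hy).hasFDerivAt
    rw [e.fderiv_eq, (d1.clm_comp (hχ.differentiableAt_fderiv hy).hasFDerivAt).fderiv]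
    simp
    abel
  have h3 := hχ.nab_eq_of_finrank hd hy u v
  rw [nab_apply] at h3
  rw [sff_apply, sff_apply, nab_apply, nab_apply, h2, chrL_congr hpull, hfd y hy]
  simp only [ContinuousLinearMap.comp_apply, Function.comp_apply, ← h3, map_add]
  abel

theorem meanL_eq_sum (h : IsImmersionOn m U f O) {y : V} (hy : y ∈ O) {ι : Type*} [Fintype ι]
    [DecidableEq ι] {e : Basis ι ℝ V} (he : OrthonormalFor (pull m f y) e) :
    meanL m f y = ∑ k, sff m f y (e k) (e k) :=
  he.mtr_eq_sum (h.isMetricOn_pull.isInner hy)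
    (LinearMap.mk₂ ℝ (fun u v => sff m f y u v) (by simp) (by simp) (by simp) (by simp))

/-- The mean curvature vector does not depend on the coordinates. -/
theorem meanL_comp (h : IsImmersionOn m U f O) {m' : W' → W' →L[ℝ] W' →L[ℝ] ℝ} {U' : Set W'}
    {β : W → W'} (hβ : IsImmersionOn m' U' β U) (hm : ∀ z ∈ U, m z = pull m' β z)
    (hd : finrank ℝ W = finrank ℝ W') {χ : V' → V} {O' : Set V'}
    (hχ : IsImmersionOn (pull m f) O χ O') (hd' : finrank ℝ V' = finrank ℝ V) {y : V'}
    (hy : y ∈ O') :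
    meanL m' (β ∘ f ∘ χ) y = fderiv ℝ β (f (χ y)) (meanL m f (χ y)) := by
  have hyO := hχ.mapsTo hy
  have hf' : IsImmersionOn m' U' (β ∘ f) O :=
    ⟨hβ.metric, h.isOpen, hβ.smooth.comp h.smooth h.mapsTo, hβ.mapsTo.comp h.mapsTo, fun z hz => by
      rw [fderiv_comp z (hβ.differentiableAt (h.mapsTo hz)) (h.differentiableAt hz)]
      exact (hβ.inj _ (h.mapsTo hz)).comp (h.inj z hz)⟩
  have hpull : ∀ z ∈ O, pull m' (β ∘ f) z = pull m f z := fun z hz => by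
    ext a b
    rw [pull_apply, pull_apply, hm _ (h.mapsTo hz), pull_apply,
      fderiv_comp z (hβ.differentiableAt (h.mapsTo hz)) (h.differentiableAt hz)]
    rfl
  have hχ' : IsImmersionOn (pull m' (β ∘ f)) O χ O' :=
    ⟨hf'.isMetricOn_pull, hχ.isOpen, hχ.smooth, hχ.mapsTo, hχ.inj⟩
  have hfd : ∀ z ∈ O', fderiv ℝ ((β ∘ f) ∘ χ) z = fderiv ℝ (β ∘ f) (χ z) ∘L fderiv ℝ χ z :=
    fun z hz => fderiv_comp z (hf'.differentiableAt (hχ.mapsTo hz)) (hχ.differentiableAt hz)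
  have hf'' : IsImmersionOn m' U' ((β ∘ f) ∘ χ) O' :=
    ⟨hβ.metric, hχ.isOpen, hf'.smooth.comp hχ.smooth hχ.mapsTo, hf'.mapsTo.comp hχ.mapsTo,
      fun z hz => by
        rw [hfd z hz]
        exact (hf'.inj _ (hχ.mapsTo hz)).comp (hχ.inj z hz)⟩
  obtain ⟨e, he⟩ := (hf''.isMetricOn_pull.isInner hy).exists_orthonormal
  have hortho : OrthonormalFor (pull m f (χ y)) fun i => fderiv ℝ χ y (e i) := fun i j => by
    rw [← he i j, ← hpull _ hyO, pull_apply m' ((β ∘ f) ∘ χ), hfd y hy]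
    rfl
  obtain ⟨b, hb⟩ := hortho.exists_basis (by simp [hd'])
  rw [← hb] at hortho
  rw [← Function.comp_assoc, hf''.meanL_eq_sum hy he, h.meanL_eq_sum hyO hortho, map_sum]
  refine Finset.sum_congr rfl fun k _ => ?_
  rw [hf'.sff_comp_right hχ' hd' hy, h.sff_comp_left hβ hm hd hyO, hb]

end IsImmersionOn

end Naturality

/-! ### Kähler metrics on open sets of a vector space -/

section Kahler

variable {V W : Type*} [NormedAddCommGroup V] [NormedSpace ℝ V]
  [NormedAddCommGroup W] [NormedSpace ℝ W]

/-- `(m, J)` is a Kähler structure on the open subset `U` of a vector space. -/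
structure IsKahlerOn (m : W → W →L[ℝ] W →L[ℝ] ℝ) (J : W → W →L[ℝ] W) (U : Set W) : Prop where
  metric : IsMetricOn m U
  smooth : ContDiffOn ℝ ∞ J U
  sq : ∀ y ∈ U, ∀ v, J y (J y v) = -v
  orth : ∀ y ∈ U, ∀ u v, m y (J y u) (J y v) = m y u v
  parallel : ∀ y ∈ U, ∀ u v,
    fderiv ℝ J y u v + chrL m y u (J y v) - J y (chrL m y u v) = 0

namespace IsKahlerOn

variable {m : W → W →L[ℝ] W →L[ℝ] ℝ} {J : W → W →L[ℝ] W} {U : Set W}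

theorem skew (h : IsKahlerOn m J U) {y : W} (hy : y ∈ U) (u v : W) :
    m y (J y u) v = - m y u (J y v) := by
  rw [← h.orth y hy u (J y v), h.sq y hy]
  simp

theorem differentiableAt (h : IsKahlerOn m J U) {y : W} (hy : y ∈ U) : DifferentiableAt ℝ J y :=
  (h.smooth.contDiffAt (h.metric.isOpen.mem_nhds hy)).differentiableAt (by simp)

theorem fderiv_J (h : IsKahlerOn m J U) {y : W} (hy : y ∈ U) (u v : W) :
    fderiv ℝ J y u v = J y (chrL m y u v) - chrL m y u (J y v) := by
  have := h.parallel y hy u v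
  rw [sub_eq_zero] at this
  rw [← this]; abel

/-- The complex structure commutes with covariant differentiation. -/
theorem hasFDerivWithinAt_J (h : IsKahlerOn m J U) {c X : V → W} {c' X' : V →L[ℝ] W} {S : Set V}
    {y : V} (hy : c y ∈ U) (hc : HasFDerivWithinAt c c' S y) (hX : HasFDerivWithinAt X X' S y) :
    ∃ D : V →L[ℝ] W, HasFDerivWithinAt (fun z => J (c z) (X z)) D S y ∧
      ∀ v, D v + chrL m (c y) (c' v) (J (c y) (X y)) =
        J (c y) (X' v + chrL m (c y) (c' v) (X y)) := by
  have h1 : HasFDerivWithinAt (fun z => J (c z)) (fderiv ℝ J (c y) ∘L c') S y :=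
    (h.differentiableAt hy).hasFDerivAt.comp_hasFDerivWithinAt y hc
  refine ⟨_, h1.clm_apply hX, fun v => ?_⟩
  simp only [add_apply, ContinuousLinearMap.comp_apply, ContinuousLinearMap.flip_apply,
    h.fderiv_J hy, map_add]
  abel

theorem cov_J (h : IsKahlerOn m J U) {f X : V → W} {y : V} (hy : f y ∈ U)
    (hf : DifferentiableAt ℝ f y) (hX : DifferentiableAt ℝ X y) (v : V) :
    cov m f (fun z => J (f z) (X z)) y v = J (f y) (cov m f X y v) := by
  obtain ⟨D, hD, hD'⟩ := h.hasFDerivWithinAt_J hy hf.hasFDerivAt.hasFDerivWithinAt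
    hX.hasFDerivAt.hasFDerivWithinAt (S := univ)
  unfold cov
  rw [(hD.hasFDerivAt univ_mem).fderiv, hD']

variable [FiniteDimensional ℝ W]

theorem riem_J (h : IsKahlerOn m J U) {y : W} (hy : y ∈ U) (u v w : W) :
    riem m y u v (J y w) = J y (riem m y u v w) := by
  have hid : ContDiffAt ℝ ∞ (fun z : W => z) y := contDiffAt_id
  have hJw : ContDiffAt ℝ ∞ (fun z => J z w) y :=
    (h.smooth.contDiffAt (h.metric.isOpen.mem_nhds hy)).clm_apply contDiffAt_const
  have h1 := h.metric.cov_comm (f := fun z => z) (X := fun z => J z w) hy hid hJw u v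
  have h2 := h.metric.cov_comm (f := fun z => z) (X := fun _ => w) hy hid contDiffAt_const u v
  have h3 : ∀ a, (fun z => cov m (fun z => z) (fun z => J z w) z a) =ᶠ[𝓝 y]
      fun z => J z (cov m (fun z => z) (fun _ => w) z a) := fun a => by
    filter_upwards [h.metric.isOpen.mem_nhds hy] with z hz
    exact h.cov_J (f := fun z => z) hz differentiableAt_id (differentiableAt_const w) a
  have h4 : ∀ a b, cov m (fun z => z) (fun z => J z (cov m (fun z => z) (fun _ => w) z a)) y b =
      J y (cov m (fun z => z) (fun z => cov m (fun z => z) (fun _ => w) z a) y b) := fun a b => by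
    obtain ⟨D, hD, -⟩ := h.metric.hasFDerivAt_cov (f := fun z => z) (X := fun _ => w) hy hid
      contDiffAt_const a
    exact h.cov_J (f := fun z => z) hy differentiableAt_id hD.differentiableAt b
  rw [cov_congr (h3 v), cov_congr (h3 u), h4, h4, ← map_sub, h2] at h1
  simpa using h1.symm

theorem riem_JJ (h : IsKahlerOn m J U) {y : W} (hy : y ∈ U) (u v w : W) :
    riem m y (J y u) (J y v) w = riem m y u v w := by
  refine h.metric.ext_inner hy fun z => ?_
  rw [h.metric.riem_pair hy, h.riem_J hy, h.orth y hy, ← h.metric.riem_pair hy]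

theorem riem_J_left (h : IsKahlerOn m J U) {y : W} (hy : y ∈ U) (u v w : W) :
    riem m y (J y u) v w = - riem m y u (J y v) w := by
  rw [← h.riem_JJ hy u (J y v), h.sq y hy]
  simp only [riem, map_neg, neg_apply]
  abel

end IsKahlerOn

end Kahler

/-! ### Products -/

section Product

variable {W₁ W₂ : Type*} [NormedAddCommGroup W₁] [NormedSpace ℝ W₁] [NormedAddCommGroup W₂]
  [NormedSpace ℝ W₂]

/-- The product of two metrics. -/
def prodM (m₁ : W₁ → W₁ →L[ℝ] W₁ →L[ℝ] ℝ) (m₂ : W₂ → W₂ →L[ℝ] W₂ →L[ℝ] ℝ) (y : W₁ × W₂) :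
    W₁ × W₂ →L[ℝ] W₁ × W₂ →L[ℝ] ℝ :=
  (m₁ y.1).bilinearComp (ContinuousLinearMap.fst ℝ W₁ W₂) (ContinuousLinearMap.fst ℝ W₁ W₂) +
    (m₂ y.2).bilinearComp (ContinuousLinearMap.snd ℝ W₁ W₂) (ContinuousLinearMap.snd ℝ W₁ W₂)

/-- The complex structure `(J₁, -J₂)` of a product. -/
def prodJm (J₁ : W₁ → W₁ →L[ℝ] W₁) (J₂ : W₂ → W₂ →L[ℝ] W₂) (y : W₁ × W₂) :
    W₁ × W₂ →L[ℝ] W₁ × W₂ :=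
  ((J₁ y.1) ∘L ContinuousLinearMap.fst ℝ W₁ W₂).prod
    (-((J₂ y.2) ∘L ContinuousLinearMap.snd ℝ W₁ W₂))

variable {m₁ : W₁ → W₁ →L[ℝ] W₁ →L[ℝ] ℝ} {m₂ : W₂ → W₂ →L[ℝ] W₂ →L[ℝ] ℝ}
  {U₁ : Set W₁} {U₂ : Set W₂}

theorem prodM_apply (y u v : W₁ × W₂) :
    prodM m₁ m₂ y u v = m₁ y.1 u.1 v.1 + m₂ y.2 u.2 v.2 := rfl

theorem prodJm_apply (J₁ : W₁ → W₁ →L[ℝ] W₁) (J₂ : W₂ → W₂ →L[ℝ] W₂) (y v : W₁ × W₂) :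
    prodJm J₁ J₂ y v = (J₁ y.1 v.1, -J₂ y.2 v.2) := rfl

theorem IsMetricOn.prod (h₁ : IsMetricOn m₁ U₁) (h₂ : IsMetricOn m₂ U₂) :
    IsMetricOn (prodM m₁ m₂) (U₁ ×ˢ U₂) where
  isOpen := h₁.isOpen.prod h₂.isOpen
  smooth := (ContDiffOn.clm_bilinearComp
      (h₁.smooth.comp contDiff_fst.contDiffOn fun _ hy => hy.1) contDiffOn_const
        contDiffOn_const).add (ContDiffOn.clm_bilinearComp
      (h₂.smooth.comp contDiff_snd.contDiffOn fun _ hy => hy.2) contDiffOn_const contDiffOn_const)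
  symm y hy u v := by rw [prodM_apply, prodM_apply, h₁.symm _ hy.1, h₂.symm _ hy.2]
  pos y hy u hu := by
    rw [prodM_apply]
    rcases eq_or_ne u.1 0 with h | h
    · have h' : u.2 ≠ 0 := fun h' => hu (Prod.ext h h')
      simpa [h] using h₂.pos _ hy.2 _ h'
    · exact add_pos_of_pos_of_nonneg (h₁.pos _ hy.1 _ h) ((h₂.isInner hy.2).nonneg _)

variable [FiniteDimensional ℝ W₁] [FiniteDimensional ℝ W₂]

theorem fderiv_prodM (h₁ : IsMetricOn m₁ U₁) (h₂ : IsMetricOn m₂ U₂) {y : W₁ × W₂}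
    (hy : y ∈ U₁ ×ˢ U₂) (u v w : W₁ × W₂) : fderiv ℝ (prodM m₁ m₂) y u v w =
      fderiv ℝ m₁ y.1 u.1 v.1 w.1 + fderiv ℝ m₂ y.2 u.2 v.2 w.2 := by
  rw [← fderiv_apply₂ ((h₁.prod h₂).differentiableAt hy)]
  have e1 : HasFDerivAt (fun z : W₁ × W₂ => m₁ z.1) _ y :=
    (h₁.differentiableAt hy.1).hasFDerivAt.comp y hasFDerivAt_fst
  have e2 : HasFDerivAt (fun z : W₁ × W₂ => m₂ z.2) _ y :=
    (h₂.differentiableAt hy.2).hasFDerivAt.comp y hasFDerivAt_snd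
  have e3 : HasFDerivAt (fun z : W₁ × W₂ => m₁ z.1 v.1 w.1 + m₂ z.2 v.2 w.2) _ y :=
    ((e1.clm_apply (hasFDerivAt_const v.1 y)).clm_apply (hasFDerivAt_const w.1 y)).add
    ((e2.clm_apply (hasFDerivAt_const v.2 y)).clm_apply (hasFDerivAt_const w.2 y))
  change fderiv ℝ (fun z : W₁ × W₂ => m₁ z.1 v.1 w.1 + m₂ z.2 v.2 w.2) y u = _
  rw [e3.fderiv]
  simp

theorem chrL_prodM (h₁ : IsMetricOn m₁ U₁) (h₂ : IsMetricOn m₂ U₂) {y : W₁ × W₂}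
    (hy : y ∈ U₁ ×ˢ U₂) (u v : W₁ × W₂) :
    chrL (prodM m₁ m₂) y u v = (chrL m₁ y.1 u.1 v.1, chrL m₂ y.2 u.2 v.2) := by
  refine (h₁.prod h₂).ext_inner hy fun z => ?_
  rw [(h₁.prod h₂).inner_chrL hy, prodM_apply, h₁.inner_chrL hy.1, h₂.inner_chrL hy.2,
    fderiv_prodM h₁ h₂ hy, fderiv_prodM h₁ h₂ hy, fderiv_prodM h₁ h₂ hy]
  ring

theorem riem_prodM (h₁ : IsMetricOn m₁ U₁) (h₂ : IsMetricOn m₂ U₂) {y : W₁ × W₂}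
    (hy : y ∈ U₁ ×ˢ U₂) (u v w : W₁ × W₂) :
    riem (prodM m₁ m₂) y u v w = (riem m₁ y.1 u.1 v.1 w.1, riem m₂ y.2 u.2 v.2 w.2) := by
  have hd : ∀ u v w : W₁ × W₂, fderiv ℝ (chrL (prodM m₁ m₂)) y u v w =
      (fderiv ℝ (chrL m₁) y.1 u.1 v.1 w.1, fderiv ℝ (chrL m₂) y.2 u.2 v.2 w.2) := fun u v w => by
    rw [← fderiv_apply₂ ((h₁.prod h₂).differentiableAt_chrL hy)]
    have e0 : (fun z => chrL (prodM m₁ m₂) z v w) =ᶠ[𝓝 y]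
        fun z => (chrL m₁ z.1 v.1 w.1, chrL m₂ z.2 v.2 w.2) := by
      filter_upwards [(h₁.prod h₂).isOpen.mem_nhds hy] with z hz using chrL_prodM h₁ h₂ hz v w
    have e1 : HasFDerivAt (fun z : W₁ × W₂ => chrL m₁ z.1) _ y :=
      (h₁.differentiableAt_chrL hy.1).hasFDerivAt.comp y hasFDerivAt_fst
    have e2 : HasFDerivAt (fun z : W₁ × W₂ => chrL m₂ z.2) _ y :=
      (h₂.differentiableAt_chrL hy.2).hasFDerivAt.comp y hasFDerivAt_snd
    have e3 : HasFDerivAt (fun z : W₁ × W₂ => (chrL m₁ z.1 v.1 w.1, chrL m₂ z.2 v.2 w.2)) _ y :=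
      ((e1.clm_apply (hasFDerivAt_const v.1 y)).clm_apply (hasFDerivAt_const w.1 y)).prodMk
      ((e2.clm_apply (hasFDerivAt_const v.2 y)).clm_apply (hasFDerivAt_const w.2 y))
    rw [e0.fderiv_eq, e3.fderiv]
    simp
  unfold riem
  simp only [hd, chrL_prodM h₁ h₂ hy]
  ext <;> simp

/-- The Kähler form of this structure on the product is the difference of the Kähler forms of the
factors. -/
theorem IsKahlerOn.prod {J₁ : W₁ → W₁ →L[ℝ] W₁} {J₂ : W₂ → W₂ →L[ℝ] W₂}
    (h₁ : IsKahlerOn m₁ J₁ U₁) (h₂ : IsKahlerOn m₂ J₂ U₂) :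
    IsKahlerOn (prodM m₁ m₂) (prodJm J₁ J₂) (U₁ ×ˢ U₂) := by
  have hs1 : ContDiffOn ℝ ∞ (fun z : W₁ × W₂ => J₁ z.1) (U₁ ×ˢ U₂) :=
    h₁.smooth.comp contDiff_fst.contDiffOn fun _ hy => hy.1
  have hs2 : ContDiffOn ℝ ∞ (fun z : W₁ × W₂ => J₂ z.2) (U₁ ×ˢ U₂) :=
    h₂.smooth.comp contDiff_snd.contDiffOn fun _ hy => hy.2
  have hs : ContDiffOn ℝ ∞ (prodJm J₁ J₂) (U₁ ×ˢ U₂) := by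
    rw [contDiffOn_clm_apply]
    intro v
    exact (hs1.clm_apply contDiffOn_const).prodMk (hs2.clm_apply contDiffOn_const).neg
  refine ⟨h₁.metric.prod h₂.metric, hs, ?_, ?_, ?_⟩
  · intro y hy v
    ext <;> simp [prodJm_apply, h₁.sq _ hy.1, h₂.sq _ hy.2]
  · intro y hy u v
    simp [prodJm_apply, prodM_apply, h₁.orth _ hy.1, h₂.orth _ hy.2]
  · intro y hy u v
    have hd : DifferentiableAt ℝ (prodJm J₁ J₂) y :=
      (hs.contDiffAt ((h₁.metric.prod h₂.metric).isOpen.mem_nhds hy)).differentiableAt (by simp)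
    have e1 : HasFDerivAt (fun z : W₁ × W₂ => J₁ z.1) _ y :=
      (h₁.differentiableAt hy.1).hasFDerivAt.comp y hasFDerivAt_fst
    have e2 : HasFDerivAt (fun z : W₁ × W₂ => J₂ z.2) _ y :=
      (h₂.differentiableAt hy.2).hasFDerivAt.comp y hasFDerivAt_snd
    have e3 : HasFDerivAt (fun z : W₁ × W₂ => (J₁ z.1 v.1, -J₂ z.2 v.2)) _ y :=
      (e1.clm_apply (hasFDerivAt_const v.1 y)).prodMk (e2.clm_apply (hasFDerivAt_const v.2 y)).neg
    have hd1 : fderiv ℝ (prodJm J₁ J₂) y u v =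
        (fderiv ℝ J₁ y.1 u.1 v.1, -fderiv ℝ J₂ y.2 u.2 v.2) := by
      rw [← fderiv_apply₁ hd]
      change fderiv ℝ (fun z : W₁ × W₂ => (J₁ z.1 v.1, -J₂ z.2 v.2)) y u = _
      rw [e3.fderiv]
      simp
    have p1 := h₁.parallel _ hy.1 u.1 v.1
    have p2 := h₂.parallel _ hy.2 u.2 v.2
    rw [hd1, chrL_prodM h₁.metric h₂.metric hy, chrL_prodM h₁.metric h₂.metric hy]
    simp only [prodJm_apply]
    ext
    · simpa using p1
    · have := congrArg Neg.neg p2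
      simp only [neg_zero, neg_sub] at this
      simp only [Prod.snd_add, Prod.snd_sub, map_neg, Prod.snd_zero]
      rw [← this]; abel

end Product

end

section

/-! ### Almost Lagrangian subspaces -/

section AlmostLagrangian

variable {V W : Type*} [NormedAddCommGroup V] [NormedSpace ℝ V]
  [NormedAddCommGroup W] [NormedSpace ℝ W]

/-- The length of a vector for the inner product `g`. -/
def gnorm (g : W →L[ℝ] W →L[ℝ] ℝ) (u : W) : ℝ := Real.sqrt (g u u)

theorem gnorm_nonneg (g : W →L[ℝ] W →L[ℝ] ℝ) (u : W) : 0 ≤ gnorm g u := Real.sqrt_nonneg _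

namespace IsInner

variable {g : W →L[ℝ] W →L[ℝ] ℝ}

theorem gnorm_sq (h : IsInner g) (u : W) : gnorm g u ^ 2 = g u u := Real.sq_sqrt (h.nonneg u)

theorem abs_inner_le (h : IsInner g) (u v : W) : |g u v| ≤ gnorm g u * gnorm g v :=
  h.abs_le (gnorm_nonneg g u) (gnorm_nonneg g v) (h.gnorm_sq u).ge (h.gnorm_sq v).ge

theorem gnorm_le (h : IsInner g) {u : W} {a : ℝ} (ha : 0 ≤ a) (hu : g u u ≤ a * gnorm g u) :
    gnorm g u ≤ a := by
  rw [← h.gnorm_sq u] at hu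
  by_contra! hlt
  nlinarith [gnorm_nonneg g u]

/-- The projection to the span of a finite orthonormal family. -/
theorem inner_proj {ι : Type*} [Fintype ι] [DecidableEq ι] {E : ι → W} (hE : OrthonormalFor g E)
    (X : W) (k : ι) : g (∑ l, g X (E l) • E l) (E k) = g X (E k) := by
  simp only [map_sum, map_smul, sum_apply, smul_apply, smul_eq_mul, hE _ _, mul_ite, mul_one,
    mul_zero, Finset.sum_ite_eq', Finset.mem_univ, if_true]

theorem inner_proj_self {ι : Type*} [Fintype ι] [DecidableEq ι] {E : ι → W}
    (hE : OrthonormalFor g E) (X : W) :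
    g (∑ l, g X (E l) • E l) (∑ l, g X (E l) • E l) = g X (∑ l, g X (E l) • E l) := by
  conv_lhs => rw [map_sum]
  conv_rhs => rw [map_sum]
  exact Finset.sum_congr rfl fun k _ => by rw [map_smul, map_smul, inner_proj hE]

theorem gnorm_orthonormal {ι : Type*} [DecidableEq ι] {E : ι → W} (hE : OrthonormalFor g E)
    (k : ι) : gnorm g (E k) = 1 := by
  rw [gnorm, hE k k]; simp

/-- An orthonormal family can be completed to an orthonormal basis. -/
theorem exists_complement [FiniteDimensional ℝ W] (h : IsInner g) {ι : Type*} [Fintype ι]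
    [DecidableEq ι] {E : ι → W} (hE : OrthonormalFor g E) {d : ℕ}
    (hd : Fintype.card ι + d = finrank ℝ W) :
    ∃ b : Basis (ι ⊕ Fin d) ℝ W, OrthonormalFor g b ∧ ∀ i, b (Sum.inl i) = E i := by
  let φ : W →ₗ[ℝ] (ι → ℝ) := LinearMap.pi fun k => (g (E k) : W →ₗ[ℝ] ℝ)
  have hφ : ∀ X k, φ X k = g (E k) X := fun X k => rfl
  have hsurj : Function.Surjective φ := fun c => ⟨∑ l, c l • E l, by
    ext k
    rw [hφ]
    simp [hE _ _]⟩
  have hrank := LinearMap.finrank_range_add_finrank_ker φ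
  rw [LinearMap.range_eq_top.2 hsurj, finrank_top, finrank_fintype_fun_eq_card] at hrank
  have hker : finrank ℝ (LinearMap.ker φ) = d := by omega
  let N := LinearMap.ker φ
  have hN : IsInner (g.bilinearComp N.subtypeL N.subtypeL) :=
    ⟨fun u v => h.symm _ _, fun u hu => h.pos _ (by simpa using hu)⟩
  obtain ⟨n, hn⟩ := hN.exists_orthonormal
  let n' : Fin d → W := fun i => n (Fin.cast hker.symm i)
  have hn' : ∀ i j, g (n' i) (n' j) = if i = j then 1 else 0 := fun i j => by
    have := hn (Fin.cast hker.symm i) (Fin.cast hker.symm j)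
    simpa using this
  have hEn : ∀ k i, g (E k) (n' i) = 0 := fun k i => by
    have h1 : φ (n' i) = 0 := (n (Fin.cast hker.symm i)).2
    rw [← hφ, h1]; rfl
  have hO : OrthonormalFor g (Sum.elim E n') := by
    rintro (i | i) (j | j)
    · simpa using hE i j
    · simpa using hEn i j
    · simpa [h.symm _ (E j)] using hEn j i
    · simpa using hn' i j
  obtain ⟨b, hb⟩ := hO.exists_basis (by simpa using hd)
  refine ⟨b, hb ▸ hO, fun i => by rw [hb]; rfl⟩

end IsInner

variable [FiniteDimensional ℝ W] {ι : Type*} [Fintype ι] [DecidableEq ι]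

/-- Let `T` be a subspace of half dimension, with orthonormal basis `E`, on which the Kähler form
has norm at most `θ ≤ 1/2`.  Then the Kähler form has norm at most `2θ` on the normal space. -/
theorem IsInner.kahler_normal_le {g : W →L[ℝ] W →L[ℝ] ℝ} (h : IsInner g) {J : W →L[ℝ] W}
    (hsq : ∀ v, J (J v) = -v) (horth : ∀ u v, g (J u) (J v) = g u v) {E : ι → W}
    (hE : OrthonormalFor g E) (hd : Fintype.card ι + Fintype.card ι = finrank ℝ W) {θ : ℝ}
    (hθ0 : 0 ≤ θ) (hθ : θ ≤ 1 / 2)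
    (hω : ∀ c d : ι → ℝ, |g (J (∑ k, c k • E k)) (∑ k, d k • E k)| ≤
      θ * gnorm g (∑ k, c k • E k) * gnorm g (∑ k, d k • E k)) {ν ν' : W}
    (hν : ∀ k, g ν (E k) = 0) (hν' : ∀ k, g ν' (E k) = 0) :
    |g (J ν) ν'| ≤ 2 * θ * gnorm g ν * gnorm g ν' := by
  have hJn : ∀ v, gnorm g (J v) = gnorm g v := fun v => by rw [gnorm, gnorm, horth]
  let φ : W →ₗ[ℝ] (ι → ℝ) := LinearMap.pi fun k => (g (E k) : W →ₗ[ℝ] ℝ)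
  have hφ : ∀ X k, φ X k = g (E k) X := fun X k => rfl
  have hsurj : Function.Surjective φ := fun c => ⟨∑ l, c l • E l, by
    ext k
    rw [hφ]
    simp [hE _ _]⟩
  have hrank := LinearMap.finrank_range_add_finrank_ker φ
  rw [LinearMap.range_eq_top.2 hsurj, finrank_top, finrank_fintype_fun_eq_card] at hrank
  let pr : W → W := fun X => ∑ l, g X (E l) • E l
  -- the map `v ↦ J v - (tangential part of J v)` to the normal space
  let ψ₀ : (ι → ℝ) →ₗ[ℝ] W := Fintype.linearCombination ℝ (fun k => J (E k) - pr (J (E k)))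
  have hψ₀ : ∀ c, ψ₀ c = J (∑ k, c k • E k) - pr (J (∑ k, c k • E k)) := fun c => by
    simp only [ψ₀, Fintype.linearCombination_apply, pr, map_sum, map_smul, smul_sub,
      Finset.sum_sub_distrib, sum_apply, smul_apply, smul_eq_mul, Finset.smul_sum, Finset.sum_smul]
    rw [Finset.sum_comm]
    simp only [mul_smul]
  let ψ : (ι → ℝ) →ₗ[ℝ] LinearMap.ker φ := ψ₀.codRestrict _ fun c => by
    rw [LinearMap.mem_ker]
    ext k
    rw [hφ, hψ₀, h.symm, map_sub, sub_apply, IsInner.inner_proj hE, sub_self]; rfl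
  have hpr : ∀ c : ι → ℝ, gnorm g (pr (J (∑ k, c k • E k))) ≤ θ * gnorm g (∑ k, c k • E k) :=
    fun c => by
      refine h.gnorm_le (mul_nonneg hθ0 (gnorm_nonneg _ _)) ?_
      rw [IsInner.inner_proj_self hE]
      exact (le_abs_self _).trans (hω _ _)
  -- `|J v| = |v|`, while the tangential part of `J v` has length at most `θ |v|`
  have hinj : Function.Injective ψ := by
    rw [← LinearMap.ker_eq_bot, LinearMap.ker_eq_bot']
    intro c hc
    have h0 : ψ₀ c = 0 := congrArg Subtype.val hc
    rw [hψ₀, sub_eq_zero] at h0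
    have h1 := hpr c
    rw [← h0, hJn] at h1
    have h2 : gnorm g (∑ k, c k • E k) = 0 := by
      nlinarith [gnorm_nonneg g (∑ k, c k • E k)]
    have h3 : ∑ k, c k • E k = 0 := by
      by_contra hne
      have := h.pos _ hne
      rw [← h.gnorm_sq, h2] at this
      simp at this
    exact funext fun k => Fintype.linearIndependent_iff.1 hE.linearIndependent c h3 k
  have hfr : finrank ℝ (ι → ℝ) = finrank ℝ (LinearMap.ker φ) := by
    rw [finrank_fintype_fun_eq_card]; omega
  -- so the normal vector `ν` is the normal part of `J v` for a tangent vector `v`, and `J ν` differs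
  -- from the tangent vector `-v` by `J s`, where `s` is the tangential part of `J v`
  obtain ⟨c, hc⟩ := (LinearMap.injective_iff_surjective_of_finrank_eq_finrank hfr).1 hinj
    ⟨ν, by
      rw [LinearMap.mem_ker]
      ext k
      rw [hφ, h.symm, hν]; rfl⟩
  have hc' : ψ₀ c = ν := congrArg Subtype.val hc
  rw [hψ₀] at hc'
  set v := ∑ k, c k • E k with hv
  set s := pr (J v) with hs
  have hsn : gnorm g s ≤ θ * gnorm g v := hpr c
  have h1 : g ν ν = g v v - g s s := by
    have e1 : g s s = g (J v) s := IsInner.inner_proj_self hE _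
    have e2 : g s (J v) = g (J v) s := h.symm _ _
    rw [← hc']
    simp only [map_sub, sub_apply, horth]
    linarith
  have h2 : gnorm g v ≤ 2 * gnorm g ν := by
    have n1 := gnorm_nonneg g v
    have n2 := gnorm_nonneg g ν
    have n3 := gnorm_nonneg g s
    rw [← h.gnorm_sq, ← h.gnorm_sq, ← h.gnorm_sq] at h1
    have h5 : gnorm g s ≤ 1 / 2 * gnorm g v := hsn.trans (mul_le_mul_of_nonneg_right hθ n1)
    refine abs_le_of_sq_le_sq' ?_ (by positivity) |>.2
    nlinarith
  have h3 : g (J ν) ν' = - g (J s) ν' := by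
    have : g v ν' = 0 := by
      rw [h.symm, hv]
      simp [hν']
    rw [← hc', map_sub, hsq]
    simp [this]
  rw [h3, abs_neg]
  calc |g (J s) ν'| ≤ gnorm g (J s) * gnorm g ν' := h.abs_inner_le _ _
    _ = gnorm g s * gnorm g ν' := by rw [hJn]
    _ ≤ (θ * (2 * gnorm g ν)) * gnorm g ν' := by
        refine mul_le_mul_of_nonneg_right (hsn.trans ?_) (gnorm_nonneg _ _)
        exact mul_le_mul_of_nonneg_left h2 hθ0
    _ = 2 * θ * gnorm g ν * gnorm g ν' := by ring

/-- In the situation of `IsInner.kahler_normal_le`, the trace of a bilinear form is, up to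
`O(θ)`, the sum of its traces over `T` and over `J T`. -/
theorem IsInner.trace_sub_le {g : W →L[ℝ] W →L[ℝ] ℝ} (h : IsInner g) {J : W →L[ℝ] W}
    (hsq : ∀ v, J (J v) = -v) (horth : ∀ u v, g (J u) (J v) = g u v) {E : ι → W}
    (hE : OrthonormalFor g E) (hd : Fintype.card ι + Fintype.card ι = finrank ℝ W) {θ : ℝ}
    (hθ0 : 0 ≤ θ) (hθ : θ ≤ 1 / 2)
    (hω : ∀ c d : ι → ℝ, |g (J (∑ k, c k • E k)) (∑ k, d k • E k)| ≤
      θ * gnorm g (∑ k, c k • E k) * gnorm g (∑ k, d k • E k))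
    (T : W →ₗ[ℝ] W) {κ : ℝ} (hT : ∀ X Y, |g (T X) Y| ≤ κ * gnorm g X * gnorm g Y)
    (hκ : 0 ≤ κ) :
    |LinearMap.trace ℝ W T - (∑ k, g (T (E k)) (E k) + ∑ k, g (T (J (E k))) (J (E k)))| ≤
      3 * Fintype.card ι * κ * θ := by
  have hJn : ∀ v, gnorm g (J v) = gnorm g v := fun v => by rw [gnorm, gnorm, horth]
  have hskew : ∀ u v, g (J u) v = - g u (J v) := fun u v => by
    rw [← horth u (J v), hsq]; simp
  obtain ⟨b, hb, hbE⟩ := h.exists_complement hE hd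
  set n : Fin (Fintype.card ι) → W := fun μ => b (Sum.inr μ) with hn
  have hnE : ∀ μ k, g (n μ) (E k) = 0 := fun μ k => by
    rw [← hbE k, hn, hb]; simp
  have hn1 : ∀ μ, gnorm g (n μ) = 1 := fun μ => by rw [gnorm, hn, hb]; simp
  have hE1 : ∀ k, gnorm g (E k) = 1 := fun k => IsInner.gnorm_orthonormal hE k
  have htr : LinearMap.trace ℝ W T = ∑ k, g (T (E k)) (E k) + ∑ μ, g (T (n μ)) (n μ) := by
    rw [hb.trace_eq_sum, Fintype.sum_sum_type]
    simp only [hbE, hn]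
  -- decomposition into tangential and normal parts
  have hdec : ∀ X, X = (∑ k, g X (E k) • E k) + ∑ μ, g X (n μ) • n μ := fun X => by
    conv_lhs => rw [← hb.sum_smul X, Fintype.sum_sum_type]
    simp only [hbE, hn]
  let D : Fin (Fintype.card ι) → W := fun μ => ∑ μ', g (J (n μ)) (n μ') • n μ'
  have hDE : ∀ μ k, g (D μ) (E k) = 0 := fun μ k => by simp [D, hnE]
  have hDn : ∀ μ, gnorm g (D μ) ≤ 2 * θ := fun μ => by
    refine h.gnorm_le (by positivity) ?_
    have hnn : OrthonormalFor g n := fun i j => by rw [hn, hb]; simp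
    rw [IsInner.inner_proj_self hnn]
    refine (le_abs_self _).trans ((h.kahler_normal_le hsq horth hE hd hθ0 hθ hω (hnE μ)
      (hDE μ)).trans ?_)
    rw [hn1, mul_one]
  let S : ι → W := fun k => ∑ l, g (J (E k)) (E l) • E l
  have hSn : ∀ k, gnorm g (S k) ≤ θ := fun k => by
    refine h.gnorm_le hθ0 ?_
    rw [IsInner.inner_proj_self hE]
    have := hω (Pi.single k 1) (fun l => g (J (E k)) (E l))
    have e : ∑ l, (Pi.single k 1 : ι → ℝ) l • E l = E k := by simp [Pi.single_apply]
    rw [e, hE1, mul_one] at this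
    exact (le_abs_self _).trans this
  have hnμ : ∀ μ, n μ = (∑ k, g (n μ) (J (E k)) • J (E k)) - J (D μ) := fun μ => by
    have e1 : n μ = - J (J (n μ)) := by rw [hsq]; simp
    have e2 : J (J (n μ)) = J ((∑ k, g (J (n μ)) (E k) • E k) + D μ) := by
      congr 1
      exact hdec _
    conv_lhs => rw [e1, e2]
    simp only [map_add, hskew, neg_smul, Finset.sum_neg_distrib, map_neg, map_sum, map_smul,
      neg_add, neg_neg, sub_eq_add_neg]
  have hJE : ∀ k, ∑ μ, g (n μ) (J (E k)) • n μ = J (E k) - S k := fun k => by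
    rw [eq_sub_iff_add_eq]
    conv_rhs => rw [hdec (J (E k))]
    rw [add_comm]
    simp only [h.symm _ (J (E k))]
    rfl
  have hN : ∑ μ, g (T (n μ)) (n μ) = ∑ k, g (T (J (E k))) (J (E k))
      - (∑ k, g (T (J (E k))) (S k) + ∑ μ, g (T (J (D μ))) (n μ)) := by
    have e1 : ∀ μ, g (T (n μ)) (n μ) = (∑ k, g (n μ) (J (E k)) * g (T (J (E k))) (n μ))
        - g (T (J (D μ))) (n μ) := fun μ => by
      conv_lhs => enter [1, 2, 2]; rw [hnμ μ]
      simp only [map_sub, map_sum, map_smul, sub_apply, sum_apply, smul_apply, smul_eq_mul]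
    have e2 : ∀ k, ∑ μ, g (n μ) (J (E k)) * g (T (J (E k))) (n μ) =
        g (T (J (E k))) (J (E k)) - g (T (J (E k))) (S k) := fun k => by
      rw [← map_sub, ← hJE]
      simp
    rw [Finset.sum_congr rfl fun μ _ => e1 μ, Finset.sum_sub_distrib, Finset.sum_comm,
      Finset.sum_congr rfl fun k _ => e2 k, Finset.sum_sub_distrib]
    ring
  have b1 : |∑ k, g (T (J (E k))) (S k)| ≤ Fintype.card ι * (κ * θ) := by
    refine (Finset.abs_sum_le_sum_abs _ _).trans ?_
    have : ∀ k ∈ (Finset.univ : Finset ι), |g (T (J (E k))) (S k)| ≤ κ * θ := fun k _ => by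
      refine (hT _ _).trans ?_
      rw [hJn, hE1, mul_one]
      exact mul_le_mul_of_nonneg_left (hSn k) hκ
    refine (Finset.sum_le_card_nsmul _ _ _ this).trans ?_
    simp
  have b2 : |∑ μ, g (T (J (D μ))) (n μ)| ≤ Fintype.card ι * (κ * (2 * θ)) := by
    refine (Finset.abs_sum_le_sum_abs _ _).trans ?_
    have : ∀ μ ∈ (Finset.univ : Finset (Fin (Fintype.card ι))),
        |g (T (J (D μ))) (n μ)| ≤ κ * (2 * θ) := fun μ _ => by
      refine (hT _ _).trans ?_
      rw [hJn, hn1, mul_one]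
      exact mul_le_mul_of_nonneg_left (hDn μ) hκ
    refine (Finset.sum_le_card_nsmul _ _ _ this).trans ?_
    simp
  rw [htr, hN]
  have e : ∀ a b c d : ℝ, a + (b - (c + d)) - (a + b) = -c - d := by intros; ring
  rw [e]
  rw [_root_.abs_le] at b1 b2 ⊢
  constructor <;> nlinarith [b1.1, b1.2, b2.1, b2.2]

end AlmostLagrangian

end

section

/-! ### The barrier estimate for the Kähler form of an almost Lagrangian submanifold -/

section Barrier

variable {V W : Type*} [NormedAddCommGroup V] [NormedSpace ℝ V] [FiniteDimensional ℝ V]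
  [NormedAddCommGroup W] [NormedSpace ℝ W] [FiniteDimensional ℝ W]

/-- The first and second order conditions along a line at a zero of a nonnegative function. -/
theorem first_second_order_conditions {Z G : V → ℝ} {Z' : V → V →L[ℝ] ℝ} {y e : V}
    (hmin : ∀ᶠ z in 𝓝 y, 0 ≤ Z z) (h0 : Z y = 0)
    (hd : ∀ᶠ z in 𝓝 y, HasFDerivAt Z (Z' z) z ∧ Z' z e = G z) (hG : DifferentiableAt ℝ G y) :
    G y = 0 ∧ 0 ≤ fderiv ℝ G y e := by
  let ℓ : ℝ → V := fun s => y + s • e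
  have hℓ : ∀ s, HasDerivAt ℓ e s := fun s => by
    have := ((hasDerivAt_id s).smul_const e).const_add y
    rw [one_smul] at this
    exact this
  have hℓ0 : ℓ 0 = y := by simp [ℓ]
  have hc : Tendsto ℓ (𝓝 0) (𝓝 y) := by
    have := (hℓ 0).continuousAt.tendsto
    rwa [hℓ0] at this
  let φ : ℝ → ℝ := Z ∘ ℓ
  have hφd : ∀ᶠ s in 𝓝 (0 : ℝ), HasDerivAt φ (G (ℓ s)) s := by
    filter_upwards [hc.eventually hd] with s hs
    have := hs.1.comp_hasDerivAt s (hℓ s)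
    rwa [hs.2] at this
  have hφ1 : deriv φ =ᶠ[𝓝 0] G ∘ ℓ := by
    filter_upwards [hφd] with s hs using hs.deriv
  have hφmin : IsLocalMin φ 0 := by
    filter_upwards [hc.eventually hmin] with s hs
    simpa [φ, hℓ0, h0] using hs
  have hG0 : G y = 0 := by
    have := hφmin.deriv_eq_zero
    rw [hφ1.eq_of_nhds] at this
    simpa [hℓ0] using this
  have hφ2 : deriv (deriv φ) 0 = fderiv ℝ G y e := by
    rw [hφ1.deriv_eq]
    have h1 : HasFDerivAt G (fderiv ℝ G y) (ℓ 0) := by rw [hℓ0]; exact hG.hasFDerivAt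
    exact (h1.comp_hasDerivAt 0 (hℓ 0)).deriv
  refine ⟨hG0, ?_⟩
  by_contra! hneg
  rw [← hφ2] at hneg
  have hmax := isLocalMax_of_deriv_deriv_neg hneg hφmin.deriv_eq_zero
    hφd.self_of_nhds.continuousAt
  have hconst : φ =ᶠ[𝓝 0] fun _ => φ 0 := by
    filter_upwards [hφmin, hmax] with s h1 h2 using le_antisymm h2 h1
  have : deriv (deriv φ) 0 = 0 := by
    rw [(hconst.deriv).deriv_eq]
    simp
  linarith

/-- A quadratic polynomial that is nonnegative and vanishes at `0` has no linear term. -/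
theorem linear_term_eq_zero {p q : ℝ} (h : ∀ s : ℝ, 0 ≤ s * p + s ^ 2 * q) : p = 0 := by
  by_contra hp
  have hq : 0 < |q| + 1 := by positivity
  have h1 := h (-(p / (|q| + 1)))
  have h2 : (-(p / (|q| + 1))) * p + (-(p / (|q| + 1))) ^ 2 * q =
      p ^ 2 / (|q| + 1) ^ 2 * (q - (|q| + 1)) := by field_simp; ring
  rw [h2] at h1
  have h3 : 0 < p ^ 2 / (|q| + 1) ^ 2 := by positivity
  have h4 : q - (|q| + 1) < 0 := by linarith [le_abs_self q]
  exact absurd h1 (not_le.2 (mul_neg_of_pos_of_neg h3 h4))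

/-- The endomorphism `u ↦ R(u, v) w`, whose trace is the Ricci tensor. -/
def riemLin (m : W → W →L[ℝ] W →L[ℝ] ℝ) (y v w : W) : W →ₗ[ℝ] W where
  toFun u := riem m y u v w
  map_add' _ _ := by simp only [riem, map_add, add_apply]; abel
  map_smul' _ _ := by simp only [riem, map_smul, smul_apply, RingHom.id_apply, smul_sub, smul_add]

variable {m : W → W →L[ℝ] W →L[ℝ] ℝ} {J : W → W →L[ℝ] W} {U : Set W} {f : V → W} {O : Set V}

omit [FiniteDimensional ℝ V] in
theorem IsKahlerOn.hasFDerivWithinAt_form (h : IsKahlerOn m J U) {c X Z : V → W}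
    {c' X' Z' : V →L[ℝ] W} {S : Set V} {y : V} (hy : c y ∈ U) (hc : HasFDerivWithinAt c c' S y)
    (hX : HasFDerivWithinAt X X' S y) (hZ : HasFDerivWithinAt Z Z' S y) :
    ∃ D : V →L[ℝ] ℝ, HasFDerivWithinAt (fun z => m (c z) (J (c z) (X z)) (Z z)) D S y ∧
      ∀ v, D v = m (c y) (J (c y) (X' v + chrL m (c y) (c' v) (X y))) (Z y) +
        m (c y) (J (c y) (X y)) (Z' v + chrL m (c y) (c' v) (Z y)) := by
  obtain ⟨DJ, hDJ, hDJ'⟩ := h.hasFDerivWithinAt_J hy hc hX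
  obtain ⟨D, hD, hD'⟩ := h.metric.hasFDerivWithinAt_inner hy hc hDJ hZ
  exact ⟨D, hD, fun v => by rw [hD', hDJ']⟩

/-- The vector field `z ↦ a - γ_y(z - y, a)` on the domain, whose covariant derivative vanishes
at `y`. -/
def adapted (m : W → W →L[ℝ] W →L[ℝ] ℝ) (f : V → W) (y a z : V) : V :=
  a - chrL (pull m f) y (z - y) a

namespace IsImmersionOn

omit [FiniteDimensional ℝ V] in
theorem hasFDerivAt_adapted (y a z : V) :
    HasFDerivAt (adapted m f y a) (-((chrL (pull m f) y).flip a)) z := by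
  have h1 : HasFDerivAt (fun z : V => z - y) (ContinuousLinearMap.id ℝ V) z :=
    (hasFDerivAt_id z).sub_const y
  have h2 := (((chrL (pull m f) y).flip a).hasFDerivAt (x := z - y)).comp z h1
  rw [ContinuousLinearMap.comp_id] at h2
  exact h2.const_sub a

theorem cov_adapted (h : IsImmersionOn m U f O) {y z : V} (hz : z ∈ O) (e a : V) :
    cov m f (fun x => fderiv ℝ f x (adapted m f y a x)) z e =
      nab m f z e (adapted m f y a z) - fderiv ℝ f z (chrL (pull m f) y e a) := by
  have h1 := hasFDerivAt_adapted (m := m) (f := f) y a z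
  rw [h.cov_fderiv_apply hz h1.differentiableAt, h1.fderiv]
  simp [sub_eq_add_neg]

/-- The second covariant derivative of the extension of `df a` by an adapted field is `(∇A)(e, e, a)` up
to a value of `A` and a tangential vector.  Neither contributes to the second order condition of
`barrier_le`: the first by the first order conditions, the second by the null vector conditions. -/
theorem cov_cov_adapted (h : IsImmersionOn m U f O) {y : V} (hy : y ∈ O) (e a : V) :
    ∃ τ : V, cov m f (fun z => cov m f (fun x => fderiv ℝ f x (adapted m f y a x)) z e) y e =
      nablaSff m f y e e a + sff m f y (chrL (pull m f) y e e) a + fderiv ℝ f y τ := by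
  have hA := h.differentiableAt_sff hy
  have hg := h.isMetricOn_pull.differentiableAt_chrL hy
  have had := hasFDerivAt_adapted (m := m) (f := f) y a y
  have ha0 : adapted m f y a y = a := by simp [adapted]
  set γ := chrL (pull m f) with hγ
  have e1 : (fun z => cov m f (fun x => fderiv ℝ f x (adapted m f y a x)) z e) =ᶠ[𝓝 y]
      fun z => sff m f z e (adapted m f y a z)
        + fderiv ℝ f z (γ z e (adapted m f y a z) - γ y e a) := by
    filter_upwards [h.isOpen.mem_nhds hy] with z hz
    rw [h.cov_adapted hz, nab_eq, map_sub]
    abel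
  obtain ⟨D, hD, hD'⟩ := hA.hasFDerivAt.hasFDerivWithinAt.clm_apply₂
    (hasFDerivWithinAt_const e y univ) had.hasFDerivWithinAt
  have hY : DifferentiableAt ℝ (fun z => γ z e (adapted m f y a z) - γ y e a) y :=
    ((hg.clm_apply (differentiableAt_const e)).clm_apply had.differentiableAt).sub_const _
  refine ⟨fderiv ℝ (fun z => γ z e (adapted m f y a z) - γ y e a) y e, ?_⟩
  rw [cov_congr e1, cov_add (hD.hasFDerivAt univ_mem).differentiableAt
    ((h.differentiableAt_fderiv hy).clm_apply hY), h.cov_fderiv_apply hy hY, ha0, sub_self,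
    map_zero, zero_add, h.nablaSff_eq hy]
  have e2 : cov m f (fun z => sff m f z e (adapted m f y a z)) y e =
      D e + chrL m (f y) (fderiv ℝ f y e) (sff m f y e a) := by
    rw [cov, (hD.hasFDerivAt univ_mem).fderiv, ha0]
  rw [e2, hD', ha0]
  simp
  abel

set_option maxHeartbeats 2000000 in
/-- Suppose that `θ (g(a', a') + g(b', b')) / 2 - ω(a', b')` is nonnegative near `y`, vanishes at
`(a, b)`, and that its time derivative at `(a, b)` is nonpositive under the mean curvature flow,
where `θ` grows at the rate `C`.  If the ambient metric is Kähler-Einstein, this bounds `C`. -/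
theorem barrier_le (h : IsImmersionOn m U f O) (hK : IsKahlerOn m J U)
    (hdim : finrank ℝ V + finrank ℝ V = finrank ℝ W) {y : V} (hy : y ∈ O) {a b : V}
    {θ C k k₂ c : ℝ} (hθ : 0 < θ) (hθ' : θ ≤ 1 / 2)
    (hmin : ∀ᶠ z in 𝓝 y, ∀ a' b', m (f z) (J (f z) (fderiv ℝ f z a')) (fderiv ℝ f z b') ≤
      θ / 2 * (pull m f z a' a' + pull m f z b' b'))
    (hab : m (f y) (J (f y) (fderiv ℝ f y a)) (fderiv ℝ f y b) =
      θ / 2 * (pull m f y a a + pull m f y b b)) (hne : a ≠ 0 ∨ b ≠ 0)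
    (htime : C * (θ / 2 * (pull m f y a a + pull m f y b b))
      + θ * (m (f y) (cov m f (meanL m f) y a) (fderiv ℝ f y a)
        + m (f y) (cov m f (meanL m f) y b) (fderiv ℝ f y b))
      - m (f y) (J (f y) (cov m f (meanL m f) y a)) (fderiv ℝ f y b)
      - m (f y) (J (f y) (fderiv ℝ f y a)) (cov m f (meanL m f) y b) ≤ 0)
    (hnab : ∀ u v, m (f y) (nab m f y u v) (nab m f y u v) ≤
      k ^ 2 * (pull m f y u u * pull m f y v v))
    (hk₂ : 0 ≤ k₂) (hR : ∀ X Y Z Z', |m (f y) (riem m (f y) X Y Z) Z'| ≤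
      k₂ * gnorm (m (f y)) X * gnorm (m (f y)) Y * gnorm (m (f y)) Z * gnorm (m (f y)) Z')
    (hRic : ∀ X Y, LinearMap.trace ℝ W (riemLin m (f y) X Y) = c * m (f y) X Y) :
    C ≤ |c| + 5 * finrank ℝ V * k₂ + 6 * finrank ℝ V * k ^ 2 := by
  have hfy := h.mapsTo hy
  have hG := h.metric.isInner hfy
  have hg := h.isMetricOn_pull.isInner hy
  have hsym := h.metric.symm _ hfy
  set G := m (f y) with hGdef
  set g := pull m f y with hgdef
  set Df := fderiv ℝ f y with hDf
  set j := J (f y) with hj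
  have hga : ∀ u v, g u v = G (Df u) (Df v) := fun u v => rfl
  have hjsq := hK.sq _ hfy
  have hjorth := hK.orth _ hfy
  have hjskew := hK.skew hfy
  have hq := hmin.self_of_nhds
  -- the null vector conditions
  have n1 : ∀ v, θ * g a v = G (j (Df v)) (Df b) := fun v => by
    have := linear_term_eq_zero (p := θ * g a v - G (j (Df v)) (Df b)) (q := θ / 2 * g v v)
      fun s => by
        have h1 := hq (a + s • v) b
        simp only [← hGdef, ← hgdef, ← hDf, ← hj, map_add, map_smul, add_apply, smul_apply,
          smul_eq_mul, hg.symm v a] at h1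
        nlinarith [h1, hab]
    linarith
  have n2 : ∀ v, θ * g b v = G (j (Df a)) (Df v) := fun v => by
    have := linear_term_eq_zero (p := θ * g b v - G (j (Df a)) (Df v)) (q := θ / 2 * g v v)
      fun s => by
        have h1 := hq a (b + s • v)
        simp only [← hGdef, ← hgdef, ← hDf, ← hj, map_add, map_smul, add_apply, smul_apply,
          smul_eq_mul, hg.symm v b] at h1
        nlinarith [h1, hab]
    linarith
  have hNab : g a a = g b b := by
    have h1 := n1 a
    have h2 := n2 b
    have : θ * (g a a - g b b) = 0 := by rw [mul_sub, h1, h2, sub_self]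
    rcases mul_eq_zero.1 this with h3 | h3
    · exact absurd h3 hθ.ne'
    · linarith
  set Nn := g a a with hN
  have hNpos : 0 < Nn := by
    rcases hne with h1 | h1
    · exact hg.pos a h1
    · rw [hNab]; exact hg.pos b h1
  have hωab : G (j (Df a)) (Df b) = θ * Nn := by rw [← n1 a]
  -- the functional that vanishes on tangential vectors
  let Λ : W → W → ℝ := fun X Y => θ * (G X (Df a) + G Y (Df b)) - G (j X) (Df b) - G (j (Df a)) Y
  have hΛadd : ∀ X X' Y Y', Λ (X + X') (Y + Y') = Λ X Y + Λ X' Y' := fun X X' Y Y' => by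
    simp only [Λ, map_add, add_apply]; ring
  have hΛsub : ∀ X X' Y Y', Λ (X - X') (Y - Y') = Λ X Y - Λ X' Y' := fun X X' Y Y' => by
    simp only [Λ, map_sub, sub_apply]; ring
  have hΛtan : ∀ u v, Λ (Df u) (Df v) = 0 := fun u v => by
    have h1 := n1 u
    have h2 := n2 v
    simp only [Λ, ← hga, hg.symm u a, hg.symm v b]
    linarith
  -- first and second order conditions along the direction `e`
  have key : ∀ e : V, Λ (sff m f y e a) (sff m f y e b) = 0 ∧
      0 ≤ Λ (nablaSff m f y e e a) (nablaSff m f y e e b)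
        + Λ (sff m f y (chrL (pull m f) y e e) a) (sff m f y (chrL (pull m f) y e e) b)
        + θ * (G (sff m f y e a) (sff m f y e a) + G (sff m f y e b) (sff m f y e b))
        - 2 * G (j (sff m f y e a)) (sff m f y e b) := by
    intro e
    let X : V → V → W := fun a z => fderiv ℝ f z (adapted m f y a z)
    let cX : V → V → W := fun a z =>
      nab m f z e (adapted m f y a z) - fderiv ℝ f z (chrL (pull m f) y e a)
    have had : ∀ a z, DifferentiableAt ℝ (adapted m f y a) z := fun a z =>
      (hasFDerivAt_adapted y a z).differentiableAt
    have hX0 : ∀ a, X a y = Df a := fun a => by simp [X, adapted, hDf]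
    have hcX0 : ∀ a, cX a y = sff m f y e a := fun a => by simp [cX, adapted, sff_apply]
    have hXd : ∀ a, ∀ z ∈ O, DifferentiableAt ℝ (X a) z := fun a z hz =>
      (h.differentiableAt_fderiv hz).clm_apply (had a z)
    have hcXd : ∀ a, DifferentiableAt ℝ (cX a) y := fun a =>
      (((h.differentiableAt_nab hy).clm_apply (differentiableAt_const e)).clm_apply (had a y)).sub
        ((h.differentiableAt_fderiv hy).clm_apply (differentiableAt_const _))
    have hcov : ∀ a, ∀ z ∈ O, fderiv ℝ (X a) z e + chrL m (f z) (fderiv ℝ f z e) (X a z) = cX a z :=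
      fun a z hz => h.cov_adapted hz e a
    have hcov0 : ∀ a, fderiv ℝ (X a) y e + chrL m (f y) (Df e) (Df a) = sff m f y e a :=
      fun a => by rw [← hcX0, ← hcov a y hy, hX0]
    have hccov : ∀ a, ∃ τ, fderiv ℝ (cX a) y e + chrL m (f y) (Df e) (cX a y) =
        nablaSff m f y e e a + sff m f y (chrL (pull m f) y e e) a + Df τ := fun a => by
      obtain ⟨τ, hτ⟩ := h.cov_cov_adapted hy e a
      refine ⟨τ, ?_⟩
      rw [← hτ, cov_congr (Z := cX a)]
      · rfl
      · filter_upwards [h.isOpen.mem_nhds hy] with z hz using h.cov_adapted hz e a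
    have hfd : ∀ z ∈ O, HasFDerivWithinAt f (fderiv ℝ f z) univ z := fun z hz =>
      (h.differentiableAt hz).hasFDerivAt.hasFDerivWithinAt
    have hXd' : ∀ a, ∀ z ∈ O, HasFDerivWithinAt (X a) (fderiv ℝ (X a) z) univ z := fun a z hz =>
      (hXd a z hz).hasFDerivAt.hasFDerivWithinAt
    have hcXd' : ∀ a, HasFDerivWithinAt (cX a) (fderiv ℝ (cX a) y) univ y := fun a =>
      (hcXd a).hasFDerivAt.hasFDerivWithinAt
    let Zf : V → ℝ := fun z => θ / 2 * (m (f z) (X a z) (X a z) + m (f z) (X b z) (X b z))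
      - m (f z) (J (f z) (X a z)) (X b z)
    let Gf : V → ℝ := fun z => θ * (m (f z) (cX a z) (X a z) + m (f z) (cX b z) (X b z))
      - m (f z) (J (f z) (cX a z)) (X b z) - m (f z) (J (f z) (X a z)) (cX b z)
    have hZd : ∀ z ∈ O, ∃ Z' : V →L[ℝ] ℝ, HasFDerivAt Zf Z' z ∧ Z' e = Gf z := fun z hz => by
      obtain ⟨D1, hD1, h1⟩ := h.metric.hasFDerivWithinAt_inner (h.mapsTo hz) (hfd z hz)
        (hXd' a z hz) (hXd' a z hz)
      obtain ⟨D2, hD2, h2⟩ := h.metric.hasFDerivWithinAt_inner (h.mapsTo hz) (hfd z hz)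
        (hXd' b z hz) (hXd' b z hz)
      obtain ⟨D3, hD3, h3⟩ := hK.hasFDerivWithinAt_form (h.mapsTo hz) (hfd z hz)
        (hXd' a z hz) (hXd' b z hz)
      refine ⟨_, (((hD1.add hD2).const_mul (θ / 2)).sub hD3).hasFDerivAt univ_mem, ?_⟩
      simp only [sub_apply, smul_apply, add_apply, h1, h2, h3, hcov _ z hz, smul_eq_mul, Gf]
      rw [h.metric.symm _ (h.mapsTo hz) (X a z) (cX a z),
        h.metric.symm _ (h.mapsTo hz) (X b z) (cX b z)]
      ring
    obtain ⟨D1, hD1, h1⟩ := h.metric.hasFDerivWithinAt_inner hfy (hfd y hy)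
      (hcXd' a) (hXd' a y hy)
    obtain ⟨D2, hD2, h2⟩ := h.metric.hasFDerivWithinAt_inner hfy (hfd y hy)
      (hcXd' b) (hXd' b y hy)
    obtain ⟨D3, hD3, h3⟩ := hK.hasFDerivWithinAt_form hfy (hfd y hy) (hcXd' a) (hXd' b y hy)
    obtain ⟨D4, hD4, h4⟩ := hK.hasFDerivWithinAt_form hfy (hfd y hy) (hXd' a y hy) (hcXd' b)
    have hGd : HasFDerivAt Gf _ y :=
      ((((hD1.add hD2).const_mul θ).sub hD3).sub hD4).hasFDerivAt univ_mem
    choose! Z' hZ' using hZd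
    have hcond := first_second_order_conditions (Z := Zf) (G := Gf) (Z' := Z') (y := y) (e := e)
      (by
        filter_upwards [hmin] with z hz
        have := hz (adapted m f y a z) (adapted m f y b z)
        simp only [Zf]
        exact sub_nonneg.2 this)
      (by
        simp only [Zf, hX0]
        rw [sub_eq_zero]
        exact hab.symm)
      (by filter_upwards [h.isOpen.mem_nhds hy] with z hz using hZ' z hz)
      hGd.differentiableAt
    obtain ⟨c1, c2⟩ := hcond
    refine ⟨?_, ?_⟩
    · simp only [Gf, hX0, hcX0] at c1
      exact c1
    · obtain ⟨τa, hτa⟩ := hccov a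
      obtain ⟨τb, hτb⟩ := hccov b
      rw [hGd.fderiv] at c2
      simp only [sub_apply, smul_apply, add_apply, h1, h2, h3, h4, smul_eq_mul,
        ← hDf, hτa, hτb] at c2
      simp only [hX0, hcX0, ← hGdef, ← hj, hcov0] at c2
      have e1 : Λ (nablaSff m f y e e a + sff m f y (chrL (pull m f) y e e) a + Df τa)
          (nablaSff m f y e e b + sff m f y (chrL (pull m f) y e e) b + Df τb) =
          Λ (nablaSff m f y e e a) (nablaSff m f y e e b)
          + Λ (sff m f y (chrL (pull m f) y e e) a) (sff m f y (chrL (pull m f) y e e) b) := by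
        rw [hΛadd, hΛadd, hΛtan, add_zero]
      rw [← e1]
      simp only [Λ]
      linarith [c2]
  -- summation over an orthonormal basis
  obtain ⟨e, he⟩ := hg.exists_orthonormal
  set E : Fin (finrank ℝ V) → W := fun i => Df (e i) with hE
  have hEo : OrthonormalFor G E := fun i j => he i j
  have hΛsum : ∀ X Y : Fin (finrank ℝ V) → W, Λ (∑ i, X i) (∑ i, Y i) = ∑ i, Λ (X i) (Y i) :=
    fun X Y => by
      simp only [Λ, map_sum, sum_apply, Finset.sum_sub_distrib, Finset.sum_add_distrib,
        Finset.mul_sum, mul_add]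
  let Rm : V → Fin (finrank ℝ V) → W := fun a i => riem m (f y) (E i) (Df a) (E i)
  have hkey : ∀ i, 0 ≤ Λ (nablaSff m f y a (e i) (e i)) (nablaSff m f y b (e i) (e i))
        + Λ (Rm a i) (Rm b i)
        + θ * (G (sff m f y (e i) a) (sff m f y (e i) a)
          + G (sff m f y (e i) b) (sff m f y (e i) b))
        - 2 * G (j (sff m f y (e i) a)) (sff m f y (e i) b) := fun i => by
    have h1 := (key (e i)).2
    rw [(key _).1, add_zero, h.nablaSff_symm hy _ _ a, h.nablaSff_symm hy _ _ b,
      h.codazzi hy _ a, h.codazzi hy _ b, ← hDf, hΛsub, hΛtan, sub_zero, hΛadd] at h1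
    exact h1
  have hsum := Finset.sum_nonneg fun i (_ : i ∈ Finset.univ) => hkey i
  simp only [Finset.sum_add_distrib, Finset.sum_sub_distrib, ← hΛsum] at hsum
  rw [← h.cov_meanL hy he, ← h.cov_meanL hy he] at hsum
  have htime' : C * (θ * Nn) + Λ (cov m f (meanL m f) y a) (cov m f (meanL m f) y b) ≤ 0 := by
    have e1 : θ / 2 * (Nn + g b b) = θ * Nn := by rw [← hNab]; ring
    rw [e1] at htime
    simp only [Λ]
    linarith
  -- estimates
  have hd1 : Fintype.card (Fin (finrank ℝ V)) + Fintype.card (Fin (finrank ℝ V)) = finrank ℝ W := by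
    simpa using hdim
  have hcomb : ∀ c : Fin (finrank ℝ V) → ℝ, ∑ i, c i • E i = Df (∑ i, c i • e i) := fun c => by
    simp [hE]
  have hωle : ∀ u v, |G (j (Df u)) (Df v)| ≤ θ * gnorm G (Df u) * gnorm G (Df v) := fun u v => by
    have hone : ∀ u v, G (j (Df u)) (Df v) ≤ θ * gnorm G (Df u) * gnorm G (Df v) := fun u v => by
      rcases eq_or_ne u 0 with rfl | hu
      · simp [gnorm]
      rcases eq_or_ne v 0 with rfl | hv
      · simp [gnorm]
      have pu : 0 < gnorm G (Df u) := Real.sqrt_pos.2 (hg.pos u hu)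
      have pv : 0 < gnorm G (Df v) := Real.sqrt_pos.2 (hg.pos v hv)
      have h1 := hq (gnorm G (Df v) • u) (gnorm G (Df u) • v)
      simp only [← hGdef, ← hgdef, ← hDf, ← hj, map_smul, smul_apply, smul_eq_mul, hga,
        ← hG.gnorm_sq (Df u), ← hG.gnorm_sq (Df v)] at h1
      have h2 : gnorm G (Df u) * gnorm G (Df v) * G (j (Df u)) (Df v) ≤
          gnorm G (Df u) * gnorm G (Df v) * (θ * gnorm G (Df u) * gnorm G (Df v)) := by
        nlinarith [h1]
      exact le_of_mul_le_mul_left h2 (mul_pos pu pv)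
    refine abs_le.2 ⟨?_, hone u v⟩
    have h1 := hone (-u) v
    have h2 : gnorm G (-Df u) = gnorm G (Df u) := by simp [gnorm]
    simp only [map_neg, neg_apply, h2] at h1
    linarith
  have hω : ∀ c d : Fin (finrank ℝ V) → ℝ, |G (j (∑ i, c i • E i)) (∑ i, d i • E i)| ≤
      θ * gnorm G (∑ i, c i • E i) * gnorm G (∑ i, d i • E i) := fun c d => by
    rw [hcomb, hcomb]; exact hωle _ _
  have hA2 : ∀ i u, G (sff m f y (e i) u) (sff m f y (e i) u) ≤ k ^ 2 * g u u := fun i u => by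
    have h1 := hnab (e i) u
    have h2 : G (nab m f y (e i) u) (nab m f y (e i) u) = G (sff m f y (e i) u) (sff m f y (e i) u)
        + g (chrL (pull m f) y (e i) u) (chrL (pull m f) y (e i) u) := by
      rw [nab_eq]
      simp only [map_add, add_apply, ← hDf, hGdef]
      rw [h.inner_sff hy, h.inner_sff' hy]
      simp [hga, hGdef, hDf]
    rw [h2, he i i, if_pos rfl, one_mul] at h1
    linarith [hg.nonneg (chrL (pull m f) y (e i) u)]
  have hJA : ∀ i, |G (j (sff m f y (e i) a)) (sff m f y (e i) b)| ≤ 2 * θ * (k ^ 2 * Nn) :=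
    fun i => by
      have h1 := hG.kahler_normal_le hjsq hjorth hEo hd1 hθ.le hθ' hω
        (fun l => h.inner_sff hy (e i) a (e l)) (fun l => h.inner_sff hy (e i) b (e l))
      have p1 := hA2 i a
      have p2 := hA2 i b
      rw [← hNab] at p2
      rw [← hG.gnorm_sq] at p1 p2
      have h3 : gnorm G (sff m f y (e i) a) * gnorm G (sff m f y (e i) b) ≤ k ^ 2 * Nn := by
        nlinarith [sq_nonneg (gnorm G (sff m f y (e i) a) - gnorm G (sff m f y (e i) b))]
      calc _ ≤ _ := h1
        _ = 2 * θ * (gnorm G (sff m f y (e i) a) * gnorm G (sff m f y (e i) b)) := by ring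
        _ ≤ _ := mul_le_mul_of_nonneg_left h3 (by positivity)
  -- the curvature term
  have hna : gnorm G (Df a) ^ 2 = Nn := hG.gnorm_sq _
  have hnb : gnorm G (Df b) ^ 2 = Nn := by rw [hG.gnorm_sq, hNab, hga]
  have hnab' : gnorm G (Df a) = gnorm G (Df b) := by
    have := hna.trans hnb.symm
    exact (sq_eq_sq₀ (gnorm_nonneg _ _) (gnorm_nonneg _ _)).1 this
  have hjn : ∀ v, gnorm G (j v) = gnorm G v := fun v => by rw [gnorm, gnorm, hjorth]
  have hE1 : ∀ i, gnorm G (E i) = 1 := fun i => IsInner.gnorm_orthonormal hEo i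
  have htrace := hG.trace_sub_le hjsq hjorth hEo hd1 hθ.le hθ' hω
    (riemLin m (f y) (Df a) (j (Df b))) (κ := k₂ * Nn) (fun X Y => by
      refine (hR X (Df a) (j (Df b)) Y).trans (le_of_eq ?_)
      rw [hjn, ← hnab', ← hna]; ring) (by positivity)
  rw [hRic] at htrace
  have hr1 : Λ (∑ i, Rm a i) (∑ i, Rm b i) = θ * (∑ i, (G (Rm a i) (Df a) + G (Rm b i) (Df b)))
      - (∑ i, G (riemLin m (f y) (Df a) (j (Df b)) (E i)) (E i)
        + ∑ i, G (riemLin m (f y) (Df a) (j (Df b)) (j (E i))) (j (E i))) := by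
    have e1 : ∀ i, G (riemLin m (f y) (Df a) (j (Df b)) (E i)) (E i) = G (j (Rm a i)) (Df b) :=
      fun i => by
        change G (riem m (f y) (E i) (Df a) (j (Df b))) (E i) = _
        rw [h.metric.riem_skew hfy, hjskew]
    have e2 : ∀ i, G (riemLin m (f y) (Df a) (j (Df b)) (j (E i))) (j (E i)) =
        G (j (Df a)) (Rm b i) := fun i => by
      change G (riem m (f y) (j (E i)) (Df a) (j (Df b))) (j (E i)) = _
      rw [hK.riem_J hfy, hjorth, hK.riem_J_left hfy, map_neg, neg_apply,
        h.metric.riem_pair hfy, hsym (j (Df a))]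
      simp only [Rm]
      rw [riem_antisymm m (f y) (E i) (Df b)]
      simp
      rfl
    simp only [e1, e2, Λ, map_sum, sum_apply, Finset.sum_add_distrib]
    ring
  have hRm : ∀ i, G (Rm a i) (Df a) + G (Rm b i) (Df b) ≤ 2 * (k₂ * Nn) := fun i => by
    have h1 := (le_abs_self _).trans (hR (E i) (Df a) (E i) (Df a))
    have h2 := (le_abs_self _).trans (hR (E i) (Df b) (E i) (Df b))
    rw [hE1] at h1 h2
    have h3 : k₂ * 1 * gnorm G (Df a) * 1 * gnorm G (Df a) = k₂ * Nn := by rw [← hna]; ring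
    have h4 : k₂ * 1 * gnorm G (Df b) * 1 * gnorm G (Df b) = k₂ * Nn := by rw [← hnb]; ring
    rw [h3] at h1
    rw [h4] at h2
    linarith
  have hRmsum := Finset.sum_le_card_nsmul _ _ _ fun i (_ : i ∈ Finset.univ) => hRm i
  have hAsum := Finset.sum_le_card_nsmul (Finset.univ) _ _ fun i (_ : i ∈ Finset.univ) =>
    add_le_add (hA2 i a) (hA2 i b)
  have hJsum := Finset.sum_le_card_nsmul (Finset.univ) _ _ fun i (_ : i ∈ Finset.univ) =>
    (neg_le_abs _).trans (hJA i)
  simp only [Finset.card_univ, Fintype.card_fin, nsmul_eq_mul, Finset.sum_neg_distrib] at hRmsum hAsum hJsum htrace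
  have hGaj : c * G (Df a) (j (Df b)) = - (c * (θ * Nn)) := by
    rw [← hωab, hjskew]; ring
  rw [hGaj] at htrace
  have hcabs : c * (θ * Nn) ≤ |c| * (θ * Nn) :=
    mul_le_mul_of_nonneg_right (le_abs_self c) (by positivity)
  have hcabs' : - (c * (θ * Nn)) ≤ |c| * (θ * Nn) := by
    rw [← neg_mul]
    exact mul_le_mul_of_nonneg_right (neg_le_abs c) (by positivity)
  have htr := (abs_le.1 htrace)
  have hΛR : Λ (∑ i, Rm a i) (∑ i, Rm b i) ≤ θ * (finrank ℝ V * (2 * (k₂ * Nn)))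
      + (|c| * (θ * Nn) + 3 * finrank ℝ V * (k₂ * Nn) * θ) := by
    rw [hr1]
    have := mul_le_mul_of_nonneg_left hRmsum hθ.le
    linarith [htr.1, htr.2]
  have hAs := mul_le_mul_of_nonneg_left hAsum hθ.le
  rw [← hNab] at hAs
  have hfin : C * (θ * Nn) ≤ (|c| + 5 * finrank ℝ V * k₂ + 6 * finrank ℝ V * k ^ 2) * (θ * Nn) := by
    rw [← Finset.mul_sum, ← Finset.mul_sum] at hsum
    linarith [hsum, htime', hΛR, hAs, hJsum]
  exact le_of_mul_le_mul_right hfin (by positivity)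

end IsImmersionOn

end Barrier

end

section

/-! ### Volume forms of Kähler forms -/

section Volume

variable {E : Type*} [NormedAddCommGroup E] [NormedSpace ℝ E] {n : ℕ}

/-- The Pfaffian of the skew part of the matrix `A`. -/
def pfaff (A : Fin (2 * n) → Fin (2 * n) → ℝ) : ℝ :=
  ((2 ^ n * n.factorial : ℕ) : ℝ)⁻¹ * ∑ σ : Equiv.Perm (Fin (2 * n)),
    ((Equiv.Perm.sign σ : ℤ) : ℝ) * ∏ i : Fin n,
      A (σ ⟨2 * i, by omega⟩) (σ ⟨2 * i + 1, by omega⟩)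

theorem contDiff_pfaff : ContDiff ℝ ∞ (pfaff (n := n)) := by
  unfold pfaff
  refine contDiff_const.mul (ContDiff.sum fun σ _ => contDiff_const.mul (contDiff_prod fun i _ => ?_))
  exact (contDiff_apply ℝ ℝ _).comp (contDiff_apply ℝ (Fin (2 * n) → ℝ) _)

/-- The value on `v` of the form `Bⁿ / n!`. -/
def volL (B : E →L[ℝ] E →L[ℝ] ℝ) (v : Fin (2 * n) → E) : ℝ := pfaff fun i j => B (v i) (v j)

theorem prod_update_eq (A : E → E → ℝ) (v : Fin (2 * n) → E) (j : Fin (2 * n)) (x : E) :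
    ∏ i : Fin n, A (Function.update v j x ⟨2 * i, by omega⟩)
        (Function.update v j x ⟨2 * i + 1, by omega⟩) =
      (if j.val % 2 = 0 then A x (v ⟨2 * (j.val / 2) + 1, by omega⟩)
        else A (v ⟨2 * (j.val / 2), by omega⟩) x) *
      ∏ i ∈ Finset.univ.erase (⟨j.val / 2, by omega⟩ : Fin n),
        A (v ⟨2 * i, by omega⟩) (v ⟨2 * i + 1, by omega⟩) := by
  rw [← Finset.mul_prod_erase Finset.univ _ (Finset.mem_univ (⟨j.val / 2, by omega⟩ : Fin n))]
  congr 1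
  · split_ifs with h
    · rw [Function.update_of_ne (a := (⟨2 * (j.val / 2) + 1, by omega⟩ : Fin (2 * n)))
        (by simp [Fin.ext_iff]; omega)]
      have : (⟨2 * (j.val / 2), by omega⟩ : Fin (2 * n)) = j := by simp [Fin.ext_iff]; omega
      rw [this, Function.update_self]
    · rw [Function.update_of_ne (a := (⟨2 * (j.val / 2), by omega⟩ : Fin (2 * n)))
        (by simp [Fin.ext_iff]; omega)]
      have : (⟨2 * (j.val / 2) + 1, by omega⟩ : Fin (2 * n)) = j := by simp [Fin.ext_iff]; omega
      rw [this, Function.update_self]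
  · refine Finset.prod_congr rfl fun i hi => ?_
    have hi' : i.val ≠ j.val / 2 := fun h => (Finset.mem_erase.1 hi).1 (Fin.ext h)
    rw [Function.update_of_ne (by simp [Fin.ext_iff]; omega),
      Function.update_of_ne (by simp [Fin.ext_iff]; omega)]

/-- The multilinear map whose antisymmetrization is `Bⁿ`. -/
def formProd (B : E →L[ℝ] E →L[ℝ] ℝ) : MultilinearMap ℝ (fun _ : Fin (2 * n) => E) ℝ where
  toFun v := ∏ i : Fin n, B (v ⟨2 * i, by omega⟩) (v ⟨2 * i + 1, by omega⟩)
  map_update_add' v j x y := by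
    rename_i inst
    cases Subsingleton.elim inst (instDecidableEqFin _)
    have := prod_update_eq (fun u v => B u v) v j
    rw [this, this, this]
    split_ifs <;> simp [add_mul]
  map_update_smul' v j c x := by
    rename_i inst
    cases Subsingleton.elim inst (instDecidableEqFin _)
    have := prod_update_eq (fun u v => B u v) v j
    rw [this, this]
    split_ifs <;> simp [mul_assoc]

theorem volL_eq (B : E →L[ℝ] E →L[ℝ] ℝ) (v : Fin (2 * n) → E) :
    volL B v = ((2 ^ n * n.factorial : ℕ) : ℝ)⁻¹ *
      MultilinearMap.alternatization (formProd B) v := by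
  rw [volL, pfaff, MultilinearMap.alternatization_apply]
  congr 1
  refine Finset.sum_congr rfl fun σ _ => ?_
  rw [Units.smul_def, zsmul_eq_mul]
  rfl

/-- The volume form transforms by the determinant. -/
theorem volL_comp [FiniteDimensional ℝ E] (hE : finrank ℝ E = 2 * n) (B : E →L[ℝ] E →L[ℝ] ℝ)
    (T : E →ₗ[ℝ] E) (v : Fin (2 * n) → E) :
    volL B (fun i => T (v i)) = LinearMap.det T * volL B v := by
  let e : Basis (Fin (2 * n)) ℝ E := (finBasis ℝ E).reindex (finCongr hE)
  rw [volL_eq, volL_eq, AlternatingMap.eq_smul_basis_det e (MultilinearMap.alternatization _)]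
  simp only [AlternatingMap.smul_apply, smul_eq_mul]
  have := e.det_comp T v
  change e.det (fun i => T (v i)) = _ at this
  rw [this]
  ring

theorem hasDerivAt_det_one_add [FiniteDimensional ℝ E] (B : E →ₗ[ℝ] E) :
    HasDerivAt (fun t : ℝ => LinearMap.det (1 + t • B)) (LinearMap.trace ℝ E B) 0 := by
  let e := finBasis ℝ E
  have h1 : ∀ t : ℝ, LinearMap.det (1 + t • B) = 1 + Matrix.trace (LinearMap.toMatrix e e B) * t
      + (Polynomial.eval t (Polynomial.divX (Polynomial.divX
        (Matrix.det (1 + (Polynomial.X : Polynomial ℝ) •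
          (LinearMap.toMatrix e e B).map Polynomial.C))))) * t ^ 2 := fun t => by
    rw [← LinearMap.det_toMatrix e, map_add, map_smul, ← Matrix.det_one_add_smul]
    simp [LinearMap.toMatrix_one]
  simp_rw [h1]
  rw [LinearMap.trace_eq_matrix_trace ℝ e]
  set p := Polynomial.divX (Polynomial.divX
        (Matrix.det (1 + (Polynomial.X : Polynomial ℝ) •
          (LinearMap.toMatrix e e B).map Polynomial.C)))
  have h2 := (((hasDerivAt_id (0 : ℝ)).const_mul (Matrix.trace (LinearMap.toMatrix e e B))).const_add 1).add
    ((p.hasDerivAt 0).mul ((hasDerivAt_id (0 : ℝ)).pow 2))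
  simpa using! h2

/-- The derivative of a determinant at the identity is the trace. -/
theorem hasFDerivWithinAt_det_one {S ι : Type*} [NormedAddCommGroup S] [NormedSpace ℝ S]
    [Fintype ι] [DecidableEq ι] {A : S → ι → ι → ℝ} {A' : ι → ι → S →L[ℝ] ℝ} {s : Set S} {y : S}
    (hA : ∀ i j, HasFDerivWithinAt (fun z => A z i j) (A' i j) s y)
    (h1 : ∀ i j, A y i j = if i = j then 1 else 0) :
    HasFDerivWithinAt (fun z => Matrix.det (Matrix.of (A z))) (∑ i, A' i i) s y := by
  have h : HasFDerivWithinAt (fun z => Matrix.det (Matrix.of (A z))) (∑ σ : Equiv.Perm ι,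
      ((Equiv.Perm.sign σ : ℤ) : ℝ) • ∑ i, (∏ j ∈ Finset.univ.erase i, A y (σ j) j) • A' (σ i) i)
      s y := by
    simp_rw [Matrix.det_apply']
    refine HasFDerivWithinAt.fun_sum fun σ _ => HasFDerivWithinAt.const_mul ?_ _
    exact HasFDerivWithinAt.finset_prod fun i _ => hA (σ i) i
  convert h using 1
  rw [Finset.sum_eq_single (1 : Equiv.Perm ι)]
  · simp [h1]
  · intro σ _ hσ
    rw [Finset.sum_eq_zero, smul_zero]
    intro i _
    have : ∃ j, j ≠ i ∧ σ j ≠ j := by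
      by_contra! hc
      refine hσ (Equiv.ext fun j => ?_)
      rcases eq_or_ne j i with rfl | hj
      · by_contra hne
        have := hc (σ j) hne
        exact hne (σ.injective this)
      · exact hc j hj
    obtain ⟨j, hj, hj'⟩ := this
    rw [Finset.prod_eq_zero (Finset.mem_erase.2 ⟨hj, Finset.mem_univ j⟩), zero_smul]
    rw [h1, if_neg hj']
  · simp

end Volume

end

section

/-! ### The logarithmic derivative of the projected volume -/

section LogDerivative

variable {E : Type*} [NormedAddCommGroup E] [NormedSpace ℝ E] {n : ℕ}

/-- The ratio on the frame `v` of the form `Bⁿ / n!` to the Riemannian volume of `g`. -/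
def starD (B g : E →L[ℝ] E →L[ℝ] ℝ) (v : Fin (2 * n) → E) : ℝ :=
  volL B v / Real.sqrt (Matrix.det (Matrix.of fun i j => g (v i) (v j)))

theorem det_gram_comp {ι : Type*} [Fintype ι] [DecidableEq ι] (g : E →L[ℝ] E →L[ℝ] ℝ)
    (b : Basis ι ℝ E) (T : E →ₗ[ℝ] E) :
    Matrix.det (Matrix.of fun i j => g (T (b i)) (T (b j))) =
      LinearMap.det T ^ 2 * Matrix.det (Matrix.of fun i j => g (b i) (b j)) := by
  have h : (Matrix.of fun i j => g (T (b i)) (T (b j))) =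
      (LinearMap.toMatrix b b T).transpose * (Matrix.of fun i j => g (b i) (b j)) *
        LinearMap.toMatrix b b T := by
    ext i j
    have e : ∀ i, T (b i) = ∑ k, LinearMap.toMatrix b b T k i • b k := fun i => by
      simp only [LinearMap.toMatrix_apply]
      exact (b.sum_repr _).symm
    simp only [Matrix.of_apply, Matrix.mul_apply, Matrix.transpose_apply]
    rw [e i, e j]
    simp only [map_sum, map_smul, sum_apply, smul_apply, smul_eq_mul, Finset.mul_sum,
      Finset.sum_mul]
    exact Finset.sum_congr rfl fun k _ => Finset.sum_congr rfl fun l _ => by ring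
  rw [h, Matrix.det_mul, Matrix.det_mul, Matrix.det_transpose, LinearMap.det_toMatrix]
  ring

theorem starD_comp [FiniteDimensional ℝ E] (hE : finrank ℝ E = 2 * n) (B g : E →L[ℝ] E →L[ℝ] ℝ)
    (b : Basis (Fin (2 * n)) ℝ E) (T : E →ₗ[ℝ] E) (hT : LinearMap.det T ≠ 0) :
    starD B g (fun i => T (b i)) = Real.sign (LinearMap.det T) * starD B g b := by
  rw [starD, starD, volL_comp hE, det_gram_comp, Real.sqrt_mul (sq_nonneg _), Real.sqrt_sq_eq_abs,
    mul_div_mul_comm]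
  rcases lt_or_gt_of_ne hT with h | h
  · rw [abs_of_neg h, Real.sign_of_neg h, div_neg, div_self hT]
  · rw [abs_of_pos h, Real.sign_of_pos h, div_self hT]

/-- The pulled-back Kähler form. -/
def formL (m : E →L[ℝ] E →L[ℝ] ℝ) (J P : E →L[ℝ] E) : E →L[ℝ] E →L[ℝ] ℝ :=
  (m ∘L J).bilinearComp P P

theorem formL_apply (m : E →L[ℝ] E →L[ℝ] ℝ) (J P : E →L[ℝ] E) (u v : E) :
    formL m J P u v = m (J (P u)) (P v) := rfl

variable [FiniteDimensional ℝ E] {m₁ m₂ : E → E →L[ℝ] E →L[ℝ] ℝ} {J₁ : E → E →L[ℝ] E}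
  {U₁ U₂ : Set E} {S : Type*} [NormedAddCommGroup S] [NormedSpace ℝ S]

/-- Since the Kähler form is parallel, the volume form `ωⁿ / n!`, pulled back by a moving linear map
`P`, changes by the trace of `P⁻¹ X`, where `X` is the covariant derivative of `P`. -/
theorem hasFDerivWithinAt_volL (hE : finrank ℝ E = 2 * n) (h₁ : IsKahlerOn m₁ J₁ U₁) {c : S → E}
    {c' : S →L[ℝ] E} {P : S → E →L[ℝ] E} {P' : S →L[ℝ] E →L[ℝ] E} {s : Set S} {y : S}
    (hy : c y ∈ U₁) (hc : HasFDerivWithinAt c c' s y) (hP : HasFDerivWithinAt P P' s y)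
    (e : Fin (2 * n) → E) {Q : E →L[ℝ] E} (hQ : ∀ v, P y (Q v) = v) :
    ∃ D : S →L[ℝ] ℝ,
      HasFDerivWithinAt (fun z => volL (formL (m₁ (c z)) (J₁ (c z)) (P z)) e) D s y ∧
      ∀ v, ∀ X : E →L[ℝ] E, (∀ w, X w = P' v w + chrL m₁ (c y) (c' v) (P y w)) →
        D v = LinearMap.trace ℝ E (Q ∘L X : E →L[ℝ] E) *
          volL (formL (m₁ (c y)) (J₁ (c y)) (P y)) e := by
  have hX : ∀ i, HasFDerivWithinAt (fun z => P z (e i)) (P'.flip (e i)) s y := fun i => by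
    simpa using! hP.clm_apply (hasFDerivWithinAt_const (e i) y s)
  choose A' hA' hA'v using fun i j => h₁.hasFDerivWithinAt_form hy hc (hX i) (hX j)
  have hA : HasFDerivWithinAt
      (fun z i j => formL (m₁ (c z)) (J₁ (c z)) (P z) (e i) (e j))
      (ContinuousLinearMap.pi fun i => ContinuousLinearMap.pi fun j => A' i j) s y :=
    hasFDerivWithinAt_pi.2 fun i => hasFDerivWithinAt_pi.2 fun j => hA' i j
  have hpf := (contDiff_pfaff (n := n)).differentiable (by simp)
    (fun i j => formL (m₁ (c y)) (J₁ (c y)) (P y) (e i) (e j))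
  refine ⟨_, hpf.hasFDerivAt.comp_hasFDerivWithinAt y hA, fun v X hXv => ?_⟩
  set B := formL (m₁ (c y)) (J₁ (c y)) (P y) with hB
  set TT : E →ₗ[ℝ] E := ((Q ∘L X : E →L[ℝ] E) : E →ₗ[ℝ] E) with hTT
  have hd1 : HasDerivAt (fun t : ℝ => volL B fun i => (1 + t • TT) (e i))
      (LinearMap.trace ℝ E TT * volL B e) 0 := by
    simp_rw [volL_comp hE]
    exact (hasDerivAt_det_one_add TT).mul_const _
  have hd2 : HasDerivAt (fun t : ℝ => fun i j => B ((1 + t • TT) (e i)) ((1 + t • TT) (e j)))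
      (fun i j => B (TT (e i)) (e j) + B (e i) (TT (e j))) 0 := by
    refine hasDerivAt_pi.2 fun i => hasDerivAt_pi.2 fun j => ?_
    have : ∀ t : ℝ, B ((1 + t • TT) (e i)) ((1 + t • TT) (e j)) =
        B (e i) (e j) + t * (B (TT (e i)) (e j) + B (e i) (TT (e j)))
          + t ^ 2 * B (TT (e i)) (TT (e j)) := fun t => by
      simp only [LinearMap.add_apply, LinearMap.smul_apply, Module.End.one_apply, map_add, map_smul,
        add_apply, smul_apply, smul_eq_mul]
      ring
    simp_rw [this]
    have h3 := (((hasDerivAt_id (0 : ℝ)).mul_const (B (TT (e i)) (e j) + B (e i) (TT (e j)))).const_add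
      (B (e i) (e j))).add (((hasDerivAt_id (0 : ℝ)).pow 2).mul_const (B (TT (e i)) (TT (e j))))
    simpa using! h3
  have hpf' : HasFDerivAt pfaff (fderiv ℝ pfaff fun i j => B (e i) (e j))
      ((fun t : ℝ => fun i j => B ((1 + t • TT) (e i)) ((1 + t • TT) (e j))) 0) := by
    simpa using hpf.hasFDerivAt
  have hd3 := hpf'.comp_hasDerivAt (0 : ℝ) hd2
  rw [hd1.unique hd3]
  rw [ContinuousLinearMap.comp_apply]
  congr 1
  funext i j
  simp only [ContinuousLinearMap.pi_apply, hA'v, hB, formL_apply]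
  have hPT : ∀ w, P y (TT w) = X w := fun w => hQ _
  rw [hPT, hPT, hXv, hXv]
  rfl

/-- The logarithmic derivative of `starD` for the map `L` from `E` to the tangent space at a moving
point `c` of a product: if `X` is the covariant derivative of `L`, it is the trace of `π X` minus
the trace of the tangential part of `X`, where `π` is the projection to the first factor. -/
theorem hasFDerivWithinAt_log_starD (hE : finrank ℝ E = 2 * n) (h₁ : IsKahlerOn m₁ J₁ U₁)
    (h₂ : IsMetricOn m₂ U₂) {c : S → E × E} {c' : S →L[ℝ] E × E} {L : S → E →L[ℝ] E × E}
    {L' : S →L[ℝ] E →L[ℝ] E × E} {s : Set S} {y : S} (hy : c y ∈ U₁ ×ˢ U₂)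
    (hc : HasFDerivWithinAt c c' s y) (hL : HasFDerivWithinAt L L' s y)
    (b : Basis (Fin (2 * n)) ℝ E) {ς : ℝ} {B g : S → E →L[ℝ] E →L[ℝ] ℝ}
    (hB : ∀ z, B z = formL (m₁ (c z).1) (J₁ (c z).1) (ContinuousLinearMap.fst ℝ E E ∘L L z))
    (hg : ∀ z, g z = (prodM m₁ m₂ (c z)).bilinearComp (L z) (L z))
    (hpos : 0 < ς * starD (B y) (g y) b) {e : Basis (Fin (2 * n)) ℝ E}
    (he : OrthonormalFor (g y) e) {Q : E →L[ℝ] E} (hQ : ∀ v, (L y (Q v)).1 = v) :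
    ∃ D : S →L[ℝ] ℝ, HasFDerivWithinAt (fun z => Real.log (ς * starD (B z) (g z) b)) D s y ∧
      ∀ v, ∀ X : E →L[ℝ] E × E,
        (∀ w, X w = L' v w + chrL (prodM m₁ m₂) (c y) (c' v) (L y w)) →
        D v = LinearMap.trace ℝ E (Q ∘L ContinuousLinearMap.fst ℝ E E ∘L X : E →L[ℝ] E) -
          ∑ i, prodM m₁ m₂ (c y) (X (e i)) (L y (e i)) := by
  -- pass to the frame `e`
  let T : E →ₗ[ℝ] E := e.constr ℝ b
  have hTb : ∀ i, T (e i) = b i := fun i => by simp [T]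
  have hT : LinearMap.det T ≠ 0 := by
    have h3 := e.det_comp T e
    have h4 : (T ∘ e) = b := funext hTb
    rw [h4, e.det_self, mul_one] at h3
    rw [← h3]
    exact (e.isUnit_det b).ne_zero
  have hst : ∀ z, starD (B z) (g z) b = Real.sign (LinearMap.det T) * starD (B z) (g z) e :=
    fun z => by
      rw [← starD_comp hE _ _ _ _ hT]
      congr 1
      exact funext fun i => (hTb i).symm
  simp_rw [hst] at hpos ⊢
  set ς' := ς * Real.sign (LinearMap.det T) with hς'
  have hass : ∀ z, ς * (Real.sign (LinearMap.det T) * starD (B z) (g z) e) =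
      ς' * starD (B z) (g z) e := fun z => by rw [hς', mul_assoc]
  simp_rw [hass] at hpos ⊢
  obtain ⟨D₁, hD₁, hD₁v⟩ := hasFDerivWithinAt_volL hE h₁ (c := fun z => (c z).1)
    (c' := ContinuousLinearMap.fst ℝ E E ∘L c') (P := fun z => ContinuousLinearMap.fst ℝ E E ∘L L z)
    (P' := (ContinuousLinearMap.compL ℝ E (E × E) E (ContinuousLinearMap.fst ℝ E E)) ∘L L')
    hy.1 ((ContinuousLinearMap.fst ℝ E E).hasFDerivAt.comp_hasFDerivWithinAt y hc)
    ((ContinuousLinearMap.compL ℝ E (E × E) E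
      (ContinuousLinearMap.fst ℝ E E)).hasFDerivAt.comp_hasFDerivWithinAt y hL) e (Q := Q) hQ
  simp_rw [← hB] at hD₁ hD₁v
  have hX : ∀ i, HasFDerivWithinAt (fun z => L z (e i)) (L'.flip (e i)) s y := fun i => by
    simpa using! hL.clm_apply (hasFDerivWithinAt_const (e i) y s)
  have hm := h₁.metric.prod h₂
  choose A' hA' hA'v using fun i j => hm.hasFDerivWithinAt_inner hy hc (hX i) (hX j)
  have hgy : ∀ i j, prodM m₁ m₂ (c y) (L y (e i)) (L y (e j)) = if i = j then 1 else 0 :=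
    fun i j => by rw [← he i j, hg]; rfl
  have hD₂ := hasFDerivWithinAt_det_one hA' hgy
  have hgz : ∀ z, Matrix.of (fun i j => prodM m₁ m₂ (c z) (L z (e i)) (L z (e j))) =
      Matrix.of fun i j => g z (e i) (e j) := fun z => by rw [hg]; rfl
  simp_rw [hgz] at hD₂
  have hdet1 : Matrix.det (Matrix.of fun i j => g y (e i) (e j)) = 1 := by
    have : (Matrix.of fun i j => g y (e i) (e j)) = (1 : Matrix (Fin (2 * n)) (Fin (2 * n)) ℝ) := by
      ext i j
      rw [Matrix.of_apply, he i j, Matrix.one_apply]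
    rw [this, Matrix.det_one]
  have hN : 0 < ς' * volL (B y) e := by
    have h5 := hpos
    rw [starD, hdet1, Real.sqrt_one, div_one] at h5
    exact h5
  have hN' := hD₁.const_mul ς'
  -- the logarithm of the quotient splits where numerator and denominator are positive
  have hev1 : ∀ᶠ z in 𝓝[s] y, 0 < ς' * volL (B z) e :=
    hN'.continuousWithinAt.eventually (lt_mem_nhds hN)
  have hev2 : ∀ᶠ z in 𝓝[s] y, 0 < Matrix.det (Matrix.of fun i j => g z (e i) (e j)) :=
    hD₂.continuousWithinAt.eventually (lt_mem_nhds (by simp only [hdet1, one_pos]))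
  have hfin := (hN'.log hN.ne').sub ((hD₂.log (by rw [hdet1]; exact one_ne_zero)).const_mul (1 / 2 : ℝ))
  have hform : ∀ z, 0 < ς' * volL (B z) e →
      0 < Matrix.det (Matrix.of fun i j => g z (e i) (e j)) →
      Real.log (ς' * starD (B z) (g z) e) = Real.log (ς' * volL (B z) e)
        - 1 / 2 * Real.log (Matrix.det (Matrix.of fun i j => g z (e i) (e j))) := fun z hz1 hz2 => by
    rw [starD, ← mul_div_assoc, Real.log_div hz1.ne' (Real.sqrt_pos.2 hz2).ne', Real.log_sqrt hz2.le]
    ring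
  refine ⟨_, hfin.congr_of_eventuallyEq ?_ ?_, fun v X hXv => ?_⟩
  · filter_upwards [hev1, hev2] with z hz1 hz2 using hform z hz1 hz2
  · exact hform y hN (by rw [hdet1]; exact one_pos)
  · have h6 := hD₁v v (ContinuousLinearMap.fst ℝ E E ∘L X) (fun w => by
      rw [ContinuousLinearMap.comp_apply, hXv, chrL_prodM h₁.metric h₂ hy]
      rfl)
    simp only [sub_apply, smul_apply, smul_eq_mul, h6, hdet1, inv_one, one_mul, sum_apply, hA'v]
    have h7 : (ς' * volL (B y) e)⁻¹ * (ς' * (LinearMap.trace ℝ E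
        (Q ∘L ContinuousLinearMap.fst ℝ E E ∘L X : E →L[ℝ] E) * volL (B y) e)) =
        LinearMap.trace ℝ E (Q ∘L ContinuousLinearMap.fst ℝ E E ∘L X : E →L[ℝ] E) := by
      rw [inv_mul_eq_iff_eq_mul₀ hN.ne']
      ring
    rw [h7, Finset.mul_sum]
    congr 1
    refine Finset.sum_congr rfl fun i _ => ?_
    have h8 : L'.flip (e i) v + chrL (prodM m₁ m₂) (c y) (c' v) (L y (e i)) = X (e i) :=
      (hXv (e i)).symm
    rw [h8, hm.symm _ hy (L y (e i))]
    ring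

end LogDerivative

end

section

/-! ### The evolution of the projected volume -/

section Evolution

variable {E : Type*} [NormedAddCommGroup E] [NormedSpace ℝ E] [FiniteDimensional ℝ E] {n : ℕ}
  {m₁ m₂ : E → E →L[ℝ] E →L[ℝ] ℝ} {J₁ : E → E →L[ℝ] E} {U₁ U₂ : Set E}

/-- The ratio of `ωⁿ / n!`, pulled back by the first component of `f`, to the volume form of the
metric induced by `f`, evaluated on the frame `b`. -/
def starF (m₁ m₂ : E → E →L[ℝ] E →L[ℝ] ℝ) (J₁ : E → E →L[ℝ] E) (b : Fin (2 * n) → E)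
    (f : E → E × E) (z : E) : ℝ :=
  starD (formL (m₁ (f z).1) (J₁ (f z).1) (ContinuousLinearMap.fst ℝ E E ∘L fderiv ℝ f z))
    (pull (prodM m₁ m₂) f z) b

/-- The trace of an endomorphism, as a continuous linear map. -/
def trL (E : Type*) [NormedAddCommGroup E] [NormedSpace ℝ E] [FiniteDimensional ℝ E] :
    (E →L[ℝ] E) →L[ℝ] ℝ :=
  LinearMap.toContinuousLinearMap
    (LinearMap.trace ℝ E ∘ₗ (ContinuousLinearMap.coeLM ℝ : (E →L[ℝ] E) →ₗ[ℝ] E →ₗ[ℝ] E))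

theorem trL_apply (T : E →L[ℝ] E) : trL E T = LinearMap.trace ℝ E T := rfl

theorem trL_comm (A B : E →L[ℝ] E) : trL E (A ∘L B) = trL E (B ∘L A) :=
  LinearMap.trace_mul_comm ℝ (A : E →ₗ[ℝ] E) (B : E →ₗ[ℝ] E)

namespace IsImmersionOn

variable {f : E → E × E} {O : Set E}

theorem contDiffOn_starF (h : IsImmersionOn (prodM m₁ m₂) (U₁ ×ˢ U₂) f O)
    (h₁ : IsKahlerOn m₁ J₁ U₁) (b : Basis (Fin (2 * n)) ℝ E) :
    ContDiffOn ℝ ∞ (starF m₁ m₂ J₁ b f) O := by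
  have hf1 : ContDiffOn ℝ ∞ (fun z => (f z).1) O := contDiff_fst.comp_contDiffOn h.smooth
  have hm1 : MapsTo (fun z => (f z).1) O U₁ := fun z hz => (h.mapsTo hz).1
  have hc1 := h₁.metric.smooth.comp hf1 hm1
  have hJ1 := h₁.smooth.comp hf1 hm1
  have hDf := h.contDiffOn_fderiv
  have hv : ∀ i, ContDiffOn ℝ ∞ (fun z => (fderiv ℝ f z (b i)).1) O := fun i =>
    contDiff_fst.comp_contDiffOn (hDf.clm_apply contDiffOn_const)
  have hnum : ContDiffOn ℝ ∞ (fun z => volL (formL (m₁ (f z).1) (J₁ (f z).1)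
      (ContinuousLinearMap.fst ℝ E E ∘L fderiv ℝ f z)) b) O := by
    refine contDiff_pfaff.comp_contDiffOn (contDiffOn_pi.2 fun i => contDiffOn_pi.2 fun j => ?_)
    exact (hc1.clm_apply (hJ1.clm_apply (hv i))).clm_apply (hv j)
  have hg := h.isMetricOn_pull
  have hdet : ContDiffOn ℝ ∞ (fun z => Matrix.det (Matrix.of fun i j =>
      pull (prodM m₁ m₂) f z (b i) (b j))) O := by
    simp_rw [Matrix.det_apply']
    refine ContDiffOn.sum fun σ _ => contDiffOn_const.mul (contDiffOn_prod fun i _ => ?_)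
    exact (hg.smooth.clm_apply contDiffOn_const).clm_apply contDiffOn_const
  have hpos : ∀ z ∈ O, 0 < Matrix.det (Matrix.of fun i j =>
      pull (prodM m₁ m₂) f z (b i) (b j)) := fun z hz => by
    obtain ⟨e, he⟩ := (hg.isInner hz).exists_orthonormal
    have hE : finrank ℝ E = 2 * n := by simpa using finrank_eq_card_basis b
    let e' : Basis (Fin (2 * n)) ℝ E := e.reindex (finCongr hE)
    let T : E →ₗ[ℝ] E := e'.constr ℝ b
    have hTb : ∀ i, T (e' i) = b i := fun i => by simp [T]
    have hT : LinearMap.det T ≠ 0 := by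
      have h3 := e'.det_comp T e'
      have h4 : (T ∘ e') = b := funext hTb
      rw [h4, e'.det_self, mul_one] at h3
      rw [← h3]
      exact (e'.isUnit_det b).ne_zero
    have h5 := det_gram_comp (pull (prodM m₁ m₂) f z) e' T
    simp only [hTb] at h5
    have h6 : (Matrix.of fun i j => pull (prodM m₁ m₂) f z (e' i) (e' j)) = 1 := by
      ext i j
      have h7 := he ((finCongr hE).symm i) ((finCongr hE).symm j)
      simp only [Matrix.of_apply, Matrix.one_apply, e', Basis.reindex_apply]
      rw [h7]
      simp
    rw [h5, h6, Matrix.det_one, mul_one]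
    positivity
  refine hnum.div (hdet.sqrt fun z hz => (hpos z hz).ne') fun z hz => ?_
  exact (Real.sqrt_pos.2 (hpos z hz)).ne'

theorem contDiffAt_log_starF (h : IsImmersionOn (prodM m₁ m₂) (U₁ ×ˢ U₂) f O)
    (h₁ : IsKahlerOn m₁ J₁ U₁) (b : Basis (Fin (2 * n)) ℝ E) {y : E} (hy : y ∈ O) {ς : ℝ}
    (hpos : 0 < ς * starF m₁ m₂ J₁ b f y) :
    ContDiffAt ℝ ∞ (fun z => Real.log (ς * starF m₁ m₂ J₁ b f z)) y :=
  (contDiffAt_const.mul ((h.contDiffOn_starF h₁ b).contDiffAt (h.isOpen.mem_nhds hy))).log hpos.ne'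

theorem isUnit_of_starF_pos (b : Basis (Fin (2 * n)) ℝ E) {y : E} {ς : ℝ}
    (hpos : 0 < ς * starF m₁ m₂ J₁ b f y) :
    IsUnit (ContinuousLinearMap.fst ℝ E E ∘L fderiv ℝ f y) := by
  have hE : finrank ℝ E = 2 * n := by simpa using finrank_eq_card_basis b
  set P := ContinuousLinearMap.fst ℝ E E ∘L fderiv ℝ f y with hP
  have h1 : volL (formL (m₁ (f y).1) (J₁ (f y).1) P) b ≠ 0 := fun h0 => by
    rw [starF, starD, ← hP, h0, zero_div, mul_zero] at hpos
    exact lt_irrefl _ hpos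
  have h2 : volL (formL (m₁ (f y).1) (J₁ (f y).1) P) b =
      LinearMap.det (P : E →ₗ[ℝ] E) * volL (formL (m₁ (f y).1) (J₁ (f y).1) 1) b := by
    rw [← volL_comp hE]
    rfl
  have h3 : LinearMap.det (P : E →ₗ[ℝ] E) ≠ 0 := fun h0 => h1 (by rw [h2, h0, zero_mul])
  have h4 : IsUnit (LinearMap.det (P : E →ₗ[ℝ] E)) := isUnit_iff_ne_zero.2 h3
  let Φ : E ≃ₗ[ℝ] E := LinearEquiv.ofIsUnitDet (f := (P : E →ₗ[ℝ] E)) (v := b) (v' := b)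
    (by rw [LinearMap.det_toMatrix]; exact h4)
  exact ⟨⟨P, Φ.toContinuousLinearEquiv.symm, ContinuousLinearMap.ext Φ.apply_symm_apply,
    ContinuousLinearMap.ext Φ.symm_apply_apply⟩, rfl⟩

/-- The logarithmic gradient of the projected volume. -/
theorem fderiv_log_starF (h : IsImmersionOn (prodM m₁ m₂) (U₁ ×ˢ U₂) f O)
    (h₁ : IsKahlerOn m₁ J₁ U₁) (h₂ : IsMetricOn m₂ U₂) (b : Basis (Fin (2 * n)) ℝ E) {y : E}
    (hy : y ∈ O) {ς : ℝ} (hpos : 0 < ς * starF m₁ m₂ J₁ b f y) {Q : E →L[ℝ] E}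
    (hQ : ∀ v, (fderiv ℝ f y (Q v)).1 = v) (hQ' : ∀ v, Q (fderiv ℝ f y v).1 = v) (w : E) :
    fderiv ℝ (fun z => Real.log (ς * starF m₁ m₂ J₁ b f z)) y w =
      trL E (Q ∘L ContinuousLinearMap.fst ℝ E E ∘L sff (prodM m₁ m₂) f y w) := by
  have hE : finrank ℝ E = 2 * n := by simpa using finrank_eq_card_basis b
  have hg := h.isMetricOn_pull.isInner hy
  obtain ⟨e₀, he₀⟩ := hg.exists_orthonormal
  let e : Basis (Fin (2 * n)) ℝ E := e₀.reindex (finCongr hE)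
  have he : OrthonormalFor (pull (prodM m₁ m₂) f y) e := fun i j => by
    have := he₀ ((finCongr hE).symm i) ((finCongr hE).symm j)
    simp only [e, Basis.reindex_apply]
    rw [this]
    simp
  obtain ⟨D, hD, hDv⟩ := hasFDerivWithinAt_log_starD hE h₁ h₂ (c := f) (L := fderiv ℝ f) (s := univ)
    (h.mapsTo hy) (h.differentiableAt hy).hasFDerivAt.hasFDerivWithinAt
    (h.differentiableAt_fderiv hy).hasFDerivAt.hasFDerivWithinAt b
    (B := fun z => formL (m₁ (f z).1) (J₁ (f z).1) (ContinuousLinearMap.fst ℝ E E ∘L fderiv ℝ f z))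
    (g := pull (prodM m₁ m₂) f) (fun _ => rfl) (fun _ => rfl) hpos he hQ
  have h3 : HasFDerivAt (fun z => Real.log (ς * starF m₁ m₂ J₁ b f z)) D y :=
    hD.hasFDerivAt univ_mem
  rw [h3.fderiv, hDv w (nab (prodM m₁ m₂) f y w) fun v => rfl]
  have h4 : Q ∘L ContinuousLinearMap.fst ℝ E E ∘L nab (prodM m₁ m₂) f y w =
      Q ∘L ContinuousLinearMap.fst ℝ E E ∘L sff (prodM m₁ m₂) f y w
        + chrL (pull (prodM m₁ m₂) f) y w := by
    ext v
    simp only [ContinuousLinearMap.comp_apply, add_apply, nab_eq, map_add,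
      ContinuousLinearMap.coe_fst', hQ']
  have h5 : trL E (chrL (pull (prodM m₁ m₂) f) y w) =
      ∑ i, prodM m₁ m₂ (f y) (nab (prodM m₁ m₂) f y w (e i)) (fderiv ℝ f y (e i)) := by
    rw [trL_apply, he.trace_eq_sum]
    exact Finset.sum_congr rfl fun i _ => (h.inner_nab hy w (e i) (e i)).symm
  rw [← trL_apply, h4, map_add, h5, add_sub_cancel_right]

end IsImmersionOn

end Evolution

end

section

/-! ### The Hessian of the logarithm of the projected volume -/

section Evolution

variable {E : Type*} [NormedAddCommGroup E] [NormedSpace ℝ E] [FiniteDimensional ℝ E] {n : ℕ}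
  {m₁ m₂ : E → E →L[ℝ] E →L[ℝ] ℝ} {J₁ : E → E →L[ℝ] E} {U₁ U₂ : Set E}

/-- The covariant derivative of the second fundamental form, as a continuous linear map in the last
argument. -/
theorem IsImmersionOn.exists_nablaSff {V W : Type*} [NormedAddCommGroup V] [NormedSpace ℝ V]
    [FiniteDimensional ℝ V] [NormedAddCommGroup W] [NormedSpace ℝ W] [FiniteDimensional ℝ W]
    {m : W → W →L[ℝ] W →L[ℝ] ℝ} {U : Set W} {f : V → W} {O : Set V}
    (h : IsImmersionOn m U f O) {y : V} (hy : y ∈ O) (u w : V) :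
    ∃ N : V →L[ℝ] W, ∀ v, N v = nablaSff m f y u w v :=
  ⟨fderiv ℝ (sff m f) y u w + chrL m (f y) (fderiv ℝ f y u) ∘L sff m f y w
      - sff m f y (chrL (pull m f) y u w) - sff m f y w ∘L chrL (pull m f) y u,
    fun v => by rw [h.nablaSff_eq hy]; rfl⟩

namespace IsImmersionOn

variable {f : E → E × E} {O : Set E}

set_option maxHeartbeats 1000000 in
/-- The Hessian of the logarithm of the projected volume. -/
theorem hessian_log_starF (h : IsImmersionOn (prodM m₁ m₂) (U₁ ×ˢ U₂) f O)
    (h₁ : IsKahlerOn m₁ J₁ U₁) (h₂ : IsMetricOn m₂ U₂) (b : Basis (Fin (2 * n)) ℝ E) {y : E}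
    (hy : y ∈ O) {ς : ℝ} (hpos : 0 < ς * starF m₁ m₂ J₁ b f y) {Q : E →L[ℝ] E}
    (hQ : ∀ v, (fderiv ℝ f y (Q v)).1 = v) (hQ' : ∀ v, Q (fderiv ℝ f y v).1 = v) (u w : E)
    {N : E →L[ℝ] E × E} (hN : ∀ v, N v = nablaSff (prodM m₁ m₂) f y u w v) :
    fderiv ℝ (fderiv ℝ fun z => Real.log (ς * starF m₁ m₂ J₁ b f z)) y u w
      - fderiv ℝ (fun z => Real.log (ς * starF m₁ m₂ J₁ b f z)) y
        (chrL (pull (prodM m₁ m₂) f) y u w) =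
      trL E (Q ∘L ContinuousLinearMap.fst ℝ E E ∘L N)
        - trL E ((Q ∘L ContinuousLinearMap.fst ℝ E E ∘L sff (prodM m₁ m₂) f y u) ∘L
          (Q ∘L ContinuousLinearMap.fst ℝ E E ∘L sff (prodM m₁ m₂) f y w)) := by
  set m := prodM m₁ m₂ with hm
  set φ := fun z => Real.log (ς * starF m₁ m₂ J₁ b f z) with hφ
  set fs := ContinuousLinearMap.fst ℝ E E with hfs
  let P : E → E →L[ℝ] E := fun z => fs ∘L fderiv ℝ f z
  have hev : ∀ᶠ z in 𝓝 y, z ∈ O ∧ 0 < ς * starF m₁ m₂ J₁ b f z := by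
    refine Eventually.and (h.isOpen.mem_nhds hy) ?_
    exact (((h.contDiffOn_starF h₁ b).contDiffAt (h.isOpen.mem_nhds hy)).continuousAt.const_mul
      ς).eventually (lt_mem_nhds hpos)
  have hinv : ∀ z, IsUnit (P z) →
      (∀ v, P z (Ring.inverse (P z) v) = v) ∧ ∀ v, Ring.inverse (P z) (P z v) = v := fun z hz =>
    ⟨fun v => by
      change (P z * Ring.inverse (P z)) v = v
      rw [Ring.mul_inverse_cancel _ hz]; rfl,
    fun v => by
      change (Ring.inverse (P z) * P z) v = v
      rw [Ring.inverse_mul_cancel _ hz]; rfl⟩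
  -- the gradient near `y`, with `P z` inverted by `Ring.inverse`, which is differentiable in `P z`
  have hd : ∀ᶠ z in 𝓝 y, fderiv ℝ φ z w = trL E (Ring.inverse (P z) ∘L fs ∘L sff m f z w) := by
    filter_upwards [hev] with z hz
    have hu := hinv z (isUnit_of_starF_pos b hz.2)
    exact h.fderiv_log_starF h₁ h₂ b hz.1 hz.2 hu.1 hu.2 w
  obtain ⟨Pu, hPu⟩ := isUnit_of_starF_pos b hpos
  have hPy := hinv y ⟨Pu, hPu⟩
  have hQe : Ring.inverse (P y) = Q := by
    ext v
    conv_lhs => rw [← hQ v]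
    exact hPy.2 (Q v)
  have hPd : HasFDerivAt P ((ContinuousLinearMap.compL ℝ E (E × E) E fs) ∘L
      fderiv ℝ (fderiv ℝ f) y) y :=
    (ContinuousLinearMap.compL ℝ E (E × E) E fs).hasFDerivAt.comp y
      (h.differentiableAt_fderiv hy).hasFDerivAt
  have hri := hasFDerivAt_ringInverse (𝕜 := ℝ) Pu
  rw [show (Pu : E →L[ℝ] E) = P y from hPu] at hri
  have hPi := hri.comp y hPd
  have hPi' : ∀ v, (↑Pu⁻¹ : E →L[ℝ] E) v = Q v := fun v => by
    rw [← hQe, show P y = Pu from hPu.symm, Ring.inverse_unit]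
  have hA : HasFDerivAt (fun z => fs ∘L sff m f z w)
      ((ContinuousLinearMap.compL ℝ E (E × E) E fs) ∘L (fderiv ℝ (sff m f) y).flip w) y :=
    (ContinuousLinearMap.compL ℝ E (E × E) E fs).hasFDerivAt.comp y
      (by simpa using! (h.differentiableAt_sff hy).hasFDerivAt.clm_apply (hasFDerivAt_const w y))
  have hφd := h.contDiffAt_log_starF h₁ b hy hpos
  have hφ2 : DifferentiableAt ℝ (fderiv ℝ φ) y :=
    (hφd.fderiv_right (m := ∞) le_rfl).differentiableAt (by simp)
  set Γ := chrL (pull m f) y with hΓ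
  have hcomp := ((trL E).hasFDerivAt.comp y (hPi.clm_comp hA)).fderiv
  rw [← fderiv_apply₁ hφ2 u w, EventuallyEq.fderiv_eq hd, h.fderiv_log_starF h₁ h₂ b hy hpos hQ hQ']
  have hmet := h.metric
  set au := Q ∘L fs ∘L sff m f y u with hau
  set aw := Q ∘L fs ∘L sff m f y w with haw
  have key : fderiv ℝ (fun z => trL E (Ring.inverse (P z) ∘L fs ∘L sff m f z w)) y u =
      trL E (Q ∘L fs ∘L N - au ∘L aw - Γ u ∘L aw + Q ∘L fs ∘L sff m f y (Γ u w) + aw ∘L Γ u) := by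
    refine (DFunLike.congr_fun hcomp u).trans ?_
    rw [ContinuousLinearMap.comp_apply]
    congr 1
    ext v
    -- the Christoffel symbols of the product cancel, since the projection is parallel
    have e1 : ∀ z, fderiv ℝ (fderiv ℝ f) y u z = sff m f y u z + fderiv ℝ f y (Γ u z)
        - chrL m (f y) (fderiv ℝ f y u) (fderiv ℝ f y z) := fun z => by
      rw [← nab_eq, nab_apply, add_sub_cancel_right]
    have e2 : fderiv ℝ (sff m f) y u w v = N v - chrL m (f y) (fderiv ℝ f y u) (sff m f y w v)
        + sff m f y (Γ u w) v + sff m f y w (Γ u v) := by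
      rw [hN, h.nablaSff_eq hy]
      abel
    have e3 : ∀ X, (chrL m (f y) (fderiv ℝ f y u) X).1 =
        chrL m₁ (f y).1 (fderiv ℝ f y u).1 X.1 := fun X => by
      rw [hm, chrL_prodM h₁.metric h₂ (h.mapsTo hy)]
    simp only [add_apply, sub_apply, ContinuousLinearMap.comp_apply, Function.comp_apply, hQe,
      ContinuousLinearMap.compL_apply, ContinuousLinearMap.flip_apply, neg_apply,
      ContinuousLinearMap.mulLeftRight_apply, mul_apply_eq_comp, hPi', e1, e2, hfs,
      ContinuousLinearMap.coe_fst', e3, hQ, hQ', map_add, map_sub,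
      hau, haw]
    abel
  rw [key]
  simp only [map_add, map_sub, trL_comm aw (Γ u)]
  ring

end IsImmersionOn

end Evolution

end

section

/-! ### The time derivative of the projected volume -/

section Evolution

variable {E : Type*} [NormedAddCommGroup E] [NormedSpace ℝ E] [FiniteDimensional ℝ E] {n : ℕ}
  {m₁ m₂ : E → E →L[ℝ] E →L[ℝ] ℝ} {J₁ : E → E →L[ℝ] E} {U₁ U₂ : Set E}

/-- The evolution of the projected volume along the mean curvature flow, in terms of the projection
`π = Q ∘ fst` to the tangent space along the second factor. -/
theorem IsImmersionOn.hasDerivWithinAt_log_starF {F : ℝ → E → E × E} {I : Set ℝ} {t : ℝ} {O : Set E}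
    (h : IsImmersionOn (prodM m₁ m₂) (U₁ ×ˢ U₂) (F t) O) (h₁ : IsKahlerOn m₁ J₁ U₁)
    (h₂ : IsMetricOn m₂ U₂) (b : Basis (Fin (2 * n)) ℝ E) {y : E} (hy : y ∈ O) {ς : ℝ}
    (hpos : 0 < ς * starF m₁ m₂ J₁ b (F t) y)
    (hc : HasDerivWithinAt (fun s => F s y) (meanL (prodM m₁ m₂) (F t) y) I t)
    (hL : HasDerivWithinAt (fun s => fderiv ℝ (F s) y)
      (fderiv ℝ (meanL (prodM m₁ m₂) (F t)) y) I t)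
    {Q : E →L[ℝ] E} (hQ : ∀ v, (fderiv ℝ (F t) y (Q v)).1 = v)
    (hQ' : ∀ v, Q (fderiv ℝ (F t) y v).1 = v) {e : Basis (Fin (2 * n)) ℝ E}
    (he : OrthonormalFor (pull (prodM m₁ m₂) (F t) y) e) :
    HasDerivWithinAt (fun s => Real.log (ς * starF m₁ m₂ J₁ b (F s) y))
      (mtr (pull (prodM m₁ m₂) (F t) y) (fun u w =>
          fderiv ℝ (fderiv ℝ fun z => Real.log (ς * starF m₁ m₂ J₁ b (F t) z)) y u w
            - fderiv ℝ (fun z => Real.log (ς * starF m₁ m₂ J₁ b (F t) z)) y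
              (chrL (pull (prodM m₁ m₂) (F t)) y u w))
        + (∑ k, (∑ i, prodM m₁ m₂ (F t y) (sff (prodM m₁ m₂) (F t) y (e k) (e i))
            (sff (prodM m₁ m₂) (F t) y (e k) (e i))
          + ∑ i, pull (prodM m₁ m₂) (F t) y (Q (sff (prodM m₁ m₂) (F t) y (e k)
              (Q (sff (prodM m₁ m₂) (F t) y (e k) (e i)).1)).1) (e i)))
        + ∑ k, ∑ i, prodM m₁ m₂ (F t y)
            (fderiv ℝ (F t) y (Q (riem (prodM m₁ m₂) (F t y) (fderiv ℝ (F t) y (e i))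
              (fderiv ℝ (F t) y (e k)) (fderiv ℝ (F t) y (e k))).1)
            - riem (prodM m₁ m₂) (F t y) (fderiv ℝ (F t) y (e i))
              (fderiv ℝ (F t) y (e k)) (fderiv ℝ (F t) y (e k)))
            (fderiv ℝ (F t) y (e i))) I t := by
  have hE : finrank ℝ E = 2 * n := by simpa using finrank_eq_card_basis b
  have hg := h.isMetricOn_pull.isInner hy
  set m := prodM m₁ m₂ with hm
  set Df := fderiv ℝ (F t) y with hDf
  set fs := ContinuousLinearMap.fst ℝ E E with hfs
  obtain ⟨D, hD, hDv⟩ := hasFDerivWithinAt_log_starD hE h₁ h₂ (c := fun s => F s y)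
    (L := fun s => fderiv ℝ (F s) y) (s := I) (h.mapsTo hy) hc.hasFDerivWithinAt
    hL.hasFDerivWithinAt b
    (B := fun s => formL (m₁ (F s y).1) (J₁ (F s y).1) (fs ∘L fderiv ℝ (F s) y))
    (g := fun s => pull m (F s) y) (fun _ => rfl) (fun _ => rfl) hpos he hQ
  choose N hN using fun k => h.exists_nablaSff hy (e k) (e k)
  let R : Fin (2 * n) → E →L[ℝ] E × E := fun k =>
    LinearMap.toContinuousLinearMap (riemLin m (F t y) (Df (e k)) (Df (e k)) ∘ₗ (Df : E →ₗ[ℝ] E × E))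
  let Rt : Fin (2 * n) → E →L[ℝ] E := fun k =>
    LinearMap.toContinuousLinearMap (riemLin (pull m (F t)) y (e k) (e k))
  -- the covariant derivative of the mean curvature vector
  let X : E →L[ℝ] E × E := ∑ k, (N k + R k - Df ∘L Rt k)
  have hX : ∀ w, X w = (ContinuousLinearMap.toSpanSingleton ℝ (fderiv ℝ (meanL m (F t)) y)) 1 w
      + chrL m (F t y) ((ContinuousLinearMap.toSpanSingleton ℝ (meanL m (F t) y)) 1) (Df w) :=
    fun w => by
      have h1 : cov m (F t) (meanL m (F t)) y w = X w := by
        rw [h.cov_meanL hy he]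
        simp only [X, sum_apply, sub_apply, add_apply]
        refine Finset.sum_congr rfl fun k _ => ?_
        rw [h.codazzi hy, h.nablaSff_symm hy, ← hN]
        rfl
      rw [← h1, cov, h.metric.chrL_symm (h.mapsTo hy)]
      simp [hDf]
  -- by Codazzi, the derivative is the Laplacian up to terms of second order in `sff` and curvature
  have hval := hDv 1 X hX
  have hder := hD.hasDerivWithinAt
  refine hder.congr_deriv ?_
  rw [hval, ← trL_apply]
  have e1 : mtr (pull m (F t) y) (fun u w =>
        fderiv ℝ (fderiv ℝ fun z => Real.log (ς * starF m₁ m₂ J₁ b (F t) z)) y u w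
          - fderiv ℝ (fun z => Real.log (ς * starF m₁ m₂ J₁ b (F t) z)) y
            (chrL (pull m (F t)) y u w)) =
      ∑ k, (trL E (Q ∘L fs ∘L N k) - trL E ((Q ∘L fs ∘L sff m (F t) y (e k)) ∘L
          (Q ∘L fs ∘L sff m (F t) y (e k)))) := by
    have h2 := he.mtr_eq_sum hg ((ContinuousLinearMap.coeLM ℝ : (E →L[ℝ] ℝ) →ₗ[ℝ] E →ₗ[ℝ] ℝ) ∘ₗ
      ((fderiv ℝ (fderiv ℝ fun z => Real.log (ς * starF m₁ m₂ J₁ b (F t) z)) y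
        - (ContinuousLinearMap.compL ℝ E E ℝ
          (fderiv ℝ (fun z => Real.log (ς * starF m₁ m₂ J₁ b (F t) z)) y)) ∘L
            chrL (pull m (F t)) y : E →L[ℝ] E →L[ℝ] ℝ) : E →ₗ[ℝ] E →L[ℝ] ℝ))
    refine h2.trans (Finset.sum_congr rfl fun k _ => ?_)
    exact h.hessian_log_starF h₁ h₂ b hy hpos hQ hQ' (e k) (e k) (hN k)
  have e2 : ∀ k, trL E ((Q ∘L fs ∘L sff m (F t) y (e k)) ∘L
      (Q ∘L fs ∘L sff m (F t) y (e k))) = ∑ i, pull m (F t) y (Q (sff m (F t) y (e k)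
              (Q (sff m (F t) y (e k) (e i)).1)).1) (e i) := fun k => by
    rw [trL_apply, he.trace_eq_sum]
    rfl
  have e3 : trL E (Q ∘L fs ∘L X) = ∑ k, (trL E (Q ∘L fs ∘L N k)
      + ∑ i, m (F t y) (Df (Q (R k (e i)).1)) (Df (e i)) - trL E (Rt k)) := by
    have h3 : Q ∘L fs ∘L X = ∑ k, (Q ∘L fs ∘L N k + Q ∘L fs ∘L R k - Rt k) := by
      ext v
      simp only [X, ContinuousLinearMap.comp_apply, sum_apply, sub_apply, add_apply, map_sum,
        map_sub, map_add]
      refine Finset.sum_congr rfl fun k _ => ?_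
      congr 1
      exact hQ' _
    rw [h3, map_sum]
    refine Finset.sum_congr rfl fun k _ => ?_
    rw [map_sub, map_add]
    congr 2
    rw [trL_apply, he.trace_eq_sum]
    rfl
  have e4 : ∑ i, m (F t y) (X (e i)) (Df (e i)) = ∑ k, (-∑ i, m (F t y)
      (sff m (F t) y (e k) (e i)) (sff m (F t) y (e k) (e i))
      + ∑ i, m (F t y) (R k (e i)) (Df (e i)) - trL E (Rt k)) := by
    simp only [X, sum_apply, sub_apply, add_apply, map_sum, map_sub, map_add]
    rw [Finset.sum_comm]
    refine Finset.sum_congr rfl fun k _ => ?_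
    rw [Finset.sum_sub_distrib, Finset.sum_add_distrib, trL_apply, he.trace_eq_sum,
      ← Finset.sum_neg_distrib]
    congr 2
    refine Finset.sum_congr rfl fun i _ => ?_
    rw [hN, h.inner_nablaSff hy]
  rw [e1, e3, e4, ← Finset.sum_sub_distrib, ← Finset.sum_add_distrib, ← Finset.sum_add_distrib]
  refine Finset.sum_congr rfl fun k _ => ?_
  have e5 : ∀ i, R k (e i) = riem m (F t y) (Df (e i)) (Df (e k)) (Df (e k)) := fun i => rfl
  simp only [e2, e5, map_sub, sub_apply, Finset.sum_sub_distrib]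
  ring

end Evolution

end

section

/-! ### Sums over pairs of indices -/

section Indices

variable {n : ℕ}

theorem partner_val (i : Fin (2 * n)) :
    (partner i).val = if i.val % 2 = 0 then i.val + 1 else i.val - 1 := by
  unfold partner
  split_ifs with h1 h2 h2
  · rfl
  · exact absurd (Nat.even_iff.1 h1) h2
  · exact absurd (Nat.even_iff.2 h2) h1
  · rfl

theorem partner_partner (i : Fin (2 * n)) : partner (partner i) = i := by
  ext
  have h1 := partner_val i
  have h2 := partner_val (partner i)
  split_ifs at h1 h2 <;> omega

theorem mem_firsts {i : Fin (2 * n)} : i ∈ firsts n ↔ i.val % 2 = 0 := by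
  simp [firsts, Nat.even_iff]

theorem partner_ne (i : Fin (2 * n)) : partner i ≠ i := fun h => by
  have h1 := partner_val i
  rw [h] at h1
  split_ifs at h1 <;> omega

theorem lt_partner_iff {i : Fin (2 * n)} : i < partner i ↔ i ∈ firsts n := by
  rw [mem_firsts, Fin.lt_def, partner_val]
  split_ifs <;> omega

theorem neg_one_pow_partner (i : Fin (2 * n)) :
    (-1 : ℝ) ^ (partner i).val = - (-1) ^ i.val := by
  rw [partner_val]
  split_ifs with h
  · rw [pow_succ]; ring
  · obtain ⟨k, hk⟩ : ∃ k, i.val = k + 1 := ⟨i.val - 1, by omega⟩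
    rw [hk, pow_succ]
    simp

theorem sum_firsts_add_partner (f : Fin (2 * n) → ℝ) :
    ∑ i ∈ firsts n, (f i + f (partner i)) = ∑ i, f i := by
  rw [Finset.sum_add_distrib, ← Finset.sum_filter_add_sum_filter_not Finset.univ
    (fun i : Fin (2 * n) => Even i.val) f]
  congr 1
  refine Finset.sum_nbij' partner partner ?_ ?_ ?_ ?_ ?_
  · intro i hi
    rw [mem_firsts] at hi
    have := partner_val i
    simp only [Finset.mem_filter, Finset.mem_univ, true_and, Nat.even_iff]
    split_ifs at this
    omega
  · intro i hi
    simp only [Finset.mem_filter, Finset.mem_univ, true_and, Nat.even_iff] at hi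
    have := partner_val i
    rw [mem_firsts]
    split_ifs at this
    omega
  · exact fun i _ => partner_partner i
  · exact fun i _ => partner_partner i
  · exact fun i _ => rfl

/-- A sum of a symmetric function over pairs of indices, split into the diagonal, the pairs
`(i, i')`, and the rest. -/
theorem sum_pairs {S : Fin (2 * n) → Fin (2 * n) → ℝ} (hS : ∀ i j, S i j = S j i) :
    ∑ i, ∑ j, S i j = ∑ i, S i i + 2 * ∑ i ∈ firsts n, S i (partner i)
      + 2 * ∑ i, ∑ j ∈ Finset.univ.filter (fun j => i < j ∧ j ≠ partner i), S i j := by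
  have h1 : ∀ i, ∑ j, S i j = S i i + ∑ j, (if i < j then S i j else 0)
      + ∑ j, (if j < i then S i j else 0) := fun i => by
    have : ∀ j, S i j = (if j = i then S i i else 0) + (if i < j then S i j else 0)
        + (if j < i then S i j else 0) := fun j => by
      rcases lt_trichotomy i j with h | h | h
      · simp [h, h.ne', not_lt.2 h.le]
      · simp [h]
      · simp [h, h.ne, not_lt.2 h.le]
    rw [Finset.sum_congr rfl fun j _ => this j, Finset.sum_add_distrib, Finset.sum_add_distrib,
      Finset.sum_ite_eq' Finset.univ i]
    simp
  have h2 : ∑ i, ∑ j, (if j < i then S i j else 0) = ∑ i, ∑ j, (if i < j then S i j else 0) := by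
    rw [Finset.sum_comm]
    exact Finset.sum_congr rfl fun i _ => Finset.sum_congr rfl fun j _ => by rw [hS]
  have h3 : ∀ i, ∑ j, (if i < j then S i j else 0) = (if i ∈ firsts n then S i (partner i) else 0)
      + ∑ j ∈ Finset.univ.filter (fun j => i < j ∧ j ≠ partner i), S i j := fun i => by
    have : ∀ j, (if i < j then S i j else 0) =
        (if j = partner i then (if i < partner i then S i (partner i) else 0) else 0)
        + (if i < j ∧ j ≠ partner i then S i j else 0) := fun j => by
      by_cases h : j = partner i
      · subst h; simp
      · simp [h]
    rw [Finset.sum_congr rfl fun j _ => this j, Finset.sum_add_distrib,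
      Finset.sum_ite_eq' Finset.univ (partner i), Finset.sum_filter]
    simp [lt_partner_iff]
  simp only [h1, Finset.sum_add_distrib, h2, h3]
  rw [Finset.sum_ite_mem, Finset.univ_inter]
  ring

/-- The reaction term, for a totally symmetric `h`. -/
theorem quadQTilde_eq {lam : Fin (2 * n) → ℝ} {h : Fin (2 * n) → Fin (2 * n) → Fin (2 * n) → ℝ}
    (hlam : ∀ i, lam i * lam (partner i) = 1) (h12 : ∀ i j k, h i j k = h j i k)
    (h23 : ∀ i j k, h i j k = h i k j) :
    quadQTilde lam h = ∑ k, (∑ i, ∑ j, h k i j ^ 2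
      + ∑ i, ∑ j, (-1) ^ (i.val + j.val) * lam i * lam j
        * (h k i (partner j) * h k j (partner i))) := by
  have h0 : ∀ i j k, h i j k = h k i j := fun i j k => by rw [h23, h12]
  have hmain : ∀ k, ∑ i, ∑ j, (-1) ^ (i.val + j.val) * lam i * lam j
        * (h k i (partner j) * h k j (partner i)) =
      - 2 * ∑ i ∈ firsts n, (h i i k * h (partner i) (partner i) k - h i (partner i) k ^ 2)
      - 2 * ∑ i, ∑ j ∈ Finset.univ.filter (fun j => i < j ∧ j ≠ partner i),
        (-1) ^ (i.val + j.val) * lam i * lam j *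
          (h (partner i) i k * h (partner j) j k - h (partner i) j k * h (partner j) i k)
      + (∑ i ∈ firsts n, (lam i - lam (partner i)) * h i (partner i) k) ^ 2 := fun k => by
    let s : Fin (2 * n) → ℝ := fun i => (-1) ^ i.val * lam i * h i (partner i) k
    have e1 : ∑ i ∈ firsts n, (lam i - lam (partner i)) * h i (partner i) k = ∑ i, s i := by
      rw [← sum_firsts_add_partner s]
      refine Finset.sum_congr rfl fun i hi => ?_
      simp only [s, neg_one_pow_partner, partner_partner]
      rw [Even.neg_one_pow (Nat.even_iff.2 (mem_firsts.1 hi)), h12 (partner i) i]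
      ring
    have e2 : (∑ i, s i) ^ 2 = ∑ i, ∑ j, s i * s j := by
      rw [sq, Finset.sum_mul_sum]
    have hsq : ∀ i : Fin (2 * n), ((-1 : ℝ) ^ i.val) * (-1) ^ i.val = 1 := fun i => by
      rw [← mul_pow]; simp
    rw [e1, e2, sum_pairs (S := fun i j => s i * s j) fun i j => mul_comm _ _,
      sum_pairs (S := fun i j => (-1) ^ (i.val + j.val) * lam i * lam j
        * (h k i (partner j) * h k j (partner i))) fun i j => by rw [add_comm i.val]; ring]
    have d1 : ∀ i : Fin (2 * n), (-1) ^ (i.val + i.val) * lam i * lam i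
        * (h k i (partner i) * h k i (partner i)) = s i * s i := fun i => by
      simp only [s, pow_add, h0 i]; ring
    have d2 : ∀ i : Fin (2 * n), (-1) ^ (i.val + (partner i).val) * lam i * lam (partner i)
        * (h k i (partner (partner i)) * h k (partner i) (partner i)) =
        - (h i i k * h (partner i) (partner i) k) := fun i => by
      rw [pow_add, neg_one_pow_partner, mul_neg, hsq, partner_partner, h0 i i, h0 (partner i)]
      linear_combination (-(h k i i * h k (partner i) (partner i))) * hlam i
    have d3 : ∀ i : Fin (2 * n), s i * s (partner i) = - h i (partner i) k ^ 2 := fun i => by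
      simp only [s, neg_one_pow_partner, partner_partner]
      rw [h12 (partner i) i]
      linear_combination (-(lam i * lam (partner i) * h i (partner i) k ^ 2)) * hsq i
        - (h i (partner i) k ^ 2) * hlam i
    have d4 : ∀ i j : Fin (2 * n), (-1) ^ (i.val + j.val) * lam i * lam j *
          (h (partner i) i k * h (partner j) j k - h (partner i) j k * h (partner j) i k) =
        s i * s j - (-1) ^ (i.val + j.val) * lam i * lam j
        * (h k i (partner j) * h k j (partner i)) := fun i j => by
      simp only [s, pow_add]
      rw [h12 (partner i) i, h12 (partner j) j, h12 (partner i) j, h12 (partner j) i,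
        h0 j (partner i), h0 i (partner j)]
      ring
    simp only [d1, d2, d3, d4, Finset.sum_sub_distrib, Finset.sum_neg_distrib]
    ring
  have hs : ∑ i, ∑ j, ∑ k, h i j k ^ 2 = ∑ k, ∑ i, ∑ j, h k i j ^ 2 := rfl
  rw [quadQTilde, quadQ, Finset.sum_add_distrib, Finset.sum_congr rfl fun k _ => hmain k, hs]
  simp only [Finset.sum_add_distrib, Finset.sum_sub_distrib, ← Finset.mul_sum]
  ring

end Indices

end

section

/-! ### The evolution equation in a singular frame -/

section SingularFrame

variable {E : Type*} [NormedAddCommGroup E] [NormedSpace ℝ E] [FiniteDimensional ℝ E] {n : ℕ}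

/-- Differentiating the Lagrangian condition: `⟨A(u, v), J df w⟩` is totally symmetric. -/
theorem IsImmersionOn.inner_sff_J_symm {V W : Type*} [NormedAddCommGroup V] [NormedSpace ℝ V]
    [FiniteDimensional ℝ V] [NormedAddCommGroup W] [NormedSpace ℝ W] [FiniteDimensional ℝ W]
    {m : W → W →L[ℝ] W →L[ℝ] ℝ} {J : W → W →L[ℝ] W} {U : Set W} {f : V → W} {O : Set V}
    (h : IsImmersionOn m U f O) (hK : IsKahlerOn m J U) {y : V} (hy : y ∈ O)
    (hLag : ∀ z ∈ O, ∀ u v, m (f z) (J (f z) (fderiv ℝ f z u)) (fderiv ℝ f z v) = 0) (u v w : V) :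
    m (f y) (sff m f y u v) (J (f y) (fderiv ℝ f y w)) =
      m (f y) (sff m f y u w) (J (f y) (fderiv ℝ f y v)) := by
  have hX : ∀ v, HasFDerivWithinAt (fun z => fderiv ℝ f z v) ((fderiv ℝ (fderiv ℝ f) y).flip v)
      univ y := fun v => by
    have h0 : HasFDerivAt (fun z => fderiv ℝ f z v) ((fderiv ℝ (fderiv ℝ f) y).flip v) y := by
      simpa using! (h.differentiableAt_fderiv hy).hasFDerivAt.clm_apply (hasFDerivAt_const v y)
    exact h0.hasFDerivWithinAt
  obtain ⟨D, hD, hDv⟩ := hK.hasFDerivWithinAt_form (h.mapsTo hy)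
    (h.differentiableAt hy).hasFDerivAt.hasFDerivWithinAt (hX v) (hX w)
  have h0 : (fun z => m (f z) (J (f z) (fderiv ℝ f z v)) (fderiv ℝ f z w)) =ᶠ[𝓝 y] fun _ => 0 := by
    filter_upwards [h.isOpen.mem_nhds hy] with z hz using hLag z hz v w
  have h1 : D = 0 := (hD.hasFDerivAt univ_mem).unique
    ((hasFDerivAt_const (0 : ℝ) y).congr_of_eventuallyEq h0)
  have h2 := hDv u
  have e : ∀ v, (fderiv ℝ (fderiv ℝ f) y).flip v u + chrL m (f y) (fderiv ℝ f y u) (fderiv ℝ f y v) =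
      sff m f y u v + fderiv ℝ f y (chrL (pull m f) y u v) := fun v => by
    rw [← nab_eq]; rfl
  rw [h1, e, e] at h2
  simp only [map_add, add_apply, hLag y hy] at h2
  rw [hK.skew (h.mapsTo hy), h.metric.symm _ (h.mapsTo hy) (J (f y) (fderiv ℝ f y v))] at h2
  simp only [zero_apply] at h2
  linarith

/-- For a Lagrangian subspace with orthonormal basis `e`, the vectors `J e` are an orthonormal
basis of the normal space. -/
theorem OrthonormalFor.exists_lagrangian_basis {W : Type*} [NormedAddCommGroup W] [NormedSpace ℝ W]
    [FiniteDimensional ℝ W] {ι : Type*} [Fintype ι] [DecidableEq ι] {g : W →L[ℝ] W →L[ℝ] ℝ}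
    (hg : IsInner g) {J : W →L[ℝ] W} (horth : ∀ u v, g (J u) (J v) = g u v) {e : ι → W}
    (he : OrthonormalFor g e) (hd : Fintype.card ι + Fintype.card ι = finrank ℝ W)
    (hLag : ∀ i j, g (J (e i)) (e j) = 0) :
    ∃ B : Basis (ι ⊕ ι) ℝ W, OrthonormalFor g B ∧ (∀ i, B (Sum.inl i) = e i) ∧
      ∀ i, B (Sum.inr i) = J (e i) := by
  have ho : OrthonormalFor g (Sum.elim e fun i => J (e i)) := by
    rintro (i | i) (j | j)
    · simpa using he i j
    · simpa [hg.symm (e i)] using hLag j i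
    · simpa using hLag i j
    · simpa [horth] using he i j
  obtain ⟨B, hB⟩ := ho.exists_basis (by rw [Fintype.card_sum, hd])
  exact ⟨B, hB ▸ ho, fun i => by rw [hB]; rfl, fun i => by rw [hB]; rfl⟩

theorem sqrt_one_add_sq_inv {l l' : ℝ} (hl : 0 < l) (h : l * l' = 1) :
    (Real.sqrt (1 + l ^ 2))⁻¹ = l' * (Real.sqrt (1 + l' ^ 2))⁻¹ := by
  have h1 : 1 + l ^ 2 = l ^ 2 * (1 + l' ^ 2) := by
    linear_combination (-1 - l * l') * h
  have h2 : Real.sqrt (1 + l ^ 2) = l * Real.sqrt (1 + l' ^ 2) := by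
    rw [h1, Real.sqrt_mul (sq_nonneg _), Real.sqrt_sq hl.le]
  rw [h2, mul_inv, ← eq_inv_of_mul_eq_one_right h]

variable {m₁ m₂ : E → E →L[ℝ] E →L[ℝ] ℝ} {J₁ J₂ : E → E →L[ℝ] E} {U₁ U₂ : Set E}

theorem J_singular_frame {J : E →L[ℝ] E} (hsq : ∀ v, J (J v) = -v) {a : Fin (2 * n) → E}
    (hJ : ∀ i ∈ firsts n, J (a i) = a (partner i)) (i : Fin (2 * n)) :
    J (a i) = (-1 : ℝ) ^ i.val • a (partner i) := by
  by_cases hi : i ∈ firsts n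
  · rw [hJ i hi, Even.neg_one_pow (Nat.even_iff.2 (mem_firsts.1 hi)), one_smul]
  · rw [mem_firsts] at hi
    have h1 : partner i ∈ firsts n := by
      rw [mem_firsts]
      have := partner_val i
      split_ifs at this
      omega
    have h2 := hJ _ h1
    rw [partner_partner] at h2
    rw [← h2, hsq, Odd.neg_one_pow (Nat.odd_iff.2 (by omega)), neg_smul, one_smul]

set_option maxHeartbeats 1000000 in
/-- The evolution of the projected volume in a singular frame. -/
theorem IsImmersionOn.evolution_singular_frame {F : ℝ → E → E × E} {I : Set ℝ} {t : ℝ} {O : Set E}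
    (h : IsImmersionOn (prodM m₁ m₂) (U₁ ×ˢ U₂) (F t) O) (h₁ : IsKahlerOn m₁ J₁ U₁)
    (h₂ : IsKahlerOn m₂ J₂ U₂) (b : Basis (Fin (2 * n)) ℝ E) {y : E} (hy : y ∈ O) {ς : ℝ}
    (hpos : 0 < ς * starF m₁ m₂ J₁ b (F t) y)
    (hc : HasDerivWithinAt (fun s => F s y) (meanL (prodM m₁ m₂) (F t) y) I t)
    (hL : HasDerivWithinAt (fun s => fderiv ℝ (F s) y)
      (fderiv ℝ (meanL (prodM m₁ m₂) (F t)) y) I t)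
    (hLag : ∀ z ∈ O, ∀ u v, prodM m₁ m₂ (F t z) (prodJm J₁ J₂ (F t z) (fderiv ℝ (F t) z u))
      (fderiv ℝ (F t) z v) = 0)
    {Q : E →L[ℝ] E} (hQ : ∀ v, (fderiv ℝ (F t) y (Q v)).1 = v)
    (hQ' : ∀ v, Q (fderiv ℝ (F t) y v).1 = v) {a : Fin (2 * n) → E} {lam : Fin (2 * n) → ℝ}
    (ha : OrthonormalFor (m₁ (F t y).1) a)
    (hJ : ∀ i ∈ firsts n, J₁ (F t y).1 (a i) = a (partner i)) (hlam : ∀ i, 0 < lam i)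
    (hpair : ∀ i, lam i * lam (partner i) = 1)
    (hdiag : ∀ i v, m₂ (F t y).2 (fderiv ℝ (F t) y (Q (a i))).2 (fderiv ℝ (F t) y (Q v)).2 =
      lam i ^ 2 * m₁ (F t y).1 (a i) v) :
    HasDerivWithinAt (fun s => Real.log (ς * starF m₁ m₂ J₁ b (F s) y))
      (mtr (pull (prodM m₁ m₂) (F t) y) (fun u w =>
          fderiv ℝ (fderiv ℝ fun z => Real.log (ς * starF m₁ m₂ J₁ b (F t) z)) y u w
            - fderiv ℝ (fun z => Real.log (ς * starF m₁ m₂ J₁ b (F t) z)) y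
              (chrL (pull (prodM m₁ m₂) (F t)) y u w))
        + quadQTilde lam (fun i j k => prodM m₁ m₂ (F t y)
            (sff (prodM m₁ m₂) (F t) y ((Real.sqrt (1 + lam i ^ 2))⁻¹ • Q (a i))
              ((Real.sqrt (1 + lam j ^ 2))⁻¹ • Q (a j)))
            (prodJm J₁ J₂ (F t y)
              (fderiv ℝ (F t) y ((Real.sqrt (1 + lam k ^ 2))⁻¹ • Q (a k)))))
        + ∑ k, ∑ i ∈ Finset.univ.filter (fun i => i ≠ k),
          lam i / ((1 + lam k ^ 2) * (lam i + lam (partner i))) *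
            (m₁ (F t y).1 (riem m₁ (F t y).1 (a i) (a k) (a k)) (a i)
              - lam k ^ 2 * m₂ (F t y).2 (riem m₂ (F t y).2
                ((lam i)⁻¹ • (fderiv ℝ (F t) y (Q (a i))).2)
                ((lam k)⁻¹ • (fderiv ℝ (F t) y (Q (a k))).2)
                ((lam k)⁻¹ • (fderiv ℝ (F t) y (Q (a k))).2))
                ((lam i)⁻¹ • (fderiv ℝ (F t) y (Q (a i))).2))) I t := by
  have hE : finrank ℝ E = 2 * n := by simpa using finrank_eq_card_basis b
  have hK := h₁.prod h₂
  have hfy := h.mapsTo hy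
  have hG := h.metric.isInner hfy
  have hLy := hLag y hy
  set m := prodM m₁ m₂ with hm
  set Df := fderiv ℝ (F t) y with hDf
  set jj := prodJm J₁ J₂ (F t y) with hjj
  set w : Fin (2 * n) → ℝ := fun i => (Real.sqrt (1 + lam i ^ 2))⁻¹ with hw
  have hwsq : ∀ i, w i * w i = (1 + lam i ^ 2)⁻¹ := fun i => by
    simp only [hw]
    rw [← mul_inv, Real.mul_self_sqrt (by positivity)]
  have hw' : ∀ i, w i = lam (partner i) * w (partner i) := fun i =>
    sqrt_one_add_sq_inv (hlam i) (hpair i)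
  -- the preimages of the vectors `e_i` under the differential of the immersion
  set ε : Fin (2 * n) → E := fun i => w i • Q (a i) with hε
  have hDε : ∀ i, Df (ε i) = (w i • a i, w i • (Df (Q (a i))).2) := fun i => by
    ext
    · simp [hε, hQ]
    · simp [hε]
  have hεo : OrthonormalFor (pull m (F t) y) ε := fun i j => by
    rw [pull_apply, ← hDf, hDε, hDε, hm, prodM_apply]
    simp only [map_smul, smul_apply, smul_eq_mul, hdiag, ha i j]
    split_ifs with hij
    · subst hij
      have h1 := hwsq i
      have h2 : (1 + lam i ^ 2) ≠ 0 := by positivity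
      field_simp at h1 ⊢
      linear_combination h1
    · simp
  obtain ⟨e, he⟩ := hεo.exists_basis (by simpa using hE.symm)
  have heo : OrthonormalFor (pull m (F t) y) e := he ▸ hεo
  have hev := h.hasDerivWithinAt_log_starF h₁ h₂.metric b hy hpos hc hL hQ hQ' heo
  simp only [he, ← hm, ← hDf] at hev
  set hh : Fin (2 * n) → Fin (2 * n) → Fin (2 * n) → ℝ := fun i j k =>
    m (F t y) (sff m (F t) y (ε i) (ε j)) (jj (Df (ε k))) with hhh
  have h12 : ∀ i j k, hh i j k = hh j i k := fun i j k => by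
    simp only [hhh, h.sff_symm hy (ε i)]
  have h23 : ∀ i j k, hh i j k = hh i k j := fun i j k =>
    h.inner_sff_J_symm hK hy hLag (ε i) (ε j) (ε k)
  obtain ⟨B, hBo, hB1, hB2⟩ := OrthonormalFor.exists_lagrangian_basis hG (J := jj)
    (hK.orth _ hfy) (e := fun i => Df (ε i)) hεo (by simp [hE]) fun i j => hLy _ _
  -- the normal space is spanned by the vectors `J e_l`
  have hAexp : ∀ k i, sff m (F t) y (ε k) (ε i) = ∑ l, hh k i l • jj (Df (ε l)) := fun k i => by
    conv_lhs => rw [← hBo.sum_smul (sff m (F t) y (ε k) (ε i))]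
    rw [Fintype.sum_sum_type]
    simp only [hB1, hB2]
    rw [Finset.sum_eq_zero, zero_add]
    exact fun l _ => by rw [h.inner_sff hy, zero_smul]
  have hAsq : ∀ k i, m (F t y) (sff m (F t) y (ε k) (ε i)) (sff m (F t) y (ε k) (ε i)) =
      ∑ l, hh k i l ^ 2 := fun k i => by
    rw [hBo.inner_eq_sum, Fintype.sum_sum_type]
    simp only [hB1, hB2]
    rw [Finset.sum_eq_zero, zero_add]
    · exact Finset.sum_congr rfl fun l _ => (sq _).symm
    · exact fun l _ => by rw [h.inner_sff hy, zero_mul]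
  -- the projection along the second factor exchanges the two vectors of a pair, up to `±λ`
  have hQJ : ∀ l, Q (jj (Df (ε l))).1 = ((-1 : ℝ) ^ l.val * lam (partner l)) • ε (partner l) :=
    fun l => by
      rw [hDε, hjj, prodJm_apply]
      simp only [map_smul]
      rw [J_singular_frame (h₁.sq _ hfy.1) hJ, map_smul, hw' l]
      simp only [hε, smul_smul]
      congr 1
      ring
  have hQA : ∀ k i, Q (sff m (F t) y (ε k) (ε i)).1 =
      ∑ l, (-((-1 : ℝ) ^ l.val * lam l * hh k i (partner l))) • ε l := fun k i => by
    have h3 : Q (sff m (F t) y (ε k) (ε i)).1 =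
        ∑ l, (hh k i l * ((-1 : ℝ) ^ l.val * lam (partner l))) • ε (partner l) := by
      rw [hAexp, Prod.fst_sum, map_sum]
      refine Finset.sum_congr rfl fun l _ => ?_
      rw [Prod.smul_fst, map_smul, hQJ, smul_smul]
    rw [h3]
    refine Finset.sum_bijective partner (Function.Involutive.bijective partner_partner)
      (by simp) fun l _ => ?_
    rw [partner_partner, neg_one_pow_partner]
    congr 1
    ring
  have htr : ∀ k i, pull m (F t) y (Q (sff m (F t) y (ε k)
      (Q (sff m (F t) y (ε k) (ε i)).1)).1) (ε i) =
      ∑ j, (-1) ^ (i.val + j.val) * lam i * lam j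
        * (hh k i (partner j) * hh k j (partner i)) := fun k i => by
    rw [hQA k i]
    simp only [map_sum, map_smul, Prod.fst_sum, Prod.smul_fst, sum_apply, smul_apply, smul_eq_mul,
      hQA]
    refine Finset.sum_congr rfl fun j _ => ?_
    rw [Finset.sum_eq_single i]
    · rw [hεo i i, if_pos rfl, pow_add]
      ring
    · intro l _ hl
      rw [hεo l i, if_neg hl, mul_zero]
    · simp
  have hQT := quadQTilde_eq hpair h12 h23
  simp only [hAsq, htr] at hev
  rw [← hQT] at hev
  refine hev.congr_deriv ?_
  congr 1
  refine Finset.sum_congr rfl fun k _ => ?_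
  rw [Finset.sum_filter]
  refine Finset.sum_congr rfl fun i _ => ?_
  have hR0 : ∀ u v : E × E, riem m (F t y) u u v = 0 := fun u v => by
    rw [riem]
    abel
  by_cases hik : i = k
  · subst hik
    simp [hR0]
  rw [if_pos hik]
  -- the vertical part of `X`, paired with `e_i`
  have hθ : ∀ X : E × E, m (F t y) (Df (Q X.1) - X) (Df (ε i)) =
      w i * (lam i ^ 2 * m₁ (F t y).1 X.1 (a i) - m₂ (F t y).2 X.2 (Df (Q (a i))).2) := fun X => by
    have h4 : (Df (Q X.1) - X).1 = 0 := by
      rw [Prod.fst_sub, hQ, sub_self]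
    rw [hm, prodM_apply, h4, hDε]
    simp only [map_zero, zero_apply, Prod.snd_sub, map_sub, sub_apply, map_smul,
      smul_eq_mul]
    rw [h₂.metric.symm _ hfy.2 (Df (Q X.1)).2, hdiag, h₁.metric.symm _ hfy.1 (a i)]
    ring
  have hR : riem m (F t y) (Df (ε i)) (Df (ε k)) (Df (ε k)) =
      ((w i * (w k * w k)) • riem m₁ (F t y).1 (a i) (a k) (a k),
        (w i * (w k * w k)) • riem m₂ (F t y).2 (Df (Q (a i))).2 (Df (Q (a k))).2
          (Df (Q (a k))).2) := by
    rw [hm, riem_prodM h₁.metric h₂.metric hfy, hDε, hDε]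
    simp only [riem, map_smul, smul_apply, smul_sub, smul_add, smul_smul, Prod.mk.injEq]
    constructor <;> module
  have hR2 : m₂ (F t y).2 (riem m₂ (F t y).2
                ((lam i)⁻¹ • (Df (Q (a i))).2)
                ((lam k)⁻¹ • (Df (Q (a k))).2)
                ((lam k)⁻¹ • (Df (Q (a k))).2))
                ((lam i)⁻¹ • (Df (Q (a i))).2) =
      (lam i)⁻¹ ^ 2 * (lam k)⁻¹ ^ 2 * m₂ (F t y).2 (riem m₂ (F t y).2
        (Df (Q (a i))).2 (Df (Q (a k))).2 (Df (Q (a k))).2) (Df (Q (a i))).2 := by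
    simp only [riem, map_smul, smul_apply, map_sub, map_add, sub_apply, add_apply, smul_eq_mul]
    ring
  rw [hθ, hR, hR2]
  simp only [map_smul, smul_apply, smul_eq_mul]
  have hli := hlam i
  have hlk := hlam k
  have hlp : lam (partner i) = (lam i)⁻¹ := (eq_inv_of_mul_eq_one_right (hpair i))
  have hwi := hwsq i
  have hwk := hwsq k
  generalize m₁ (F t y).1 (riem m₁ (F t y).1 (a i) (a k) (a k)) (a i) = r₁
  generalize m₂ (F t y).2 (riem m₂ (F t y).2
        (Df (Q (a i))).2 (Df (Q (a k))).2 (Df (Q (a k))).2) (Df (Q (a i))).2 = r₂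
  calc w i * (lam i ^ 2 * (w i * (w k * w k) * r₁) - w i * (w k * w k) * r₂) =
      (w i * w i) * (w k * w k) * (lam i ^ 2 * r₁ - r₂) := by ring
    _ = _ := by
      rw [hwi, hwk, hlp]
      field_simp
      ring

end SingularFrame

end

section

/-! ### Existence of singular frames -/

section SingularFrameExistence

variable {E : Type*} [NormedAddCommGroup E] [NormedSpace ℝ E] [FiniteDimensional ℝ E]
  {E' : Type*} [NormedAddCommGroup E'] [NormedSpace ℝ E'] [FiniteDimensional ℝ E'] {n : ℕ}

/-- A nonnegative quadratic form restricted to a nonzero subspace attains the minimum of its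
Rayleigh quotient, at a critical point. -/
theorem IsInner.exists_rayleigh_min {g : E →L[ℝ] E →L[ℝ] ℝ} (hg : IsInner g)
    {q : E →L[ℝ] E →L[ℝ] ℝ} (hq : ∀ u v, q u v = q v u) (K : Submodule ℝ E) {v₀ : E} (hv₀ : v₀ ∈ K)
    (hne : v₀ ≠ 0) : ∃ v ∈ K, v ≠ 0 ∧ ∃ μ : ℝ, ∀ u ∈ K, q v u = μ * g v u := by
  have hcomp : IsCompact (Metric.sphere (0 : E) 1 ∩ K) :=
    (isCompact_sphere (0 : E) 1).inter_right K.closed_of_finiteDimensional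
  have hn : ‖v₀‖ ≠ 0 := norm_ne_zero_iff.2 hne
  have hnem : (Metric.sphere (0 : E) 1 ∩ K).Nonempty :=
    ⟨‖v₀‖⁻¹ • v₀, by simp [norm_smul, hn], K.smul_mem _ hv₀⟩
  have hs : ∀ v ∈ Metric.sphere (0 : E) 1 ∩ (K : Set E), v ≠ 0 := fun v hv h0 => by
    have := hv.1
    rw [h0] at this
    simp at this
  have hcont : ContinuousOn (fun v => q v v / g v v) (Metric.sphere (0 : E) 1 ∩ K) := by
    refine ContinuousOn.div (by fun_prop) (by fun_prop) fun v hv => (hg.pos v (hs v hv)).ne'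
  obtain ⟨v, hv, hmin⟩ := hcomp.exists_isMinOn hnem hcont
  refine ⟨v, hv.2, hs v hv, q v v / g v v, fun u hu => ?_⟩
  set μ := q v v / g v v with hμ
  have hgv := hg.pos v (hs v hv)
  have hqv : q v v = μ * g v v := by rw [hμ, div_mul_cancel₀ _ hgv.ne']
  have hall : ∀ x ∈ K, 0 ≤ q x x - μ * g x x := fun x hx => by
    rcases eq_or_ne x 0 with rfl | hx0
    · simp
    have hxn : 0 < ‖x‖ := norm_pos_iff.2 hx0
    have h1 : q v v / g v v ≤ _ :=
      hmin (show ‖x‖⁻¹ • x ∈ Metric.sphere (0 : E) 1 ∩ (K : Set E) from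
        ⟨by simp [norm_smul, hxn.ne'], K.smul_mem _ hx⟩)
    simp only [map_smul, smul_apply, smul_eq_mul] at h1
    have hgx := hg.pos x hx0
    have h2 : ‖x‖⁻¹ * (‖x‖⁻¹ * q x x) / (‖x‖⁻¹ * (‖x‖⁻¹ * g x x)) = q x x / g x x := by
      field_simp
    rw [h2, ← hμ, le_div_iff₀ hgx] at h1
    linarith
  have hlin := linear_term_eq_zero (p := 2 * (q v u - μ * g v u)) (q := q u u - μ * g u u)
    fun s => by
      have h1 := hall (v + s • u) (K.add_mem hv.2 (K.smul_mem s hu))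
      simp only [map_add, add_apply, map_smul, smul_apply, smul_eq_mul, hq u v, hg.symm u v] at h1
      linarith
  linarith

/-- A linear symplectic map admits an orthonormal system adapted to its singular values. -/
theorem IsInner.exists_singular_vectors {g : E →L[ℝ] E →L[ℝ] ℝ} (hg : IsInner g) {J : E →L[ℝ] E}
    (hsq : ∀ v, J (J v) = -v) (horth : ∀ u v, g (J u) (J v) = g u v)
    {g' : E' →L[ℝ] E' →L[ℝ] ℝ} (hg' : IsInner g') {J' : E' →L[ℝ] E'} (hsq' : ∀ v, J' (J' v) = -v)
    (hdim : finrank ℝ E = finrank ℝ E') {L : E →L[ℝ] E'}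
    (hL : ∀ u v, g' (J' (L u)) (L v) = g (J u) v) (hE : finrank ℝ E = 2 * n) :
    ∀ k ≤ n, ∃ (c : ℕ → E) (μ : ℕ → ℝ), (∀ i < k, ∀ j < k,
      g (c i) (c j) = (if i = j then 1 else 0) ∧ g (c i) (J (c j)) = 0) ∧
      ∀ i < k, 0 < μ i ∧ ∀ v, g' (L (c i)) (L v) = μ i ^ 2 * g (c i) v ∧
        g' (L (J (c i))) (L v) = (μ i)⁻¹ ^ 2 * g (J (c i)) v := by
  have hskew : ∀ u v, g (J u) v = - g u (J v) := fun u v => by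
    rw [← horth u (J v), hsq, map_neg, neg_neg]
  have hinj : Function.Injective L := by
    refine (injective_iff_map_eq_zero L).2 fun x hx => ?_
    have h1 : J x = 0 := hg.ext_inner fun z => by rw [← hL, hx]; simp
    have h2 := hsq x
    rw [h1, map_zero] at h2
    exact neg_eq_zero.1 h2.symm
  have hsurj : Function.Surjective L :=
    (LinearMap.injective_iff_surjective_of_finrank_eq_finrank (f := (L : E →ₗ[ℝ] E')) hdim).1 hinj
  -- an eigenvector for `λ²` is mapped by `J` to one for `λ⁻²`
  have hJeig : ∀ (v : E) (l : ℝ), l ≠ 0 → (∀ u, g' (L v) (L u) = l ^ 2 * g v u) →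
      ∀ u, g' (L (J v)) (L u) = l⁻¹ ^ 2 * g (J v) u := fun v l hl hv u => by
    have h1 : L v = -(l ^ 2 • J' (L (J v))) := hg'.ext_inner fun z => by
      obtain ⟨x, rfl⟩ := hsurj z
      rw [hv]
      simp only [map_neg, map_smul, neg_apply, smul_apply, smul_eq_mul]
      rw [hL, hsq]
      simp
    have h2 : J' (L v) = l ^ 2 • L (J v) := by
      rw [h1, map_neg, map_smul, hsq', smul_neg, neg_neg]
    have h3 := hL v u
    rw [h2] at h3
    simp only [map_smul, smul_apply, smul_eq_mul] at h3
    rw [← h3]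
    field_simp
  intro k
  induction k with
  | zero => exact fun _ => ⟨fun _ => 0, fun _ => 0, by simp, by simp⟩
  | succ k ih =>
    intro hk
    obtain ⟨c, μ, hc, hμ⟩ := ih (by omega)
    let Φ : E →ₗ[ℝ] (Fin k → ℝ) × (Fin k → ℝ) :=
      LinearMap.prod (LinearMap.pi fun i => (g (c i) : E →ₗ[ℝ] ℝ))
        (LinearMap.pi fun i => (g (J (c i)) : E →ₗ[ℝ] ℝ))
    have hker : LinearMap.ker Φ ≠ ⊥ := LinearMap.ker_ne_bot_of_finrank_lt (by
      simp only [finrank_prod, finrank_fin_fun, hE]; omega)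
    obtain ⟨v₀, hv₀, hne₀⟩ := Submodule.exists_mem_ne_zero_of_ne_bot hker
    have hmem : ∀ v, v ∈ LinearMap.ker Φ ↔ ∀ i < k, g (c i) v = 0 ∧ g (J (c i)) v = 0 := fun v => by
      rw [LinearMap.mem_ker, Prod.ext_iff, funext_iff, funext_iff]
      constructor
      · exact fun h i hi => ⟨h.1 ⟨i, hi⟩, h.2 ⟨i, hi⟩⟩
      · exact fun h => ⟨fun i => (h i i.2).1, fun i => (h i i.2).2⟩
    obtain ⟨v, hv, hvne, ν, hν⟩ := hg.exists_rayleigh_min (q := g'.bilinearComp L L)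
      (fun u v => hg'.symm _ _) (LinearMap.ker Φ) hv₀ hne₀
    have hν' : ∀ u ∈ LinearMap.ker Φ, g' (L v) (L u) = ν * g v u := hν
    have hνpos : 0 < ν := by
      have h1 := hν' v hv
      have h2 := hg'.pos (L v) fun h0 => hvne (hinj (by rw [h0, map_zero]))
      rw [h1] at h2
      exact pos_of_mul_pos_left h2 (hg.nonneg v)
    have hv' := (hmem v).1 hv
    -- the critical equation extends to all of `E`
    have hall : ∀ u, g' (L v) (L u) = ν * g v u := by
      obtain ⟨e, he⟩ := hg.exists_orthonormal
      let S : E := ∑ i, g' (L v) (L (e i)) • e i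
      have hS : ∀ u, g S u = g' (L v) (L u) := fun u => by
        conv_rhs => rw [← he.sum_smul u]
        simp only [S, map_sum, map_smul, sum_apply, smul_apply, smul_eq_mul]
        exact Finset.sum_congr rfl fun i _ => by rw [hg.symm (e i)]; ring
      have hSK : S - ν • v ∈ LinearMap.ker Φ := (hmem _).2 fun i hi => by
        constructor
        · rw [map_sub, map_smul, (hv' i hi).1, hg.symm, hS, hg'.symm, ((hμ i hi).2 v).1,
            (hv' i hi).1]
          simp
        · rw [map_sub, map_smul, (hv' i hi).2, hg.symm, hS, hg'.symm, ((hμ i hi).2 v).2,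
            (hv' i hi).2]
          simp
      have h0 : S - ν • v = 0 := by
        by_contra hne
        have h1 := hg.pos _ hne
        have h2 : g (S - ν • v) (S - ν • v) = 0 := by
          rw [map_sub g, sub_apply, hS, map_smul, smul_apply, smul_eq_mul, hν' _ hSK, sub_self]
        exact h1.ne' h2
      intro u
      rw [← hS, sub_eq_zero.1 h0]
      simp
    have hgv := hg.pos v hvne
    let w : E := (Real.sqrt (g v v))⁻¹ • v
    have hww : g w w = 1 := by
      simp only [w, map_smul, smul_apply, smul_eq_mul]
      rw [← mul_assoc, ← mul_inv, Real.mul_self_sqrt hgv.le, inv_mul_cancel₀ hgv.ne']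
    have hwJ : g w (J w) = 0 := by
      have h1 := hskew w w
      rw [hg.symm] at h1
      linarith
    have hwc : ∀ i < k, g (c i) w = 0 ∧ g (c i) (J w) = 0 := fun i hi => by
      have h1 : g (c i) (J w) = - g (J (c i)) w := by rw [hskew, neg_neg]
      rw [h1]
      simp [w, (hv' i hi).1, (hv' i hi).2]
    have hwL : ∀ u, g' (L w) (L u) = Real.sqrt ν ^ 2 * g w u := fun u => by
      rw [Real.sq_sqrt hνpos.le]
      simp only [w, map_smul, smul_apply, smul_eq_mul, hall]
      ring
    have hsν : 0 < Real.sqrt ν := Real.sqrt_pos.2 hνpos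
    refine ⟨Function.update c k w, Function.update μ k (Real.sqrt ν), fun i hi j hj => ?_,
      fun i hi => ?_⟩
    · rcases eq_or_ne i k with hik | hik <;> rcases eq_or_ne j k with hjk | hjk
      · simp [hik, hjk, hww, hwJ]
      · have hj' : j < k := by omega
        have h2 := hwc j hj'
        have h3 : g w (J (c j)) = 0 := by
          have h4 := hskew w (c j)
          rw [hg.symm, h2.2] at h4
          linarith
        simp [hik, Function.update_of_ne hjk, hg.symm w (c j), h2.1, h3, hjk.symm]
      · have hi' : i < k := by omega
        simp [hjk, Function.update_of_ne hik, (hwc i hi').1, (hwc i hi').2, hik]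
      · rw [Function.update_of_ne hik, Function.update_of_ne hjk]
        exact hc i (by omega) j (by omega)
    · rcases eq_or_ne i k with rfl | hik
      · simp only [Function.update_self]
        exact ⟨hsν, fun u => ⟨hwL u, hJeig w _ hsν.ne' hwL u⟩⟩
      · simp only [Function.update_of_ne hik]
        exact hμ i (by omega)

/-- A linear symplectic map between Hermitian spaces has a singular frame. -/
theorem IsInner.exists_singular_frame {g : E →L[ℝ] E →L[ℝ] ℝ} (hg : IsInner g) {J : E →L[ℝ] E}
    (hsq : ∀ v, J (J v) = -v) (horth : ∀ u v, g (J u) (J v) = g u v)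
    {g' : E' →L[ℝ] E' →L[ℝ] ℝ} (hg' : IsInner g') {J' : E' →L[ℝ] E'} (hsq' : ∀ v, J' (J' v) = -v)
    (hdim : finrank ℝ E = finrank ℝ E') {L : E →L[ℝ] E'}
    (hL : ∀ u v, g' (J' (L u)) (L v) = g (J u) v) (hE : finrank ℝ E = 2 * n) :
    ∃ (a : Fin (2 * n) → E) (lam : Fin (2 * n) → ℝ), OrthonormalFor g a ∧
      (∀ i ∈ firsts n, J (a i) = a (partner i)) ∧ (∀ i, 0 < lam i) ∧
      (∀ i, lam i * lam (partner i) = 1) ∧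
      ∀ i v, g' (L (a i)) (L v) = lam i ^ 2 * g (a i) v := by
  obtain ⟨c, μ, hc, hμ⟩ := hg.exists_singular_vectors hsq horth hg' hsq' hdim hL hE n le_rfl
  have hskew : ∀ u v, g (J u) v = - g u (J v) := fun u v => by
    rw [← horth u (J v), hsq, map_neg, neg_neg]
  refine ⟨fun i => if i.val % 2 = 0 then c (i.val / 2) else J (c (i.val / 2)),
    fun i => if i.val % 2 = 0 then μ (i.val / 2) else (μ (i.val / 2))⁻¹, fun i j => ?_,
    fun i hi => ?_, fun i => ?_, fun i => ?_, fun i v => ?_⟩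
  · have hi2 : i.val / 2 < n := by omega
    have hj2 : j.val / 2 < n := by omega
    have h1 := hc _ hi2 _ hj2
    have h2 := hc _ hj2 _ hi2
    by_cases hi : i.val % 2 = 0 <;> by_cases hj : j.val % 2 = 0
    · simp only [hi, hj, if_true, h1.1]
      exact if_congr (by rw [Fin.ext_iff]; omega) rfl rfl
    · simp only [hi, hj, if_true, if_false, h1.2]
      rw [if_neg (by rw [Fin.ext_iff]; omega)]
    · simp only [hi, hj, if_true, if_false]
      rw [if_neg (by rw [Fin.ext_iff]; omega), hg.symm, h2.2]
    · simp only [hi, hj, if_false, horth, h1.1]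
      exact if_congr (by rw [Fin.ext_iff]; omega) rfl rfl
  · rw [mem_firsts] at hi
    have h1 := partner_val i
    rw [if_pos hi] at h1
    have h2 : (partner i).val % 2 ≠ 0 := by omega
    have h3 : (partner i).val / 2 = i.val / 2 := by omega
    simp only [hi, h2, h3, if_true, if_false]
  · have h1 := (hμ (i.val / 2) (by omega)).1
    dsimp only
    split_ifs
    · exact h1
    · exact inv_pos.2 h1
  · have h0 := (hμ (i.val / 2) (by omega)).1.ne'
    have h1 := partner_val i
    have h3 : (partner i).val / 2 = i.val / 2 := by split_ifs at h1 <;> omega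
    by_cases hi : i.val % 2 = 0
    · have h2 : (partner i).val % 2 ≠ 0 := by split_ifs at h1 <;> omega
      simp [hi, h2, h3, h0]
    · have h2 : (partner i).val % 2 = 0 := by split_ifs at h1 <;> omega
      simp [hi, h2, h3, h0]
  · have h1 := (hμ (i.val / 2) (by omega)).2 v
    dsimp only
    split_ifs
    · exact h1.1
    · exact h1.2

end SingularFrameExistence

end

section

/-! ### Tensors in charts -/

section Charts

variable {E : Type*} [NormedAddCommGroup E] [NormedSpace ℝ E]
  {H : Type*} [TopologicalSpace H] {I : ModelWithCorners ℝ E H} [I.Boundaryless]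
  {M : Type*} [TopologicalSpace M] [ChartedSpace H M] [IsManifold I ∞ M]

theorem isManifold_one : IsManifold I 1 M := IsManifold.of_le (n := ∞) (by simpa using ENat.LEInfty.out)

/-- The derivative of the inverse of the chart at `x`. -/
def chartD (I : ModelWithCorners ℝ E H) {M : Type*} [TopologicalSpace M] [ChartedSpace H M] (x : M)
    (y : E) : E →L[ℝ] E :=
  (mfderiv 𝓘(ℝ, E) I (extChartAt I x).symm y : E →L[ℝ] TangentSpace I ((extChartAt I x).symm y))

/-- The derivative of the chart at `x`, at the point `z`. -/
def chartA (I : ModelWithCorners ℝ E H) {M : Type*} [TopologicalSpace M] [ChartedSpace H M] (x z : M) :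
    E →L[ℝ] E :=
  (mfderiv I 𝓘(ℝ, E) (extChartAt I x) z : TangentSpace I z →L[ℝ] E)

theorem chartA_chartD {x : M} {y : E} (hy : y ∈ (extChartAt I x).target) (v : E) :
    chartA I x ((extChartAt I x).symm y) (chartD I x y v) = v := by
  have : IsManifold I 1 M := isManifold_one
  have h := mfderiv_extChartAt_comp_mfderivWithin_extChartAt_symm hy
  rw [I.range_eq_univ, mfderivWithin_univ] at h
  exact DFunLike.congr_fun h v

theorem chartD_chartA {x : M} {y : E} (hy : y ∈ (extChartAt I x).target) (v : E) :
    chartD I x y (chartA I x ((extChartAt I x).symm y) v) = v := by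
  have : IsManifold I 1 M := isManifold_one
  have h := mfderivWithin_extChartAt_symm_comp_mfderiv_extChartAt hy
  rw [I.range_eq_univ, mfderivWithin_univ] at h
  exact DFunLike.congr_fun h v

theorem chartA_self (x : M) : chartA I x x = ContinuousLinearMap.id ℝ E := by
  have : IsManifold I 1 M := isManifold_one
  exact mfderiv_extChartAt_self

theorem chartD_self (x : M) : chartD I x (extChartAt I x x) = ContinuousLinearMap.id ℝ E := by
  ext v
  have h := chartD_chartA (I := I) (mem_extChartAt_target x) v
  rw [extChartAt_to_inv, chartA_self] at h
  exact h

theorem isOpen_target (x : M) : IsOpen (extChartAt I x).target := isOpen_extChartAt_target x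

theorem contMDiffOn_symm (x : M) :
    ContMDiffOn 𝓘(ℝ, E) I ∞ (extChartAt I x).symm (extChartAt I x).target :=
  contMDiffOn_extChartAt_symm x

/-- A vector field along the inverse of a chart is smooth if and only if its components are. -/
theorem contMDiffAt_section_chart {x : M} {y : E} (hy : y ∈ (extChartAt I x).target)
    (s : ∀ y : E, TangentSpace I ((extChartAt I x).symm y)) :
    ContMDiffAt 𝓘(ℝ, E) (I.prod 𝓘(ℝ, E)) ∞
      (fun y => Bundle.TotalSpace.mk' E (E := (TangentSpace I : M → Type _))
        ((extChartAt I x).symm y) (s y)) y ↔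
    ContDiffAt ℝ ∞ (fun y => chartA I x ((extChartAt I x).symm y) (s y)) y := by
  have : IsManifold I 1 M := isManifold_one
  have hsrc : (extChartAt I x).symm y ∈ (chartAt H x).source := by
    rw [← extChartAt_source I]
    exact (extChartAt I x).map_target hy
  have h1 := Bundle.Trivialization.contMDiffAt_iff (IB := I) (n := ∞) (IM := 𝓘(ℝ, E))
    (e := trivializationAt E (TangentSpace I : M → Type _) x)
    (f := fun y => Bundle.TotalSpace.mk' E (E := (TangentSpace I : M → Type _))
        ((extChartAt I x).symm y) (s y)) (x₀ := y) (by
      rw [Bundle.Trivialization.mem_source]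
      exact hsrc)
  rw [h1]
  have hsm : ContMDiffAt 𝓘(ℝ, E) I ∞ (extChartAt I x).symm y :=
    (contMDiffOn_symm x).contMDiffAt ((isOpen_target x).mem_nhds hy)
  have h2 : (fun y => ((trivializationAt E (TangentSpace I : M → Type _) x)
      (Bundle.TotalSpace.mk' E (E := (TangentSpace I : M → Type _))
        ((extChartAt I x).symm y) (s y))).2) =ᶠ[𝓝 y]
      fun y => chartA I x ((extChartAt I x).symm y) (s y) := by
    filter_upwards [(isOpen_target x).mem_nhds hy] with z hz
    have hz' : (extChartAt I x).symm z ∈ (chartAt H x).source := by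
      rw [← extChartAt_source I]
      exact (extChartAt I x).map_target hz
    have h3 := DFunLike.congr_fun
      (TangentBundle.continuousLinearMapAt_trivializationAt (I := I) hz') (s z)
    have h4 := congrFun ((trivializationAt E (TangentSpace I : M → Type _)
      x).coe_linearMapAt_of_mem (R := ℝ) hz') (s z)
    exact h4.symm.trans h3
  constructor
  · intro h
    exact (h.2.congr_of_eventuallyEq h2.symm).contDiffAt
  · intro h
    exact ⟨hsm, (h.contMDiffAt).congr_of_eventuallyEq h2⟩

theorem metricInChart_apply (g : MetricField I M) (x : M) (y u v : E) :
    metricInChart g x y u v = g ((extChartAt I x).symm y) (chartD I x y u) (chartD I x y v) := rfl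

theorem contMDiffAt_chartD {x : M} {y : E} (hy : y ∈ (extChartAt I x).target) (u : E) :
    ContMDiffAt 𝓘(ℝ, E) (I.prod 𝓘(ℝ, E)) ∞
      (fun y => Bundle.TotalSpace.mk' E (E := (TangentSpace I : M → Type _))
        ((extChartAt I x).symm y) (chartD I x y u)) y := by
  refine (contMDiffAt_section_chart hy _).2 ?_
  refine (contDiffAt_const (c := u)).congr_of_eventuallyEq ?_
  filter_upwards [(isOpen_target x).mem_nhds hy] with z hz using chartA_chartD hz u

theorem contDiffAt_metricInChart
    (g : Bundle.ContMDiffRiemannianMetric I ∞ E (TangentSpace I : M → Type _)) {x : M} {y : E}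
    (hy : y ∈ (extChartAt I x).target) (u v : E) :
    ContDiffAt ℝ ∞ (fun m => metricInChart g.inner x m u v) y := by
  have hsm : ContMDiffAt 𝓘(ℝ, E) I ∞ (extChartAt I x).symm y :=
    (contMDiffOn_symm x).contMDiffAt ((isOpen_target x).mem_nhds hy)
  have : ContMDiffAt 𝓘(ℝ, E) (I.prod 𝓘(ℝ)) ∞
      (fun m ↦ Bundle.TotalSpace.mk' ℝ (E := Bundle.Trivial M ℝ) ((extChartAt I x).symm m)
        (g.inner ((extChartAt I x).symm m) (chartD I x m u) (chartD I x m v))) y := by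
    apply ContMDiffAt.clm_bundle_apply₂ (F₁ := E) (F₂ := E)
    · exact ContMDiffAt.comp y g.contMDiff.contMDiffAt hsm
    · exact contMDiffAt_chartD hy u
    · exact contMDiffAt_chartD hy v
  simp only [Bundle.contMDiffAt_totalSpace] at this
  exact this.2.contDiffAt

/-- The components of a smooth Riemannian metric in a chart. -/
theorem isMetricOn_metricInChart [FiniteDimensional ℝ E]
    (g : Bundle.ContMDiffRiemannianMetric I ∞ E (TangentSpace I : M → Type _)) (x : M) :
    IsMetricOn (metricInChart g.inner x) (extChartAt I x).target := by
  refine ⟨isOpen_target x, ?_, fun y _ u v => ?_, fun y hy v hv => ?_⟩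
  · refine contDiffOn_clm_apply.2 fun u => contDiffOn_clm_apply.2 fun v => ?_
    exact fun y hy => (contDiffAt_metricInChart g hy u v).contDiffWithinAt
  · exact g.symm ((extChartAt I x).symm y) (chartD I x y u) (chartD I x y v)
  · refine g.pos ((extChartAt I x).symm y) (chartD I x y v) fun h0 => hv ?_
    rw [← chartA_chartD (I := I) hy v]
    exact (congrArg (chartA I x ((extChartAt I x).symm y)) h0).trans (map_zero _)

end Charts

end

section

/-! ### Maps between manifolds in charts -/

section Maps

variable {E : Type*} [NormedAddCommGroup E] [NormedSpace ℝ E]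
  {H : Type*} [TopologicalSpace H] {I : ModelWithCorners ℝ E H} [I.Boundaryless]
  {M : Type*} [TopologicalSpace M] [ChartedSpace H M] [IsManifold I ∞ M]
  {E' : Type*} [NormedAddCommGroup E'] [NormedSpace ℝ E']
  {H' : Type*} [TopologicalSpace H'] {I' : ModelWithCorners ℝ E' H'} [I'.Boundaryless]
  {N : Type*} [TopologicalSpace N] [ChartedSpace H' N] [IsManifold I' ∞ N]

/-- The map `F` in the charts at `x` and `q`. -/
def inCharts (I : ModelWithCorners ℝ E H) (I' : ModelWithCorners ℝ E' H') {M : Type*}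
    [TopologicalSpace M] [ChartedSpace H M] {N : Type*} [TopologicalSpace N] [ChartedSpace H' N]
    (x : M) (q : N) (F : M → N) (y : E) : E' :=
  extChartAt I' q (F ((extChartAt I x).symm y))

/-- The derivative of `F` at `z`, as a map between the model spaces. -/
def mfd (I : ModelWithCorners ℝ E H) (I' : ModelWithCorners ℝ E' H') {M : Type*}
    [TopologicalSpace M] [ChartedSpace H M] {N : Type*} [TopologicalSpace N] [ChartedSpace H' N]
    (F : M → N) (z : M) : E →L[ℝ] E' :=
  (mfderiv I I' F z : TangentSpace I z →L[ℝ] TangentSpace I' (F z))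

theorem mfd_id (z : M) : mfd I I (id : M → M) z = ContinuousLinearMap.id ℝ E := mfderiv_id

theorem mdifferentiableAt_symm {x : M} {y : E} (hy : y ∈ (extChartAt I x).target) :
    MDifferentiableAt 𝓘(ℝ, E) I (extChartAt I x).symm y :=
  ((contMDiffOn_symm x).contMDiffAt ((isOpen_target x).mem_nhds hy)).mdifferentiableAt (by simp)

theorem mdifferentiableAt_chart {x z : M} (hz : z ∈ (extChartAt I x).source) :
    MDifferentiableAt I 𝓘(ℝ, E) (extChartAt I x) z := by
  rw [extChartAt_source] at hz
  exact (contMDiffAt_extChartAt' (n := ∞) hz).mdifferentiableAt (by simp)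

theorem hasFDerivAt_inCharts {x : M} {q : N} {F : M → N} {y : E}
    (hy : y ∈ (extChartAt I x).target)
    (hF : MDifferentiableAt I I' F ((extChartAt I x).symm y))
    (hq : F ((extChartAt I x).symm y) ∈ (extChartAt I' q).source) :
    HasFDerivAt (inCharts I I' x q F) (chartA I' q (F ((extChartAt I x).symm y)) ∘L
      mfd I I' F ((extChartAt I x).symm y) ∘L chartD I x y) y := by
  have h1 := (mdifferentiableAt_symm hy).hasMFDerivAt
  have h2 := hF.hasMFDerivAt
  have h3 := (mdifferentiableAt_chart hq).hasMFDerivAt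
  exact (h3.comp y (h2.comp y h1)).hasFDerivAt

theorem fderiv_inCharts {x : M} {q : N} {F : M → N} {y : E}
    (hy : y ∈ (extChartAt I x).target)
    (hF : MDifferentiableAt I I' F ((extChartAt I x).symm y))
    (hq : F ((extChartAt I x).symm y) ∈ (extChartAt I' q).source) :
    fderiv ℝ (inCharts I I' x q F) y = chartA I' q (F ((extChartAt I x).symm y)) ∘L
      mfd I I' F ((extChartAt I x).symm y) ∘L chartD I x y :=
  (hasFDerivAt_inCharts hy hF hq).fderiv

theorem chartD_chartA' {q : N} {z : N} (hz : z ∈ (extChartAt I' q).source) (v : E') :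
    chartD I' q (extChartAt I' q z) (chartA I' q z v) = v := by
  have := chartD_chartA (I := I') (x := q) ((extChartAt I' q).map_source hz) v
  rwa [(extChartAt I' q).left_inv hz] at this

theorem chartD_fderiv_inCharts {x : M} {q : N} {F : M → N} {y : E}
    (hy : y ∈ (extChartAt I x).target)
    (hF : MDifferentiableAt I I' F ((extChartAt I x).symm y))
    (hq : F ((extChartAt I x).symm y) ∈ (extChartAt I' q).source) (v : E) :
    chartD I' q (inCharts I I' x q F y) (fderiv ℝ (inCharts I I' x q F) y v) =
      mfd I I' F ((extChartAt I x).symm y) (chartD I x y v) := by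
  rw [fderiv_inCharts hy hF hq]
  exact chartD_chartA' hq _

theorem metricInChart_chart (G : MetricField I' N) {q z : N} (hz : z ∈ (extChartAt I' q).source)
    (u v : E') : metricInChart G q (extChartAt I' q z) u v =
      G z (chartD I' q (extChartAt I' q z) u) (chartD I' q (extChartAt I' q z) v) := by
  have h := congrArg (fun r => (G r : E' →L[ℝ] E' →L[ℝ] ℝ)
    (chartD I' q (extChartAt I' q z) u) (chartD I' q (extChartAt I' q z) v))
    ((extChartAt I' q).left_inv hz)
  exact h

theorem pull_inCharts (G : MetricField I' N) {x : M} {q : N} {F : M → N} {y : E}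
    (hy : y ∈ (extChartAt I x).target)
    (hF : MDifferentiableAt I I' F ((extChartAt I x).symm y))
    (hq : F ((extChartAt I x).symm y) ∈ (extChartAt I' q).source) :
    metricInChart (I := I) (pullbackMetric G F) x y = pull (metricInChart G q) (inCharts I I' x q F) y := by
  ext u v
  rw [pull_apply]
  refine Eq.trans ?_ (metricInChart_chart G hq _ _).symm
  have h1 := chartD_fderiv_inCharts hy hF hq u
  have h2 := chartD_fderiv_inCharts hy hF hq v
  rw [inCharts] at h1 h2
  rw [h1, h2]
  rfl

theorem contDiffAt_inCharts {x : M} {q : N} {F : M → N} {y : E}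
    (hy : y ∈ (extChartAt I x).target)
    (hF : ContMDiffAt I I' ∞ F ((extChartAt I x).symm y))
    (hq : F ((extChartAt I x).symm y) ∈ (extChartAt I' q).source) :
    ContDiffAt ℝ ∞ (inCharts I I' x q F) y := by
  have h1 := (contMDiffOn_symm x).contMDiffAt ((isOpen_target x).mem_nhds hy)
  have h3 : ContMDiffAt I' 𝓘(ℝ, E') ∞ (extChartAt I' q) (F ((extChartAt I x).symm y)) := by
    rw [extChartAt_source] at hq
    exact contMDiffAt_extChartAt' hq
  exact (ContMDiffAt.comp y h3 (ContMDiffAt.comp y hF h1)).contDiffAt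

/-- The domain of a transition map. -/
def transDom (I : ModelWithCorners ℝ E H) {M : Type*} [TopologicalSpace M] [ChartedSpace H M]
    (x z : M) : Set E :=
  (extChartAt I x).target ∩ (extChartAt I x).symm ⁻¹' (extChartAt I z).source

theorem isOpen_transDom (x z : M) : IsOpen (transDom I x z) :=
  (continuousOn_extChartAt_symm x).isOpen_inter_preimage (isOpen_target x)
    (isOpen_extChartAt_source z)

theorem metricInChart_eq_pull (g : MetricField I M) {x z : M} {y : E} (hy : y ∈ transDom I x z) :
    metricInChart g x y = pull (metricInChart g z) (inCharts I I x z id) y := by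
  rw [← pull_inCharts g hy.1 mdifferentiableAt_id hy.2]
  ext u v
  rw [metricInChart_apply, metricInChart_apply]
  have h := mfd_id (I := I) ((extChartAt I x).symm y)
  show g _ _ _ = g _ (mfd I I id _ (chartD I x y u)) (mfd I I id _ (chartD I x y v))
  rw [h]
  rfl

theorem fderiv_transition {x z : M} {y : E} (hy : y ∈ transDom I x z) (v : E) :
    fderiv ℝ (inCharts I I x z id) y v =
      chartA I z ((extChartAt I x).symm y) (chartD I x y v) := by
  rw [fderiv_inCharts hy.1 mdifferentiableAt_id hy.2, mfd_id]
  rfl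

variable [FiniteDimensional ℝ E]

theorem transition_injective {x z : M} {y : E} (hy : y ∈ transDom I x z) :
    Function.Injective (fderiv ℝ (inCharts I I x z id) y) := fun u v huv => by
  have h1 := chartD_fderiv_inCharts (I' := I) hy.1 (F := id) mdifferentiableAt_id hy.2 u
  have h2 := chartD_fderiv_inCharts (I' := I) hy.1 (F := id) mdifferentiableAt_id hy.2 v
  rw [mfd_id] at h1 h2
  rw [huv] at h1
  have h3 : chartD I x y u = chartD I x y v := h1.symm.trans h2
  rw [← chartA_chartD (I := I) hy.1 u, h3, chartA_chartD hy.1]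

theorem isImmersionOn_transition {g : MetricField I M} {z : M}
    (hg : IsMetricOn (metricInChart g z) (extChartAt I z).target) (x : M) :
    IsImmersionOn (metricInChart g z) (extChartAt I z).target (inCharts I I x z id)
      (transDom I x z) where
  metric := hg
  isOpen := isOpen_transDom x z
  smooth := fun y hy => (contDiffAt_inCharts hy.1 contMDiffAt_id hy.2).contDiffWithinAt
  mapsTo := fun y hy => (extChartAt I z).map_source hy.2
  inj := fun y hy => transition_injective hy

end Maps

namespace KahlerStructure

variable {n : ℕ} {M : Type*} [TopologicalSpace M]
  [ChartedSpace (EuclideanSpace ℝ (Fin (2 * n))) M] [IsManifold (𝓡 (2 * n)) ∞ M]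
  (K : KahlerStructure n M)

/-- The complex structure at `z`, as a map of the model space. -/
def Jp (z : M) : EuclideanSpace ℝ (Fin (2 * n)) →L[ℝ] EuclideanSpace ℝ (Fin (2 * n)) := K.J z

/-- The components of the complex structure in the chart at `x`. -/
def JInChart (x : M) (y : EuclideanSpace ℝ (Fin (2 * n))) :
    EuclideanSpace ℝ (Fin (2 * n)) →L[ℝ] EuclideanSpace ℝ (Fin (2 * n)) :=
  chartA (𝓡 (2 * n)) x ((extChartAt (𝓡 (2 * n)) x).symm y) ∘L
    K.Jp ((extChartAt (𝓡 (2 * n)) x).symm y) ∘L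
    chartD (𝓡 (2 * n)) x y

theorem contDiffAt_JInChart {x : M} {y : EuclideanSpace ℝ (Fin (2 * n))}
    (hy : y ∈ (extChartAt (𝓡 (2 * n)) x).target) : ContDiffAt ℝ ∞ (K.JInChart x) y := by
  suffices h : ContDiffOn ℝ ∞ (K.JInChart x) (extChartAt (𝓡 (2 * n)) x).target from
    h.contDiffAt ((isOpen_target x).mem_nhds hy)
  refine contDiffOn_clm_apply.2 fun u z hz => ContDiffAt.contDiffWithinAt ?_
  have hsm := (contMDiffOn_symm (I := 𝓡 (2 * n)) x).contMDiffAt ((isOpen_target x).mem_nhds hz)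
  refine (contMDiffAt_section_chart hz (fun y =>
    K.J ((extChartAt (𝓡 (2 * n)) x).symm y) (chartD (𝓡 (2 * n)) x y u))).1 ?_
  exact ContMDiffAt.clm_bundle_apply (F₁ := EuclideanSpace ℝ (Fin (2 * n)))
    (F₂ := EuclideanSpace ℝ (Fin (2 * n)))
    (ContMDiffAt.comp z K.J_smooth.contMDiffAt hsm) (contMDiffAt_chartD hz u)

theorem chartD_JInChart {x : M} {y : EuclideanSpace ℝ (Fin (2 * n))}
    (hy : y ∈ (extChartAt (𝓡 (2 * n)) x).target) (v : EuclideanSpace ℝ (Fin (2 * n))) :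
    chartD (𝓡 (2 * n)) x y (K.JInChart x y v) =
      K.Jp ((extChartAt (𝓡 (2 * n)) x).symm y) (chartD (𝓡 (2 * n)) x y v) :=
  chartD_chartA hy _

theorem fderiv_transition_J {x z : M} {y : EuclideanSpace ℝ (Fin (2 * n))}
    (hy : y ∈ transDom (𝓡 (2 * n)) x z) (v : EuclideanSpace ℝ (Fin (2 * n))) :
    fderiv ℝ (inCharts (𝓡 (2 * n)) (𝓡 (2 * n)) x z id) y (K.JInChart x y v) =
      K.JInChart z (inCharts (𝓡 (2 * n)) (𝓡 (2 * n)) x z id y)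
        (fderiv ℝ (inCharts (𝓡 (2 * n)) (𝓡 (2 * n)) x z id) y v) := by
  rw [fderiv_transition hy, K.chartD_JInChart hy.1]
  have h1 := chartD_fderiv_inCharts (I := 𝓡 (2 * n)) (I' := 𝓡 (2 * n)) hy.1 (F := id)
    mdifferentiableAt_id hy.2 v
  rw [mfd_id] at h1
  have h2 : (extChartAt (𝓡 (2 * n)) z).symm (inCharts (𝓡 (2 * n)) (𝓡 (2 * n)) x z id y) =
      (extChartAt (𝓡 (2 * n)) x).symm y := (extChartAt (𝓡 (2 * n)) z).left_inv hy.2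
  simp only [JInChart, ContinuousLinearMap.comp_apply]
  rw [h1, h2]
  rfl

/-- In a chart, a Kähler structure is a Kähler structure on an open subset of `ℝ²ⁿ`. -/
theorem isKahlerOn (x : M) : IsKahlerOn (metricInChart K.g x) (K.JInChart x)
    (extChartAt (𝓡 (2 * n)) x).target where
  metric := isMetricOn_metricInChart K.metric x
  smooth := fun y hy => (K.contDiffAt_JInChart hy).contDiffWithinAt
  sq := fun y hy v => by
    rw [← chartA_chartD (I := 𝓡 (2 * n)) hy (K.JInChart x y _), K.chartD_JInChart hy,
      K.chartD_JInChart hy]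
    have h := congrArg (chartA (𝓡 (2 * n)) x ((extChartAt (𝓡 (2 * n)) x).symm y))
      (K.J_sq ((extChartAt (𝓡 (2 * n)) x).symm y) (chartD (𝓡 (2 * n)) x y v))
    refine h.trans ?_
    rw [← chartA_chartD (I := 𝓡 (2 * n)) hy (-v), map_neg]
    rfl
  orth := fun y hy u v => by
    rw [metricInChart_apply, metricInChart_apply, K.chartD_JInChart hy, K.chartD_JInChart hy]
    exact K.J_orthogonal _ _ _
  parallel := fun y hy u v => by
    set z := (extChartAt (𝓡 (2 * n)) x).symm y with hz
    have hyz : y ∈ transDom (𝓡 (2 * n)) x z := ⟨hy, by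
      show (extChartAt (𝓡 (2 * n)) x).symm y ∈ (extChartAt (𝓡 (2 * n)) z).source
      exact mem_extChartAt_source z⟩
    have him : IsImmersionOn (metricInChart K.g z) (extChartAt (𝓡 (2 * n)) z).target
      (inCharts (𝓡 (2 * n)) (𝓡 (2 * n)) x z id) (transDom (𝓡 (2 * n)) x z) :=
      isImmersionOn_transition (isMetricOn_metricInChart K.metric z) x
    set χ := inCharts (𝓡 (2 * n)) (𝓡 (2 * n)) x z id with hχ
    have hy' : χ y = extChartAt (𝓡 (2 * n)) z z := rfl
    have hpar := K.J_parallel z (fderiv ℝ χ y u) (fderiv ℝ χ y v)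
    have hpar' : fderiv ℝ (K.JInChart z) (χ y) (fderiv ℝ χ y u) (fderiv ℝ χ y v) +
        chrL (metricInChart K.g z) (χ y) (fderiv ℝ χ y u) (K.JInChart z (χ y) (fderiv ℝ χ y v)) -
        K.JInChart z (χ y) (chrL (metricInChart K.g z) (χ y) (fderiv ℝ χ y u) (fderiv ℝ χ y v))
        = 0 := hpar
    have hnab := fun w => him.nab_eq_of_finrank rfl hyz u w
    simp only [nab_apply] at hnab
    have hchr : chrL (pull (metricInChart K.g z) χ) y = chrL (metricInChart K.g x) y := by
      refine (chrL_congr ?_).symm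
      filter_upwards [(isOpen_transDom x z).mem_nhds hyz] with w hw
      exact metricInChart_eq_pull K.g hw
    have hχs : ContDiffAt ℝ ∞ χ y := him.contDiffAt hyz
    have hdχ : DifferentiableAt ℝ (fderiv ℝ χ) y := him.differentiableAt_fderiv hyz
    have hJx : DifferentiableAt ℝ (K.JInChart x) y :=
      (K.contDiffAt_JInChart hy).differentiableAt (by simp)
    have hJz : DifferentiableAt ℝ (K.JInChart z) (χ y) :=
      (K.contDiffAt_JInChart (him.mapsTo hyz)).differentiableAt (by simp)
    have hev : (fun w => fderiv ℝ χ w (K.JInChart x w v)) =ᶠ[𝓝 y]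
        fun w => K.JInChart z (χ w) (fderiv ℝ χ w v) := by
      filter_upwards [(isOpen_transDom x z).mem_nhds hyz] with w hw
      exact K.fderiv_transition_J hw v
    have hd1 := hdχ.hasFDerivAt.clm_apply
      (hJx.hasFDerivAt.clm_apply (hasFDerivAt_const v y))
    have hd2 := (hJz.hasFDerivAt.comp y (hχs.differentiableAt (by simp)).hasFDerivAt).clm_apply
      (hdχ.hasFDerivAt.clm_apply (hasFDerivAt_const v y))
    have hd := DFunLike.congr_fun (hd1.unique (hd2.congr_of_eventuallyEq hev)) u
    simp only [add_apply, ContinuousLinearMap.comp_apply, ContinuousLinearMap.flip_apply,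
      zero_apply, map_zero, zero_add, Function.comp_apply] at hd
    have hn1 := hnab v
    have hn2 := hnab (K.JInChart x y v)
    rw [hchr] at hn1 hn2
    have hJy := fun w => K.fderiv_transition_J hyz w
    rw [← hχ] at hJy
    apply him.inj y hyz
    rw [map_zero, map_sub, map_add, hJy, ← hn1, ← hn2, hJy v, map_add]
    refine Eq.trans ?_ hpar'
    rw [eq_sub_of_add_eq hd]
    abel

end KahlerStructure

end

section

/-! ### Families of maps, differentiable up to the boundary of the time interval -/

section Families

variable {V W : Type*} [NormedAddCommGroup V] [NormedSpace ℝ V] [NormedAddCommGroup W]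
  [NormedSpace ℝ W] {Φ : ℝ × V → W} {S : Set ℝ} {O : Set V} {s : ℝ} {y : V}

theorem hasFDerivAt_slice (hΦ : ContDiffOn ℝ ∞ Φ (S ×ˢ O)) (hO : IsOpen O) (hs : s ∈ S)
    (hy : y ∈ O) : HasFDerivAt (fun z => Φ (s, z))
      (fderivWithin ℝ Φ (S ×ˢ O) (s, y) ∘L ContinuousLinearMap.inr ℝ ℝ V) y := by
  have h1 : HasFDerivWithinAt Φ (fderivWithin ℝ Φ (S ×ˢ O) (s, y)) (S ×ˢ O) (s, y) :=
    (hΦ.differentiableOn (by simp) (s, y) ⟨hs, hy⟩).hasFDerivWithinAt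
  have h2 : HasFDerivWithinAt (fun z : V => (s, z)) (ContinuousLinearMap.inr ℝ ℝ V) O y :=
    (hasFDerivAt_prodMk_right s y).hasFDerivWithinAt
  exact (h1.comp y h2 fun z hz => ⟨hs, hz⟩).hasFDerivAt (hO.mem_nhds hy)

theorem hasDerivWithinAt_slice (hΦ : ContDiffOn ℝ ∞ Φ (S ×ˢ O)) (hs : s ∈ S)
    (hy : y ∈ O) : HasDerivWithinAt (fun r => Φ (r, y))
      (fderivWithin ℝ Φ (S ×ˢ O) (s, y) (1, 0)) S s := by
  have h1 : HasFDerivWithinAt Φ (fderivWithin ℝ Φ (S ×ˢ O) (s, y)) (S ×ˢ O) (s, y) :=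
    (hΦ.differentiableOn (by simp) (s, y) ⟨hs, hy⟩).hasFDerivWithinAt
  have h2 : HasFDerivWithinAt (fun r : ℝ => (r, y)) (ContinuousLinearMap.inl ℝ ℝ V) S s :=
    (hasFDerivAt_prodMk_left s y).hasFDerivWithinAt
  have h3 : MapsTo (fun r : ℝ => (r, y)) S (S ×ˢ O) := fun z hz => ⟨hz, hy⟩
  exact (h1.comp s h2 h3).hasDerivWithinAt

theorem contDiffOn_fderiv_slice (hΦ : ContDiffOn ℝ ∞ Φ (S ×ˢ O)) (hS : UniqueDiffOn ℝ S)
    (hO : IsOpen O) : ContDiffOn ℝ ∞ (fun p : ℝ × V => fderiv ℝ (fun z => Φ (p.1, z)) p.2)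
      (S ×ˢ O) := by
  have h1 : ContDiffOn ℝ ∞ (fderivWithin ℝ Φ (S ×ˢ O)) (S ×ˢ O) :=
    hΦ.fderivWithin (hS.prod hO.uniqueDiffOn) (by simp)
  refine (h1.clm_comp (contDiffOn_const (c := ContinuousLinearMap.inr ℝ ℝ V))).congr ?_
  rintro ⟨r, z⟩ ⟨hr, hz⟩
  exact (hasFDerivAt_slice hΦ hO hr hz).fderiv

/-- Time and space derivatives commute, also at the boundary of the time interval. -/
theorem hasDerivWithinAt_fderiv_slice (hΦ : ContDiffOn ℝ ∞ Φ (S ×ˢ O)) (hS : UniqueDiffOn ℝ S)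
    (hS' : S ⊆ closure (interior S)) (hO : IsOpen O) (hs : s ∈ S) (hy : y ∈ O) :
    HasDerivWithinAt (fun r => fderiv ℝ (fun z => Φ (r, z)) y)
      (fderiv ℝ (fun z => fderivWithin ℝ Φ (S ×ˢ O) (s, z) (1, 0)) y) S s := by
  have hD : UniqueDiffOn ℝ (S ×ˢ O) := hS.prod hO.uniqueDiffOn
  have h1 : ContDiffOn ℝ ∞ (fderivWithin ℝ Φ (S ×ˢ O)) (S ×ˢ O) := hΦ.fderivWithin hD (by simp)
  have h2 := hasDerivWithinAt_slice h1 hs hy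
  have h3 := hasFDerivAt_slice h1 hO hs hy
  have hsym : IsSymmSndFDerivWithinAt ℝ Φ (S ×ˢ O) (s, y) := by
    refine (hΦ (s, y) ⟨hs, hy⟩).isSymmSndFDerivWithinAt (by simpa using ENat.LEInfty.out) hD ?_ ⟨hs, hy⟩
    rw [interior_prod_eq, closure_prod_eq, hO.interior_eq]
    exact ⟨hS' hs, subset_closure hy⟩
  have h4 : HasDerivWithinAt (fun r => fderiv ℝ (fun z => Φ (r, z)) y)
      (fderivWithin ℝ (fderivWithin ℝ Φ (S ×ˢ O)) (S ×ˢ O) (s, y) (1, 0) ∘L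
        ContinuousLinearMap.inr ℝ ℝ V) S s := by
    have h5 := h2.clm_comp (hasDerivWithinAt_const s S (ContinuousLinearMap.inr ℝ ℝ V))
    simp only [ContinuousLinearMap.comp_zero, add_zero] at h5
    exact h5.congr (fun r hr => (hasFDerivAt_slice hΦ hO hr hy).fderiv)
      (hasFDerivAt_slice hΦ hO hs hy).fderiv
  convert h4 using 1
  have h6 := (h3.clm_apply (hasFDerivAt_const ((1 : ℝ), (0 : V)) y)).fderiv
  rw [h6]
  ext v
  simp only [add_apply, ContinuousLinearMap.comp_apply, zero_apply, map_zero, zero_add,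
    ContinuousLinearMap.flip_apply, ContinuousLinearMap.inr_apply]
  exact (hsym (0, v) (1, 0))

/-- Positive definiteness is an open condition, with a locally uniform lower bound. -/
theorem eventually_posDef [FiniteDimensional ℝ V] {X : Type*} [TopologicalSpace X]
    {B : X → V →L[ℝ] V →L[ℝ] ℝ} {D : Set X} {p : X} (hB : ContinuousWithinAt B D p)
    (hpos : ∀ v, v ≠ 0 → 0 < B p v v) :
    ∃ c, 0 < c ∧ ∀ᶠ q in 𝓝[D] p, ∀ v, c * ‖v‖ ^ 2 ≤ B q v v := by
  have : ProperSpace V := FiniteDimensional.proper_real V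
  obtain ⟨c, hc, hc'⟩ : ∃ c, 0 < c ∧ ∀ v, c * ‖v‖ ^ 2 ≤ B p v v := by
    rcases subsingleton_or_nontrivial V with hV | hV
    · exact ⟨1, one_pos, fun v => by simp [Subsingleton.elim v 0]⟩
    have hne : (Metric.sphere (0 : V) 1).Nonempty := NormedSpace.sphere_nonempty.2 zero_le_one
    obtain ⟨v₀, hv₀, hmin⟩ := (isCompact_sphere (0 : V) 1).exists_isMinOn hne
      (f := fun v => B p v v) (by fun_prop)
    refine ⟨B p v₀ v₀, hpos v₀ (ne_zero_of_mem_unit_sphere ⟨v₀, hv₀⟩), fun v => ?_⟩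
    rcases eq_or_ne v 0 with rfl | hv
    · simp
    have hv' : ‖v‖ ≠ 0 := norm_ne_zero_iff.2 hv
    have h1 : ‖v‖⁻¹ • v ∈ Metric.sphere (0 : V) 1 := by
      rw [mem_sphere_zero_iff_norm, norm_smul, norm_inv, norm_norm, inv_mul_cancel₀ hv']
    have h2 := isMinOn_iff.1 hmin _ h1
    simp only [map_smul, smul_apply, smul_eq_mul] at h2
    have h3 : 0 < ‖v‖ ^ 2 := by positivity
    calc B p v₀ v₀ * ‖v‖ ^ 2 ≤ (‖v‖⁻¹ * (‖v‖⁻¹ * B p v v)) * ‖v‖ ^ 2 := by gcongr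
      _ = B p v v := by field_simp
  refine ⟨c / 2, half_pos hc, ?_⟩
  have h1 : ∀ᶠ q in 𝓝[D] p, ‖B q - B p‖ < c / 2 := by
    have := Metric.tendsto_nhds.1 hB (c / 2) (half_pos hc)
    filter_upwards [this] with q hq
    rwa [← dist_eq_norm]
  filter_upwards [h1] with q hq v
  have h2 : |B q v v - B p v v| ≤ c / 2 * ‖v‖ ^ 2 := by
    have h3 := ((B q - B p)).le_opNorm₂ v v
    rw [sub_apply, sub_apply, Real.norm_eq_abs] at h3
    refine h3.trans ?_
    rw [mul_assoc, ← sq]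
    gcongr
  have h4 := abs_le.1 h2
  have h5 := hc' v
  linarith [h4.1]

theorem HasDerivWithinAt.nonpos_of_left {φ : ℝ → ℝ} {φ' : ℝ} (h : HasDerivWithinAt φ φ' S s)
    (hS : ∀ᶠ r in 𝓝[<] s, r ∈ S) (hφ : ∀ᶠ r in 𝓝[<] s, 0 ≤ φ r) (hs : φ s = 0) : φ' ≤ 0 := by
  have h1 : HasDerivWithinAt φ φ' (Iio s) s := by
    refine h.mono_of_mem_nhdsWithin hS
  rw [hasDerivWithinAt_iff_tendsto_slope' (by simp)] at h1
  refine le_of_tendsto h1 ?_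
  filter_upwards [hφ, self_mem_nhdsWithin] with r hr hrs
  rw [slope_def_field, hs, sub_zero]
  exact div_nonpos_of_nonneg_of_nonpos hr (sub_nonpos.2 (le_of_lt hrs))

end Families

end

section

/-! ### Immersions and mean curvature flow in charts -/

section FlowCharts

theorem meanL_congr {V W : Type*} [NormedAddCommGroup V] [NormedSpace ℝ V]
    [NormedAddCommGroup W] [NormedSpace ℝ W] [FiniteDimensional ℝ V]
    {m m' : W → W →L[ℝ] W →L[ℝ] ℝ} {f f' : V → W} {y : V}
    (hf : f =ᶠ[𝓝 y] f') (hc : ContinuousAt f y) (h : m =ᶠ[𝓝 (f y)] m') :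
    meanL m f y = meanL m' f' y := by
  unfold meanL
  rw [sff_congr hf hc h, (pull_congr hf hc h).eq_of_nhds]

theorem IsMetricOn.mono {W : Type*} [NormedAddCommGroup W] [NormedSpace ℝ W]
    {m : W → W →L[ℝ] W →L[ℝ] ℝ} {U U' : Set W} (h : IsMetricOn m U) (hU : IsOpen U')
    (hsub : U' ⊆ U) : IsMetricOn m U' :=
  ⟨hU, h.smooth.mono hsub, fun y hy => h.symm y (hsub hy), fun y hy => h.pos y (hsub hy)⟩

variable {E : Type*} [NormedAddCommGroup E] [NormedSpace ℝ E] [FiniteDimensional ℝ E]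
  {H : Type*} [TopologicalSpace H] {I : ModelWithCorners ℝ E H} [I.Boundaryless]
  {M : Type*} [TopologicalSpace M] [ChartedSpace H M] [IsManifold I ∞ M]
  {E' : Type*} [NormedAddCommGroup E'] [NormedSpace ℝ E'] [FiniteDimensional ℝ E']
  {H' : Type*} [TopologicalSpace H'] {I' : ModelWithCorners ℝ E' H'} [I'.Boundaryless]
  {N : Type*} [TopologicalSpace N] [ChartedSpace H' N] [IsManifold I' ∞ N]
  {G : MetricField I' N}

theorem metricInChart_self (g : MetricField I M) (x : M) :
    metricInChart g x (extChartAt I x x) = g x := by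
  ext u v
  refine (metricInChart_chart g (mem_extChartAt_source x) u v).trans ?_
  rw [chartD_self]
  rfl

/-- The set where `inCharts I I' x q F` is defined. -/
def chartDom (I : ModelWithCorners ℝ E H) (I' : ModelWithCorners ℝ E' H') {M : Type*}
    [TopologicalSpace M] [ChartedSpace H M] {N : Type*} [TopologicalSpace N] [ChartedSpace H' N]
    (x : M) (q : N) (F : M → N) : Set E :=
  (extChartAt I x).target ∩ (fun y => F ((extChartAt I x).symm y)) ⁻¹' (extChartAt I' q).source

theorem isOpen_chartDom {F : M → N} (hF : Continuous F) (x : M) (q : N) :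
    IsOpen (chartDom I I' x q F) :=
  (hF.comp_continuousOn (continuousOn_extChartAt_symm x)).isOpen_inter_preimage (isOpen_target x)
    (isOpen_extChartAt_source q)

theorem mem_chartDom {x : M} {F : M → N} : extChartAt I x x ∈ chartDom I I' x (F x) F := by
  refine ⟨mem_extChartAt_target x, ?_⟩
  show F ((extChartAt I x).symm (extChartAt I x x)) ∈ (extChartAt I' (F x)).source
  rw [extChartAt_to_inv]
  exact mem_extChartAt_source (F x)

theorem isImmersionOn_inCharts {q : N}
    (hG : IsMetricOn (metricInChart G q) (extChartAt I' q).target) {F : M → N}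
    (hF : ContMDiff I I' ∞ F) (hinj : ∀ x, Function.Injective (mfderiv I I' F x)) (x : M) :
    IsImmersionOn (metricInChart G q) (extChartAt I' q).target (inCharts I I' x q F)
      (chartDom I I' x q F) where
  metric := hG
  isOpen := isOpen_chartDom hF.continuous x q
  smooth := fun y hy => (contDiffAt_inCharts hy.1 hF.contMDiffAt hy.2).contDiffWithinAt
  mapsTo := fun y hy => (extChartAt I' q).map_source hy.2
  inj := fun y hy u v huv => by
    have hd := (hF.mdifferentiable (by simp)) ((extChartAt I x).symm y)
    have h1 := chartD_fderiv_inCharts hy.1 hd hy.2 u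
    have h2 := chartD_fderiv_inCharts hy.1 hd hy.2 v
    rw [huv] at h1
    have h3 : chartD I x y u = chartD I x y v := hinj _ (h1.symm.trans h2)
    rw [← chartA_chartD (I := I) hy.1 u, h3, chartA_chartD hy.1]

theorem metricInChart_pullbackMetric {F : M → N} (hF : ContMDiff I I' ∞ F) (x : M) :
    metricInChart (I := I) (pullbackMetric G F) x =ᶠ[𝓝 (extChartAt I x x)]
      pull (metricInChart G (F x)) (inCharts I I' x (F x) F) := by
  filter_upwards [(isOpen_chartDom (I := I) (I' := I') hF.continuous x (F x)).mem_nhds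
    mem_chartDom] with y hy
  exact pull_inCharts G hy.1 (hF.mdifferentiable (by simp) _) hy.2

theorem pullbackMetric_eq_pull {F : M → N} (hF : ContMDiff I I' ∞ F) (x : M) :
    (pullbackMetric (I := I) G F x : E →L[ℝ] E →L[ℝ] ℝ) =
      pull (metricInChart G (F x)) (inCharts I I' x (F x) F) (extChartAt I x x) := by
  rw [← (metricInChart_pullbackMetric hF x).eq_of_nhds, metricInChart_self]

theorem inCharts_self (F : M → N) (x : M) :
    inCharts I I' x (F x) F (extChartAt I x x) = extChartAt I' (F x) (F x) := by
  rw [inCharts, extChartAt_to_inv]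

theorem secondFundamentalForm_eq_sff {F : M → N} (hF : ContMDiff I I' ∞ F) (x : M) (u v : E) :
    secondFundamentalForm (I := I) G F x u v =
      sff (metricInChart G (F x)) (inCharts I I' x (F x) F) (extChartAt I x x) u v := by
  rw [sff_apply, nab_apply, ← chrL_congr (metricInChart_pullbackMetric hF x), inCharts_self]
  rfl

/-- The mean curvature vector, in charts. -/
theorem meanCurvature_eq_meanL {F : M → N} (hF : ContMDiff I I' ∞ F) (x : M) :
    meanCurvature I G F x =
      meanL (metricInChart G (F x)) (inCharts I I' x (F x) F) (extChartAt I x x) := by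
  unfold meanL
  rw [← pullbackMetric_eq_pull hF x]
  have h := funext fun u => funext fun v => secondFundamentalForm_eq_sff (G := G) hF x u v
  exact congrArg (fun B => mtr (V := E) (pullbackMetric (I := I) G F x) B) h

/-- The mean curvature vector, in arbitrary charts. -/
theorem chartA_meanCurvature
    (hG : ∀ q, IsMetricOn (metricInChart G q) (extChartAt I' q).target) {F : M → N}
    (hF : ContMDiff I I' ∞ F) (hinj : ∀ x, Function.Injective (mfderiv I I' F x)) {x : M} {q : N}
    {y : E} (hy : y ∈ chartDom I I' x q F) :
    chartA I' q (F ((extChartAt I x).symm y)) (meanCurvature I G F ((extChartAt I x).symm y)) =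
      meanL (metricInChart G q) (inCharts I I' x q F) y := by
  -- compare with the charts centred at `z` and `F z`, by the transition maps `χ` and `β`
  set z := (extChartAt I x).symm y with hz
  rw [meanCurvature_eq_meanL hF]
  set O₁ : Set E := chartDom I I' z (F z) F ∩ chartDom I I' z q F
  have hO₁ : IsOpen O₁ := (isOpen_chartDom hF.continuous _ _).inter (isOpen_chartDom hF.continuous _ _)
  set χ := inCharts I I x z id with hχ
  set O' : Set E := transDom I x z ∩ χ ⁻¹' O₁ with hO'
  have hχc : ContDiffOn ℝ ∞ χ (transDom I x z) := fun w hw =>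
    (contDiffAt_inCharts hw.1 contMDiffAt_id hw.2).contDiffWithinAt
  have hO'o : IsOpen O' := hχc.continuousOn.isOpen_inter_preimage (isOpen_transDom x z) hO₁
  have hyt : y ∈ transDom I x z := ⟨hy.1, mem_extChartAt_source (I := I) z⟩
  have hχy : χ y = extChartAt I z z := rfl
  have hFz : F ((extChartAt I z).symm (extChartAt I z z)) = F z := by rw [extChartAt_to_inv]
  have hyO : y ∈ O' := by
    refine ⟨hyt, ?_⟩
    show χ y ∈ O₁
    rw [hχy]
    refine ⟨mem_chartDom, mem_extChartAt_target z, ?_⟩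
    show F ((extChartAt I z).symm (extChartAt I z z)) ∈ (extChartAt I' q).source
    rw [hFz]
    exact hy.2
  set f := inCharts I I' z (F z) F
  set β := inCharts I' I' (F z) q id
  have hf : IsImmersionOn (metricInChart G (F z)) (transDom I' (F z) q) f O₁ := by
    have h := isImmersionOn_inCharts (hG (F z)) hF hinj z
    refine ⟨(hG (F z)).mono (isOpen_transDom _ _) inter_subset_left, hO₁,
      h.smooth.mono inter_subset_left, fun w hw => ⟨h.mapsTo hw.1, ?_⟩, fun w hw => h.inj w hw.1⟩
    show (extChartAt I' (F z)).symm (extChartAt I' (F z) (F ((extChartAt I z).symm w))) ∈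
      (extChartAt I' q).source
    rw [(extChartAt I' (F z)).left_inv hw.1.2]
    exact hw.2.2
  have hβ := isImmersionOn_transition (hG q) (F z)
  have hχi : IsImmersionOn (pull (metricInChart G (F z)) f) O₁ χ O' :=
    ⟨hf.isMetricOn_pull, hO'o, hχc.mono inter_subset_left, fun w hw => hw.2,
      fun w hw => transition_injective hw.1⟩
  have key := hf.meanL_comp hβ (fun w hw => metricInChart_eq_pull G hw) rfl hχi rfl hyO
  have hgerm : inCharts I I' x q F =ᶠ[𝓝 y] β ∘ f ∘ χ := by
    filter_upwards [hO'o.mem_nhds hyO] with w hw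
    have h1 : (extChartAt I z).symm (χ w) = (extChartAt I x).symm w :=
      (extChartAt I z).left_inv hw.1.2
    have h2 : F ((extChartAt I z).symm (χ w)) ∈ (extChartAt I' (F z)).source := hw.2.1.2
    show extChartAt I' q (F ((extChartAt I x).symm w)) = extChartAt I' q
      ((extChartAt I' (F z)).symm (extChartAt I' (F z) (F ((extChartAt I z).symm (χ w)))))
    rw [(extChartAt I' (F z)).left_inv h2, h1]
  have hc : ContinuousAt (inCharts I I' x q F) y :=
    (contDiffAt_inCharts hy.1 hF.contMDiffAt hy.2).continuousAt
  rw [meanL_congr hgerm hc Filter.EventuallyEq.rfl, key, hχy]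
  have hfz : f (extChartAt I z z) = extChartAt I' (F z) (F z) := inCharts_self F z
  rw [hfz, fderiv_transition ⟨mem_extChartAt_target (F z), by
    show (extChartAt I' (F z)).symm (extChartAt I' (F z) (F z)) ∈ (extChartAt I' q).source
    rw [extChartAt_to_inv]
    exact hy.2⟩, chartD_self, extChartAt_to_inv]
  rfl

end FlowCharts

end

section

/-! ### Mean curvature flow in charts -/

section FlowCharts

variable {E : Type*} [NormedAddCommGroup E] [NormedSpace ℝ E] [FiniteDimensional ℝ E]
  {H : Type*} [TopologicalSpace H] {I : ModelWithCorners ℝ E H} [I.Boundaryless]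
  {M : Type*} [TopologicalSpace M] [ChartedSpace H M] [IsManifold I ∞ M]
  {E' : Type*} [NormedAddCommGroup E'] [NormedSpace ℝ E'] [FiniteDimensional ℝ E']
  {H' : Type*} [TopologicalSpace H'] {I' : ModelWithCorners ℝ E' H'} [I'.Boundaryless]
  {N : Type*} [TopologicalSpace N] [ChartedSpace H' N] [IsManifold I' ∞ N]
  {G : MetricField I' N}

/-- `F` maps the product of the time interval `S` and the part of the chart at `x` with image `O`
into the domain of the chart at `q`. -/
structure IsFlowChart (I : ModelWithCorners ℝ E H) (I' : ModelWithCorners ℝ E' H') {M : Type*}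
    [TopologicalSpace M] [ChartedSpace H M] {N : Type*} [TopologicalSpace N] [ChartedSpace H' N]
    (T : ℝ) (F : ℝ → M → N) (x : M) (q : N) (S : Set ℝ) (O : Set E) : Prop where
  interval : ∃ V, IsOpen V ∧ S = Ico 0 T ∩ V
  isOpen : IsOpen O
  mem : ∀ s ∈ S, O ⊆ chartDom I I' x q (F s)

variable {T : ℝ} {F : ℝ → M → N}

theorem IsMeanCurvatureFlow.contMDiff (hF : IsMeanCurvatureFlow I G T F) {s : ℝ}
    (hs : s ∈ Ico 0 T) : ContMDiff I I' ∞ (F s) := by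
  have h1 : ContMDiff I (𝓘(ℝ, ℝ).prod I) ∞ fun x : M => (s, x) :=
    contMDiff_const.prodMk contMDiff_id
  have h2 := hF.smooth.comp (s := univ) h1.contMDiffOn fun x _ => ⟨hs, mem_univ _⟩
  exact contMDiffOn_univ.1 h2

theorem IsMeanCurvatureFlow.exists_isFlowChart (hF : IsMeanCurvatureFlow I G T F) {t : ℝ}
    (ht : t ∈ Ico 0 T) (x : M) :
    ∃ S O, IsFlowChart I I' T F x (F t x) S O ∧ t ∈ S ∧ extChartAt I x x ∈ O := by
  have hc : ContinuousWithinAt (fun p : ℝ × M => F p.1 p.2) (Ico 0 T ×ˢ univ) (t, x) :=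
    hF.smooth.continuousOn (t, x) ⟨ht, mem_univ _⟩
  have h1 := hc ((isOpen_extChartAt_source (I := I') (F t x)).mem_nhds (mem_extChartAt_source _))
  rw [mem_map, nhdsWithin_prod_eq, nhdsWithin_univ, Filter.mem_prod_iff] at h1
  obtain ⟨S₀, hS₀, O₀, hO₀, hsub⟩ := h1
  obtain ⟨V, hV, htV, hVS⟩ := mem_nhdsWithin.1 hS₀
  obtain ⟨O₁, hO₁, hO₁o, hxO₁⟩ := mem_nhds_iff.1 hO₀
  refine ⟨Ico 0 T ∩ V, (extChartAt I x).target ∩ (extChartAt I x).symm ⁻¹' O₁,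
    ⟨⟨V, hV, rfl⟩, (continuousOn_extChartAt_symm x).isOpen_inter_preimage (isOpen_target x) hO₁o,
      fun s hs y hy => ⟨hy.1, ?_⟩⟩, ⟨ht, htV⟩, mem_extChartAt_target x, ?_⟩
  · have : ((s, (extChartAt I x).symm y) : ℝ × M) ∈ S₀ ×ˢ O₀ := ⟨hVS ⟨hs.2, hs.1⟩, hO₁ hy.2⟩
    exact hsub this
  · rw [mem_preimage, extChartAt_to_inv]
    exact hxO₁

namespace IsFlowChart

variable {x : M} {q : N} {S : Set ℝ} {O : Set E}

theorem subset (h : IsFlowChart I I' T F x q S O) : S ⊆ Ico 0 T := by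
  obtain ⟨V, -, rfl⟩ := h.interval
  exact inter_subset_left

theorem uniqueDiffOn (h : IsFlowChart I I' T F x q S O) : UniqueDiffOn ℝ S := by
  obtain ⟨V, hV, rfl⟩ := h.interval
  exact (uniqueDiffOn_Ico 0 T).inter hV

theorem subset_closure_interior (h : IsFlowChart I I' T F x q S O) :
    S ⊆ closure (interior S) := by
  obtain ⟨V, hV, rfl⟩ := h.interval
  rintro s ⟨hs, hsV⟩
  rw [interior_inter, interior_Ico, hV.interior_eq]
  have h1 : s ∈ closure (Ioo 0 T) := by
    rw [closure_Ioo (ne_of_lt (lt_of_le_of_lt hs.1 hs.2))]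
    exact Ico_subset_Icc_self hs
  exact hV.closure_inter ⟨h1, hsV⟩

theorem nhdsWithin_eq (h : IsFlowChart I I' T F x q S O) {s : ℝ} (hs : s ∈ S) :
    𝓝[S] s = 𝓝[Ico 0 T] s := by
  obtain ⟨V, hV, rfl⟩ := h.interval
  exact nhdsWithin_inter_of_mem' (mem_nhdsWithin_of_mem_nhds (hV.mem_nhds hs.2))

theorem contDiffOn (h : IsFlowChart I I' T F x q S O) (hF : IsMeanCurvatureFlow I G T F) :
    ContDiffOn ℝ ∞ (fun p : ℝ × E => inCharts I I' x q (F p.1) p.2) (S ×ˢ O) := by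
  have h1 : ContMDiffOn 𝓘(ℝ, ℝ × E) (𝓘(ℝ, ℝ).prod I) ∞
      (fun p : ℝ × E => (p.1, (extChartAt I x).symm p.2)) (S ×ˢ O) :=
    contDiff_fst.contMDiff.contMDiffOn.prodMk
      ((contMDiffOn_symm x).comp contDiff_snd.contMDiff.contMDiffOn
        fun p hp => (h.mem p.1 hp.1 hp.2).1)
  have h2 : ContMDiffOn 𝓘(ℝ, ℝ × E) I' ∞
      (fun p : ℝ × E => F p.1 ((extChartAt I x).symm p.2)) (S ×ˢ O) :=
    hF.smooth.comp h1 fun p hp => ⟨h.subset hp.1, mem_univ _⟩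
  have h3 : ContMDiffOn I' 𝓘(ℝ, E') ∞ (extChartAt I' q) (extChartAt I' q).source := by
    rw [extChartAt_source]
    exact contMDiffOn_extChartAt
  exact (h3.comp h2 fun p hp => (h.mem p.1 hp.1 hp.2).2).contDiffOn

theorem isImmersionOn (h : IsFlowChart I I' T F x q S O) (hF : IsMeanCurvatureFlow I G T F)
    (hG : IsMetricOn (metricInChart G q) (extChartAt I' q).target) {s : ℝ} (hs : s ∈ S) :
    IsImmersionOn (metricInChart G q) (extChartAt I' q).target (inCharts I I' x q (F s)) O :=
  (isImmersionOn_inCharts hG (hF.contMDiff (h.subset hs)) (hF.immersion s (h.subset hs))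
    x).mono h.isOpen (h.mem s hs)

/-- The flow equation in fixed charts. -/
theorem hasDerivWithinAt (h : IsFlowChart I I' T F x q S O) (hF : IsMeanCurvatureFlow I G T F)
    (hG : ∀ q, IsMetricOn (metricInChart G q) (extChartAt I' q).target) {s : ℝ} (hs : s ∈ S)
    {y : E} (hy : y ∈ O) :
    HasDerivWithinAt (fun r => inCharts I I' x q (F r) y)
      (meanL (metricInChart G q) (inCharts I I' x q (F s)) y) S s := by
  set z := (extChartAt I x).symm y
  have hs' := h.subset hs
  have h1 : MDifferentiableWithinAt 𝓘(ℝ, ℝ) I' (fun r => F r z) (Ico 0 T) s := by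
    have h2 : ContMDiffOn 𝓘(ℝ, ℝ) (𝓘(ℝ, ℝ).prod I) ∞ (fun r : ℝ => (r, z)) (Ico 0 T) :=
      contMDiffOn_id.prodMk contMDiffOn_const
    exact (hF.smooth.comp h2 fun r hr => ⟨hr, mem_univ _⟩).mdifferentiableOn (by simp) s hs'
  have h3 := (mdifferentiableAt_chart (I := I') (h.mem s hs hy).2).hasMFDerivAt
  have h4 : HasFDerivWithinAt (fun r => inCharts I I' x q (F r) y)
      (chartA I' q (F s z) ∘L
        (mfderivWithin 𝓘(ℝ, ℝ) I' (fun r => F r z) (Ico 0 T) s : ℝ →L[ℝ] E')) (Ico 0 T) s :=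
    (h3.comp_hasMFDerivWithinAt s h1.hasMFDerivWithinAt).hasFDerivWithinAt
  rw [← chartA_meanCurvature hG (hF.contMDiff hs') (hF.immersion s hs') (h.mem s hs hy),
    ← hF.flow s hs' z]
  exact h4.hasDerivWithinAt.mono h.subset

theorem hasDerivWithinAt_fderiv (h : IsFlowChart I I' T F x q S O)
    (hF : IsMeanCurvatureFlow I G T F)
    (hG : ∀ q, IsMetricOn (metricInChart G q) (extChartAt I' q).target) {s : ℝ} (hs : s ∈ S)
    {y : E} (hy : y ∈ O) :
    HasDerivWithinAt (fun r => fderiv ℝ (inCharts I I' x q (F r)) y)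
      (fderiv ℝ (meanL (metricInChart G q) (inCharts I I' x q (F s))) y) S s := by
  have h1 := hasDerivWithinAt_fderiv_slice (h.contDiffOn hF) h.uniqueDiffOn
    h.subset_closure_interior h.isOpen hs hy
  have h2 : (meanL (metricInChart G q) (inCharts I I' x q (F s))) =ᶠ[𝓝 y] fun z =>
      fderivWithin ℝ (fun p : ℝ × E => inCharts I I' x q (F p.1) p.2) (S ×ˢ O) (s, z) (1, 0) := by
    filter_upwards [h.isOpen.mem_nhds hy] with z hz
    exact (h.uniqueDiffOn s hs).eq_deriv _ (h.hasDerivWithinAt hF hG hs hz)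
      (hasDerivWithinAt_slice (h.contDiffOn hF) hs hz)
  rw [h2.fderiv_eq]
  exact h1

end IsFlowChart

end FlowCharts

end

section

/-! ### Products of Kähler manifolds in charts -/

section Product

variable {E : Type*} [NormedAddCommGroup E] [NormedSpace ℝ E] [FiniteDimensional ℝ E]
  {H : Type*} [TopologicalSpace H] {I : ModelWithCorners ℝ E H} [I.Boundaryless]
  {M : Type*} [TopologicalSpace M] [ChartedSpace H M] [IsManifold I ∞ M]
  {E' : Type*} [NormedAddCommGroup E'] [NormedSpace ℝ E'] [FiniteDimensional ℝ E']
  {H' : Type*} [TopologicalSpace H'] {I' : ModelWithCorners ℝ E' H'} [I'.Boundaryless]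
  {N : Type*} [TopologicalSpace N] [ChartedSpace H' N] [IsManifold I' ∞ N]

theorem target_prod (q : M × N) : (extChartAt (I.prod I') q).target =
    (extChartAt I q.1).target ×ˢ (extChartAt I' q.2).target := by
  rw [extChartAt_prod]
  rfl

theorem chartD_prod {q : M × N} {y : E × E'} (hy : y ∈ (extChartAt (I.prod I') q).target) :
    chartD (I.prod I') q y = (chartD I q.1 y.1).prodMap (chartD I' q.2 y.2) := by
  rw [target_prod] at hy
  have h := ((mdifferentiableAt_symm (I := I) hy.1).hasMFDerivAt.prodMap
    (mdifferentiableAt_symm (I := I') hy.2).hasMFDerivAt).mfderiv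
  rw [← modelWithCornersSelf_prod, chartedSpaceSelf_prod] at h
  unfold chartD
  rw [extChartAt_prod]
  exact h

theorem metricInChart_prodMetric (g : MetricField I M) (g' : MetricField I' N) {q : M × N}
    {y : E × E'} (hy : y ∈ (extChartAt (I.prod I') q).target) :
    metricInChart (prodMetric g g') q y =
      prodM (metricInChart g q.1) (metricInChart g' q.2) y := by
  refine ContinuousLinearMap.ext fun u => ContinuousLinearMap.ext fun v => ?_
  rw [metricInChart_apply, chartD_prod hy, extChartAt_prod]
  rfl

theorem metricInChart_prodMetric_eventuallyEq (g : MetricField I M) (g' : MetricField I' N)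
    {q : M × N} {y : E × E'} (hy : y ∈ (extChartAt (I.prod I') q).target) :
    metricInChart (prodMetric g g') q =ᶠ[𝓝 y]
      prodM (metricInChart g q.1) (metricInChart g' q.2) := by
  filter_upwards [(isOpen_target q).mem_nhds hy] with z hz using metricInChart_prodMetric g g' hz

theorem isMetricOn_prodMetric {g : MetricField I M} {g' : MetricField I' N} {q : M × N}
    (h : IsMetricOn (metricInChart g q.1) (extChartAt I q.1).target)
    (h' : IsMetricOn (metricInChart g' q.2) (extChartAt I' q.2).target) :
    IsMetricOn (metricInChart (prodMetric g g') q) (extChartAt (I.prod I') q).target := by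
  have hp := h.prod h'
  rw [← target_prod] at hp
  refine ⟨hp.isOpen, hp.smooth.congr fun y hy => metricInChart_prodMetric g g' hy,
    fun y hy u v => ?_, fun y hy u hu => ?_⟩
  · rw [metricInChart_prodMetric g g' hy]
    exact hp.symm y hy u v
  · rw [metricInChart_prodMetric g g' hy]
    exact hp.pos y hy u hu

end Product

namespace KahlerStructure

variable {n : ℕ} {M : Type*} [TopologicalSpace M]
  [ChartedSpace (EuclideanSpace ℝ (Fin (2 * n))) M] [IsManifold (𝓡 (2 * n)) ∞ M]
  {N : Type*} [TopologicalSpace N]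
  [ChartedSpace (EuclideanSpace ℝ (Fin (2 * n))) N] [IsManifold (𝓡 (2 * n)) ∞ N]
  (K : KahlerStructure n M) (K' : KahlerStructure n N)

local notation "𝓔" => EuclideanSpace ℝ (Fin (2 * n))
local notation "𝓡₀" => 𝓡 (2 * n)
local notation "𝓟" => ModelWithCorners.prod (𝓡 (2 * n)) (𝓡 (2 * n))

theorem isMetricOn_prodG (q : M × N) : IsMetricOn (metricInChart (K.prodG K') q)
    (extChartAt 𝓟 q).target :=
  isMetricOn_prodMetric (K.isKahlerOn q.1).metric (K'.isKahlerOn q.2).metric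

variable {K K'} {T : ℝ} {F : ℝ → M → M × N} {x : M} {q : M × N} {S : Set ℝ}
  {O : Set (EuclideanSpace ℝ (Fin (2 * n)))}

theorem isImmersionOn_of_isFlowChart
    (h : IsFlowChart 𝓡₀ 𝓟 T F x q S O)
    (hF : IsMeanCurvatureFlow 𝓡₀ (K.prodG K') T F) {s : ℝ} (hs : s ∈ S) :
    IsImmersionOn (prodM (metricInChart K.g q.1) (metricInChart K'.g q.2))
      ((extChartAt 𝓡₀ q.1).target ×ˢ (extChartAt 𝓡₀ q.2).target)
      (inCharts 𝓡₀ 𝓟 x q (F s)) O := by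
  have h1 := h.isImmersionOn hF (K.isMetricOn_prodG K' q) hs
  exact ⟨(K.isKahlerOn q.1).metric.prod (K'.isKahlerOn q.2).metric, h1.isOpen, h1.smooth,
    by rw [← target_prod]; exact h1.mapsTo, h1.inj⟩

theorem meanL_of_isFlowChart
    (h : IsFlowChart 𝓡₀ 𝓟 T F x q S O)
    (hF : IsMeanCurvatureFlow 𝓡₀ (K.prodG K') T F) {s : ℝ} (hs : s ∈ S)
    {y : 𝓔} (hy : y ∈ O) :
    meanL (metricInChart (K.prodG K') q)
        (inCharts 𝓡₀ 𝓟 x q (F s)) y =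
      meanL (prodM (metricInChart K.g q.1) (metricInChart K'.g q.2))
        (inCharts 𝓡₀ 𝓟 x q (F s)) y := by
  have h1 := h.isImmersionOn hF (K.isMetricOn_prodG K' q) hs
  exact meanL_congr Filter.EventuallyEq.rfl (h1.contDiffAt hy).continuousAt
    (metricInChart_prodMetric_eventuallyEq K.g K'.g (h1.mapsTo hy))

theorem hasDerivWithinAt_of_isFlowChart
    (h : IsFlowChart 𝓡₀ 𝓟 T F x q S O)
    (hF : IsMeanCurvatureFlow 𝓡₀ (K.prodG K') T F) {s : ℝ} (hs : s ∈ S)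
    {y : 𝓔} (hy : y ∈ O) :
    HasDerivWithinAt
      (fun r => inCharts 𝓡₀ 𝓟 x q (F r) y)
      (meanL (prodM (metricInChart K.g q.1) (metricInChart K'.g q.2))
        (inCharts 𝓡₀ 𝓟 x q (F s)) y) S s := by
  rw [← meanL_of_isFlowChart h hF hs hy]
  exact h.hasDerivWithinAt hF (K.isMetricOn_prodG K') hs hy

theorem hasDerivWithinAt_fderiv_of_isFlowChart
    (h : IsFlowChart 𝓡₀ 𝓟 T F x q S O)
    (hF : IsMeanCurvatureFlow 𝓡₀ (K.prodG K') T F) {s : ℝ} (hs : s ∈ S)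
    {y : 𝓔} (hy : y ∈ O) :
    HasDerivWithinAt
      (fun r => fderiv ℝ (inCharts 𝓡₀ 𝓟 x q (F r)) y)
      (fderiv ℝ (meanL (prodM (metricInChart K.g q.1) (metricInChart K'.g q.2))
        (inCharts 𝓡₀ 𝓟 x q (F s))) y) S s := by
  have h1 : meanL (metricInChart (K.prodG K') q)
      (inCharts 𝓡₀ 𝓟 x q (F s)) =ᶠ[𝓝 y]
      meanL (prodM (metricInChart K.g q.1) (metricInChart K'.g q.2))
        (inCharts 𝓡₀ 𝓟 x q (F s)) := by
    filter_upwards [h.isOpen.mem_nhds hy] with z hz using meanL_of_isFlowChart h hF hs hz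
  rw [← h1.fderiv_eq]
  exact h.hasDerivWithinAt_fderiv hF (K.isMetricOn_prodG K') hs hy

/-- The differentials of the components of `F`, in charts. -/
theorem chartD_fst_fderiv {f : M → M × N}
    (hf : ContMDiff 𝓡₀ 𝓟 ∞ f)
    {y : 𝓔}
    (hy : y ∈ chartDom 𝓡₀ 𝓟 x q f)
    (v : 𝓔) :
    chartD 𝓡₀ q.1 (inCharts 𝓡₀ 𝓟 x q f y).1
        (fderiv ℝ (inCharts 𝓡₀ 𝓟 x q f) y v).1 =
      (mfd 𝓡₀ 𝓟 f ((extChartAt 𝓡₀ x).symm y)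
        (chartD 𝓡₀ x y v)).1 ∧
    chartD 𝓡₀ q.2 (inCharts 𝓡₀ 𝓟 x q f y).2
        (fderiv ℝ (inCharts 𝓡₀ 𝓟 x q f) y v).2 =
      (mfd 𝓡₀ 𝓟 f ((extChartAt 𝓡₀ x).symm y)
        (chartD 𝓡₀ x y v)).2 := by
  have h := chartD_fderiv_inCharts hy.1 (hf.mdifferentiable (by simp) _) hy.2 v
  have hm : inCharts 𝓡₀ 𝓟 x q f y ∈
      (extChartAt 𝓟 q).target :=
    (extChartAt 𝓟 q).map_source hy.2
  rw [chartD_prod hm] at h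
  exact ⟨congrArg Prod.fst h, congrArg Prod.snd h⟩

theorem symm_inCharts {f : M → M × N} {y : 𝓔}
    (hy : y ∈ chartDom 𝓡₀ 𝓟 x q f) :
    (extChartAt 𝓡₀ q.1).symm
        (inCharts 𝓡₀ 𝓟 x q f y).1 =
      (f ((extChartAt 𝓡₀ x).symm y)).1 ∧
    (extChartAt 𝓡₀ q.2).symm
        (inCharts 𝓡₀ 𝓟 x q f y).2 =
      (f ((extChartAt 𝓡₀ x).symm y)).2 := by
  have h := (extChartAt 𝓟 q).left_inv hy.2
  rw [extChartAt_prod] at h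
  unfold inCharts
  rw [extChartAt_prod]
  exact ⟨congrArg Prod.fst h, congrArg Prod.snd h⟩

end KahlerStructure

end

section

theorem Real.sign_eq_sign_mul_mul_sign {d : ℝ} (hd : d ≠ 0) (v : ℝ) :
    Real.sign v = Real.sign (d * v) * Real.sign d := by
  rcases lt_or_gt_of_ne hd with h | h <;> rcases lt_trichotomy v 0 with h' | h' | h'
  · rw [sign_of_neg h, sign_of_neg h', sign_of_pos (mul_pos_of_neg_of_neg h h')]; simp
  · simp [h']
  · rw [sign_of_neg h, sign_of_pos h', sign_of_neg (mul_neg_of_neg_of_pos h h')]; simp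
  · rw [sign_of_pos h, sign_of_neg h', sign_of_neg (mul_neg_of_pos_of_neg h h')]; simp
  · simp [h']
  · rw [sign_of_pos h, sign_of_pos h', sign_of_pos (mul_pos h h')]; simp

namespace KahlerStructure

variable {n : ℕ} {M : Type*} [TopologicalSpace M]
  [ChartedSpace (EuclideanSpace ℝ (Fin (2 * n))) M] [IsManifold (𝓡 (2 * n)) ∞ M]
  {N : Type*} [TopologicalSpace N]
  [ChartedSpace (EuclideanSpace ℝ (Fin (2 * n))) N] [IsManifold (𝓡 (2 * n)) ∞ N]
  {K : KahlerStructure n M} {K' : KahlerStructure n N}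

local notation "𝓔" => EuclideanSpace ℝ (Fin (2 * n))
local notation "𝓡₀" => 𝓡 (2 * n)
local notation "𝓟" => ModelWithCorners.prod (𝓡 (2 * n)) (𝓡 (2 * n))

/-! ### The function `*Ω` in charts -/

/-- The Kähler form at `p`, as a bilinear form on the model space. -/
def kform (K : KahlerStructure n M) (p : M) : 𝓔 →L[ℝ] 𝓔 →L[ℝ] ℝ :=
  formL (K.g p) (K.Jp p) (ContinuousLinearMap.id ℝ 𝓔)

/-- The Kähler form in a chart. -/
theorem kahlerForm_inChart {x : M} {y : 𝓔} (hy : y ∈ (extChartAt 𝓡₀ x).target) (u v : 𝓔) :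
    metricInChart K.g x y (K.JInChart x y u) v =
      K.kform ((extChartAt 𝓡₀ x).symm y) (chartD 𝓡₀ x y u) (chartD 𝓡₀ x y v) := by
  rw [metricInChart_apply, K.chartD_JInChart hy]
  rfl

theorem isUnit_det_chartD {x : M} {y : 𝓔} (hy : y ∈ (extChartAt 𝓡₀ x).target) :
    LinearMap.det (chartD 𝓡₀ x y : 𝓔 →ₗ[ℝ] 𝓔) ≠ 0 := by
  have h : (chartA 𝓡₀ x ((extChartAt 𝓡₀ x).symm y) : 𝓔 →ₗ[ℝ] 𝓔) ∘ₗ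
      (chartD 𝓡₀ x y : 𝓔 →ₗ[ℝ] 𝓔) = LinearMap.id := LinearMap.ext fun v => chartA_chartD hy v
  have h2 := congrArg LinearMap.det h
  rw [LinearMap.det_comp, LinearMap.det_id] at h2
  exact right_ne_zero_of_mul (h2 ▸ one_ne_zero)

/-- The orientation of the chart at `x`, at the coordinate point `y`. -/
def chartVol (K : KahlerStructure n M) (x : M) (y : 𝓔) : ℝ :=
  volL (formL (metricInChart K.g x y) (K.JInChart x y) (ContinuousLinearMap.id ℝ 𝓔))
    (EuclideanSpace.basisFun (Fin (2 * n)) ℝ).toBasis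

theorem chartVol_eq {x : M} {y : 𝓔} (hy : y ∈ (extChartAt 𝓡₀ x).target) :
    K.chartVol x y = LinearMap.det (chartD 𝓡₀ x y : 𝓔 →ₗ[ℝ] 𝓔) *
      K.volumeForm ((extChartAt 𝓡₀ x).symm y) (EuclideanSpace.basisFun (Fin (2 * n)) ℝ) := by
  set p := (extChartAt 𝓡₀ x).symm y
  have h1 := volL_comp (n := n) (by simp) (K.kform p) (chartD 𝓡₀ x y : 𝓔 →ₗ[ℝ] 𝓔)
    (EuclideanSpace.basisFun (Fin (2 * n)) ℝ)
  refine Eq.trans ?_ h1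
  rw [chartVol, OrthonormalBasis.coe_toBasis]
  have hB : ∀ u v, formL (metricInChart K.g x y) (K.JInChart x y) (ContinuousLinearMap.id ℝ 𝓔) u v =
      K.kform p (chartD 𝓡₀ x y u) (chartD 𝓡₀ x y v) := fun u v => by
    rw [formL_apply]
    exact kahlerForm_inChart hy u v
  unfold volL
  simp only [hB]
  rfl

theorem continuousAt_chartVol {x : M} {y : 𝓔} (hy : y ∈ (extChartAt 𝓡₀ x).target) :
    ContinuousAt (K.chartVol x) y := by
  have h := K.isKahlerOn x
  have h1 := (h.metric.contDiffAt hy).continuousAt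
  have h2 := (h.differentiableAt hy).continuousAt
  have h3 : ∀ u v : 𝓔, ContinuousAt (fun z => metricInChart K.g x z (K.JInChart x z u) v) y :=
    fun u v => (h1.clm_apply (h2.clm_apply continuousAt_const)).clm_apply continuousAt_const
  generalize hb : (EuclideanSpace.basisFun (Fin (2 * n)) ℝ).toBasis = b
  have h5 : K.chartVol x = fun z => pfaff fun i j => metricInChart K.g x z
      (K.JInChart x z (b i)) (b j) := by
    rw [← hb]
    rfl
  have h4 : ContinuousAt (fun z => fun i j : Fin (2 * n) => metricInChart K.g x z
      (K.JInChart x z (b i)) (b j)) y :=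
    continuousAt_pi.2 fun i => continuousAt_pi.2 fun j => h3 _ _
  rw [h5]
  exact ContinuousAt.comp (g := pfaff) (contDiff_pfaff (n := n)).continuous.continuousAt h4

theorem mem_target_of_mem_chartDom {f : M → M × N} {x : M} {q : M × N} {y : 𝓔}
    (hy : y ∈ chartDom 𝓡₀ 𝓟 x q f) :
    (inCharts 𝓡₀ 𝓟 x q f y).1 ∈ (extChartAt 𝓡₀ q.1).target ∧
      (inCharts 𝓡₀ 𝓟 x q f y).2 ∈ (extChartAt 𝓡₀ q.2).target := by
  have h : inCharts 𝓡₀ 𝓟 x q f y ∈ (extChartAt 𝓟 q).target := (extChartAt 𝓟 q).map_source hy.2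
  rw [target_prod] at h
  exact h

theorem kahlerForm_inChart_fst {f : M → M × N} (hf : ContMDiff 𝓡₀ 𝓟 ∞ f) {x : M} {q : M × N}
    {y : 𝓔} (hy : y ∈ chartDom 𝓡₀ 𝓟 x q f) (u v : 𝓔) :
    metricInChart K.g q.1 (inCharts 𝓡₀ 𝓟 x q f y).1
      (K.JInChart q.1 (inCharts 𝓡₀ 𝓟 x q f y).1 (fderiv ℝ (inCharts 𝓡₀ 𝓟 x q f) y u).1)
      (fderiv ℝ (inCharts 𝓡₀ 𝓟 x q f) y v).1 =
    K.kform (f ((extChartAt 𝓡₀ x).symm y)).1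
      (dF₁ f ((extChartAt 𝓡₀ x).symm y) (chartD 𝓡₀ x y u))
      (dF₁ f ((extChartAt 𝓡₀ x).symm y) (chartD 𝓡₀ x y v)) := by
  rw [kahlerForm_inChart (mem_target_of_mem_chartDom hy).1, (chartD_fst_fderiv hf hy u).1,
    (chartD_fst_fderiv hf hy v).1]
  exact congrArg (fun p => K.kform p _ _) (symm_inCharts hy).1

theorem kahlerForm_inChart_snd {f : M → M × N} (hf : ContMDiff 𝓡₀ 𝓟 ∞ f) {x : M} {q : M × N}
    {y : 𝓔} (hy : y ∈ chartDom 𝓡₀ 𝓟 x q f) (u v : 𝓔) :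
    metricInChart K'.g q.2 (inCharts 𝓡₀ 𝓟 x q f y).2
      (K'.JInChart q.2 (inCharts 𝓡₀ 𝓟 x q f y).2 (fderiv ℝ (inCharts 𝓡₀ 𝓟 x q f) y u).2)
      (fderiv ℝ (inCharts 𝓡₀ 𝓟 x q f) y v).2 =
    K'.kform (f ((extChartAt 𝓡₀ x).symm y)).2
      (dF₂ f ((extChartAt 𝓡₀ x).symm y) (chartD 𝓡₀ x y u))
      (dF₂ f ((extChartAt 𝓡₀ x).symm y) (chartD 𝓡₀ x y v)) := by
  rw [kahlerForm_inChart (mem_target_of_mem_chartDom hy).2, (chartD_fst_fderiv hf hy u).2,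
    (chartD_fst_fderiv hf hy v).2]
  exact congrArg (fun p => K'.kform p _ _) (symm_inCharts hy).2

theorem pull_prodM_inCharts {f : M → M × N} (hf : ContMDiff 𝓡₀ 𝓟 ∞ f) {x : M} {q : M × N}
    {y : 𝓔} (hy : y ∈ chartDom 𝓡₀ 𝓟 x q f) (u v : 𝓔) :
    pull (prodM (metricInChart K.g q.1) (metricInChart K'.g q.2)) (inCharts 𝓡₀ 𝓟 x q f) y u v =
      pullbackMetric (I := 𝓡₀) (K.prodG K') f ((extChartAt 𝓡₀ x).symm y) (chartD 𝓡₀ x y u)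
        (chartD 𝓡₀ x y v) := by
  have h1 := pull_inCharts (I := 𝓡₀) (I' := 𝓟) (K.prodG K') hy.1
    (hf.mdifferentiable (by simp) _) hy.2
  have h2 := DFunLike.congr_fun (DFunLike.congr_fun h1 u) v
  rw [metricInChart_apply, pull_apply] at h2
  rw [h2, pull_apply, prodG, metricInChart_prodMetric]
  exact (extChartAt 𝓟 q).map_source hy.2

/-- In charts, `*Ω` is `starF` up to the sign of the orientation of the chart at `x`. -/
theorem starOmega_eq {f : M → M × N} (hf : ContMDiff 𝓡₀ 𝓟 ∞ f) {x : M} {q : M × N} {y : 𝓔}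
    (hy : y ∈ chartDom 𝓡₀ 𝓟 x q f) :
    K.starOmega K' f ((extChartAt 𝓡₀ x).symm y) = Real.sign (K.chartVol x y) *
      starF (metricInChart K.g q.1) (metricInChart K'.g q.2) (K.JInChart q.1)
        (EuclideanSpace.basisFun (Fin (2 * n)) ℝ).toBasis (inCharts 𝓡₀ 𝓟 x q f) y := by
  set p := (extChartAt 𝓡₀ x).symm y with hp
  set b := (EuclideanSpace.basisFun (Fin (2 * n)) ℝ).toBasis with hb
  obtain ⟨P, hP⟩ : ∃ P : 𝓔 →L[ℝ] 𝓔, P = dF₁ (n := n) f p := ⟨_, rfl⟩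
  obtain ⟨B, hB⟩ : ∃ B : 𝓔 →L[ℝ] 𝓔 →L[ℝ] ℝ, B = (K.kform (f p).1).bilinearComp P P := ⟨_, rfl⟩
  obtain ⟨g, hg⟩ : ∃ g : 𝓔 →L[ℝ] 𝓔 →L[ℝ] ℝ,
      g = pullbackMetric (I := 𝓡₀) (K.prodG K') f p := ⟨_, rfl⟩
  have hdet := isUnit_det_chartD hy.1
  have h1 : starF (metricInChart K.g q.1) (metricInChart K'.g q.2) (K.JInChart q.1) b
      (inCharts 𝓡₀ 𝓟 x q f) y = starD B g fun i => (chartD 𝓡₀ x y : 𝓔 →ₗ[ℝ] 𝓔) (b i) := by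
    have hB' : ∀ u v, formL (metricInChart K.g q.1 (inCharts 𝓡₀ 𝓟 x q f y).1)
        (K.JInChart q.1 (inCharts 𝓡₀ 𝓟 x q f y).1)
        (ContinuousLinearMap.fst ℝ 𝓔 𝓔 ∘L fderiv ℝ (inCharts 𝓡₀ 𝓟 x q f) y) u v =
        B (chartD 𝓡₀ x y u) (chartD 𝓡₀ x y v) := fun u v => by
      rw [formL_apply, hB, hP]
      exact kahlerForm_inChart_fst hf hy u v
    have hg' : ∀ u v, pull (prodM (metricInChart K.g q.1) (metricInChart K'.g q.2))
        (inCharts 𝓡₀ 𝓟 x q f) y u v = g (chartD 𝓡₀ x y u) (chartD 𝓡₀ x y v) := fun u v => by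
      rw [hg]
      exact pull_prodM_inCharts hf hy u v
    unfold starF starD volL
    simp only [hB', hg']
    rfl
  rw [h1, starD_comp (by simp) B g b _ hdet, chartVol_eq hy.1, ← mul_assoc]
  have h2 : K.starOmega K' f p = Real.sign (K.volumeForm p
      (EuclideanSpace.basisFun (Fin (2 * n)) ℝ)) * starD B g b := by
    rw [starD, ← mul_div_assoc, hb, OrthonormalBasis.coe_toBasis, hB, hP, hg]
    rfl
  rw [h2]
  congr 1
  exact Real.sign_eq_sign_mul_mul_sign hdet _

end KahlerStructure

end

section

namespace KahlerStructure

variable {n : ℕ} {M : Type*} [TopologicalSpace M]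
  [ChartedSpace (EuclideanSpace ℝ (Fin (2 * n))) M] [IsManifold (𝓡 (2 * n)) ∞ M]
  {N : Type*} [TopologicalSpace N]
  [ChartedSpace (EuclideanSpace ℝ (Fin (2 * n))) N] [IsManifold (𝓡 (2 * n)) ∞ N]
  {K : KahlerStructure n M} {K' : KahlerStructure n N}

local notation "𝓔" => EuclideanSpace ℝ (Fin (2 * n))
local notation "𝓡₀" => 𝓡 (2 * n)
local notation "𝓟" => ModelWithCorners.prod (𝓡 (2 * n)) (𝓡 (2 * n))

/-! ### Immersions into a product, at the centre of the charts -/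

theorem mfd_eq_fderiv {f : M → M × N} (hf : ContMDiff 𝓡₀ 𝓟 ∞ f) (x : M) :
    mfd 𝓡₀ 𝓟 f x = fderiv ℝ (inCharts 𝓡₀ 𝓟 x (f x) f) (extChartAt 𝓡₀ x x) := by
  have hx : f ((extChartAt 𝓡₀ x).symm (extChartAt 𝓡₀ x x)) ∈ (extChartAt 𝓟 (f x)).source := by
    rw [extChartAt_to_inv]
    exact mem_extChartAt_source (f x)
  rw [fderiv_inCharts (mem_extChartAt_target x) (hf.mdifferentiable (by simp) _) hx,
    extChartAt_to_inv, chartA_self, chartD_self]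
  rfl

theorem JInChart_self (K : KahlerStructure n M) (x : M) :
    K.JInChart x (extChartAt 𝓡₀ x x) = K.Jp x := by
  rw [JInChart, extChartAt_to_inv, chartA_self, chartD_self]
  rfl

theorem inCharts_self_fst (f : M → M × N) (x : M) :
    (inCharts 𝓡₀ 𝓟 x (f x) f (extChartAt 𝓡₀ x x)).1 = extChartAt 𝓡₀ (f x).1 (f x).1 ∧
    (inCharts 𝓡₀ 𝓟 x (f x) f (extChartAt 𝓡₀ x x)).2 = extChartAt 𝓡₀ (f x).2 (f x).2 := by
  rw [inCharts_self, extChartAt_prod]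
  exact ⟨rfl, rfl⟩

theorem metricInChart_pullback_prodG {f : M → M × N} (hf : ContMDiff 𝓡₀ 𝓟 ∞ f) (x : M) :
    metricInChart (I := 𝓡₀) (pullbackMetric (K.prodG K') f) x =ᶠ[𝓝 (extChartAt 𝓡₀ x x)]
      pull (prodM (metricInChart K.g (f x).1) (metricInChart K'.g (f x).2))
        (inCharts 𝓡₀ 𝓟 x (f x) f) := by
  refine (metricInChart_pullbackMetric hf x).trans ?_
  have hmem := mem_chartDom (I := 𝓡₀) (I' := 𝓟) (x := x) (F := f)
  refine pull_congr Filter.EventuallyEq.rfl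
    (contDiffAt_inCharts hmem.1 hf.contMDiffAt hmem.2).continuousAt ?_
  exact metricInChart_prodMetric_eventuallyEq K.g K'.g
    ((extChartAt 𝓟 (f x)).map_source hmem.2)

theorem secondFundamentalForm_prodG {f : M → M × N} (hf : ContMDiff 𝓡₀ 𝓟 ∞ f) (x : M) (u v : 𝓔) :
    secondFundamentalForm (I := 𝓡₀) (K.prodG K') f x u v =
      sff (prodM (metricInChart K.g (f x).1) (metricInChart K'.g (f x).2))
        (inCharts 𝓡₀ 𝓟 x (f x) f) (extChartAt 𝓡₀ x x) u v := by
  have hmem := mem_chartDom (I := 𝓡₀) (I' := 𝓟) (x := x) (F := f)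
  have h := sff_congr Filter.EventuallyEq.rfl
    (contDiffAt_inCharts hmem.1 hf.contMDiffAt hmem.2).continuousAt
    (metricInChart_prodMetric_eventuallyEq K.g K'.g ((extChartAt 𝓟 (f x)).map_source hmem.2))
  exact (secondFundamentalForm_eq_sff hf x u v).trans
    (DFunLike.congr_fun (DFunLike.congr_fun h u) v)

theorem laplacian_eq_mtr {f : M → M × N} (hf : ContMDiff 𝓡₀ 𝓟 ∞ f) (x : M) {φ : M → ℝ} {ψ : 𝓔 → ℝ}
    (h : φ ∘ (extChartAt 𝓡₀ x).symm =ᶠ[𝓝 (extChartAt 𝓡₀ x x)] ψ) :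
    laplacian (pullbackMetric (I := 𝓡₀) (K.prodG K') f) φ x =
      mtr (pull (prodM (metricInChart K.g (f x).1) (metricInChart K'.g (f x).2))
        (inCharts 𝓡₀ 𝓟 x (f x) f) (extChartAt 𝓡₀ x x)) (fun u w =>
          fderiv ℝ (fderiv ℝ ψ) (extChartAt 𝓡₀ x x) u w - fderiv ℝ ψ (extChartAt 𝓡₀ x x)
            (chrL (pull (prodM (metricInChart K.g (f x).1) (metricInChart K'.g (f x).2))
              (inCharts 𝓡₀ 𝓟 x (f x) f)) (extChartAt 𝓡₀ x x) u w)) := by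
  have h1 := metricInChart_pullback_prodG (K := K) (K' := K') hf x
  rw [← chrL_congr h1, ← h1.eq_of_nhds, metricInChart_self, ← h.fderiv.fderiv_eq,
    ← h.fderiv_eq]
  rfl

theorem curvatureTensor_eq_riem (K : KahlerStructure n M) (p : M) (u v : 𝓔) :
    curvatureTensor K.g p u v u v = metricInChart K.g p (extChartAt 𝓡₀ p p)
      (riem (metricInChart K.g p) (extChartAt 𝓡₀ p p) u v v) u := by
  rw [metricInChart_self, ← curvature_eq_riem K.g p (K.isKahlerOn p).metric (mem_extChartAt_target p)]
  rfl

theorem isLagrangian_inCharts {f : M → M × N} (hf : ContMDiff 𝓡₀ 𝓟 ∞ f)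
    (hLag : K.IsLagrangian K' f) {x : M} {q : M × N} {y : 𝓔} (hy : y ∈ chartDom 𝓡₀ 𝓟 x q f)
    (u v : 𝓔) :
    prodM (metricInChart K.g q.1) (metricInChart K'.g q.2) (inCharts 𝓡₀ 𝓟 x q f y)
      (prodJm (K.JInChart q.1) (K'.JInChart q.2) (inCharts 𝓡₀ 𝓟 x q f y)
        (fderiv ℝ (inCharts 𝓡₀ 𝓟 x q f) y u)) (fderiv ℝ (inCharts 𝓡₀ 𝓟 x q f) y v) = 0 := by
  rw [prodM_apply, prodJm_apply]
  simp only [map_neg, neg_apply]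
  rw [kahlerForm_inChart_fst hf hy, kahlerForm_inChart_snd hf hy]
  exact hLag _ _ _

end KahlerStructure

end

section

/-! ### The evolution equation on a Lagrangian submanifold -/

namespace KahlerStructure

variable {n : ℕ} {M : Type*} [TopologicalSpace M]
  [ChartedSpace (EuclideanSpace ℝ (Fin (2 * n))) M] [IsManifold (𝓡 (2 * n)) ∞ M]
  {N : Type*} [TopologicalSpace N]
  [ChartedSpace (EuclideanSpace ℝ (Fin (2 * n))) N] [IsManifold (𝓡 (2 * n)) ∞ N]
  {K : KahlerStructure n M} {K' : KahlerStructure n N}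

local notation "𝓔" => EuclideanSpace ℝ (Fin (2 * n))
local notation "𝓡₀" => 𝓡 (2 * n)
local notation "𝓟" => ModelWithCorners.prod (𝓡 (2 * n)) (𝓡 (2 * n))

/-- Where `*Ω` is positive, the differential of the first component of an immersion is invertible,
so that the immersed submanifold is locally a graph. -/
theorem exists_inverse_of_starOmega_pos {f : M → M × N} (hf : ContMDiff 𝓡₀ 𝓟 ∞ f) {x : M}
    (hpos : 0 < K.starOmega K' f x) :
    ∃ Q : 𝓔 →L[ℝ] 𝓔, Q = (ContinuousLinearMap.fst ℝ 𝓔 𝓔 ∘L mfd 𝓡₀ 𝓟 f x).inverse ∧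
      (∀ v, (mfd 𝓡₀ 𝓟 f x (Q v)).1 = v) ∧ ∀ v, Q (mfd 𝓡₀ 𝓟 f x v).1 = v := by
  have h := starOmega_eq (K := K) (K' := K') hf (mem_chartDom (I := 𝓡₀) (I' := 𝓟) (x := x) (F := f))
  rw [extChartAt_to_inv] at h
  rw [h] at hpos
  have hunit := IsImmersionOn.isUnit_of_starF_pos _ hpos
  rw [← mfd_eq_fderiv hf x] at hunit
  obtain ⟨D, hD⟩ : ∃ D : 𝓔 →L[ℝ] 𝓔 × 𝓔, D = mfd 𝓡₀ 𝓟 f x := ⟨_, rfl⟩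
  rw [← hD] at hunit ⊢
  obtain ⟨e, he⟩ : (ContinuousLinearMap.fst ℝ 𝓔 𝓔 ∘L D).IsInvertible := by
    obtain ⟨e, he⟩ := hunit
    exact ⟨ContinuousLinearEquiv.ofUnit e, by rw [← he]; rfl⟩
  refine ⟨_, rfl, fun v => ?_, fun v => ?_⟩
  · rw [← he, ContinuousLinearMap.inverse_equiv]
    have h2 : (D (e.symm v)).1 = (ContinuousLinearMap.fst ℝ 𝓔 𝓔 ∘L D) (e.symm v) := rfl
    exact h2.trans (by rw [← he]; exact e.apply_symm_apply v)
  · rw [← he, ContinuousLinearMap.inverse_equiv]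
    have h2 : (D v).1 = (ContinuousLinearMap.fst ℝ 𝓔 𝓔 ∘L D) v := rfl
    rw [h2, ← he]
    exact e.symm_apply_apply v

/-- If the immersed submanifold is Lagrangian, the map of which it is locally the graph is
symplectic. -/
theorem symplectic_graphDeriv {f : M → M × N} (hf : ContMDiff 𝓡₀ 𝓟 ∞ f) {x : M}
    (hpos : 0 < K.starOmega K' f x) (hLag : K.IsLagrangian K' f) (u v : 𝓔) :
    K'.kform (f x).2 (graphDeriv (n := n) f x u) (graphDeriv (n := n) f x v) =
      K.kform (f x).1 u v := by
  obtain ⟨Q, hQ, hPQ, -⟩ := exists_inverse_of_starOmega_pos hf hpos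
  have hL : ∀ v : 𝓔, graphDeriv (n := n) f x v = (mfd 𝓡₀ 𝓟 f x (Q v)).2 := fun v => by
    rw [hQ]
    rfl
  have h : K.kform (f x).1 (mfd 𝓡₀ 𝓟 f x (Q u)).1 (mfd 𝓡₀ 𝓟 f x (Q v)).1 -
      K'.kform (f x).2 (mfd 𝓡₀ 𝓟 f x (Q u)).2 (mfd 𝓡₀ 𝓟 f x (Q v)).2 = 0 := hLag x (Q u) (Q v)
  rw [hPQ, hPQ, ← hL, ← hL] at h
  exact (sub_eq_zero.1 h).symm

/-- The evolution equation at a time when the flow is Lagrangian: the local computation in the charts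
at `x` and `F t x`, rewritten in terms of tensors on the manifolds. -/
theorem evolution_of_isLagrangian {T : ℝ} {F : ℝ → M → M × N}
    (hF : IsMeanCurvatureFlow 𝓡₀ (K.prodG K') T F) {t : ℝ} (ht : t ∈ Ico 0 T) {x : M}
    (hpos : 0 < K.starOmega K' (F t) x) (hLag : K.IsLagrangian K' (F t)) :
    ContMDiffAt 𝓡₀ 𝓘(ℝ, ℝ) ∞ (fun y => Real.log (K.starOmega K' (F t) y)) x ∧
      (∃ a lam, K.IsSingularFrame K' (graphDeriv (F t) x) a lam) ∧
      ∀ a lam, K.IsSingularFrame K' (graphDeriv (F t) x) a lam →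
        HasDerivWithinAt (fun s => Real.log (K.starOmega K' (F s) x))
          (laplacian (pullbackMetric (I := 𝓡₀) (K.prodG K') (F t))
              (fun y => Real.log (K.starOmega K' (F t) y)) x
            + quadQTilde lam (K.hCoeff K' (F t) x a lam)
            + K.curvatureTerm K' (graphDeriv (F t) x) a lam)
          (Ico 0 T) t := by
  obtain ⟨S, O, hchart, htS, hxO⟩ := hF.exists_isFlowChart ht x
  have hFt := hF.contMDiff ht
  set q := F t x with hq
  set y := extChartAt 𝓡₀ x x with hy
  set b := (EuclideanSpace.basisFun (Fin (2 * n)) ℝ).toBasis with hb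
  have hx : (extChartAt 𝓡₀ x).symm y = x := extChartAt_to_inv x
  have him := isImmersionOn_of_isFlowChart hchart hF htS
  have h₁ := K.isKahlerOn q.1
  have h₂ := K'.isKahlerOn q.2
  set ς := Real.sign (K.chartVol x y) with hς
  have hstar : ∀ s ∈ S, K.starOmega K' (F s) x = ς * starF (metricInChart K.g q.1)
      (metricInChart K'.g q.2) (K.JInChart q.1) b (inCharts 𝓡₀ 𝓟 x q (F s)) y := fun s hs => by
    have h := starOmega_eq (K := K) (K' := K') (hF.contMDiff (hchart.subset hs))
      (hchart.mem s hs hxO)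
    rwa [hx] at h
  have hpos' := hpos
  rw [hstar t htS] at hpos'
  -- the orientation of the chart at `x` is constant near `x`
  have hvol : K.chartVol x y ≠ 0 := fun h0 => by
    rw [hς, h0, Real.sign_zero, zero_mul] at hpos'
    exact lt_irrefl _ hpos'
  have hsign : ∀ᶠ z in 𝓝 y, Real.sign (K.chartVol x z) = ς := by
    have hc := continuousAt_chartVol (K := K) (mem_extChartAt_target (I := 𝓡₀) x)
    rcases lt_or_gt_of_ne hvol with h | h
    · filter_upwards [hc.eventually_lt continuousAt_const h] with z hz
      rw [hς, Real.sign_of_neg h, Real.sign_of_neg hz]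
    · filter_upwards [continuousAt_const.eventually_lt hc h] with z hz
      rw [hς, Real.sign_of_pos h, Real.sign_of_pos hz]
  set ψ : 𝓔 → ℝ := fun z => Real.log (ς * starF (metricInChart K.g q.1)
      (metricInChart K'.g q.2) (K.JInChart q.1) b (inCharts 𝓡₀ 𝓟 x q (F t)) z) with hψ
  have hgerm : (fun z => Real.log (K.starOmega K' (F t) z)) ∘ (extChartAt 𝓡₀ x).symm =ᶠ[𝓝 y] ψ := by
    filter_upwards [hsign, hchart.isOpen.mem_nhds hxO] with z hz hzO
    show Real.log (K.starOmega K' (F t) ((extChartAt 𝓡₀ x).symm z)) = _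
    rw [starOmega_eq hFt (hchart.mem t htS hzO), hz]
  have hsmooth : ContDiffAt ℝ ∞ ψ y := him.contDiffAt_log_starF h₁ b hxO hpos'
  refine ⟨?_, ?_⟩
  · have h1 : ContMDiffAt 𝓡₀ 𝓘(ℝ, ℝ) ∞ (ψ ∘ extChartAt 𝓡₀ x) x :=
      ContMDiffAt.comp x hsmooth.contMDiffAt contMDiffAt_extChartAt
    refine h1.congr_of_eventuallyEq ?_
    have h2 := (continuousAt_extChartAt (I := 𝓡₀) x).eventually hgerm
    filter_upwards [h2, extChartAt_source_mem_nhds (I := 𝓡₀) x] with z hz hzs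
    rw [Function.comp_apply, ← hz, Function.comp_apply, (extChartAt 𝓡₀ x).left_inv hzs]
  -- the differential of the first component is invertible
  obtain ⟨D, hD⟩ : ∃ D : 𝓔 →L[ℝ] 𝓔 × 𝓔, D = fderiv ℝ (inCharts 𝓡₀ 𝓟 x q (F t)) y := ⟨_, rfl⟩
  have hDF : mfd 𝓡₀ 𝓟 (F t) x = D := (mfd_eq_fderiv hFt x).trans hD.symm
  obtain ⟨Q, hQ, hPQ, hQP⟩ := exists_inverse_of_starOmega_pos hFt hpos
  rw [hDF] at hQ hPQ hQP
  have hgraph : ∀ v : 𝓔, graphDeriv (n := n) (F t) x v = (D (Q v)).2 := fun v => by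
    rw [hQ, ← hDF]
    rfl
  have hframe : ∀ (a : Fin (2 * n) → 𝓔) (lam : Fin (2 * n) → ℝ) (i : Fin (2 * n)),
      tangentFrame (F t) x a lam i = (Real.sqrt (1 + lam i ^ 2))⁻¹ • Q (a i) := fun a lam i => by
    rw [hQ, ← hDF]
    rfl
  obtain ⟨L, hLg⟩ : ∃ L : 𝓔 →L[ℝ] 𝓔, L = graphDeriv (n := n) (F t) x := ⟨_, rfl⟩
  have hL : ∀ v, L v = (D (Q v)).2 := fun v => by
    rw [hLg]
    exact hgraph v
  obtain ⟨g₁, hg₁'⟩ : ∃ g₁ : 𝓔 →L[ℝ] 𝓔 →L[ℝ] ℝ, g₁ = K.g q.1 := ⟨_, rfl⟩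
  obtain ⟨g₂, hg₂'⟩ : ∃ g₂ : 𝓔 →L[ℝ] 𝓔 →L[ℝ] ℝ, g₂ = K'.g q.2 := ⟨_, rfl⟩
  have hg₁ : metricInChart K.g q.1 (inCharts 𝓡₀ 𝓟 x q (F t) y).1 = g₁ := by
    rw [(inCharts_self_fst (F t) x).1, metricInChart_self, hg₁']
  have hg₂ : metricInChart K'.g q.2 (inCharts 𝓡₀ 𝓟 x q (F t) y).2 = g₂ := by
    rw [(inCharts_self_fst (F t) x).2, metricInChart_self, hg₂']
  have hJ₁ : K.JInChart q.1 (inCharts 𝓡₀ 𝓟 x q (F t) y).1 = K.Jp q.1 := by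
    rw [(inCharts_self_fst (F t) x).1, JInChart_self]
  have hJ₂ : K'.JInChart q.2 (inCharts 𝓡₀ 𝓟 x q (F t) y).2 = K'.Jp q.2 := by
    rw [(inCharts_self_fst (F t) x).2, JInChart_self]
  have hi₁ : IsInner g₁ := by
    rw [← hg₁]
    exact h₁.metric.isInner (him.mapsTo hxO).1
  have hi₂ : IsInner g₂ := by
    rw [← hg₂]
    exact h₂.metric.isInner (him.mapsTo hxO).2
  constructor
  · have hsymp : ∀ u v : 𝓔, g₂ (K'.Jp q.2 (L u)) (L v) =
        g₁ (K.Jp q.1 u) v := fun u v => by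
      rw [hg₁', hg₂', hLg]
      exact symplectic_graphDeriv hFt hpos hLag u v
    obtain ⟨a, lam, h1, h2, h3, h4, h5⟩ := hi₁.exists_singular_frame (n := n) (J := K.Jp q.1) (K.J_sq q.1)
      (by rw [hg₁']; exact K.J_orthogonal q.1) hi₂ (J' := K'.Jp q.2) (K'.J_sq q.2) rfl hsymp (by simp)
    refine ⟨a, lam, ⟨by rw [hg₁'] at h1; exact h1, h2, h3, h4, ?_⟩⟩
    intro i v
    have h6 := h5 i v
    rw [hLg, hg₁', hg₂'] at h6
    exact h6
  · intro (a : Fin (2 * n) → 𝓔) lam hfr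
    have hdiag : ∀ i (v : 𝓔), metricInChart K'.g q.2 (inCharts 𝓡₀ 𝓟 x q (F t) y).2
        (fderiv ℝ (inCharts 𝓡₀ 𝓟 x q (F t)) y (Q (a i))).2
        (fderiv ℝ (inCharts 𝓡₀ 𝓟 x q (F t)) y (Q v)).2 =
        lam i ^ 2 * metricInChart K.g q.1 (inCharts 𝓡₀ 𝓟 x q (F t) y).1 (a i) v := fun i v => by
      rw [← hD, ← hL, ← hL, hg₁, hg₂, hLg, hg₁', hg₂']
      exact hfr.diag i v
    have key := him.evolution_singular_frame h₁ h₂ b hxO hpos'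
      (F := fun s => inCharts 𝓡₀ 𝓟 x q (F s))
      (hasDerivWithinAt_of_isFlowChart hchart hF htS hxO)
      (hasDerivWithinAt_fderiv_of_isFlowChart hchart hF htS hxO)
      (fun z hz u v => isLagrangian_inCharts hFt hLag (hchart.mem t htS hz) u v)
      (Q := Q) (by rw [← hD]; exact hPQ) (by rw [← hD]; exact hQP) (a := a) (lam := lam)
      (by rw [hg₁, hg₁']; exact hfr.orthonormal) (by rw [hJ₁]; exact hfr.J_frame) hfr.pos hfr.pair hdiag
    have hS : S ∈ 𝓝[Ico 0 T] t := by
      rw [← hchart.nhdsWithin_eq htS]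
      exact self_mem_nhdsWithin
    have key' := key.mono_of_mem_nhdsWithin hS
    have hev : (fun s => Real.log (K.starOmega K' (F s) x)) =ᶠ[𝓝[Ico 0 T] t]
        fun s => Real.log (ς * starF (metricInChart K.g q.1) (metricInChart K'.g q.2)
          (K.JInChart q.1) b (inCharts 𝓡₀ 𝓟 x q (F s)) y) := by
      filter_upwards [hS] with s hs
      rw [hstar s hs]
    refine (key'.congr_of_eventuallyEq hev (by rw [hstar t htS])).congr_deriv ?_
    rw [laplacian_eq_mtr hFt x hgerm]
    congr 1
    · congr 2
      funext i j k
      obtain ⟨X, hX⟩ : ∃ X : 𝓔 × 𝓔, X = secondFundamentalForm (I := 𝓡₀) (K.prodG K') (F t) x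
        (tangentFrame (n := n) (F t) x a lam i) (tangentFrame (n := n) (F t) x a lam j) :=
        ⟨_, rfl⟩
      have h7 : sff (prodM (metricInChart K.g q.1) (metricInChart K'.g q.2))
          (inCharts 𝓡₀ 𝓟 x q (F t)) y ((Real.sqrt (1 + lam i ^ 2))⁻¹ • Q (a i))
          ((Real.sqrt (1 + lam j ^ 2))⁻¹ • Q (a j)) = X := by
        rw [hX, ← hframe a lam i, ← hframe a lam j]
        exact (secondFundamentalForm_prodG hFt x _ _).symm
      rw [h7, ← hframe a lam k, ← hD, ← hDF, prodM_apply, prodJm_apply, hg₁, hg₂, hJ₁, hJ₂, hg₁',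
        hg₂', hX]
      rfl
    · refine Finset.sum_congr rfl fun k _ => Finset.sum_congr rfl fun i _ => ?_
      rw [← hD, ← hL, ← hL, (inCharts_self_fst (F t) x).1, (inCharts_self_fst (F t) x).2, hLg]
      rw [← curvatureTensor_eq_riem, ← curvatureTensor_eq_riem]
      rfl

end KahlerStructure

end

section

namespace KahlerStructure

variable {n : ℕ} {M : Type*} [TopologicalSpace M]
  [ChartedSpace (EuclideanSpace ℝ (Fin (2 * n))) M] [IsManifold (𝓡 (2 * n)) ∞ M]
  {N : Type*} [TopologicalSpace N]
  [ChartedSpace (EuclideanSpace ℝ (Fin (2 * n))) N] [IsManifold (𝓡 (2 * n)) ∞ N]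
  {K : KahlerStructure n M} {K' : KahlerStructure n N}

local notation "𝓔" => EuclideanSpace ℝ (Fin (2 * n))
local notation "𝓡₀" => 𝓡 (2 * n)
local notation "𝓟" => ModelWithCorners.prod (𝓡 (2 * n)) (𝓡 (2 * n))

/-! ### The Einstein condition in charts -/

theorem ricci_eq_trace (K : KahlerStructure n M) (p : M) (v w : 𝓔) : ricci K.g p v w =
    LinearMap.trace ℝ 𝓔 (riemLin (metricInChart K.g p) (extChartAt 𝓡₀ p p) v w) := by
  have hm := (K.isKahlerOn p).metric
  have hg := hm.isInner (mem_extChartAt_target (I := 𝓡₀) p)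
  obtain ⟨e, he⟩ := hg.exists_orthonormal
  rw [he.trace_eq_sum]
  have h1 := he.mtr_eq_sum hg (((ContinuousLinearMap.coeLM ℝ : (𝓔 →L[ℝ] ℝ) →ₗ[ℝ] 𝓔 →ₗ[ℝ] ℝ) ∘ₗ
    (metricInChart K.g p (extChartAt 𝓡₀ p p) : 𝓔 →ₗ[ℝ] 𝓔 →L[ℝ] ℝ)) ∘ₗ
      riemLin (metricInChart K.g p) (extChartAt 𝓡₀ p p) v w)
  refine Eq.trans ?_ h1
  rw [metricInChart_self] at *
  unfold ricci curvatureTensor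
  rw [metricTrace_eq_mtr]
  congr 1
  ext u u'
  exact congrArg (fun r => K.g p r u')
    (curvature_eq_riem K.g p hm (mem_extChartAt_target p) u v w)

/-- The Einstein condition at all points of a chart. -/
theorem trace_riemLin_of_einstein {c : ℝ}
    (hc : ∀ (x : M) (v w : TangentSpace 𝓡₀ x), ricci K.g x v w = c * K.g x v w) (x : M) {y : 𝓔}
    (hy : y ∈ (extChartAt 𝓡₀ x).target) (v w : 𝓔) :
    LinearMap.trace ℝ 𝓔 (riemLin (metricInChart K.g x) y v w) =
      c * metricInChart K.g x y v w := by
  set z := (extChartAt 𝓡₀ x).symm y with hz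
  have hyz : y ∈ transDom 𝓡₀ x z := ⟨hy, mem_extChartAt_source (I := 𝓡₀) z⟩
  have him := isImmersionOn_transition (K.isKahlerOn z).metric x
  set χ := inCharts 𝓡₀ 𝓡₀ x z id with hχ
  have hy' : χ y = extChartAt 𝓡₀ z z := rfl
  have hev : metricInChart K.g x =ᶠ[𝓝 y] pull (metricInChart K.g z) χ := by
    filter_upwards [(isOpen_transDom x z).mem_nhds hyz] with w hw
    exact metricInChart_eq_pull K.g hw
  let e : 𝓔 ≃ₗ[ℝ] 𝓔 := LinearEquiv.ofInjectiveEndo (fderiv ℝ χ y : 𝓔 →ₗ[ℝ] 𝓔) (him.inj y hyz)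
  have he : ∀ u, e u = fderiv ℝ χ y u := fun u => rfl
  have hconj : e.conj (riemLin (metricInChart K.g x) y v w) =
      riemLin (metricInChart K.g z) (χ y) (fderiv ℝ χ y v) (fderiv ℝ χ y w) := by
    ext1 u
    obtain ⟨u, rfl⟩ := e.surjective u
    rw [LinearEquiv.conj_apply_apply, LinearEquiv.symm_apply_apply, he, he]
    have h1 := him.riem_natural rfl hyz u v w
    rw [← riem_congr hev] at h1
    exact h1.symm
  rw [← LinearMap.trace_conj' _ e, hconj, hy', ← ricci_eq_trace, hev.eq_of_nhds, pull_apply,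
    hy', metricInChart_self]
  exact hc z _ _

theorem scalarCurvature_of_einstein {c : ℝ}
    (hc : ∀ (x : M) (v w : TangentSpace 𝓡₀ x), ricci K.g x v w = c * K.g x v w) (x : M) :
    scalarCurvature K.g x = c * (2 * n : ℕ) := by
  obtain ⟨g, hgx⟩ : ∃ g : 𝓔 →L[ℝ] 𝓔 →L[ℝ] ℝ, g = K.g x := ⟨_, rfl⟩
  have hg : IsInner g := by
    rw [hgx.trans (metricInChart_self K.g x).symm]
    exact (K.isKahlerOn x).metric.isInner (mem_extChartAt_target (I := 𝓡₀) x)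
  obtain ⟨e, he⟩ := hg.exists_orthonormal
  have h0 : ricci K.g x = fun v w => c * K.g x v w := funext fun v => funext fun w => hc x v w
  have h1 := he.mtr_eq_sum hg
    (c • ((ContinuousLinearMap.coeLM ℝ : (𝓔 →L[ℝ] ℝ) →ₗ[ℝ] 𝓔 →ₗ[ℝ] ℝ) ∘ₗ (g : 𝓔 →ₗ[ℝ] 𝓔 →L[ℝ] ℝ)))
  have h2 : ∀ k, (c • ((ContinuousLinearMap.coeLM ℝ : (𝓔 →L[ℝ] ℝ) →ₗ[ℝ] 𝓔 →ₗ[ℝ] ℝ) ∘ₗ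
      (g : 𝓔 →ₗ[ℝ] 𝓔 →L[ℝ] ℝ))) (e k) (e k) = c := fun k => by
    have h3 : g (e k) (e k) = 1 := by simpa using he k k
    exact (congrArg (c * ·) h3).trans (mul_one c)
  rw [Finset.sum_congr rfl fun k _ => h2 k] at h1
  rw [scalarCurvature, h0, metricTrace_eq_mtr, ← hgx]
  refine h1.trans ?_
  simp [mul_comm]

theorem exists_einstein_constant {x : M} {q : N} (hE : IsEinstein K.g) (hE' : IsEinstein K'.g)
    (hs : scalarCurvature K.g x = scalarCurvature K'.g q) :
    ∃ c : ℝ, (∀ (p : M) (v w : TangentSpace 𝓡₀ p), ricci K.g p v w = c * K.g p v w) ∧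
      ∀ (p : N) (v w : TangentSpace 𝓡₀ p), ricci K'.g p v w = c * K'.g p v w := by
  obtain ⟨c, hc⟩ := hE
  obtain ⟨c', hc'⟩ := hE'
  have h1 : scalarCurvature K.g x = c * (2 * n : ℕ) := scalarCurvature_of_einstein hc x
  have h2 : scalarCurvature K'.g q = c' * (2 * n : ℕ) := scalarCurvature_of_einstein hc' q
  rcases Nat.eq_zero_or_pos n with rfl | hn
  · have h0 : ∀ v w : EuclideanSpace ℝ (Fin (2 * 0)), v = w := fun v w => by
      ext i
      exact (i.elim0)
    refine ⟨c, hc, fun p v w => ?_⟩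
    have h3 : K'.g p v w = 0 := by
      rw [h0 v 0]
      exact DFunLike.congr_fun (map_zero (K'.g p)) w
    rw [hc', h3, mul_zero, mul_zero]
  · have h3 : c = c' := by
      rw [h1, h2] at hs
      exact mul_right_cancel₀ (by positivity) hs
    exact ⟨c, hc, fun p v w => by rw [hc' p v w, h3]⟩

/-- The trace of the curvature of the product. -/
theorem trace_riemLin_prodM {c : ℝ}
    (hc : ∀ (p : M) (v w : TangentSpace 𝓡₀ p), ricci K.g p v w = c * K.g p v w)
    (hc' : ∀ (p : N) (v w : TangentSpace 𝓡₀ p), ricci K'.g p v w = c * K'.g p v w) (q : M × N)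
    {y : 𝓔 × 𝓔} (hy : y ∈ (extChartAt 𝓡₀ q.1).target ×ˢ (extChartAt 𝓡₀ q.2).target)
    (X Y : 𝓔 × 𝓔) :
    LinearMap.trace ℝ (𝓔 × 𝓔)
        (riemLin (prodM (metricInChart K.g q.1) (metricInChart K'.g q.2)) y X Y) =
      c * prodM (metricInChart K.g q.1) (metricInChart K'.g q.2) y X Y := by
  have h : riemLin (prodM (metricInChart K.g q.1) (metricInChart K'.g q.2)) y X Y =
      LinearMap.prodMap (riemLin (metricInChart K.g q.1) y.1 X.1 Y.1)
        (riemLin (metricInChart K'.g q.2) y.2 X.2 Y.2) :=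
    LinearMap.ext fun u => riem_prodM (K.isKahlerOn q.1).metric (K'.isKahlerOn q.2).metric hy _ _ _
  rw [h, LinearMap.trace_prodMap', trace_riemLin_of_einstein hc q.1 hy.1,
    trace_riemLin_of_einstein hc' q.2 hy.2, prodM_apply, mul_add]

end KahlerStructure

end

section

/-! ### The maximum principle for the Lagrangian condition -/

section Touching

variable {V W : Type*} [NormedAddCommGroup V] [NormedSpace ℝ V] [NormedAddCommGroup W]
  [NormedSpace ℝ W] [FiniteDimensional ℝ V] [FiniteDimensional ℝ W]
  {m : W → W →L[ℝ] W →L[ℝ] ℝ} {J : W → W →L[ℝ] W} {U : Set W} {F : ℝ → V → W} {O : Set V}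
  {S : Set ℝ} {s : ℝ} {y : V}

/-- The growth rate of a barrier `ε e^{Cr}` that touches the Kähler form at time `s` is bounded. -/
theorem IsImmersionOn.growth_le (h : IsImmersionOn m U (F s) O) (hK : IsKahlerOn m J U)
    (hdim : finrank ℝ V + finrank ℝ V = finrank ℝ W) (hy : y ∈ O)
    (hc : HasDerivWithinAt (fun r => F r y) (meanL m (F s) y) S s)
    (hL : HasDerivWithinAt (fun r => fderiv ℝ (F r) y) (fderiv ℝ (meanL m (F s)) y) S s)
    (hS : ∀ᶠ r in 𝓝[<] s, r ∈ S) {a b : V} {ε C k k₂ c : ℝ} (hε : 0 < ε)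
    (hθ : ε * Real.exp (C * s) ≤ 1 / 2)
    (hbar : ∀ᶠ r in 𝓝[<] s, m (F r y) (J (F r y) (fderiv ℝ (F r) y a)) (fderiv ℝ (F r) y b) ≤
      ε * Real.exp (C * r) / 2 * (pull m (F r) y a a + pull m (F r) y b b))
    (hmin : ∀ᶠ z in 𝓝 y, ∀ a' b', m (F s z) (J (F s z) (fderiv ℝ (F s) z a'))
      (fderiv ℝ (F s) z b') ≤
      ε * Real.exp (C * s) / 2 * (pull m (F s) z a' a' + pull m (F s) z b' b'))
    (hab : m (F s y) (J (F s y) (fderiv ℝ (F s) y a)) (fderiv ℝ (F s) y b) =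
      ε * Real.exp (C * s) / 2 * (pull m (F s) y a a + pull m (F s) y b b)) (hne : a ≠ 0 ∨ b ≠ 0)
    (hnab : ∀ u v, m (F s y) (nab m (F s) y u v) (nab m (F s) y u v) ≤
      k ^ 2 * (pull m (F s) y u u * pull m (F s) y v v))
    (hk₂ : 0 ≤ k₂) (hR : ∀ X Y Z Z', |m (F s y) (riem m (F s y) X Y Z) Z'| ≤
      k₂ * gnorm (m (F s y)) X * gnorm (m (F s y)) Y * gnorm (m (F s y)) Z * gnorm (m (F s y)) Z')
    (hRic : ∀ X Y, LinearMap.trace ℝ W (riemLin m (F s y) X Y) = c * m (F s y) X Y) :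
    C ≤ |c| + 5 * finrank ℝ V * k₂ + 6 * finrank ℝ V * k ^ 2 := by
  refine h.barrier_le hK hdim hy (by positivity) hθ hmin hab hne ?_ hnab hk₂ hR hRic
  have hyU := h.mapsTo hy
  have hX : ∀ v : V, HasFDerivWithinAt (fun r => fderiv ℝ (F r) y v)
      (ContinuousLinearMap.toSpanSingleton ℝ (fderiv ℝ (meanL m (F s)) y v)) S s := fun v => by
    have h1 := hL.clm_apply (hasDerivWithinAt_const s S v)
    simp only [map_zero, add_zero] at h1
    exact h1.hasFDerivWithinAt
  obtain ⟨D₁, hD₁, h₁⟩ := hK.hasFDerivWithinAt_form (c := fun r => F r y) hyU hc.hasFDerivWithinAt (hX a) (hX b)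
  obtain ⟨D₂, hD₂, h₂⟩ := hK.metric.hasFDerivWithinAt_inner (c := fun r => F r y) hyU hc.hasFDerivWithinAt (hX a) (hX a)
  obtain ⟨D₃, hD₃, h₃⟩ := hK.metric.hasFDerivWithinAt_inner (c := fun r => F r y) hyU hc.hasFDerivWithinAt (hX b) (hX b)
  have hexp : HasDerivWithinAt (fun r => ε * Real.exp (C * r) / 2)
      (C * (ε * Real.exp (C * s) / 2)) S s := by
    have h4 : HasDerivAt (fun r => ε * Real.exp (C * r) / 2)
        (ε * (Real.exp (C * s) * (C * 1)) / 2) s :=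
      ((((hasDerivAt_id s).const_mul C).exp).const_mul ε).div_const 2
    exact h4.hasDerivWithinAt.congr_deriv (by ring)
  have hφ := (hexp.mul (hD₂.hasDerivWithinAt.add hD₃.hasDerivWithinAt)).sub hD₁.hasDerivWithinAt
  have hcov : ∀ v, fderiv ℝ (meanL m (F s)) y v + chrL m (F s y) (meanL m (F s) y)
      (fderiv ℝ (F s) y v) = cov m (F s) (meanL m (F s)) y v := fun v => by
    rw [cov, h.metric.chrL_symm hyU]
  have key := hφ.nonpos_of_left hS (by
    filter_upwards [hbar] with r hr
    exact sub_nonneg.2 hr) (sub_eq_zero.2 hab.symm)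
  refine le_trans (le_of_eq ?_) key
  rw [h₁, h₂, h₃]
  simp only [ContinuousLinearMap.toSpanSingleton_apply, one_smul, hcov, pull_apply, Pi.add_apply]
  rw [h.metric.symm _ hyU (fderiv ℝ (F s) y a) (cov m (F s) (meanL m (F s)) y a),
    h.metric.symm _ hyU (fderiv ℝ (F s) y b) (cov m (F s) (meanL m (F s)) y b)]
  ring

variable {X : Type*} [TopologicalSpace X] {D : Set X} {p : X}

theorem eventually_norm_le {Y : Type*} [SeminormedAddCommGroup Y] {f : X → Y}
    (hf : ContinuousWithinAt f D p) : ∀ᶠ q in 𝓝[D] p, ‖f q‖ ≤ ‖f p‖ + 1 := by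
  filter_upwards [hf.norm.eventually_lt continuousWithinAt_const (lt_add_one ‖f p‖)] with q hq
  exact hq.le

/-- A continuous family of bilinear maps is locally uniformly bounded with respect to continuous
families of metrics. -/
theorem exists_bound_bilinear {μ : X → W →L[ℝ] W →L[ℝ] ℝ} {g : X → V →L[ℝ] V →L[ℝ] ℝ}
    {B : X → V →L[ℝ] V →L[ℝ] W} (hμ : ContinuousWithinAt μ D p) (hg : ContinuousWithinAt g D p)
    (hB : ContinuousWithinAt B D p) (hpos : ∀ v, v ≠ 0 → 0 < g p v v) :
    ∃ k : ℝ, ∀ᶠ q in 𝓝[D] p, ∀ u v,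
      μ q (B q u v) (B q u v) ≤ k ^ 2 * (g q u u * g q v v) := by
  obtain ⟨c, hc, hc'⟩ := eventually_posDef hg hpos
  refine ⟨Real.sqrt ((‖μ p‖ + 1) * (‖B p‖ + 1) ^ 2 / c ^ 2), ?_⟩
  filter_upwards [hc', eventually_norm_le hμ, eventually_norm_le hB] with q h1 h2 h3 u v
  rw [Real.sq_sqrt (by positivity)]
  have h4 : ‖B q u v‖ ≤ (‖B p‖ + 1) * ‖u‖ * ‖v‖ := ((B q).le_opNorm₂ u v).trans (by gcongr)
  have h5 : μ q (B q u v) (B q u v) ≤ (‖μ p‖ + 1) * ((‖B p‖ + 1) * ‖u‖ * ‖v‖) ^ 2 := by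
    calc μ q (B q u v) (B q u v) ≤ ‖μ q (B q u v) (B q u v)‖ := le_abs_self _
      _ ≤ ‖μ q‖ * ‖B q u v‖ * ‖B q u v‖ := (μ q).le_opNorm₂ _ _
      _ = ‖μ q‖ * ‖B q u v‖ ^ 2 := by ring
      _ ≤ _ := by gcongr
  refine h5.trans ?_
  have h6 : c ^ 2 * (‖u‖ ^ 2 * ‖v‖ ^ 2) ≤ g q u u * g q v v := by
    calc c ^ 2 * (‖u‖ ^ 2 * ‖v‖ ^ 2) = (c * ‖u‖ ^ 2) * (c * ‖v‖ ^ 2) := by ring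
      _ ≤ _ := mul_le_mul (h1 u) (h1 v) (by positivity) (le_trans (by positivity) (h1 u))
  calc (‖μ p‖ + 1) * ((‖B p‖ + 1) * ‖u‖ * ‖v‖) ^ 2
      = (‖μ p‖ + 1) * (‖B p‖ + 1) ^ 2 / c ^ 2 * (c ^ 2 * (‖u‖ ^ 2 * ‖v‖ ^ 2)) := by
        field_simp
    _ ≤ _ := by gcongr

omit [FiniteDimensional ℝ V] in
/-- The curvature is locally uniformly bounded. -/
theorem IsMetricOn.exists_bound_riem (h : IsMetricOn m U) {w : X → W}
    (hw : ContinuousWithinAt w D p) (hp : w p ∈ U) :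
    ∃ k₂ : ℝ, 0 ≤ k₂ ∧ ∀ᶠ q in 𝓝[D] p, ∀ X Y Z Z', |m (w q) (riem m (w q) X Y Z) Z'| ≤
      k₂ * gnorm (m (w q)) X * gnorm (m (w q)) Y * gnorm (m (w q)) Z * gnorm (m (w q)) Z' := by
  have hm : ContinuousWithinAt (fun q => m (w q)) D p :=
    (h.contDiffAt hp).continuousAt.comp_continuousWithinAt hw
  have hΓc := h.contDiffOn_chrL.contDiffAt (h.isOpen.mem_nhds hp)
  have hΓ : ContinuousWithinAt (fun q => chrL m (w q)) D p :=
    hΓc.continuousAt.comp_continuousWithinAt hw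
  have hA : ContinuousWithinAt (fun q => fderiv ℝ (chrL m) (w q)) D p :=
    (hΓc.fderiv_right (m := ∞) le_rfl).continuousAt.comp_continuousWithinAt hw
  obtain ⟨c, hc, hc'⟩ := eventually_posDef hm (h.pos _ hp)
  set a := ‖m (w p)‖ + 1
  set b := ‖chrL m (w p)‖ + 1
  set d := ‖fderiv ℝ (chrL m) (w p)‖ + 1
  refine ⟨a * (2 * d + 2 * b ^ 2) / c ^ 2, by positivity, ?_⟩
  filter_upwards [hc', eventually_norm_le hm, eventually_norm_le hΓ, eventually_norm_le hA]
    with q h1 h2 h3 h4 X Y Z Z'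
  have hA' : ∀ u v z, ‖fderiv ℝ (chrL m) (w q) u v z‖ ≤ d * ‖u‖ * ‖v‖ * ‖z‖ := fun u v z => by
    refine ((fderiv ℝ (chrL m) (w q) u).le_opNorm₂ v z).trans ?_
    gcongr
    exact ((fderiv ℝ (chrL m) (w q)).le_opNorm u).trans (by gcongr)
  have hΓ' : ∀ u v, ‖chrL m (w q) u v‖ ≤ b * ‖u‖ * ‖v‖ := fun u v =>
    ((chrL m (w q)).le_opNorm₂ u v).trans (by gcongr)
  have hΓ₂ : ∀ u v z, ‖chrL m (w q) u (chrL m (w q) v z)‖ ≤ b * ‖u‖ * (b * ‖v‖ * ‖z‖) :=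
    fun u v z => (hΓ' _ _).trans (by gcongr; exact hΓ' v z)
  have hR : ‖riem m (w q) X Y Z‖ ≤ (2 * d + 2 * b ^ 2) * (‖X‖ * ‖Y‖ * ‖Z‖) := by
    unfold riem
    refine (norm_sub_le _ _).trans ?_
    have e1 := norm_add_le (fderiv ℝ (chrL m) (w q) X Y Z - fderiv ℝ (chrL m) (w q) Y X Z)
      (chrL m (w q) X (chrL m (w q) Y Z))
    have e2 := norm_sub_le (fderiv ℝ (chrL m) (w q) X Y Z) (fderiv ℝ (chrL m) (w q) Y X Z)
    have e3 := hA' X Y Z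
    have e4 := hA' Y X Z
    have e5 := hΓ₂ X Y Z
    have e6 := hΓ₂ Y X Z
    nlinarith
  have hn : ∀ u, ‖u‖ ≤ gnorm (m (w q)) u / Real.sqrt c := fun u => by
    rw [le_div_iff₀ (Real.sqrt_pos.2 hc), gnorm]
    refine Real.le_sqrt_of_sq_le ?_
    rw [mul_pow, Real.sq_sqrt hc.le, mul_comm]
    exact h1 u
  have hs : Real.sqrt c ^ 2 = c := Real.sq_sqrt hc.le
  have hs0 := Real.sqrt_pos.2 hc
  have hs4 : c ^ 2 = Real.sqrt c ^ 4 := by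
    rw [show 4 = 2 * 2 from rfl, pow_mul, hs]
  have hX := gnorm_nonneg (m (w q)) X
  have hY := gnorm_nonneg (m (w q)) Y
  have hZ := gnorm_nonneg (m (w q)) Z
  calc |m (w q) (riem m (w q) X Y Z) Z'|
      ≤ ‖m (w q)‖ * ‖riem m (w q) X Y Z‖ * ‖Z'‖ := (m (w q)).le_opNorm₂ _ _
    _ ≤ a * ((2 * d + 2 * b ^ 2) * (‖X‖ * ‖Y‖ * ‖Z‖)) * ‖Z'‖ := by gcongr
    _ ≤ a * ((2 * d + 2 * b ^ 2) * (gnorm (m (w q)) X / Real.sqrt c *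
        (gnorm (m (w q)) Y / Real.sqrt c) * (gnorm (m (w q)) Z / Real.sqrt c))) *
        (gnorm (m (w q)) Z' / Real.sqrt c) := by
        gcongr <;> exact hn _
    _ = _ := by
        rw [hs4]
        field_simp

end Touching

end

section

/-! ### Preservation of the Lagrangian condition -/

section Families

variable {V W : Type*} [NormedAddCommGroup V] [NormedSpace ℝ V] [NormedAddCommGroup W]
  [NormedSpace ℝ W] [FiniteDimensional ℝ V] [FiniteDimensional ℝ W]
  {m : W → W →L[ℝ] W →L[ℝ] ℝ} {J : W → W →L[ℝ] W} {U : Set W} {F : ℝ → V → W} {O : Set V}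
  {S : Set ℝ}

theorem IsMetricOn.contDiffOn_pull_slice (hm : IsMetricOn m U)
    (hF : ContDiffOn ℝ ∞ (fun p : ℝ × V => F p.1 p.2) (S ×ˢ O)) (hS : UniqueDiffOn ℝ S)
    (hO : IsOpen O) (hU : MapsTo (fun p : ℝ × V => F p.1 p.2) (S ×ˢ O) U) :
    ContDiffOn ℝ ∞ (fun p : ℝ × V => pull m (F p.1) p.2) (S ×ˢ O) := by
  have hD := contDiffOn_fderiv_slice hF hS hO
  exact ContDiffOn.clm_bilinearComp (hm.smooth.comp hF hU) hD hD

theorem IsMetricOn.contDiffOn_nab_slice (hm : IsMetricOn m U)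
    (hF : ContDiffOn ℝ ∞ (fun p : ℝ × V => F p.1 p.2) (S ×ˢ O)) (hS : UniqueDiffOn ℝ S)
    (hO : IsOpen O) (hU : MapsTo (fun p : ℝ × V => F p.1 p.2) (S ×ˢ O) U) :
    ContDiffOn ℝ ∞ (fun p : ℝ × V => nab m (F p.1) p.2) (S ×ˢ O) := by
  have hD := contDiffOn_fderiv_slice hF hS hO
  exact (contDiffOn_fderiv_slice hD hS hO).add
    (ContDiffOn.clm_bilinearComp (hm.contDiffOn_chrL.comp hF hU) hD hD)

theorem IsKahlerOn.contDiffOn_form_slice (hK : IsKahlerOn m J U)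
    (hF : ContDiffOn ℝ ∞ (fun p : ℝ × V => F p.1 p.2) (S ×ˢ O)) (hS : UniqueDiffOn ℝ S)
    (hO : IsOpen O) (hU : MapsTo (fun p : ℝ × V => F p.1 p.2) (S ×ˢ O) U) :
    ContDiffOn ℝ ∞ (fun p : ℝ × V => ((m (F p.1 p.2)) ∘L (J (F p.1 p.2))).bilinearComp
      (fderiv ℝ (F p.1) p.2) (fderiv ℝ (F p.1) p.2)) (S ×ˢ O) := by
  have hD := contDiffOn_fderiv_slice hF hS hO
  exact ContDiffOn.clm_bilinearComp
    ((hK.metric.smooth.comp hF hU).clm_comp (hK.smooth.comp hF hU)) hD hD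

end Families

namespace KahlerStructure

variable {n : ℕ} {M : Type*} [TopologicalSpace M]
  [ChartedSpace (EuclideanSpace ℝ (Fin (2 * n))) M] [IsManifold (𝓡 (2 * n)) ∞ M]
  {N : Type*} [TopologicalSpace N]
  [ChartedSpace (EuclideanSpace ℝ (Fin (2 * n))) N] [IsManifold (𝓡 (2 * n)) ∞ N]
  {K : KahlerStructure n M} {K' : KahlerStructure n N}

local notation "𝓔" => EuclideanSpace ℝ (Fin (2 * n))
local notation "𝓡₀" => 𝓡 (2 * n)
local notation "𝓟" => ModelWithCorners.prod (𝓡 (2 * n)) (𝓡 (2 * n))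

/-- The restriction of the form `π₁^* ω - π₂^* ω'` to the immersed submanifold. -/
def lagForm (K : KahlerStructure n M) (K' : KahlerStructure n N) (f : M → M × N) (x : M)
    (u v : 𝓔) : ℝ :=
  K.kform (f x).1 (dF₁ f x u) (dF₁ f x v) - K'.kform (f x).2 (dF₂ f x u) (dF₂ f x v)

/-- The induced metric of the immersed submanifold. -/
def indForm (K : KahlerStructure n M) (K' : KahlerStructure n N) (f : M → M × N) (x : M)
    (u v : 𝓔) : ℝ := pullbackMetric (I := 𝓡₀) (K.prodG K') f x u v

theorem isLagrangian_iff {f : M → M × N} :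
    K.IsLagrangian K' f ↔ ∀ (x : M) (u v : 𝓔), K.lagForm K' f x u v = 0 := Iff.rfl

theorem lagForm_inCharts {f : M → M × N} (hf : ContMDiff 𝓡₀ 𝓟 ∞ f) {x : M} {q : M × N} {y : 𝓔}
    (hy : y ∈ chartDom 𝓡₀ 𝓟 x q f) (u v : 𝓔) :
    K.lagForm K' f ((extChartAt 𝓡₀ x).symm y) (chartD 𝓡₀ x y u) (chartD 𝓡₀ x y v) =
    prodM (metricInChart K.g q.1) (metricInChart K'.g q.2) (inCharts 𝓡₀ 𝓟 x q f y)
      (prodJm (K.JInChart q.1) (K'.JInChart q.2) (inCharts 𝓡₀ 𝓟 x q f y)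
        (fderiv ℝ (inCharts 𝓡₀ 𝓟 x q f) y u)) (fderiv ℝ (inCharts 𝓡₀ 𝓟 x q f) y v) := by
  rw [prodM_apply, prodJm_apply]
  simp only [map_neg, neg_apply]
  rw [kahlerForm_inChart_fst hf hy, kahlerForm_inChart_snd hf hy]
  rfl

theorem indForm_inCharts {f : M → M × N} (hf : ContMDiff 𝓡₀ 𝓟 ∞ f) {x : M} {q : M × N} {y : 𝓔}
    (hy : y ∈ chartDom 𝓡₀ 𝓟 x q f) (u v : 𝓔) :
    K.indForm K' f ((extChartAt 𝓡₀ x).symm y) (chartD 𝓡₀ x y u) (chartD 𝓡₀ x y v) =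
    pull (prodM (metricInChart K.g q.1) (metricInChart K'.g q.2)) (inCharts 𝓡₀ 𝓟 x q f) y u v :=
  (pull_prodM_inCharts hf hy u v).symm

theorem _root_.IsFlowChart.tendsto {T : ℝ} {F : ℝ → M → M × N} {x : M} {q : M × N} {S : Set ℝ}
    {O : Set (EuclideanSpace ℝ (Fin (2 * n)))} (h : IsFlowChart 𝓡₀ 𝓟 T F x q S O) {t : ℝ}
    (ht : t ∈ S) (hx : extChartAt 𝓡₀ x x ∈ O) :
    Tendsto (fun p : ℝ × M => (p.1, extChartAt 𝓡₀ x p.2)) (𝓝[Ico 0 T ×ˢ univ] (t, x))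
      (𝓝[S ×ˢ O] (t, extChartAt 𝓡₀ x x)) := by
  have h1 : Tendsto (fun p : ℝ × M => p.1) (𝓝[Ico 0 T ×ˢ univ] (t, x)) (𝓝[S] t) := by
    rw [h.nhdsWithin_eq ht, nhdsWithin_prod_eq]
    exact tendsto_fst
  have h2 : Tendsto (fun p : ℝ × M => extChartAt 𝓡₀ x p.2) (𝓝[Ico 0 T ×ˢ univ] (t, x))
      (𝓝[O] (extChartAt 𝓡₀ x x)) := by
    rw [h.isOpen.nhdsWithin_eq hx]
    refine (continuousAt_extChartAt (I := 𝓡₀) x).tendsto.comp ?_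
    rw [nhdsWithin_prod_eq, nhdsWithin_univ]
    exact tendsto_snd
  have h3 := h1.prodMk h2
  rwa [← nhdsWithin_prod_eq] at h3

/-- The quadratic form `θ/2 (g(a, a) + g(b, b)) - ω(a, b)` is positive definite. -/
def IsBelow (K : KahlerStructure n M) (K' : KahlerStructure n N) (f : M → M × N) (θ : ℝ) (x : M) :
    Prop :=
  ∀ a b : 𝓔, (a ≠ 0 ∨ b ≠ 0) →
    K.lagForm K' f x a b < θ / 2 * (K.indForm K' f x a a + K.indForm K' f x b b)

/-- The barrier `ε e^{Cr}` lies above the form `lagForm` up to the time of `p`, and touches it at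
`p`. -/
def Touches (K : KahlerStructure n M) (K' : KahlerStructure n N) (F : ℝ → M → M × N) (C ε : ℝ)
    (p : ℝ × M) : Prop :=
  0 < p.1 ∧ 0 < ε ∧ ε * Real.exp (C * p.1) ≤ 1 / 2 ∧
  (∀ r ∈ Icc 0 p.1, ∀ x (a b : 𝓔), K.lagForm K' (F r) x a b ≤
    ε * Real.exp (C * r) / 2 * (K.indForm K' (F r) x a a + K.indForm K' (F r) x b b)) ∧
  ∃ a b : 𝓔, (a ≠ 0 ∨ b ≠ 0) ∧ K.lagForm K' (F p.1) p.2 a b =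
    ε * Real.exp (C * p.1) / 2 * (K.indForm K' (F p.1) p.2 a a + K.indForm K' (F p.1) p.2 b b)

variable {T : ℝ} {F : ℝ → M → M × N}

section FlowChart

variable {x : M} {q : M × N} {S : Set ℝ} {O : Set (EuclideanSpace ℝ (Fin (2 * n)))}

/-- The Kähler form `π₁^* ω - π₂^* ω'`, restricted to the immersed submanifold, in charts. -/
def lagL (K : KahlerStructure n M) (K' : KahlerStructure n N) (x : M) (q : M × N) (f : M → M × N)
    (y : 𝓔) : 𝓔 →L[ℝ] 𝓔 →L[ℝ] ℝ :=
  (prodM (metricInChart K.g q.1) (metricInChart K'.g q.2) (inCharts 𝓡₀ 𝓟 x q f y) ∘L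
    prodJm (K.JInChart q.1) (K'.JInChart q.2) (inCharts 𝓡₀ 𝓟 x q f y)).bilinearComp
    (fderiv ℝ (inCharts 𝓡₀ 𝓟 x q f) y) (fderiv ℝ (inCharts 𝓡₀ 𝓟 x q f) y)

/-- The induced metric in charts. -/
def indL (K : KahlerStructure n M) (K' : KahlerStructure n N) (x : M) (q : M × N) (f : M → M × N)
    (y : 𝓔) : 𝓔 →L[ℝ] 𝓔 →L[ℝ] ℝ :=
  pull (prodM (metricInChart K.g q.1) (metricInChart K'.g q.2)) (inCharts 𝓡₀ 𝓟 x q f) y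

theorem mapsTo_of_isFlowChart (h : IsFlowChart 𝓡₀ 𝓟 T F x q S O)
    (hF : IsMeanCurvatureFlow 𝓡₀ (K.prodG K') T F) :
    MapsTo (fun p : ℝ × 𝓔 => inCharts 𝓡₀ 𝓟 x q (F p.1) p.2) (S ×ˢ O)
      ((extChartAt 𝓡₀ q.1).target ×ˢ (extChartAt 𝓡₀ q.2).target) := fun p hp =>
  (isImmersionOn_of_isFlowChart h hF hp.1).mapsTo hp.2

theorem contDiffOn_lagL (h : IsFlowChart 𝓡₀ 𝓟 T F x q S O)
    (hF : IsMeanCurvatureFlow 𝓡₀ (K.prodG K') T F) :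
    ContDiffOn ℝ ∞ (fun p : ℝ × 𝓔 => K.lagL K' x q (F p.1) p.2) (S ×ˢ O) :=
  ((K.isKahlerOn q.1).prod (K'.isKahlerOn q.2)).contDiffOn_form_slice
    (F := fun r => inCharts 𝓡₀ 𝓟 x q (F r)) (h.contDiffOn hF) h.uniqueDiffOn h.isOpen
    (mapsTo_of_isFlowChart h hF)

theorem contDiffOn_indL (h : IsFlowChart 𝓡₀ 𝓟 T F x q S O)
    (hF : IsMeanCurvatureFlow 𝓡₀ (K.prodG K') T F) :
    ContDiffOn ℝ ∞ (fun p : ℝ × 𝓔 => K.indL K' x q (F p.1) p.2) (S ×ˢ O) :=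
  ((K.isKahlerOn q.1).metric.prod (K'.isKahlerOn q.2).metric).contDiffOn_pull_slice
    (F := fun r => inCharts 𝓡₀ 𝓟 x q (F r)) (h.contDiffOn hF) h.uniqueDiffOn h.isOpen
    (mapsTo_of_isFlowChart h hF)

/-- The forms `lagForm` and `indForm` on vectors given by their coordinates in a fixed chart. -/
theorem forms_eq (h : IsFlowChart 𝓡₀ 𝓟 T F x q S O) (hF : IsMeanCurvatureFlow 𝓡₀ (K.prodG K') T F)
    {s : ℝ} (hs : s ∈ S) {y : 𝓔} (hy : y ∈ O) (u v : 𝓔) :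
    K.lagL K' x q (F s) y u v = K.lagForm K' (F s) ((extChartAt 𝓡₀ x).symm y)
      (chartD 𝓡₀ x y u) (chartD 𝓡₀ x y v) ∧
    K.indL K' x q (F s) y u v = K.indForm K' (F s) ((extChartAt 𝓡₀ x).symm y)
      (chartD 𝓡₀ x y u) (chartD 𝓡₀ x y v) :=
  ⟨(lagForm_inCharts (hF.contMDiff (h.subset hs)) (h.mem s hs hy) u v).symm,
    (indForm_inCharts (hF.contMDiff (h.subset hs)) (h.mem s hs hy) u v).symm⟩

theorem forms_eq_chartA (h : IsFlowChart 𝓡₀ 𝓟 T F x q S O)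
    (hF : IsMeanCurvatureFlow 𝓡₀ (K.prodG K') T F)
    {s : ℝ} (hs : s ∈ S) {z : M} (hz : z ∈ (extChartAt 𝓡₀ x).source) (hy : extChartAt 𝓡₀ x z ∈ O)
    (a b : 𝓔) :
    K.lagForm K' (F s) z a b =
      K.lagL K' x q (F s) (extChartAt 𝓡₀ x z) (chartA 𝓡₀ x z a) (chartA 𝓡₀ x z b) ∧
    K.indForm K' (F s) z a b =
      K.indL K' x q (F s) (extChartAt 𝓡₀ x z) (chartA 𝓡₀ x z a) (chartA 𝓡₀ x z b) := by
  have h1 := forms_eq h hF hs hy (chartA 𝓡₀ x z a) (chartA 𝓡₀ x z b)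
  rw [chartD_chartA' hz, chartD_chartA' hz, (extChartAt 𝓡₀ x).left_inv hz] at h1
  exact ⟨h1.1.symm, h1.2.symm⟩

theorem chartA_ne_zero {z : M} (hz : z ∈ (extChartAt 𝓡₀ x).source) {a : 𝓔} (ha : a ≠ 0) :
    chartA 𝓡₀ x z a ≠ 0 := fun h0 => ha (by rw [← chartD_chartA' hz a, h0, map_zero])

theorem eventually_mem_of_isFlowChart (h : IsFlowChart 𝓡₀ 𝓟 T F x q S O) {t : ℝ} (ht : t ∈ S)
    (hx : extChartAt 𝓡₀ x x ∈ O) :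
    ∀ᶠ p : ℝ × M in 𝓝[Ico 0 T ×ˢ univ] (t, x), p.1 ∈ S ∧ p.2 ∈ (extChartAt 𝓡₀ x).source ∧
      extChartAt 𝓡₀ x p.2 ∈ O := by
  have h1 : ∀ᶠ p : ℝ × M in 𝓝[Ico 0 T ×ˢ univ] (t, x), p.2 ∈ (extChartAt 𝓡₀ x).source := by
    refine mem_nhdsWithin_of_mem_nhds (continuous_snd.continuousAt.preimage_mem_nhds ?_)
    exact extChartAt_source_mem_nhds x
  filter_upwards [h1, (h.tendsto ht hx).eventually self_mem_nhdsWithin] with p h1 h2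
  exact ⟨h2.1, h1, h2.2⟩

end FlowChart

/-- Positivity is an open condition in space and time. -/
theorem eventually_isBelow (hF : IsMeanCurvatureFlow 𝓡₀ (K.prodG K') T F) {t : ℝ}
    (ht : t ∈ Ico 0 T) {x : M} {θ : ℝ → ℝ} (hθ : Continuous θ)
    (h : K.IsBelow K' (F t) (θ t) x) :
    ∀ᶠ p : ℝ × M in 𝓝[Ico 0 T ×ˢ univ] (t, x), K.IsBelow K' (F p.1) (θ p.1) p.2 := by
  obtain ⟨S, O, hch, htS, hxO⟩ := hF.exists_isFlowChart ht x
  set q := F t x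
  let P₁ := ContinuousLinearMap.fst ℝ 𝓔 𝓔
  let P₂ := ContinuousLinearMap.snd ℝ 𝓔 𝓔
  let B : ℝ × 𝓔 → (𝓔 × 𝓔) →L[ℝ] (𝓔 × 𝓔) →L[ℝ] ℝ := fun p =>
    (θ p.1 / 2) • ((K.indL K' x q (F p.1) p.2).bilinearComp P₁ P₁ +
      (K.indL K' x q (F p.1) p.2).bilinearComp P₂ P₂) -
      (K.lagL K' x q (F p.1) p.2).bilinearComp P₁ P₂
  have hB : ContinuousWithinAt B (S ×ˢ O) (t, extChartAt 𝓡₀ x x) := by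
    have hi := contDiffOn_indL hch hF
    have hl := contDiffOn_lagL hch hF
    have h1 := ContDiffOn.clm_bilinearComp hi (D := fun _ => P₁) (D' := fun _ => P₁)
      contDiffOn_const contDiffOn_const
    have h2 := ContDiffOn.clm_bilinearComp hi (D := fun _ => P₂) (D' := fun _ => P₂)
      contDiffOn_const contDiffOn_const
    have h3 := ContDiffOn.clm_bilinearComp hl (D := fun _ => P₁) (D' := fun _ => P₂)
      contDiffOn_const contDiffOn_const
    have hθ' : Continuous fun p : ℝ × 𝓔 => θ p.1 / 2 := (hθ.comp continuous_fst).div_const 2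
    exact (hθ'.continuousOn.smul (h1.add h2).continuousOn).sub h3.continuousOn _ ⟨htS, hxO⟩
  have happ : ∀ {s : ℝ}, s ∈ S → ∀ {z : M}, z ∈ (extChartAt 𝓡₀ x).source →
      extChartAt 𝓡₀ x z ∈ O → ∀ a b : 𝓔,
      B (s, extChartAt 𝓡₀ x z) (chartA 𝓡₀ x z a, chartA 𝓡₀ x z b)
        (chartA 𝓡₀ x z a, chartA 𝓡₀ x z b) =
      θ s / 2 * (K.indForm K' (F s) z a a + K.indForm K' (F s) z b b) -
        K.lagForm K' (F s) z a b := fun hs z hz hy a b => by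
    rw [(forms_eq_chartA hch hF hs hz hy a a).2, (forms_eq_chartA hch hF hs hz hy b b).2,
      (forms_eq_chartA hch hF hs hz hy a b).1]
    rfl
  obtain ⟨c, hc, hc'⟩ := eventually_posDef hB fun w hw => by
    have h1 := happ htS (mem_extChartAt_source x) hxO w.1 w.2
    simp only [chartA_self, ContinuousLinearMap.coe_id', id_eq, Prod.mk.eta] at h1
    rw [h1]
    refine sub_pos.2 (h _ _ ?_)
    by_contra! h0
    exact hw (Prod.ext h0.1 h0.2)
  filter_upwards [eventually_mem_of_isFlowChart hch htS hxO, (hch.tendsto htS hxO).eventually hc']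
    with p h1 h2 a b hab
  have h3 := h2 (chartA 𝓡₀ x p.2 a, chartA 𝓡₀ x p.2 b)
  rw [happ h1.1 h1.2.1 h1.2.2] at h3
  have h4 : 0 < ‖(chartA 𝓡₀ x p.2 a, chartA 𝓡₀ x p.2 b)‖ := by
    rw [norm_pos_iff]
    intro h0
    rw [Prod.mk_eq_zero] at h0
    exact hab.elim (fun ha => chartA_ne_zero h1.2.1 ha h0.1) fun hb => chartA_ne_zero h1.2.1 hb h0.2
  have h5 : 0 < c * ‖(chartA 𝓡₀ x p.2 a, chartA 𝓡₀ x p.2 b)‖ ^ 2 := by positivity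
  linarith

theorem continuousWithinAt_forms (hF : IsMeanCurvatureFlow 𝓡₀ (K.prodG K') T F) {t : ℝ}
    (ht : t ∈ Ico 0 T) (x : M) (a b : 𝓔) :
    ContinuousWithinAt (fun s => K.lagForm K' (F s) x a b) (Ico 0 T) t ∧
    ContinuousWithinAt (fun s => K.indForm K' (F s) x a b) (Ico 0 T) t := by
  obtain ⟨S, O, hch, htS, hxO⟩ := hF.exists_isFlowChart ht x
  have h0 : Tendsto (fun s : ℝ => (s, extChartAt 𝓡₀ x x)) (𝓝[S] t)
      (𝓝[S ×ˢ O] (t, extChartAt 𝓡₀ x x)) := by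
    refine tendsto_nhdsWithin_iff.2 ⟨?_, ?_⟩
    · exact (Continuous.prodMk_left _).continuousAt.tendsto.mono_left nhdsWithin_le_nhds
    · filter_upwards [self_mem_nhdsWithin] with s hs using ⟨hs, hxO⟩
  have hl := ((contDiffOn_lagL hch hF).continuousOn (t, _) ⟨htS, hxO⟩).tendsto.comp h0
  have hi := ((contDiffOn_indL hch hF).continuousOn (t, _) ⟨htS, hxO⟩).tendsto.comp h0
  have he : ∀ {B : ℝ → 𝓔 →L[ℝ] 𝓔 →L[ℝ] ℝ}, ContinuousWithinAt B S t →
      ContinuousWithinAt (fun s => B s a b) S t := fun hB =>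
    (hB.clm_apply continuousWithinAt_const).clm_apply continuousWithinAt_const
  have hl' := he (B := fun s => K.lagL K' x (F t x) (F s) (extChartAt 𝓡₀ x x)) hl
  have hi' := he (B := fun s => K.indL K' x (F t x) (F s) (extChartAt 𝓡₀ x x)) hi
  have hS : ∀ᶠ s in 𝓝[S] t, s ∈ S := self_mem_nhdsWithin
  have hx := mem_extChartAt_source (I := 𝓡₀) x
  have hid : ∀ v : 𝓔, chartA 𝓡₀ x x v = v := fun v => by rw [chartA_self]; rfl
  rw [ContinuousWithinAt, ContinuousWithinAt, ← hch.nhdsWithin_eq htS]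
  constructor
  · refine (hl'.congr (fun s hs => ?_) ?_).tendsto
    · rw [(forms_eq_chartA hch hF hs hx hxO a b).1, hid, hid]
    · rw [(forms_eq_chartA hch hF htS hx hxO a b).1, hid, hid]
  · refine (hi'.congr (fun s hs => ?_) ?_).tendsto
    · rw [(forms_eq_chartA hch hF hs hx hxO a b).2, hid, hid]
    · rw [(forms_eq_chartA hch hF htS hx hxO a b).2, hid, hid]

/-- The growth rates `C` of the barriers that touch the form `lagForm` are locally bounded, because the
geometry of the flow is locally bounded. -/
theorem exists_growth_bound (hF : IsMeanCurvatureFlow 𝓡₀ (K.prodG K') T F) {c : ℝ}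
    (hc : ∀ (p : M) (v w : TangentSpace 𝓡₀ p), ricci K.g p v w = c * K.g p v w)
    (hc' : ∀ (p : N) (v w : TangentSpace 𝓡₀ p), ricci K'.g p v w = c * K'.g p v w)
    {t : ℝ} (ht : t ∈ Ico 0 T) (x : M) :
    ∃ C₀, ∀ᶠ p : ℝ × M in 𝓝[Ico 0 T ×ˢ univ] (t, x), ∀ C ε, K.Touches K' F C ε p → C ≤ C₀ := by
  obtain ⟨S, O, hch, htS, hxO⟩ := hF.exists_isFlowChart ht x
  set q := F t x
  have hKW := (K.isKahlerOn q.1).prod (K'.isKahlerOn q.2)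
  have hU := mapsTo_of_isFlowChart hch hF
  have hw : ContinuousWithinAt (fun p : ℝ × 𝓔 => inCharts 𝓡₀ 𝓟 x q (F p.1) p.2) (S ×ˢ O)
      (t, extChartAt 𝓡₀ x x) := (hch.contDiffOn hF).continuousOn _ ⟨htS, hxO⟩
  have hwU := hU (show (t, extChartAt 𝓡₀ x x) ∈ S ×ˢ O from ⟨htS, hxO⟩)
  obtain ⟨k, hk⟩ := exists_bound_bilinear
    (ContinuousAt.comp_continuousWithinAt (f := fun p : ℝ × 𝓔 => inCharts 𝓡₀ 𝓟 x q (F p.1) p.2)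
      (hKW.metric.contDiffAt hwU).continuousAt hw)
    ((contDiffOn_indL hch hF).continuousOn (t, extChartAt 𝓡₀ x x) ⟨htS, hxO⟩)
    ((hKW.metric.contDiffOn_nab_slice (F := fun r => inCharts 𝓡₀ 𝓟 x q (F r))
      (hch.contDiffOn hF) hch.uniqueDiffOn hch.isOpen hU).continuousOn
      (t, extChartAt 𝓡₀ x x) ⟨htS, hxO⟩)
    ((isImmersionOn_of_isFlowChart hch hF htS).isMetricOn_pull.pos _ hxO)
  obtain ⟨k₂, hk₂, hR⟩ := hKW.metric.exists_bound_riem hw hwU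
  refine ⟨|c| + 5 * finrank ℝ 𝓔 * k₂ + 6 * finrank ℝ 𝓔 * k ^ 2, ?_⟩
  filter_upwards [eventually_mem_of_isFlowChart hch htS hxO, (hch.tendsto htS hxO).eventually hk,
    (hch.tendsto htS hxO).eventually hR]
  rintro ⟨s, z⟩ ⟨hs, hz, hy⟩ h2 h3 C ε ⟨hs0, hε, hθ, hbar, a, b, hab, hlag⟩
  have hleft : 𝓝[<] s ≤ 𝓝[S] s := by
    rw [hch.nhdsWithin_eq hs]
    refine nhdsWithin_le_iff.2 ?_
    filter_upwards [Ioo_mem_nhdsLT hs0] with r hr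
    exact ⟨hr.1.le, hr.2.trans (hch.subset hs).2⟩
  have hSl : ∀ᶠ r in 𝓝[<] s, r ∈ S := hleft self_mem_nhdsWithin
  refine (isImmersionOn_of_isFlowChart hch hF hs).growth_le
    (F := fun r => inCharts 𝓡₀ 𝓟 x q (F r)) hKW (by rw [finrank_prod]) hy
    (hasDerivWithinAt_of_isFlowChart hch hF hs hy)
    (hasDerivWithinAt_fderiv_of_isFlowChart hch hF hs hy) hSl hε hθ
    (a := chartA 𝓡₀ x z a) (b := chartA 𝓡₀ x z b) ?_ ?_ ?_
    (hab.imp (chartA_ne_zero hz) (chartA_ne_zero hz)) h2 hk₂ h3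
    (trace_riemLin_prodM hc hc' q (hU (show (s, extChartAt 𝓡₀ x z) ∈ S ×ˢ O from ⟨hs, hy⟩)))
  · filter_upwards [hSl, Ioo_mem_nhdsLT hs0] with r hr hr0
    have h5 := hbar r ⟨hr0.1.le, hr0.2.le⟩ z a b
    rw [(forms_eq_chartA hch hF hr hz hy a a).2, (forms_eq_chartA hch hF hr hz hy b b).2,
      (forms_eq_chartA hch hF hr hz hy a b).1] at h5
    exact h5
  · filter_upwards [hch.isOpen.mem_nhds hy] with y' hy' a' b'
    have h5 := hbar s ⟨hs0.le, le_rfl⟩ ((extChartAt 𝓡₀ x).symm y') (chartD 𝓡₀ x y' a')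
      (chartD 𝓡₀ x y' b')
    rw [← (forms_eq hch hF hs hy' a' a').2, ← (forms_eq hch hF hs hy' b' b').2,
      ← (forms_eq hch hF hs hy' a' b').1] at h5
    exact h5
  · rw [(forms_eq_chartA hch hF hs hz hy a a).2, (forms_eq_chartA hch hF hs hz hy b b).2,
      (forms_eq_chartA hch hF hs hz hy a b).1] at hlag
    exact hlag

theorem indForm_pos (hF : IsMeanCurvatureFlow 𝓡₀ (K.prodG K') T F) {t : ℝ}
    (ht : t ∈ Ico 0 T) (x : M) {a : 𝓔} (ha : a ≠ 0) : 0 < K.indForm K' (F t) x a a := by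
  obtain ⟨S, O, hch, htS, hxO⟩ := hF.exists_isFlowChart ht x
  have hx := mem_extChartAt_source (I := 𝓡₀) x
  rw [(forms_eq_chartA hch hF htS hx hxO a a).2]
  exact (isImmersionOn_of_isFlowChart hch hF htS).isMetricOn_pull.pos _ hxO _ (chartA_ne_zero hx ha)

theorem lagForm_neg {f : M → M × N} (x : M) (a b : 𝓔) :
    K.lagForm K' f x (-a) b = -K.lagForm K' f x a b := by
  have key : ∀ (B B' : 𝓔 →L[ℝ] 𝓔 →L[ℝ] ℝ) (D D' : 𝓔 →L[ℝ] 𝓔),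
      B (D (-a)) (D b) - B' (D' (-a)) (D' b) = -(B (D a) (D b) - B' (D' a) (D' b)) := by
    intro B B' D D'
    simp only [map_neg, neg_apply]
    ring
  exact key (K.kform (f x).1) (K'.kform (f x).2) (dF₁ (n := n) f x) (dF₂ (n := n) f x)

theorem indForm_zero {f : M → M × N} (x : M) : K.indForm K' f x 0 0 = 0 := by
  have key : ∀ B : 𝓔 →L[ℝ] 𝓔 →L[ℝ] ℝ, B 0 0 = 0 := by simp
  exact key (pullbackMetric (I := 𝓡₀) (K.prodG K') f x)

theorem lagForm_zero {f : M → M × N} (x : M) : K.lagForm K' f x 0 0 = 0 := by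
  have h := lagForm_neg (K := K) (K' := K') (f := f) x 0 0
  rw [neg_zero] at h
  linarith

/-- If the initial immersion is Lagrangian and the barrier `ε e^{Cr}` does not lie strictly above the
form `lagForm` at time `t`, then it touches the form at some earlier point: by compactness there is
a first time at which strict positivity fails. -/
theorem exists_touches [CompactSpace M] (hF : IsMeanCurvatureFlow 𝓡₀ (K.prodG K') T F)
    (h0 : K.IsLagrangian K' (F 0)) {t : ℝ} (ht : t ∈ Ico 0 T) {C ε : ℝ} (hC : 0 ≤ C) (hε : 0 < ε)
    (hεt : ε * Real.exp (C * t) ≤ 1 / 2) {x : M}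
    (hx : ¬ K.IsBelow K' (F t) (ε * Real.exp (C * t)) x) :
    ∃ p ∈ Icc 0 t ×ˢ (univ : Set M), K.Touches K' F C ε p := by
  set θ : ℝ → ℝ := fun r => ε * Real.exp (C * r) with hθ
  have hθc : Continuous θ := by fun_prop
  have hsub : Icc 0 t ×ˢ (univ : Set M) ⊆ Ico 0 T ×ˢ univ := fun p hp =>
    ⟨⟨hp.1.1, hp.1.2.trans_lt ht.2⟩, hp.2⟩
  -- the closed set of points at which the barrier is not strictly above the form
  set Z := {p ∈ Icc 0 t ×ˢ (univ : Set M) | ¬ K.IsBelow K' (F p.1) (θ p.1) p.2}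
  have hZc : IsClosed Z := by
    refine isClosed_of_closure_subset fun p hp => ?_
    have hpK : p ∈ Icc 0 t ×ˢ (univ : Set M) :=
      (isClosed_Icc.prod isClosed_univ).closure_subset_iff.2 (fun _ h => h.1) hp
    refine ⟨hpK, fun hb => ?_⟩
    have h1 := eventually_isBelow hF (hsub hpK).1 hθc hb
    have h2 : 𝓝[Z] p ≤ 𝓝[Ico 0 T ×ˢ univ] p := nhdsWithin_mono _ fun _ h => hsub h.1
    have : (𝓝[Z] p).NeBot := mem_closure_iff_nhdsWithin_neBot.1 hp
    obtain ⟨z, hz1, hz2⟩ := ((h1.filter_mono h2).and self_mem_nhdsWithin).exists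
    exact hz2.2 hz1
  have hZ : IsCompact Z := (isCompact_Icc.prod isCompact_univ).of_isClosed_subset hZc fun _ h => h.1
  obtain ⟨⟨s, z⟩, ⟨hs, hnb⟩, hmin⟩ := hZ.exists_isMinOn ⟨(t, x), ⟨⟨⟨ht.1, le_rfl⟩, mem_univ _⟩, hx⟩⟩
    continuous_fst.continuousOn
  have hsT : s ∈ Ico 0 T := (hsub hs).1
  have hs0 : 0 < s := by
    refine lt_of_le_of_ne hs.1.1 fun h => hnb fun a b hab => ?_
    simp only [← h] at hsT ⊢
    rw [isLagrangian_iff.1 h0 z a b]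
    have h1 : ∀ v : 𝓔, 0 ≤ K.indForm K' (F 0) z v v := fun v => by
      rcases eq_or_ne v 0 with rfl | hv
      · exact (indForm_zero z).ge
      · exact (indForm_pos hF hsT z hv).le
    have h2 : 0 < K.indForm K' (F 0) z a a + K.indForm K' (F 0) z b b := by
      rcases hab with ha | hb
      · exact add_pos_of_pos_of_nonneg (indForm_pos hF hsT z ha) (h1 b)
      · exact add_pos_of_nonneg_of_pos (h1 a) (indForm_pos hF hsT z hb)
    have : 0 < θ 0 := by positivity
    positivity
  have hlt : ∀ r ∈ Ico 0 s, ∀ y (a b : 𝓔), K.lagForm K' (F r) y a b ≤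
      θ r / 2 * (K.indForm K' (F r) y a a + K.indForm K' (F r) y b b) := fun r hr y a b => by
    by_cases hab : a ≠ 0 ∨ b ≠ 0
    · have h1 : K.IsBelow K' (F r) (θ r) y := by
        by_contra hc
        have h2 := hmin (show (r, y) ∈ Z from
          ⟨⟨⟨hr.1, hr.2.le.trans hs.1.2⟩, mem_univ _⟩, hc⟩)
        exact absurd hr.2 (not_lt.2 h2)
      exact (h1 a b hab).le
    · push Not at hab
      rw [hab.1, hab.2, lagForm_zero, indForm_zero, add_zero, mul_zero]
  have hle : ∀ r ∈ Icc 0 s, ∀ y (a b : 𝓔), K.lagForm K' (F r) y a b ≤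
      θ r / 2 * (K.indForm K' (F r) y a a + K.indForm K' (F r) y b b) := fun r hr y a b => by
    rcases hr.2.lt_or_eq with h | rfl
    · exact hlt r ⟨hr.1, h⟩ y a b
    have hl : 𝓝[<] r ≤ 𝓝[Ico 0 T] r := by
      refine nhdsWithin_le_iff.2 ?_
      filter_upwards [Ioo_mem_nhdsLT hs0] with r' hr'
      exact ⟨hr'.1.le, hr'.2.trans hsT.2⟩
    have hc := fun u v => continuousWithinAt_forms hF hsT y u v
    refine le_of_tendsto_of_tendsto ((hc a b).1.tendsto.mono_left hl)
      ((((hθc.div_const 2).continuousWithinAt.tendsto).mul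
        ((hc a a).2.tendsto.add (hc b b).2.tendsto)).mono_left hl) ?_
    filter_upwards [Ioo_mem_nhdsLT hs0] with r' hr' using hlt r' ⟨hr'.1.le, hr'.2⟩ y a b
  have hnb' := hnb
  unfold IsBelow at hnb'
  push Not at hnb'
  obtain ⟨a, b, hab, hge⟩ := hnb'
  refine ⟨(s, z), hs, hs0, hε, le_trans ?_ hεt, hle, a, b, hab,
    le_antisymm (hle s ⟨hs0.le, le_rfl⟩ z a b) hge⟩
  have := hs.1.2
  gcongr

/-- On a compact manifold, the Lagrangian condition is preserved. -/
theorem isLagrangian_of_compact [CompactSpace M]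
    (hF : IsMeanCurvatureFlow 𝓡₀ (K.prodG K') T F) {c : ℝ}
    (hc : ∀ (p : M) (v w : TangentSpace 𝓡₀ p), ricci K.g p v w = c * K.g p v w)
    (hc' : ∀ (p : N) (v w : TangentSpace 𝓡₀ p), ricci K'.g p v w = c * K'.g p v w)
    (h0 : K.IsLagrangian K' (F 0)) {t : ℝ} (ht : t ∈ Ico 0 T) : K.IsLagrangian K' (F t) := by
  obtain ⟨C₁, hC₁⟩ : ∃ C₁, ∀ p ∈ Icc 0 t ×ˢ (univ : Set M), ∀ C ε, K.Touches K' F C ε p →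
      C ≤ C₁ := by
    refine (isCompact_Icc.prod isCompact_univ).induction_on
      (p := fun s => ∃ C₁, ∀ p ∈ s, ∀ C ε, K.Touches K' F C ε p → C ≤ C₁)
      ⟨0, by simp⟩ (fun s s' hs ⟨C, h⟩ => ⟨C, fun p hp => h p (hs hp)⟩) ?_ ?_
    · rintro s s' ⟨C, h⟩ ⟨C', h'⟩
      refine ⟨max C C', fun p hp D ε hT => ?_⟩
      rcases hp with hp | hp
      · exact (h p hp D ε hT).trans (le_max_left _ _)
      · exact (h' p hp D ε hT).trans (le_max_right _ _)
    · rintro ⟨s, z⟩ hsz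
      obtain ⟨C₀, h⟩ := exists_growth_bound hF hc hc' (t := s) ⟨hsz.1.1, hsz.1.2.trans_lt ht.2⟩ z
      refine ⟨_, ?_, C₀, fun p hp => hp⟩
      refine nhdsWithin_mono _ ?_ h
      exact fun p hp => ⟨⟨hp.1.1, hp.1.2.trans_lt ht.2⟩, hp.2⟩
  have hle : ∀ (x : M) (u v : 𝓔), K.lagForm K' (F t) x u v ≤ 0 := by
    intro x u v
    by_contra! hpos
    set A := K.lagForm K' (F t) x u v
    set B := |K.indForm K' (F t) x u u + K.indForm K' (F t) x v v|
    -- a barrier that grows faster than touching barriers can, and is small enough at time `t` to fail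
    -- at `(u, v)`
    set C := max C₁ 0 + 1
    have hC : 0 ≤ C := by positivity
    set δ := min (1 / 2) (A / (B + 1))
    have hB : 0 < B + 1 := by positivity
    have hδ : 0 < δ := lt_min (by norm_num) (by positivity)
    have he : δ * Real.exp (-(C * t)) * Real.exp (C * t) = δ := by
      rw [mul_assoc, ← Real.exp_add, neg_add_cancel, Real.exp_zero, mul_one]
    obtain ⟨p, hp, hT⟩ := exists_touches hF h0 ht (C := C) (ε := δ * Real.exp (-(C * t))) hC
      (by positivity) (by rw [he]; exact min_le_left _ _) (x := x) fun hb => by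
        have huv : u ≠ 0 ∨ v ≠ 0 := by
          by_contra! h
          have : A = 0 := by
            simp only [A]
            rw [h.1, h.2, lagForm_zero]
          exact hpos.ne' this
        have h1 := hb u v huv
        rw [he] at h1
        have h2 : δ * (B + 1) ≤ A := (le_div_iff₀ hB).1 (min_le_right _ _)
        have h3 : δ / 2 * (K.indForm K' (F t) x u u + K.indForm K' (F t) x v v) ≤ δ / 2 * B :=
          mul_le_mul_of_nonneg_left (le_abs_self _) (by positivity)
        have h4 : 0 ≤ δ * B := by positivity
        have h5 : A < δ / 2 * (K.indForm K' (F t) x u u + K.indForm K' (F t) x v v) := h1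
        linarith
    have h1 := hC₁ p hp _ _ hT
    have h2 := le_max_left C₁ 0
    simp only [C] at h1
    linarith
  refine isLagrangian_iff.2 fun x u v => le_antisymm (hle x u v) ?_
  have h1 := hle x (-u) v
  rw [lagForm_neg] at h1
  linarith

end KahlerStructure

end

section

/-! ### The Fubini-Study metric in an affine chart -/

section FubiniStudy

variable {V : Type*} [NormedAddCommGroup V] [InnerProductSpace ℝ V]

local notation "⟪" x ", " y "⟫" => inner ℝ x y

/-- The inner product as a continuous bilinear form. -/
def innerB : V →L[ℝ] V →L[ℝ] ℝ := innerSL ℝ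

theorem innerB_apply (u v : V) : innerB u v = ⟪u, v⟫ := rfl

/-- The Fubini-Study metric of holomorphic sectional curvature `1` in the affine chart with complex
structure `J`: the restriction of the homogeneous expression to the slice `{z₀ + w}` with `|z₀| = 1`
and `w ⟂ z₀`. -/
def fsMetric (J : V →L[ℝ] V) (w : V) : V →L[ℝ] V →L[ℝ] ℝ :=
  (4 * (1 + ⟪w, w⟫)⁻¹) • innerB - (4 * ((1 + ⟪w, w⟫)⁻¹) ^ 2) •
    ((innerB w).smulRight (innerB w) + (innerB (J w)).smulRight (innerB (J w)))

/-- The Christoffel symbols of the Fubini-Study metric in an affine chart. -/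
def fsChr (J : V →L[ℝ] V) (w : V) : V →L[ℝ] V →L[ℝ] V :=
  -((1 + ⟪w, w⟫)⁻¹ • (((innerB w).smulRight (ContinuousLinearMap.id ℝ V) +
    (innerB (J w)).smulRight J) + ((innerB w).smulRight (ContinuousLinearMap.id ℝ V) +
    (innerB (J w)).smulRight J).flip))

variable {J : V →L[ℝ] V}

theorem fsMetric_apply (w u v : V) : fsMetric J w u v = 4 * (1 + ⟪w, w⟫)⁻¹ * ⟪u, v⟫ -
    4 * ((1 + ⟪w, w⟫)⁻¹) ^ 2 * (⟪w, u⟫ * ⟪w, v⟫ + ⟪J w, u⟫ * ⟪J w, v⟫) := by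
  simp [fsMetric, innerB_apply]
  ring

theorem fsChr_apply (w u v : V) : fsChr J w u v = -((1 + ⟪w, w⟫)⁻¹ •
    ((⟪w, u⟫ • v + ⟪J w, u⟫ • J v) + (⟪w, v⟫ • u + ⟪J w, v⟫ • J u))) := by
  simp [fsChr, innerB_apply]

theorem one_add_inner_self_pos (w : V) : 0 < 1 + ⟪w, w⟫ :=
  add_pos_of_pos_of_nonneg one_pos real_inner_self_nonneg

theorem contDiff_fsMetric : ContDiff ℝ ∞ (fsMetric J) := by
  have h1 : ContDiff ℝ ∞ fun w : V => (1 + ⟪w, w⟫)⁻¹ :=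
    (contDiff_const.add (contDiff_id.inner ℝ contDiff_id)).inv fun w =>
      (one_add_inner_self_pos w).ne'
  have h2 : ContDiff ℝ ∞ fun w : V => (innerB w : V →L[ℝ] ℝ) := innerB.contDiff
  have h3 : ContDiff ℝ ∞ fun w : V => (innerB (J w) : V →L[ℝ] ℝ) := h2.comp J.contDiff
  exact ((contDiff_const.mul h1).smul (contDiff_const (c := innerB))).sub
    ((contDiff_const.mul (h1.pow 2)).smul ((h2.smulRight h2).add (h3.smulRight h3)))

theorem contDiff_fsChr : ContDiff ℝ ∞ (fsChr J) := by
  have h1 : ContDiff ℝ ∞ fun w : V => (1 + ⟪w, w⟫)⁻¹ :=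
    (contDiff_const.add (contDiff_id.inner ℝ contDiff_id)).inv fun w =>
      (one_add_inner_self_pos w).ne'
  have h2 : ContDiff ℝ ∞ fun w : V => (innerB w : V →L[ℝ] ℝ) := innerB.contDiff
  have h3 : ContDiff ℝ ∞ fun w : V => (innerB (J w) : V →L[ℝ] ℝ) := h2.comp J.contDiff
  have h4 := (h2.smulRight (contDiff_const (c := ContinuousLinearMap.id ℝ V))).add
    (h3.smulRight (contDiff_const (c := J)))
  exact (h1.smul (h4.add ((ContinuousLinearMap.flipₗᵢ ℝ V V V).contDiff.comp h4))).neg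

variable (hsq : ∀ v, J (J v) = -v) (horth : ∀ u v, ⟪J u, J v⟫ = ⟪u, v⟫)

include hsq horth in
theorem inner_J_left (u v : V) : ⟪J u, v⟫ = -⟪u, J v⟫ := by
  rw [← horth (J u) v, hsq, inner_neg_left]

include hsq horth in
theorem inner_J_self (u : V) : ⟪J u, u⟫ = 0 := by
  have h := inner_J_left hsq horth u u
  rw [real_inner_comm (J u) u] at h
  linarith

include hsq horth in
/-- Positivity comes from the Cauchy-Schwarz inequality for the Hermitian form with real part the inner
product. -/
theorem isMetricOn_fsMetric : IsMetricOn (fsMetric J) univ where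
  isOpen := isOpen_univ
  smooth := contDiff_fsMetric.contDiffOn
  symm w _ u v := by
    rw [fsMetric_apply, fsMetric_apply, real_inner_comm u v]
    ring
  pos w _ u hu := by
    have hN := one_add_inner_self_pos w
    have h0 : 0 < ⟪u, u⟫ := real_inner_self_pos.2 hu
    have h1 : ⟪w, u⟫ ^ 2 + ⟪J w, u⟫ ^ 2 ≤ ⟪w, w⟫ * ⟪u, u⟫ := by
      have h2 := real_inner_self_nonneg (x := ⟪u, u⟫ • w - (⟪w, u⟫ • u - ⟪J w, u⟫ • J u))
      simp only [inner_sub_left, inner_sub_right, inner_smul_left, inner_smul_right,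
        conj_trivial, horth, inner_J_self hsq horth] at h2
      rw [real_inner_comm w u, real_inner_comm (J u) u, inner_J_self hsq horth,
        real_inner_comm w (J u)] at h2
      have h3 : 0 ≤ ⟪u, u⟫ * (⟪w, w⟫ * ⟪u, u⟫ - (⟪w, u⟫ ^ 2 + ⟪J w, u⟫ ^ 2)) := by
        have h4 : ⟪w, J u⟫ = -⟪J w, u⟫ := by rw [inner_J_left hsq horth, neg_neg]
        rw [h4] at h2
        nlinarith
      linarith [nonneg_of_mul_nonneg_right h3 h0]
    rw [fsMetric_apply]
    have h5 : 4 * (1 + ⟪w, w⟫)⁻¹ * ⟪u, u⟫ -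
        4 * ((1 + ⟪w, w⟫)⁻¹) ^ 2 * (⟪w, u⟫ * ⟪w, u⟫ + ⟪J w, u⟫ * ⟪J w, u⟫) =
        4 * ((1 + ⟪w, w⟫)⁻¹) ^ 2 *
          (⟪u, u⟫ + (⟪w, w⟫ * ⟪u, u⟫ - (⟪w, u⟫ ^ 2 + ⟪J w, u⟫ ^ 2))) := by
      field_simp
      ring
    rw [h5]
    have : 0 ≤ ⟪w, w⟫ * ⟪u, u⟫ - (⟪w, u⟫ ^ 2 + ⟪J w, u⟫ ^ 2) := by linarith
    positivity

theorem fderiv_fsMetric (w s u v : V) : fderiv ℝ (fsMetric J) w s u v =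
    -8 * ((1 + ⟪w, w⟫)⁻¹) ^ 2 * ⟪w, s⟫ * ⟪u, v⟫ +
    16 * ((1 + ⟪w, w⟫)⁻¹) ^ 3 * ⟪w, s⟫ * (⟪w, u⟫ * ⟪w, v⟫ + ⟪J w, u⟫ * ⟪J w, v⟫) -
    4 * ((1 + ⟪w, w⟫)⁻¹) ^ 2 * (⟪s, u⟫ * ⟪w, v⟫ + ⟪w, u⟫ * ⟪s, v⟫ +
      ⟪J s, u⟫ * ⟪J w, v⟫ + ⟪J w, u⟫ * ⟪J s, v⟫) := by
  have hN := one_add_inner_self_pos w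
  have hd : HasFDerivAt (fsMetric J) (fderiv ℝ (fsMetric J) w) w :=
    ((contDiff_fsMetric (J := J)).differentiable (by simp) w).hasFDerivAt
  have hl : HasDerivAt (fun r : ℝ => w + r • s) s 0 := by
    simpa using ((hasDerivAt_id (0 : ℝ)).smul_const s).const_add w
  have h0 : w + (0 : ℝ) • s = w := by simp
  have h1 : HasDerivAt (fun r : ℝ => fsMetric J (w + r • s) u v)
      (fderiv ℝ (fsMetric J) w s u v) 0 := by
    have hd' : HasFDerivAt (fsMetric J) (fderiv ℝ (fsMetric J) w) (w + (0 : ℝ) • s) := by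
      rw [h0]
      exact hd
    have h2 := HasFDerivAt.comp_hasDerivAt (0 : ℝ) hd' hl
    have h3 := (h2.clm_apply (hasDerivAt_const _ u)).clm_apply (hasDerivAt_const _ v)
    simpa using h3
  have hi : ∀ a, HasDerivAt (fun r : ℝ => ⟪w + r • s, a⟫) ⟪s, a⟫ 0 := fun a => by
    simpa using hl.inner ℝ (hasDerivAt_const (0 : ℝ) a)
  have hJ : ∀ a, HasDerivAt (fun r : ℝ => ⟪J (w + r • s), a⟫) ⟪J s, a⟫ 0 := fun a => by
    simpa using (J.hasFDerivAt.comp_hasDerivAt (0 : ℝ) hl).inner ℝ (hasDerivAt_const (0 : ℝ) a)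
  have hn : HasDerivAt (fun r : ℝ => (1 + ⟪w + r • s, w + r • s⟫)⁻¹)
      (-(2 * ⟪w, s⟫) / (1 + ⟪w, w⟫) ^ 2) 0 := by
    have h2 := ((hl.inner ℝ hl).const_add 1).inv (by rw [h0]; exact hN.ne')
    refine h2.congr_deriv ?_
    rw [h0, real_inner_comm w s]
    ring
  have h4 := ((hn.const_mul 4).mul_const ⟪u, v⟫).sub (((hn.pow 2).const_mul 4).mul
    (((hi u).mul (hi v)).add ((hJ u).mul (hJ v))))
  have h5 : (fun r : ℝ => fsMetric J (w + r • s) u v) = _ := funext fun r =>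
    fsMetric_apply (J := J) (w + r • s) u v
  rw [h5] at h1
  rw [h1.unique h4]
  simp only [Pi.add_apply, Pi.mul_apply, Pi.pow_apply, zero_smul, add_zero, Nat.cast_ofNat,
    show 2 - 1 = 1 from rfl, pow_one]
  have hN' := hN.ne'
  generalize 1 + ⟪w, w⟫ = N at hN'
  field_simp
  ring

variable [FiniteDimensional ℝ V]

include hsq horth in
/-- The Christoffel symbols are determined by the Koszul formula, because `fsMetric` is nondegenerate. -/
theorem chrL_fsMetric : chrL (fsMetric J) = fsChr J := by
  have hm := isMetricOn_fsMetric hsq horth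
  funext w
  refine ContinuousLinearMap.ext fun u => ContinuousLinearMap.ext fun v => ?_
  refine (hm.isInner (mem_univ w)).ext_inner fun z => ?_
  rw [hm.inner_chrL (mem_univ w), fderiv_fsMetric, fderiv_fsMetric, fderiv_fsMetric, fsMetric_apply,
    fsChr_apply]
  have hN := one_add_inner_self_pos w
  have hJJ : ∀ a b, ⟪J a, b⟫ = -⟪a, J b⟫ := inner_J_left hsq horth
  have hJJ' : ∀ a, ⟪J w, J a⟫ = ⟪w, a⟫ := horth w
  have hc : ∀ a, ⟪w, J a⟫ = -⟪J w, a⟫ := fun a => by rw [hJJ, neg_neg]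
  simp only [inner_neg_left, inner_smul_left, inner_add_left, inner_neg_right, inner_smul_right,
    inner_add_right, conj_trivial, hJJ', hc]
  have hz : ∀ a, ⟪J z, a⟫ = -⟪J a, z⟫ := fun a => by rw [hJJ, real_inner_comm]
  rw [hz u, hz v, hJJ v u, ← real_inner_comm u v, real_inner_comm v (J u)]
  rw [real_inner_comm u z, real_inner_comm v z]
  ring

theorem fderiv_fsChr (s u v : V) : fderiv ℝ (fsChr J) 0 s u v =
    -(⟪s, u⟫ • v + ⟪J s, u⟫ • J v + (⟪s, v⟫ • u + ⟪J s, v⟫ • J u)) := by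
  have hd : HasFDerivAt (fsChr J) (fderiv ℝ (fsChr J) 0) (0 + (0 : ℝ) • s) := by
    rw [zero_smul, zero_add]
    exact ((contDiff_fsChr (J := J)).differentiable (by simp) 0).hasFDerivAt
  have hl : HasDerivAt (fun r : ℝ => (0 : V) + r • s) s 0 := by
    simpa using (hasDerivAt_id (0 : ℝ)).smul_const s
  have h2 := HasFDerivAt.comp_hasDerivAt (0 : ℝ) hd hl
  have h3 := (h2.clm_apply (hasDerivAt_const _ u)).clm_apply (hasDerivAt_const _ v)
  simp only [map_zero, add_zero, zero_add, zero_apply, Function.comp_def] at h3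
  have h4 : HasDerivAt (fun r : ℝ => (-(r * (1 + ⟪r • s, r • s⟫)⁻¹))) (-1) 0 := by
    have h5 : HasDerivAt (fun r : ℝ => 1 + r * (r * ⟪s, s⟫)) (1 * (0 * ⟪s, s⟫) + 0 * (1 * ⟪s, s⟫)) 0 :=
      ((hasDerivAt_id (0 : ℝ)).mul ((hasDerivAt_id (0 : ℝ)).mul_const _)).const_add 1
    have h6 := ((hasDerivAt_id (0 : ℝ)).mul (h5.inv (by simp))).neg
    simp only [inner_smul_left, inner_smul_right, conj_trivial]
    refine h6.congr_deriv ?_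
    simp
  have h5 := h4.smul_const (⟪s, u⟫ • v + ⟪J s, u⟫ • J v + (⟪s, v⟫ • u + ⟪J s, v⟫ • J u))
  rw [neg_one_smul] at h5
  refine h3.unique ?_
  convert h5 using 2 with r
  rw [fsChr_apply]
  simp only [map_smul, inner_smul_left, conj_trivial]
  module

include hsq horth in
/-- The curvature of the Fubini-Study metric at the origin of the affine chart. -/
theorem riem_fsMetric (u v w : V) : riem (fsMetric J) 0 u v w =
    ⟪v, w⟫ • u + ⟪J v, w⟫ • J u - ⟪u, w⟫ • v - ⟪J u, w⟫ • J v + (2 * ⟪J v, u⟫) • J w := by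
  unfold riem
  rw [chrL_fsMetric hsq horth, fderiv_fsChr, fderiv_fsChr]
  have h0 : ∀ a b, fsChr J 0 a b = 0 := fun a b => by simp [fsChr_apply]
  rw [h0, h0, real_inner_comm u v, inner_J_left hsq horth u v, ← real_inner_comm u (J v)]
  module

end FubiniStudy

end

section

/-! ### Affine slices of complex projective space -/

namespace KahlerStructure

variable {n : ℕ} {M : Type*} [TopologicalSpace M]
  [ChartedSpace (EuclideanSpace ℝ (Fin (2 * n))) M] [IsManifold (𝓡 (2 * n)) ∞ M]
  {N : Type*} [TopologicalSpace N]
  [ChartedSpace (EuclideanSpace ℝ (Fin (2 * n))) N] [IsManifold (𝓡 (2 * n)) ∞ N]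
  {K : KahlerStructure n M} {K' : KahlerStructure n N}

local notation "𝓔" => EuclideanSpace ℝ (Fin (2 * n))
local notation "𝓡₀" => 𝓡 (2 * n)
local notation "𝓟" => ModelWithCorners.prod (𝓡 (2 * n)) (𝓡 (2 * n))


local notation "ℂE" => EuclideanSpace ℂ (Fin (n + 1))

/-- The conditions on `π` in the definition of the Fubini-Study metric at a point `z`: `dπ` is
complex linear, and pulls back the metric to the homogeneous expression. -/
def IsFSAt (K : KahlerStructure n M) (π : EuclideanSpace ℂ (Fin (n + 1)) → M)
    (z : EuclideanSpace ℂ (Fin (n + 1))) : Prop :=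
  (∀ v : ℂE, mfd 𝓘(ℝ, ℂE) 𝓡₀ π z (Complex.I • v) = K.Jp (π z) (mfd 𝓘(ℝ, ℂE) 𝓡₀ π z v)) ∧
  ∀ v w : ℂE, K.g (π z) (mfd 𝓘(ℝ, ℂE) 𝓡₀ π z v) (mfd 𝓘(ℝ, ℂE) 𝓡₀ π z w) =
    4 * (((‖z‖ ^ 2 : ℝ) : ℂ) * inner ℂ v w - inner ℂ v z * inner ℂ z w).re / ‖z‖ ^ 4

theorem chartD_modelSpace (z y : ℂE) : chartD 𝓘(ℝ, ℂE) z y = ContinuousLinearMap.id ℝ ℂE := by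
  have h : ((extChartAt 𝓘(ℝ, ℂE) z).symm : ℂE → ℂE) = id := rfl
  unfold chartD
  rw [h]
  exact mfderiv_id

section Slice

variable {V : Type*} [NormedAddCommGroup V] [InnerProductSpace ℝ V] [FiniteDimensional ℝ V]
  {J : V →L[ℝ] V} {π : EuclideanSpace ℂ (Fin (n + 1)) → M}
  {z₀ : EuclideanSpace ℂ (Fin (n + 1))} {ι : V →L[ℝ] EuclideanSpace ℂ (Fin (n + 1))}

/-- The homogeneous expression for the Fubini-Study metric, on vectors tangent to the slice
`{z₀ + w}`. -/
theorem inner_slice (hz : ‖z₀‖ = 1) (hι : ∀ u v, (inner ℂ (ι u) (ι v)).re = inner ℝ u v)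
    (hι' : ∀ u v, (inner ℂ (ι u) (ι v)).im = inner ℝ (J u) v) (hperp : ∀ u, inner ℂ (ι u) z₀ = 0)
    (w u v : V) :
    4 * (((‖z₀ + ι w‖ ^ 2 : ℝ) : ℂ) * inner ℂ (ι u) (ι v) -
      inner ℂ (ι u) (z₀ + ι w) * inner ℂ (z₀ + ι w) (ι v)).re / ‖z₀ + ι w‖ ^ 4 =
    fsMetric J w u v := by
  have h1 : ∀ u, inner ℂ z₀ (ι u) = 0 := fun u => by
    rw [← inner_conj_symm, hperp, map_zero]
  have h2 : ‖z₀ + ι w‖ ^ 2 = 1 + inner ℝ w w := by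
    rw [norm_add_sq (𝕜 := ℂ), h1, hz, ← hι, ← inner_self_eq_norm_sq (𝕜 := ℂ) (ι w)]
    simp
  have h4 : ‖z₀ + ι w‖ ^ 4 = (1 + inner ℝ w w) ^ 2 := by rw [← h2]; ring
  have hN := one_add_inner_self_pos w
  have h5 : inner ℂ (ι u) (ι w) = (starRingEnd ℂ) (inner ℂ (ι w) (ι u)) := (inner_conj_symm _ _).symm
  rw [h4, h2, fsMetric_apply, inner_add_left, inner_add_right, h1, hperp, zero_add, zero_add, h5]
  simp only [Complex.sub_re, Complex.mul_re, Complex.conj_re, Complex.conj_im, Complex.ofReal_re,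
    Complex.ofReal_im, hι, hι']
  field_simp
  ring

/-- The projection `π`, restricted to the slice `{z₀ + w}` with `w` orthogonal to `z₀`, is a holomorphic
local isometry from `fsMetric` to the metric of the projective space. -/
theorem exists_slice_chart (hz : ‖z₀‖ = 1) (hι : ∀ u v, (inner ℂ (ι u) (ι v)).re = inner ℝ u v)
    (hι' : ∀ u v, (inner ℂ (ι u) (ι v)).im = inner ℝ (J u) v) (hperp : ∀ u, inner ℂ (ι u) z₀ = 0)
    (hsq : ∀ v, J (J v) = -v) (horth : ∀ u v, inner ℝ (J u) (J v) = inner ℝ u v)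
    (hJ : ∀ u, ι (J u) = Complex.I • ι u)
    (hsm : ContMDiffOn 𝓘(ℝ, ℂE) 𝓡₀ ∞ π {0}ᶜ) (hfs : ∀ z, z ≠ 0 → K.IsFSAt π z) :
    ∃ (f : V → 𝓔) (O : Set V), IsImmersionOn (metricInChart K.g (π z₀))
      (extChartAt 𝓡₀ (π z₀)).target f O ∧ (0 : V) ∈ O ∧
      f 0 = extChartAt 𝓡₀ (π z₀) (π z₀) ∧
      (∀ y ∈ O, pull (metricInChart K.g (π z₀)) f y = fsMetric J y) ∧
      ∀ v, fderiv ℝ f 0 (J v) = K.Jp (π z₀) (fderiv ℝ f 0 v) := by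
  set p := π z₀
  have hne : ∀ w, z₀ + ι w ≠ 0 := fun w h0 => by
    have h1 : inner ℂ z₀ (z₀ + ι w) = 0 := by rw [h0, inner_zero_right]
    rw [inner_add_right, ← inner_conj_symm z₀ (ι w), hperp, map_zero, add_zero,
      inner_self_eq_norm_sq_to_K, hz] at h1
    simp at h1
  set O : Set V := (fun w => π (z₀ + ι w)) ⁻¹' (extChartAt 𝓡₀ p).source
  have hcm : ∀ w, ContMDiffAt 𝓘(ℝ, ℂE) 𝓡₀ ∞ π (z₀ + ι w) := fun w =>
    hsm.contMDiffAt (isOpen_compl_singleton.mem_nhds (hne w))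
  have hcont : Continuous fun w => π (z₀ + ι w) := by
    refine continuous_iff_continuousAt.2 fun w => ?_
    exact (hcm w).continuousAt.comp (f := fun w => z₀ + ι w) (by fun_prop)
  set ψ : ℂE → 𝓔 := inCharts 𝓘(ℝ, ℂE) 𝓡₀ z₀ p π
  have htgt : ∀ y : ℂE, y ∈ (extChartAt 𝓘(ℝ, ℂE) z₀).target := fun y => by
    rw [extChartAt_target]
    exact ⟨mem_univ y, y, rfl⟩
  have hsymm : ∀ y : ℂE, (extChartAt 𝓘(ℝ, ℂE) z₀).symm y = y := fun y => rfl
  have hψ : ∀ w ∈ O, ContDiffAt ℝ ∞ ψ (z₀ + ι w) := fun w hw =>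
    contDiffAt_inCharts (htgt _) (by rw [hsymm]; exact hcm w) (by rw [hsymm]; exact hw)
  have hψD : ∀ w ∈ O, ∀ v, chartD 𝓡₀ p (ψ (z₀ + ι w)) (fderiv ℝ ψ (z₀ + ι w) v) =
      mfd 𝓘(ℝ, ℂE) 𝓡₀ π (z₀ + ι w) v := fun w hw v => by
    have h := chartD_fderiv_inCharts (I := 𝓘(ℝ, ℂE)) (I' := 𝓡₀) (x := z₀) (q := p) (F := π)
      (htgt (z₀ + ι w)) (by rw [hsymm]; exact (hcm w).mdifferentiableAt (by simp))
      (by rw [hsymm]; exact hw) v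
    rw [chartD_modelSpace, hsymm] at h
    exact h
  have hlin : ∀ w, HasFDerivAt (fun w => z₀ + ι w) ι w := fun w => ι.hasFDerivAt.const_add z₀
  set f : V → 𝓔 := fun w => ψ (z₀ + ι w)
  have hf : ∀ w ∈ O, fderiv ℝ f w = (fderiv ℝ ψ (z₀ + ι w)) ∘L ι := fun w hw =>
    (HasFDerivAt.comp (g := ψ) (f := fun w => z₀ + ι w) w
      ((hψ w hw).differentiableAt (by simp)).hasFDerivAt (hlin w)).fderiv
  have hψv : ∀ w, (extChartAt 𝓡₀ p).symm (ψ (z₀ + ι w)) = (extChartAt 𝓡₀ p).symm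
      (extChartAt 𝓡₀ p (π (z₀ + ι w))) := fun w => rfl
  have hpull : ∀ w ∈ O, pull (metricInChart K.g p) f w = fsMetric J w := fun w hw => by
    refine ContinuousLinearMap.ext fun u => ContinuousLinearMap.ext fun v => ?_
    rw [pull_apply, hf w hw, ← inner_slice hz hι hι' hperp, ← (hfs _ (hne w)).2, ← hψD w hw,
      ← hψD w hw]
    exact metricInChart_chart K.g hw _ _
  have hJpos := isMetricOn_fsMetric hsq horth
  have h0 : (0 : V) ∈ O := by
    simp only [O, mem_preimage, map_zero, add_zero]
    exact mem_extChartAt_source p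
  refine ⟨f, O, ⟨(K.isKahlerOn p).metric, (isOpen_extChartAt_source p).preimage hcont,
    fun w hw => ?_, fun w hw => (extChartAt 𝓡₀ p).map_source hw, fun w hw => ?_⟩, h0, ?_, hpull, ?_⟩
  · exact (ContDiffAt.comp (g := ψ) (f := fun w => z₀ + ι w) w (hψ w hw)
      (by fun_prop)).contDiffWithinAt
  · refine (injective_iff_map_eq_zero _).2 fun v hv => ?_
    by_contra h0
    have h1 := hJpos.pos w (mem_univ w) v h0
    rw [← hpull w hw, pull_apply, hv, map_zero] at h1
    exact lt_irrefl _ h1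
  · show extChartAt 𝓡₀ p (π (z₀ + ι 0)) = _
    rw [map_zero, add_zero]
  · intro v
    have h1 : ∀ v : ℂE, fderiv ℝ ψ (z₀ + ι 0) v = mfd 𝓘(ℝ, ℂE) 𝓡₀ π z₀ v := fun v => by
      have h2 := hψD 0 h0 v
      have h3 : ψ (z₀ + ι 0) = extChartAt 𝓡₀ p p := by
        show extChartAt 𝓡₀ p (π (z₀ + ι 0)) = _
        rw [map_zero, add_zero]
      rw [h3, chartD_self] at h2
      rw [map_zero, add_zero] at h2 ⊢
      exact h2
    have hz0 : z₀ ≠ 0 := by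
      have := hne 0
      rwa [map_zero, add_zero] at this
    rw [hf 0 h0]
    show fderiv ℝ ψ (z₀ + ι 0) (ι (J v)) = K.Jp p (fderiv ℝ ψ (z₀ + ι 0) (ι v))
    rw [h1, h1, hJ]
    exact (hfs z₀ hz0).1 _

end Slice

end KahlerStructure

end

section

/-! ### The curvature of complex projective space -/

namespace KahlerStructure

variable {n : ℕ} {M : Type*} [TopologicalSpace M]
  [ChartedSpace (EuclideanSpace ℝ (Fin (2 * n))) M] [IsManifold (𝓡 (2 * n)) ∞ M]
  {N : Type*} [TopologicalSpace N]
  [ChartedSpace (EuclideanSpace ℝ (Fin (2 * n))) N] [IsManifold (𝓡 (2 * n)) ∞ N]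
  {K : KahlerStructure n M} {K' : KahlerStructure n N}

local notation "𝓔" => EuclideanSpace ℝ (Fin (2 * n))
local notation "𝓡₀" => 𝓡 (2 * n)
local notation "𝓟" => ModelWithCorners.prod (𝓡 (2 * n)) (𝓡 (2 * n))


local notation "ℂE" => EuclideanSpace ℂ (Fin (n + 1))

theorem euclidean_inner_re (u v : ℂE) : (inner ℂ u v).re = inner ℝ u v := by
  simp [PiLp.inner_apply, Complex.inner]

theorem euclidean_inner_im (u v : ℂE) : (inner ℂ u v).im = inner ℝ (Complex.I • u) v := by
  rw [← euclidean_inner_re, inner_smul_left]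
  simp

/-- Every point is represented by a unit vector. -/
theorem IsFubiniStudy.exists_normalized (h : K.IsFubiniStudy) (p : M) :
    ∃ (π : ℂE → M) (z₀ : ℂE), ‖z₀‖ = 1 ∧ π z₀ = p ∧ ContMDiffOn 𝓘(ℝ, ℂE) 𝓡₀ ∞ π {0}ᶜ ∧
      ∀ z, z ≠ 0 → K.IsFSAt π z := by
  obtain ⟨π, hsm, hsurj, hfib, hfs⟩ := h
  obtain ⟨z, hz, rfl⟩ := hsurj p
  have hz' := norm_ne_zero_iff.2 hz
  have h1 : ‖(((‖z‖⁻¹ : ℝ) : ℂ) • z)‖ = 1 := by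
    rw [norm_smul, Complex.norm_real, norm_inv, norm_norm, inv_mul_cancel₀ hz']
  refine ⟨π, ((‖z‖⁻¹ : ℝ) : ℂ) • z, h1, ?_, hsm, hfs⟩
  exact ((hfib _ _ hz (norm_ne_zero_iff.1 (by rw [h1]; exact one_ne_zero))).2 ⟨_, rfl⟩).symm

/-- The curvature of complex projective space. -/
theorem IsFubiniStudy.riem_eq (h : K.IsFubiniStudy) (p : M) (X Y Z : 𝓔) :
    riem (metricInChart K.g p) (extChartAt 𝓡₀ p p) X Y Z = (1 / 4 : ℝ) •
      (metricInChart K.g p (extChartAt 𝓡₀ p p) Y Z • X +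
        metricInChart K.g p (extChartAt 𝓡₀ p p) (K.Jp p Y) Z • K.Jp p X -
        metricInChart K.g p (extChartAt 𝓡₀ p p) X Z • Y -
        metricInChart K.g p (extChartAt 𝓡₀ p p) (K.Jp p X) Z • K.Jp p Y +
        (2 * metricInChart K.g p (extChartAt 𝓡₀ p p) (K.Jp p Y) X) • K.Jp p Z) := by
  obtain ⟨π, z₀, hz, rfl, hsm, hfs⟩ := h.exists_normalized p
  -- the slice through `z₀` is modelled on the orthogonal complement of the line through `z₀`
  set V : Submodule ℝ ℂE := ((ℂ ∙ z₀)ᗮ).restrictScalars ℝ with hV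
  have hVmem : ∀ v : ℂE, v ∈ V ↔ inner ℂ v z₀ = 0 := fun v =>
    Submodule.mem_orthogonal_singleton_iff_inner_left
  let J₀ : ℂE →L[ℝ] ℂE := (Complex.I • ContinuousLinearMap.id ℂ ℂE).restrictScalars ℝ
  have hJ₀ : ∀ v, J₀ v = Complex.I • v := fun v => rfl
  have hJV : ∀ v : V, J₀ (V.subtypeL v) ∈ V := fun v => by
    have h1 : inner ℂ (V.subtypeL v) z₀ = 0 := (hVmem _).1 v.2
    rw [hVmem, hJ₀, inner_smul_left, h1, mul_zero]
  let J : V →L[ℝ] V := (J₀ ∘L V.subtypeL).codRestrict V hJV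
  have hJ : ∀ v, V.subtypeL (J v) = Complex.I • V.subtypeL v := fun v => rfl
  have hsq : ∀ v, J (J v) = -v := fun v => Subtype.ext (by
    show Complex.I • Complex.I • (v : ℂE) = -v
    rw [smul_smul, Complex.I_mul_I, neg_one_smul])
  have horth : ∀ u v, inner ℝ (J u) (J v) = inner ℝ u v := fun u v => by
    show inner ℝ (Complex.I • (u : ℂE)) (Complex.I • (v : ℂE)) = inner ℝ (u : ℂE) v
    rw [← euclidean_inner_re, ← euclidean_inner_re, inner_smul_left, inner_smul_right,
      ← mul_assoc]
    simp
  obtain ⟨f, O, him, h0, hf0, hpull, hfJ⟩ := exists_slice_chart (K := K) (J := J)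
    (ι := V.subtypeL) hz (fun u v => euclidean_inner_re _ _)
    (fun u v => euclidean_inner_im _ _) (fun u => (hVmem _).1 u.2) hsq horth hJ hsm hfs
  have hdim : finrank ℝ V = finrank ℝ 𝓔 := by
    have h1 : finrank ℝ V = 2 * finrank ℂ ((ℂ ∙ z₀)ᗮ : Submodule ℂ ℂE) :=
      finrank_real_of_complex _
    have hz0 : z₀ ≠ 0 := norm_ne_zero_iff.1 (by rw [hz]; exact one_ne_zero)
    have h2 := Submodule.finrank_add_finrank_orthogonal (ℂ ∙ z₀)
    rw [finrank_span_singleton hz0, finrank_euclideanSpace_fin] at h2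
    rw [h1, finrank_euclideanSpace_fin]
    omega
  have hsurj : Function.Surjective (fderiv ℝ f 0) :=
    (LinearMap.injective_iff_surjective_of_finrank_eq_finrank
      (f := (fderiv ℝ f 0 : V →ₗ[ℝ] 𝓔)) hdim).1 (him.inj 0 h0)
  have hm : ∀ u v, metricInChart K.g (π z₀) (extChartAt 𝓡₀ (π z₀) (π z₀)) (fderiv ℝ f 0 u)
      (fderiv ℝ f 0 v) = 4 * inner ℝ u v := fun u v => by
    rw [← hf0, ← pull_apply, hpull 0 h0, fsMetric_apply]
    simp
  obtain ⟨u, rfl⟩ := hsurj X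
  obtain ⟨v, rfl⟩ := hsurj Y
  obtain ⟨w, rfl⟩ := hsurj Z
  have h1 := him.riem_natural hdim h0 u v w
  have hev : pull (metricInChart K.g (π z₀)) f =ᶠ[𝓝 0] fsMetric J := by
    filter_upwards [him.isOpen.mem_nhds h0] with y hy using hpull y hy
  rw [hf0, riem_congr hev, riem_fsMetric hsq horth] at h1
  rw [h1]
  simp only [← hfJ, hm, map_add, map_sub, map_smul]
  module

/-- At `p`, the complex structure is orthogonal, hence skew. -/
theorem metricInChart_Jp_left (K : KahlerStructure n M) (p : M) (u v : 𝓔) :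
    metricInChart K.g p (extChartAt 𝓡₀ p p) (K.Jp p u) v =
      -metricInChart K.g p (extChartAt 𝓡₀ p p) u (K.Jp p v) := by
  have hK := K.isKahlerOn p
  have hp := mem_extChartAt_target (I := 𝓡₀) p
  have h1 := hK.orth _ hp u (K.Jp p v)
  have h2 := hK.sq _ hp v
  rw [JInChart_self] at h1 h2
  rw [h2, map_neg] at h1
  linarith

/-- The Fubini-Study metric is an Einstein metric. -/
theorem IsFubiniStudy.ricci_eq (h : K.IsFubiniStudy) (p : M) (v w : TangentSpace 𝓡₀ p) :
    ricci K.g p v w = ((n + 1) / 2 : ℝ) * K.g p v w := by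
  have hp := mem_extChartAt_target (I := 𝓡₀) p
  have hK := K.isKahlerOn p
  have hg := hK.metric.isInner hp
  have key : ∀ v w : 𝓔, LinearMap.trace ℝ 𝓔
      (riemLin (metricInChart K.g p) (extChartAt 𝓡₀ p p) v w) =
      ((n + 1) / 2 : ℝ) * metricInChart K.g p (extChartAt 𝓡₀ p p) v w := by
    intro v w
    obtain ⟨e, he⟩ := hg.exists_orthonormal
    have hR : ∀ u, riemLin (metricInChart K.g p) (extChartAt 𝓡₀ p p) v w u = _ :=
      fun u => h.riem_eq p u v w
    have hJ := K.metricInChart_Jp_left p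
    have horth := hK.orth _ hp v w
    rw [JInChart_self] at horth
    set g := metricInChart K.g p (extChartAt 𝓡₀ p p)
    have hJ0 : ∀ u, g (K.Jp p u) u = 0 := fun u => by
      have h1 := hJ u u
      rw [hg.symm u] at h1
      linarith
    have hterm : ∀ i, g (riemLin (metricInChart K.g p) (extChartAt 𝓡₀ p p) v w (e i)) (e i) =
        (1 / 4) * (g v w - g v (e i) * g w (e i) +
          3 * (g (K.Jp p v) (e i) * g (K.Jp p w) (e i))) := fun i => by
      rw [hR]
      simp only [map_smul, map_add, map_sub, add_apply, sub_apply, smul_apply, smul_eq_mul, hJ0]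
      rw [he i i, if_pos rfl, hg.symm (e i) w, hJ (e i) w, hg.symm (e i) (K.Jp p w)]
      ring
    rw [he.trace_eq_sum, Finset.sum_congr rfl fun i _ => hterm i, ← Finset.mul_sum,
      Finset.sum_add_distrib, Finset.sum_sub_distrib, ← Finset.mul_sum, ← he.inner_eq_sum,
      ← he.inner_eq_sum, horth]
    simp
    ring
  refine (ricci_eq_trace K p v w).trans ((key v w).trans ?_)
  rw [metricInChart_self]
  rfl

/-- The sectional curvatures of the Fubini-Study metric. -/
theorem IsFubiniStudy.curvatureTensor_eq (h : K.IsFubiniStudy) (p : M) (u v : 𝓔) :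
    curvatureTensor K.g p u v u v = (1 / 4 : ℝ) *
      (metricInChart K.g p (extChartAt 𝓡₀ p p) u u * metricInChart K.g p (extChartAt 𝓡₀ p p) v v -
        metricInChart K.g p (extChartAt 𝓡₀ p p) u v ^ 2 + 3 * K.kform p v u ^ 2) := by
  have hg := (K.isKahlerOn p).metric.isInner (mem_extChartAt_target (I := 𝓡₀) p)
  have hJ := K.metricInChart_Jp_left p
  have hk : K.kform p v u = metricInChart K.g p (extChartAt 𝓡₀ p p) (K.Jp p v) u := by
    rw [metricInChart_self]
    rfl
  rw [curvatureTensor_eq_riem, h.riem_eq, hk]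
  set g := metricInChart K.g p (extChartAt 𝓡₀ p p)
  have hJ0 : ∀ u, g (K.Jp p u) u = 0 := fun u => by
    have h1 := hJ u u
    rw [hg.symm u] at h1
    linarith
  simp only [map_smul, map_add, map_sub, add_apply, sub_apply, smul_apply, smul_eq_mul, hJ0]
  rw [hJ u v, hg.symm u (K.Jp p v), hg.symm v u]
  ring

/-- The projective space is the image of the unit sphere. -/
theorem IsFubiniStudy.compactSpace (h : K.IsFubiniStudy) : CompactSpace M := by
  obtain ⟨π, hsm, hsurj, hfib, -⟩ := h
  have hc : IsCompact (π '' Metric.sphere (0 : ℂE) 1) := by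
    refine (isCompact_sphere (0 : ℂE) 1).image_of_continuousOn (hsm.continuousOn.mono fun z hz => ?_)
    refine norm_ne_zero_iff.1 ?_
    rw [mem_sphere_zero_iff_norm.1 hz]
    exact one_ne_zero
  refine ⟨hc.of_isClosed_subset isClosed_univ fun x _ => ?_⟩
  obtain ⟨z, hz, rfl⟩ := hsurj x
  have hz' := norm_ne_zero_iff.2 hz
  have h1 : ‖(((‖z‖⁻¹ : ℝ) : ℂ) • z)‖ = 1 := by
    rw [norm_smul, Complex.norm_real, norm_inv, norm_norm, inv_mul_cancel₀ hz']
  exact ⟨((‖z‖⁻¹ : ℝ) : ℂ) • z, mem_sphere_zero_iff_norm.2 h1,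
    ((hfib _ _ hz (norm_ne_zero_iff.1 (by rw [h1]; exact one_ne_zero))).2 ⟨_, rfl⟩).symm⟩

end KahlerStructure

/-- The curvature term of the evolution equation for metrics of constant holomorphic sectional
curvature. -/
theorem sum_fubiniStudy {n : ℕ} {lam : Fin (2 * n) → ℝ} (hpos : ∀ i, 0 < lam i)
    (hpair : ∀ i, lam i * lam (partner i) = 1) :
    ∑ k, ∑ i ∈ Finset.univ.filter (fun i => i ≠ k),
      lam i / ((1 + lam k ^ 2) * (lam i + lam (partner i))) *
        ((1 / 4 : ℝ) * (1 + 3 * if i = partner k then 1 else 0) -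
          lam k ^ 2 * ((1 / 4 : ℝ) * (1 + 3 * if i = partner k then 1 else 0))) =
    ∑ k ∈ firsts n, (1 - lam k ^ 2) ^ 2 / (1 + lam k ^ 2) ^ 2 := by
  set s : Fin (2 * n) → ℝ := fun i => lam i / (lam i + lam (partner i)) with hs
  set S := ∑ i, s i with hS
  have hinner : ∀ k, ∑ i ∈ Finset.univ.filter (fun i => i ≠ k),
      lam i / ((1 + lam k ^ 2) * (lam i + lam (partner i))) *
        ((1 / 4 : ℝ) * (1 + 3 * if i = partner k then 1 else 0) -
          lam k ^ 2 * ((1 / 4 : ℝ) * (1 + 3 * if i = partner k then 1 else 0))) =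
      (1 - lam k ^ 2) / (1 + lam k ^ 2) * ((1 / 4) * (S - s k + 3 * s (partner k))) := fun k => by
    have h1 : ∀ i, lam i / ((1 + lam k ^ 2) * (lam i + lam (partner i))) *
        ((1 / 4 : ℝ) * (1 + 3 * if i = partner k then 1 else 0) -
          lam k ^ 2 * ((1 / 4 : ℝ) * (1 + 3 * if i = partner k then 1 else 0))) =
        (1 - lam k ^ 2) / (1 + lam k ^ 2) * ((1 / 4) *
          (s i + 3 * if i = partner k then s i else 0)) := fun i => by
      have h2 := hpos i
      have h3 := hpos (partner i)
      simp only [hs]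
      split_ifs
      · field_simp
      · field_simp
        ring
    have hm : partner k ∈ Finset.univ.filter (fun i => i ≠ k) :=
      Finset.mem_filter.2 ⟨Finset.mem_univ _, partner_ne k⟩
    rw [Finset.sum_congr rfl fun i _ => h1 i, ← Finset.mul_sum, ← Finset.mul_sum,
      Finset.sum_add_distrib, ← Finset.mul_sum, Finset.sum_ite_eq', if_pos hm, Finset.filter_ne',
      Finset.sum_erase_eq_sub (Finset.mem_univ k)]
  rw [Finset.sum_congr rfl fun k _ => hinner k, ← sum_firsts_add_partner]
  refine Finset.sum_congr rfl fun k _ => ?_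
  have h2 := hpos k
  have h3 : lam (partner k) = (lam k)⁻¹ :=
    eq_inv_of_mul_eq_one_right (hpair k)
  simp only [hs, partner_partner, h3]
  field_simp
  ring

end

section

/-! ### The curvature term for complex projective spaces -/

namespace KahlerStructure

variable {n : ℕ} {M : Type*} [TopologicalSpace M]
  [ChartedSpace (EuclideanSpace ℝ (Fin (2 * n))) M] [IsManifold (𝓡 (2 * n)) ∞ M]
  {N : Type*} [TopologicalSpace N]
  [ChartedSpace (EuclideanSpace ℝ (Fin (2 * n))) N] [IsManifold (𝓡 (2 * n)) ∞ N]
  {K : KahlerStructure n M} {K' : KahlerStructure n N}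

local notation "𝓔" => EuclideanSpace ℝ (Fin (2 * n))
local notation "𝓡₀" => 𝓡 (2 * n)
local notation "𝓟" => ModelWithCorners.prod (𝓡 (2 * n)) (𝓡 (2 * n))


/-- Since `L` is symplectic, `ω(ã_k, ã_i)` is the multiple `(λ_i λ_k)⁻¹` of `ω(a_k, a_i)`, so the
curvatures of both factors on a singular frame are those of a unitary frame. -/
theorem curvatureTerm_of_isFubiniStudy (h : K.IsFubiniStudy) (h' : K'.IsFubiniStudy) {p : M} {q : N}
    {L : TangentSpace 𝓡₀ p →L[ℝ] TangentSpace 𝓡₀ q}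
    (hL : ∀ u v : 𝓔, K'.kform q (L u) (L v) = K.kform p u v)
    {a : Fin (2 * n) → TangentSpace 𝓡₀ p} {lam : Fin (2 * n) → ℝ}
    (hfr : K.IsSingularFrame K' L a lam) :
    K.curvatureTerm K' L a lam = ∑ k ∈ firsts n, (1 - lam k ^ 2) ^ 2 / (1 + lam k ^ 2) ^ 2 := by
  rw [← sum_fubiniStudy hfr.pos hfr.pair]
  obtain ⟨g, hg⟩ : ∃ g : 𝓔 →L[ℝ] 𝓔 →L[ℝ] ℝ, g = K.g p := ⟨_, rfl⟩
  obtain ⟨g', hg'⟩ : ∃ g' : 𝓔 →L[ℝ] 𝓔 →L[ℝ] ℝ, g' = K'.g q := ⟨_, rfl⟩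
  obtain ⟨L', hL'⟩ : ∃ L' : 𝓔 →L[ℝ] 𝓔, L' = L := ⟨_, rfl⟩
  obtain ⟨b, hb⟩ : ∃ b : Fin (2 * n) → 𝓔, b = a := ⟨_, rfl⟩
  have horth : ∀ i j, g (b i) (b j) = if i = j then 1 else 0 := fun i j => by
    rw [hg, hb]
    exact hfr.orthonormal i j
  have hdiag : ∀ i v, g' (L' (b i)) (L' v) = lam i ^ 2 * g (b i) v := fun i v => by
    rw [hg, hg', hb, hL']
    exact hfr.diag i v
  have hk : ∀ u v, K'.kform q (L' u) (L' v) = K.kform p u v := fun u v => by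
    rw [hL']
    exact hL u v
  have hkf : ∀ i k, K.kform p (b k) (b i) = g (K.Jp p (b k)) (b i) := fun i k => by
    rw [hg]
    rfl
  have hJ₁ : ∀ k ∈ firsts n, K.Jp p (b k) = b (partner k) := fun k hk => by
    rw [hb]
    exact hfr.J_frame k hk
  -- the Kähler form in a frame adapted to the complex structure
  have hform : ∀ i k, K.kform p (b k) (b i) ^ 2 = if i = partner k then 1 else 0 := fun i k => by
    rw [hkf]
    by_cases hf : k ∈ firsts n
    · rw [hJ₁ k hf, horth]
      by_cases hik : i = partner k
      · rw [if_pos hik, if_pos hik.symm, one_pow]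
      · rw [if_neg hik, if_neg (Ne.symm hik), zero_pow two_ne_zero]
    · have hf' : partner k ∈ firsts n := by
        rw [mem_firsts] at hf ⊢
        rw [partner_val, if_neg hf]
        omega
      have h2 : K.Jp p (b k) = -b (partner k) := by
        have h3 := hJ₁ _ hf'
        rw [partner_partner] at h3
        rw [← h3]
        exact K.J_sq p _
      rw [h2, map_neg, neg_apply, neg_sq, horth]
      by_cases hik : i = partner k
      · rw [if_pos hik, if_pos hik.symm, one_pow]
      · rw [if_neg hik, if_neg (Ne.symm hik), zero_pow two_ne_zero]
  refine Finset.sum_congr rfl fun k _ => Finset.sum_congr rfl fun i hi => ?_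
  have hik : i ≠ k := (Finset.mem_filter.1 hi).2
  have e1 : curvatureTensor K.g p (a i) (a k) (a i) (a k) =
      (1 / 4 : ℝ) * (1 + 3 * if i = partner k then 1 else 0) := by
    rw [← hb]
    refine (h.curvatureTensor_eq p (b i) (b k)).trans ?_
    have hm : metricInChart K.g p (extChartAt 𝓡₀ p p) = g := (metricInChart_self K.g p).trans hg.symm
    rw [hm, horth, horth, horth, if_pos rfl, if_pos rfl, if_neg hik, hform]
    ring
  have e2 : curvatureTensor K'.g q ((lam i)⁻¹ • L (a i)) ((lam k)⁻¹ • L (a k))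
      ((lam i)⁻¹ • L (a i)) ((lam k)⁻¹ • L (a k)) =
      (1 / 4 : ℝ) * (1 + 3 * if i = partner k then 1 else 0) := by
    rw [← hb, ← hL']
    refine (h'.curvatureTensor_eq q ((lam i)⁻¹ • L' (b i)) ((lam k)⁻¹ • L' (b k))).trans ?_
    have hm : metricInChart K'.g q (extChartAt 𝓡₀ q q) = g' :=
      (metricInChart_self K'.g q).trans hg'.symm
    have hi0 := (hfr.pos i).ne'
    have hk0 := (hfr.pos k).ne'
    rw [hm]
    simp only [map_smul, smul_apply, smul_eq_mul, hdiag, hk, horth, if_neg hik, mul_pow, hform]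
    simp only [if_true, mul_one]
    -- `λ_i λ_k = 1` whenever the Kähler form does not vanish on `a_i`, `a_k`
    by_cases hp : i = partner k
    · have h1 := hfr.pair k
      rw [← hp] at h1
      rw [if_pos hp, eq_inv_of_mul_eq_one_left h1]
      field_simp
      ring
    · rw [if_neg hp]
      field_simp
      ring
  show lam i / _ * (_ - lam k ^ 2 * curvatureTensor K'.g q ((lam i)⁻¹ • L (a i))
    ((lam k)⁻¹ • L (a k)) ((lam i)⁻¹ • L (a i)) ((lam k)⁻¹ • L (a k))) = _
  rw [e1, e2]

/-- The graph of a symplectomorphism is Lagrangian. -/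
theorem isLagrangian_graph {f : M ≃ₘ⟮𝓡 (2 * n), 𝓡 (2 * n)⟯ N} (hf : K.IsSymplectomorphism K' f) :
    K.IsLagrangian K' fun x => (x, f x) := by
  intro x u v
  have h1 : MDifferentiableAt 𝓡₀ 𝓡₀ f x := f.contMDiff.mdifferentiableAt (by simp)
  have h2 : mfderiv 𝓡₀ 𝓟 (fun x => (x, f x)) x =
      (mfderiv 𝓡₀ 𝓡₀ (fun x : M => x) x).prod (mfderiv 𝓡₀ 𝓡₀ f x) :=
    mfderiv_prodMk (mdifferentiableAt_id (I := 𝓡₀) (x := x)) h1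
  have h3 : mfderiv 𝓡₀ 𝓡₀ (fun x : M => x) x = ContinuousLinearMap.id ℝ _ := mfderiv_id
  have e1 : ∀ w, dF₁ (fun x : M => (x, f x)) x w = w := fun w => by
    unfold dF₁ dF
    rw [h2, h3]
    rfl
  have e2 : ∀ w, dF₂ (fun x : M => (x, f x)) x w = mfderiv 𝓡₀ 𝓡₀ f x w := fun w => by
    unfold dF₂ dF
    rw [h2]
    rfl
  have e3 := hf x u v
  rw [e1, e1, e2, e2]
  exact sub_eq_zero.2 e3.symm

end KahlerStructure

end

end

end

theorem proposition3p11 (n : ℕ)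
    {M : Type*} [TopologicalSpace M] [T2Space M] [SecondCountableTopology M]
    [ChartedSpace (EuclideanSpace ℝ (Fin (2 * n))) M] [IsManifold (𝓡 (2 * n)) ∞ M]
    {N : Type*} [TopologicalSpace N] [T2Space N] [SecondCountableTopology N]
    [ChartedSpace (EuclideanSpace ℝ (Fin (2 * n))) N] [IsManifold (𝓡 (2 * n)) ∞ N]
    (K : KahlerStructure n M) (K' : KahlerStructure n N)
    (f : M ≃ₘ⟮𝓡 (2 * n), 𝓡 (2 * n)⟯ N) (hf : K.IsSymplectomorphism K' f)
    (T : ℝ) (F : ℝ → M → M × N)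
    (hF : IsMeanCurvatureFlow (𝓡 (2 * n)) (K.prodG K') T F)
    (hF0 : ∀ x, F 0 x = (x, f x))
    (t : ℝ) (ht : t ∈ Set.Ico 0 T) (x : M) (hpos : 0 < K.starOmega K' (F t) x) :
    -- the general case
    (IsEinstein K.g → IsEinstein K'.g →
      (∀ (p : M) (q : N), scalarCurvature K.g p = scalarCurvature K'.g q) →
      (CompactSpace M ∨ ∀ s ∈ Set.Ico 0 T, K.IsLagrangian K' (F s)) →
      ContMDiffAt (𝓡 (2 * n)) 𝓘(ℝ, ℝ) ∞ (fun y => Real.log (K.starOmega K' (F t) y)) x ∧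
      (∃ a lam, K.IsSingularFrame K' (KahlerStructure.graphDeriv (F t) x) a lam) ∧
      ∀ a lam, K.IsSingularFrame K' (KahlerStructure.graphDeriv (F t) x) a lam →
        HasDerivWithinAt (fun s => Real.log (K.starOmega K' (F s) x))
          (laplacian (pullbackMetric (I := 𝓡 (2 * n)) (K.prodG K') (F t))
              (fun y => Real.log (K.starOmega K' (F t) y)) x
            + quadQTilde lam (K.hCoeff K' (F t) x a lam)
            + K.curvatureTerm K' (KahlerStructure.graphDeriv (F t) x) a lam)
          (Set.Ico 0 T) t) ∧
    -- the case of complex projective spaces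
    (K.IsFubiniStudy → K'.IsFubiniStudy →
      ContMDiffAt (𝓡 (2 * n)) 𝓘(ℝ, ℝ) ∞ (fun y => Real.log (K.starOmega K' (F t) y)) x ∧
      (∃ a lam, K.IsSingularFrame K' (KahlerStructure.graphDeriv (F t) x) a lam) ∧
      ∀ a lam, K.IsSingularFrame K' (KahlerStructure.graphDeriv (F t) x) a lam →
        HasDerivWithinAt (fun s => Real.log (K.starOmega K' (F s) x))
          (laplacian (pullbackMetric (I := 𝓡 (2 * n)) (K.prodG K') (F t))
              (fun y => Real.log (K.starOmega K' (F t) y)) x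
            + quadQTilde lam (K.hCoeff K' (F t) x a lam)
            + ∑ k ∈ firsts n, (1 - lam k ^ 2) ^ 2 / (1 + lam k ^ 2) ^ 2)
          (Set.Ico 0 T) t) := by
  have hF0' : F 0 = fun x => (x, f x) := funext hF0
  have h0 : K.IsLagrangian K' (F 0) := by
    rw [hF0']
    exact KahlerStructure.isLagrangian_graph hf
  refine ⟨fun hE hE' hs hcase => ?_, fun hFS hFS' => ?_⟩
  · have hLag : K.IsLagrangian K' (F t) := by
      rcases hcase with hM | hLag
      · obtain ⟨c, hc, hc'⟩ := KahlerStructure.exists_einstein_constant hE hE' (hs x (f x))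
        exact KahlerStructure.isLagrangian_of_compact hF hc hc' h0 ht
      · exact hLag t ht
    exact KahlerStructure.evolution_of_isLagrangian hF ht hpos hLag
  · have hM := hFS.compactSpace
    have hLag := KahlerStructure.isLagrangian_of_compact hF hFS.ricci_eq hFS'.ricci_eq h0 ht
    obtain ⟨h1, h2, h3⟩ := KahlerStructure.evolution_of_isLagrangian hF ht hpos hLag
    refine ⟨h1, h2, fun a lam hfr => ?_⟩
    have h4 := h3 a lam hfr
    rwa [KahlerStructure.curvatureTerm_of_isFubiniStudy hFS hFS'
      (KahlerStructure.symplectic_graphDeriv (hF.contMDiff ht) hpos hLag) hfr] at h4
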